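/- Let $G$ be a connected undirected unweighted graph with $n$ vertices and let $s$ be a vertex of $G$. \emph{Recursion.} A node is a graph $H$ with a source $s_H$, whose edges are either unweighted (length $1$) or weighted (positive integer length); a weighted edge may be parallel to an unweighted one. The root is $G$ with source $s$. At a node $H$ take a shortest path tree $T$ from $s_H$ and a vertex $r$ that splits $T$ into edge-disjoint subtrees $M\ni s_H$ and $N$ (rooted at $r$) with $V_M\cup V_N=V_H$, $V_M\cap V_N=\{r\}$ and $|V_M|,|V_N|\ge |V_H|/3$. The path $\mathcal P$ of $T$ from $s_H$ to $r$ is the primary path. The left child is the subgraph of $H$ induced by $V_M$, with source $s_H$, together with a weighted edge from $r$ to each $v\in V_M\setminus\{r\}$ whose weight is the distance in $H$ from $r$ to $v$ after deletion of all edges inside $V_M$ (no edge if there is no such path). The right child is the subgraph of $H$ induced by $V_N$, together with a source $s'$ (a new vertex if $r\ne s_H$, and $s'=s_H$ if $r=s_H$) and a weighted edge from $s'$ to each $v\in V_N\setminus\{s'\}$ whose weight is the distance in $H$ from $s_H$ to $v$ after deletion of all edges inside $V_N$ (no edge if there is no such path). Of parallel weighted edges only the lightest is kept. \emph{Departing replacement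 paths.} Let $H$ be a node with primary path $\mathcal P$, let $e$ be an unweighted edge of $\mathcal P$ and $t\in V_H$. A departing replacement path for $(t,e)$ is a shortest path from $s_H$ to $t$ in $H-e$ that uses no vertex of $\mathcal P$ after $e$. \emph{Statement.} There are two fixed deterministic word-RAM programs (words of $O(\log n)$ bits), \textsc{Build} and \textsc{Query}, such that for all $G$, $s$, every node $H$ of the recursion, with $m_H$ edges and $n_H$ vertices, and every choice of $T$, $r$, $M$, $N$ at $H$ as above, with primary path $\mathcal P$: (1) given $H$ and $\mathcal P$ (vertices numbered and edges listed in any order), \textsc{Build} finds the departing replacement paths for all destinations in $\widetilde O((m_H+1)\sqrt n)$ time and stores them in a data structure of $\widetilde O(n_H\sqrt n)$ words; (2) given only this data structure, a vertex $t\in V_H$ and an unweighted edge $e$ of $\mathcal P$, \textsc{Query} takes $\widetilde O(1)$ time. If a departing replacement path for $(t,e)$ exists, it returns its length and, if $t\ne s_H$, the last vertex before $t$ on such a path. In every case, a length that it returns is at least the distance from $s_H$ to $t$ in $H-e$ (it may also return that nothing was found). Here $\widetilde O$ hides a constant and a power of $\log(n+2)$, which are the same for all inputs. At the root $m_H=m$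 and $n_H=n$. -/

import Mathlib

/-! ## A word RAM with a step count -/

namespace RAM

/-- Arithmetic operations of the machine (natural numbers; `sub` is truncated, `div` is floor). -/
inductive Op
  | add | sub | mul | div

def Op.eval : Op → ℕ → ℕ → ℕ
  | .add, x, y => x + y
  | .sub, x, y => x - y
  | .mul, x, y => x * y
  | .div, x, y => x / y

/-- Programs. A program mentions finitely many registers; memory is addressed indirectly. -/
inductive Prog
  | skip
  /-- `R[d] := k` -/
  | const (d k : ℕ)
  /-- `R[d] := R[a] o R[b]` -/
  | op (o : Op) (d a b : ℕ)
  /-- `R[d] := M[R[a]]` -/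
  | load (d a : ℕ)
  /-- `M[R[a]] := R[b]` -/
  | store (a b : ℕ)
  | seq (p q : Prog)
  /-- `if R[a] < R[b] then p else q` -/
  | ite (a b : ℕ) (p q : Prog)
  /-- `while R[a] < R[b] do p` -/
  | loop (a b : ℕ) (p : Prog)

/-- Registers and memory cells. -/
structure State where
  reg : ℕ → ℕ
  mem : ℕ → ℕ

def State.setReg (σ : State) (d v : ℕ) : State := ⟨Function.update σ.reg d v, σ.mem⟩

def State.setMem (σ : State) (a v : ℕ) : State := ⟨σ.reg, Function.update σ.mem a v⟩

/-- `Exec B p σ τ c`: started in `σ`, the program `p` halts in `τ` after exactly `c` steps, and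
every word that it computes, every address that it uses and every word that it moves is below
`B`. Every elementary instruction and every test costs one step. -/
inductive Exec (B : ℕ) : Prog → State → State → ℕ → Prop
  | skip (σ : State) : Exec B .skip σ σ 1
  | const (σ : State) (d k : ℕ) : k < B → Exec B (.const d k) σ (σ.setReg d k) 1
  | op (σ : State) (o : Op) (d a b : ℕ) : o.eval (σ.reg a) (σ.reg b) < B →
      Exec B (.op o d a b) σ (σ.setReg d (o.eval (σ.reg a) (σ.reg b))) 1
  | load (σ : State) (d a : ℕ) : σ.reg a < B → σ.mem (σ.reg a) < B →
      Exec B (.load d a) σ (σ.setReg d (σ.mem (σ.reg a))) 1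
  | store (σ : State) (a b : ℕ) : σ.reg a < B → σ.reg b < B →
      Exec B (.store a b) σ (σ.setMem (σ.reg a) (σ.reg b)) 1
  | seq {p q : Prog} {σ τ ρ : State} {c d : ℕ} :
      Exec B p σ τ c → Exec B q τ ρ d → Exec B (.seq p q) σ ρ (c + d)
  | iteTrue {a b : ℕ} {p q : Prog} {σ τ : State} {c : ℕ} : σ.reg a < σ.reg b →
      Exec B p σ τ c → Exec B (.ite a b p q) σ τ (c + 1)
  | iteFalse {a b : ℕ} {p q : Prog} {σ τ : State} {c : ℕ} : ¬ σ.reg a < σ.reg b →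
      Exec B q σ τ c → Exec B (.ite a b p q) σ τ (c + 1)
  | loopTrue {a b : ℕ} {p : Prog} {σ τ ρ : State} {c d : ℕ} : σ.reg a < σ.reg b →
      Exec B p σ τ c → Exec B (.loop a b p) τ ρ d → Exec B (.loop a b p) σ ρ (c + d + 1)
  | loopFalse {a b : ℕ} {p : Prog} {σ : State} : ¬ σ.reg a < σ.reg b →
      Exec B (.loop a b p) σ σ 1

/-- The state whose registers (memory) hold the given words from position `0` on, and `0`
elsewhere. -/
def State.ofLists (regs mem : List ℕ) : State :=
  ⟨fun i => regs.getD i 0, fun a => mem.getD a 0⟩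

/-- The first `k` memory cells. -/
def State.firstCells (σ : State) (k : ℕ) : List ℕ := (List.range k).map σ.mem

end RAM

/-! ## Shortest paths -/

/-- `Route A u v l ℓ`: `l` is the list of vertices of a walk from `u` to `v` of total weight `ℓ`,
where `A x y w` says that there is an edge of weight `w` from `x` to `y`. -/
inductive Route {α : Type} (A : α → α → ℕ → Prop) : α → α → List α → ℕ → Prop
  | nil (u : α) : Route A u u [u] 0
  | cons {u v t : α} {w ℓ : ℕ} {l : List α} :
      A u v w → Route A v t l ℓ → Route A u t (u :: l) (w + ℓ)

/-- Weight of a shortest walk from `u` to `v`; `⊤` if there is none. -/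
noncomputable def routeDist {α : Type} (A : α → α → ℕ → Prop) (u v : α) : ℕ∞ :=
  ⨅ (l : List α) (ℓ : ℕ) (_ : Route A u v l ℓ), (ℓ : ℕ∞)

/-! ## The nodes of the recursion -/

/-- The graph at a node. Its vertices are vertices `some v` of the input graph and possibly one
artificial source, `none`. It has unweighted edges (of length `1`) and, possibly parallel to them,
weighted edges; `added u v` is the weight of the weighted edge between `u` and `v`, `⊤` if there
is none. -/
structure Node (V : Type) where
  verts : Finset (Option V)
  src : Option V
  plain : SimpleGraph (Option V)
  added : Option V → Option V → ℕ∞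

namespace Node

variable {V : Type}

/-- There is an edge of weight `w` between `u` and `v`; the flag tells whether it is one of the
weighted edges. -/
def IsEdge (H : Node V) (u v : Option V) (w : ℕ) (weighted : Bool) : Prop :=
  if weighted then H.added u v = (w : ℕ∞) else H.plain.Adj u v ∧ w = 1

def Step (H : Node V) (u v : Option V) (w : ℕ) : Prop :=
  ∃ κ, H.IsEdge u v w κ

/-- The edges that are left when all edges of the subgraph induced by `K` are deleted. -/
def StepOutside (H : Node V) (K : Finset (Option V)) (u v : Option V) (w : ℕ) : Prop :=
  H.Step u v w ∧ ¬ (u ∈ K ∧ v ∈ K)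

/-- The edges that are left when the unweighted edge `e` is deleted. -/
def StepAvoid (H : Node V) (e : Sym2 (Option V)) (u v : Option V) (w : ℕ) : Prop :=
  H.IsEdge u v w true ∨ (H.IsEdge u v w false ∧ s(u, v) ≠ e)

/-- A shortest path tree from the source, as a parent map, with a vertex `r` that separates it
into two edge-disjoint subtrees `M ∋ src` and `N` (rooted at `r`), each with at least a third of
the vertices. -/
structure Split (H : Node V) where
  par : Option V → Option V
  par_mem : ∀ v ∈ H.verts, v ≠ H.src → par v ∈ H.verts
  par_dist : ∀ v ∈ H.verts, v ≠ H.src → ∃ w : ℕ, H.Step (par v) v w ∧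
    routeDist H.Step H.src v = routeDist H.Step H.src (par v) + w
  r : Option V
  M : Finset (Option V)
  N : Finset (Option V)
  mem_union : ∀ v, v ∈ H.verts ↔ v ∈ M ∨ v ∈ N
  mem_inter : ∀ v, v ∈ M ∧ v ∈ N ↔ v = r
  src_mem : H.src ∈ M
  par_mem_M : ∀ v ∈ M, v ≠ H.src → par v ∈ M
  par_mem_N : ∀ v ∈ N, v ≠ r → par v ∈ N
  third_le_M : H.verts.card ≤ 3 * M.card
  third_le_N : H.verts.card ≤ 3 * N.card

/-- `P` is the primary path: the path from the source to `r` in the shortest path tree. -/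
def Split.IsPrimary {H : Node V} (S : H.Split) (P : List (Option V)) : Prop :=
  P.head? = some H.src ∧ P.getLast? = some S.r ∧
    P.IsChain (fun u v => v ≠ H.src ∧ S.par v = u)

/-- The subgraph of unweighted edges with both ends in `K`. -/
def plainIn (H : Node V) (K : Finset (Option V)) : SimpleGraph (Option V) where
  Adj u v := H.plain.Adj u v ∧ u ∈ K ∧ v ∈ K
  symm := ⟨fun _ _ h => ⟨h.1.symm, h.2.2, h.2.1⟩⟩
  loopless := ⟨fun _ h => H.plain.loopless.irrefl _ h.1⟩

open Classical in
/-- The weighted edges with both ends in `K`. -/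
noncomputable def addedIn (H : Node V) (K : Finset (Option V)) (u v : Option V) : ℕ∞ :=
  if u ∈ K ∧ v ∈ K then H.added u v else ⊤

open Classical in
/-- The weighted edges from `c` to every other vertex `v ∈ K`, of weight `d v`. -/
noncomputable def star (c : Option V) (K : Finset (Option V)) (d : Option V → ℕ∞)
    (u v : Option V) : ℕ∞ :=
  if u = c ∧ v ∈ K ∧ v ≠ c then d v
  else if v = c ∧ u ∈ K ∧ u ≠ c then d u
  else ⊤

/-- The left child: the subgraph induced by `M`, with a weighted edge from `r` to each `v ∈ M`
whose weight is the distance from `r` to `v` without the edges inside `M`. -/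
noncomputable def left (H : Node V) (S : H.Split) : Node V where
  verts := S.M
  src := H.src
  plain := H.plainIn S.M
  added u v := min (H.addedIn S.M u v)
    (star S.r S.M (fun x => routeDist (H.StepOutside S.M) S.r x) u v)

open Classical in
/-- The source of the right child: a new vertex, unless the old source is `r`. -/
noncomputable def rightSrc (H : Node V) (S : H.Split) : Option V :=
  if S.r = H.src then H.src else none

open Classical in
/-- The right child: the subgraph induced by `N`, with a source that has a weighted edge to each
`v ∈ N` whose weight is the distance from the old source to `v` without the edges inside `N`. -/
noncomputable def right (H : Node V) (S : H.Split) : Node V where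
  verts := insert (H.rightSrc S) S.N
  src := H.rightSrc S
  plain := H.plainIn S.N
  added u v := min (H.addedIn S.N u v)
    (star (H.rightSrc S) S.N (fun x => routeDist (H.StepOutside S.N) H.src x) u v)

/-- The root: the unweighted input graph with source `s`. -/
def root [Fintype V] (G : SimpleGraph V) (s : V) : Node V where
  verts := Finset.univ.map Function.Embedding.some
  src := some s
  plain := G.map Function.Embedding.some
  added _ _ := ⊤

/-- The nodes of the recursion for the input graph `G` with source `s`. -/
inductive InTree [Fintype V] (G : SimpleGraph V) (s : V) : Node V → Prop
  | root : InTree G s (Node.root G s)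
  | left {H : Node V} (S : H.Split) : InTree G s H → InTree G s (H.left S)
  | right {H : Node V} (S : H.Split) : InTree G s H → InTree G s (H.right S)

/-- `l` is a shortest path, of weight `ℓ`, from the source to `t` that avoids the unweighted edge
`e` of the primary path, and it uses no vertex of `after`, the part of the primary path that
follows `e`. -/
def IsDepartingReplacement (H : Node V) (e : Sym2 (Option V)) (after : List (Option V))
    (t : Option V) (l : List (Option V)) (ℓ : ℕ) : Prop :=
  Route (H.StepAvoid e) H.src t l ℓ ∧
    (ℓ : ℕ∞) = routeDist (H.StepAvoid e) H.src t ∧ ∀ u ∈ l, u ∉ after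

/-! ### The input of the algorithm -/

/-- A numbering of the vertices by `0, 1, …`. -/
def IsNumbering (H : Node V) (num : Option V → ℕ) : Prop :=
  Set.BijOn num H.verts (Set.Iio H.verts.card)

/-- A list of all edges (ends, weight, flag), each edge once and in one orientation; so the number
of edges is its length. -/
def IsEdgeList (H : Node V) (E : List (Option V × Option V × ℕ × Bool)) : Prop :=
  (∀ u v w κ, H.IsEdge u v w κ ↔ ((u, v, w, κ) ∈ E ∨ (v, u, w, κ) ∈ E)) ∧
    (E.map fun a => (s(a.1, a.2.1), a.2.2.2)).Nodup

/-- The input: numbers of vertices and edges, source, length of the primary path, its vertices in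
order, and the edges. -/
def encode (H : Node V) (num : Option V → ℕ) (P : List (Option V))
    (E : List (Option V × Option V × ℕ × Bool)) : List ℕ :=
  [H.verts.card, E.length, num H.src, P.length] ++ P.map num ++
    E.flatMap fun a => [num a.1, num a.2.1, a.2.2.1, a.2.2.2.toNat]

end Node

/-! ## A structured language on top of the word RAM -/

/-! Fix a node, number its vertices, let `d` be the distances from the source and `p 0, …, p (L -
1)` the primary path (`Scene`). Suppose that the edge between `p i` and `p (i + 1)` fails. A
destination on the path is trivial: before the edge the path itself is optimal, after the edge no
departing path exists. For `t` off the path, cut a departing path at its last vertex `p a` on the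
primary path. Then `a ≤ i`, the first part may be replaced by the primary path, and the weight is `d
(p a)` plus that of a detour which never returns to the path (`Scene.Safe.exists_detour`). Detours
are handled by three tables, with `ρ` about the square root of the number of vertices.

Detours that use weighted edges meet a vertex cover of these edges (`Scene.unweighted_or_meets`).
For each vertex `c` of a small cover one Dijkstra computation that does not pass through the path
gives the distances from `c` to all `t`; prefix minima over `a ≤ i` of `d (p a)` plus the distance
from `p a` to `c` give the best way to reach `c`. A query tries all `c`.

Unweighted detours of total length at most `d t + 4 ρ`: for every excess `δ ≤ 4 ρ` and every `t`,
store the first path index from which an unweighted detour reaches `t` with total length at most `d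
t + δ` (`Scene.fst`). Deleting the last edge of a detour gives a recurrence over smaller excess, or
equal excess and smaller distance. A query bisects for the least `δ` whose entry is at most `i`.

Unweighted detours with larger excess (`Scene.exists_pivot`): if such a path is optimal then, as
long as it is within distance `ρ` of the path, it cannot be near a path vertex beyond the failing
edge, since going over to that vertex and along the path would give excess at most `4 ρ`
(`Scene.no_jump`). Hence for every `lam` between `1` and `ρ` it passes a vertex at distance exactly
`lam` from the path, and it arrives there with excess `0`. By pigeonhole some `lam` has at most `ρ`
such vertices, the pivots. A pivot is admissible for the edge `i` if its entry of excess `0` is at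
most `i`. With the pivots sorted by this key the admissible ones form a prefix, so it suffices to
store for each prefix and each `t` the best route through a pivot of the prefix. That takes `ρ`
Dijkstra computations and about `ρ` rows.

Every stored value is the weight bound of an actual walk that avoids the edge and the vertices after
it (`Scene.Out`), so answers are never too small; when a departing replacement path exists, the case
distinction shows that they are not too large either (`Node.Setup.answer`).

The size bounds come from an invariant of the recursion (`Node.Light`). Generations that do not
shrink a node by the factor `8 / 9` merely relabel it; every other generation adds at most one
vertex to the cover of the weighted edges and multiplies the weight of simple routes by at most `4`.
With `e` shrinking generations `(9 / 8) ^ e ≤ n`, so the cover has `O(log n)` vertices and all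
weights are polynomial in `n`, hence fit into machine words. A greedy maximal matching finds a cover
of at most twice the size.

The programs are written in a small structured language whose cost semantics is transferred to the
word RAM by a verified compiler (`RAM.Big.exec`); correctness and running times are proved with
weakest preconditions (`RAM.wp`). -/

namespace RAM

/-- Number of variables. -/
local notation "NV" => (100 : ℕ)

/-- Number of arrays. -/
local notation "NA" => (40 : ℕ)

theorem Exec.cast {B : ℕ} {p : Prog} {σ τ : State} {c c' : ℕ} (h : Exec B p σ τ c) (e : c = c') :
    Exec B p σ τ c' := e ▸ h

/-- Expressions over variables, arrays and the input. -/
inductive Expr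
  | c (k : ℕ)
  | v (x : ℕ)
  | g (a : ℕ) (e : Expr)
  | inp (e : Expr)
  | o (p : Op) (e f : Expr)

/-- Variables, arrays, and the read-only input. -/
structure St where
  v : ℕ → ℕ
  a : ℕ → ℕ → ℕ
  i : ℕ → ℕ

def St.set (s : St) (x k : ℕ) : St := ⟨Function.update s.v x k, s.a, s.i⟩

def St.put (s : St) (a j k : ℕ) : St :=
  ⟨s.v, Function.update s.a a (Function.update (s.a a) j k), s.i⟩

namespace Expr

instance : Add Expr := ⟨.o .add⟩
instance : Sub Expr := ⟨.o .sub⟩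
instance : Mul Expr := ⟨.o .mul⟩
instance : Div Expr := ⟨.o .div⟩
instance : OfNat Expr 0 := ⟨.c 0⟩
instance : OfNat Expr 1 := ⟨.c 1⟩

def eval : Expr → St → ℕ
  | .c k, _ => k
  | .v x, s => s.v x
  | .g a e, s => s.a a (e.eval s)
  | .inp e, s => s.i (e.eval s)
  | .o p e f, s => p.eval (e.eval s) (f.eval s)

/-- The number of steps of the compiled expression. -/
def cost : Expr → ℕ
  | .c _ => 1
  | .v _ => 2
  | .g _ e => e.cost + 6
  | .inp e => e.cost + 2
  | .o _ e f => e.cost + f.cost + 1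

/-- The value is below the power of the word bound with this exponent. -/
def deg : Expr → ℕ
  | .c _ => 1
  | .v _ => 1
  | .g _ _ => 1
  | .inp _ => 1
  | .o .add e f => e.deg + f.deg
  | .o .mul e f => e.deg + f.deg
  | .o .sub e _ => e.deg
  | .o .div e _ => e.deg


/-- Degree at most `8` keeps all intermediate values below the eighth power of the bound on stored
words, which leaves room for address arithmetic below the twelfth power. -/
def ok : Expr → Bool
  | .c k => k < 1000
  | .v x => x < NV
  | .g a e => a < NA && e.ok && e.deg ≤ 8
  | .inp e => e.ok && e.deg ≤ 8
  | .o p e f => e.ok && f.ok && (Expr.o p e f).deg ≤ 8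

/-- Compiled code; the value ends up in register `NV + 1 + d`. -/
def code : Expr → ℕ → Prog
  | .c k, d => .const (NV + 1 + d) k
  | .v x, d => .seq (.const (NV + 1 + d) 0) (.op .add (NV + 1 + d) (NV + 1 + d) x)
  -- The arrays are interleaved: entry `j` of array `a` has the address base `+ NA * j + a`, so no
  -- array needs a length fixed in advance.
  | .g a e, d => .seq (e.code d) (.seq (.const (NV + 2 + d) NA)
      (.seq (.op .mul (NV + 1 + d) (NV + 1 + d) (NV + 2 + d)) (.seq (.const (NV + 2 + d) a)
      (.seq (.op .add (NV + 1 + d) (NV + 1 + d) (NV + 2 + d))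
      (.seq (.op .add (NV + 1 + d) (NV + 1 + d) NV) (.load (NV + 1 + d) (NV + 1 + d)))))))
  -- Beyond the end of the input the arrays begin, so such reads must return the default `0`.
  | .inp e, d => .seq (e.code d) (.ite (NV + 1 + d) NV (.load (NV + 1 + d) (NV + 1 + d))
      (.const (NV + 1 + d) 0))
  | .o p e f, d => .seq (e.code d) (.seq (f.code (d + 1))
      (.op p (NV + 1 + d) (NV + 1 + d) (NV + 2 + d)))

@[simp] theorem eval_c (k : ℕ) (s : St) : (Expr.c k).eval s = k := rfl
@[simp] theorem eval_v (x : ℕ) (s : St) : (Expr.v x).eval s = s.v x := rfl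
@[simp] theorem eval_g (a : ℕ) (e : Expr) (s : St) : (Expr.g a e).eval s = s.a a (e.eval s) := rfl
@[simp] theorem eval_inp (e : Expr) (s : St) : (Expr.inp e).eval s = s.i (e.eval s) := rfl
@[simp] theorem eval_add (e f : Expr) (s : St) : (e + f).eval s = e.eval s + f.eval s := rfl
@[simp] theorem eval_sub (e f : Expr) (s : St) : (e - f).eval s = e.eval s - f.eval s := rfl
@[simp] theorem eval_mul (e f : Expr) (s : St) : (e * f).eval s = e.eval s * f.eval s := rfl
@[simp] theorem eval_div (e f : Expr) (s : St) : (e / f).eval s = e.eval s / f.eval s := rfl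
@[simp] theorem eval_zero (s : St) : (0 : Expr).eval s = 0 := rfl
@[simp] theorem eval_one (s : St) : (1 : Expr).eval s = 1 := rfl

@[simp] theorem cost_c (k : ℕ) : (Expr.c k).cost = 1 := rfl
@[simp] theorem cost_v (x : ℕ) : (Expr.v x).cost = 2 := rfl
@[simp] theorem cost_g (a : ℕ) (e : Expr) : (Expr.g a e).cost = e.cost + 6 := rfl
@[simp] theorem cost_inp (e : Expr) : (Expr.inp e).cost = e.cost + 2 := rfl
@[simp] theorem cost_add (e f : Expr) : (e + f).cost = e.cost + f.cost + 1 := rfl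
@[simp] theorem cost_sub (e f : Expr) : (e - f).cost = e.cost + f.cost + 1 := rfl
@[simp] theorem cost_mul (e f : Expr) : (e * f).cost = e.cost + f.cost + 1 := rfl
@[simp] theorem cost_div (e f : Expr) : (e / f).cost = e.cost + f.cost + 1 := rfl
@[simp] theorem cost_zero : (0 : Expr).cost = 1 := rfl
@[simp] theorem cost_one : (1 : Expr).cost = 1 := rfl

end Expr

namespace St

@[simp] theorem set_v (s : St) (x k y : ℕ) : (s.set x k).v y = if y = x then k else s.v y := by
  simp [St.set, Function.update_apply]
@[simp] theorem set_a (s : St) (x k : ℕ) : (s.set x k).a = s.a := rfl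
@[simp] theorem set_i (s : St) (x k : ℕ) : (s.set x k).i = s.i := rfl
@[simp] theorem put_v (s : St) (a j k : ℕ) : (s.put a j k).v = s.v := rfl
@[simp] theorem put_i (s : St) (a j k : ℕ) : (s.put a j k).i = s.i := rfl
@[simp] theorem put_a (s : St) (a j k b : ℕ) :
    (s.put a j k).a b = if b = a then Function.update (s.a a) j k else s.a b := by
  by_cases h : b = a
  · subst h; simp [St.put]
  · simp [St.put, h]

end St

/-- All words of the state are below `M`. -/
structure Bd (M : ℕ) (s : St) : Prop where
  v : ∀ x, s.v x < M
  a : ∀ a j, s.a a j < M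
  i : ∀ j, s.i j < M

/-- Structured programs. -/
inductive Cmd
  | skip
  | set (x : ℕ) (e : Expr)
  | put (a : ℕ) (e f : Expr)
  | seq (p q : Cmd)
  | ite (e f : Expr) (p q : Cmd)
  | whl (e f : Expr) (p : Cmd)

/-- `Big M p s t c`: from `s` the program ends in `t` after `c` steps of the compiled code, and
all words that it stores are below `M`. -/
inductive Big (M : ℕ) : Cmd → St → St → ℕ → Prop
  | skip (s : St) : Big M .skip s s 1
  | set (s : St) (x : ℕ) (e : Expr) : e.eval s < M →
      Big M (.set x e) s (s.set x (e.eval s)) (e.cost + 2)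
  | put (s : St) (a : ℕ) (e f : Expr) : f.eval s < M →
      Big M (.put a e f) s (s.put a (e.eval s) (f.eval s)) (e.cost + f.cost + 6)
  | seq {p q : Cmd} {s t u : St} {c d : ℕ} :
      Big M p s t c → Big M q t u d → Big M (.seq p q) s u (c + d)
  | iteT {e f : Expr} {p q : Cmd} {s t : St} {c : ℕ} : e.eval s < f.eval s →
      Big M p s t c → Big M (.ite e f p q) s t (c + (e.cost + f.cost + 1))
  | iteF {e f : Expr} {p q : Cmd} {s t : St} {c : ℕ} : ¬ e.eval s < f.eval s →
      Big M q s t c → Big M (.ite e f p q) s t (c + (e.cost + f.cost + 1))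
  | whlT {e f : Expr} {p : Cmd} {s t u : St} {c d : ℕ} : e.eval s < f.eval s →
      Big M p s t c → Big M (.whl e f p) t u d →
      Big M (.whl e f p) s u (c + d + (e.cost + f.cost + 1))
  | whlF {e f : Expr} {p : Cmd} {s : St} : ¬ e.eval s < f.eval s →
      Big M (.whl e f p) s s (e.cost + f.cost + 1)

namespace Cmd

/-- Variables that a program may modify. -/
def mv : Cmd → List ℕ
  | .skip => []
  | .set x _ => [x]
  | .put _ _ _ => []
  | .seq p q => p.mv ++ q.mv
  | .ite _ _ p q => p.mv ++ q.mv
  | .whl _ _ p => p.mv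

/-- Arrays that a program may modify. -/
def ma : Cmd → List ℕ
  | .skip => []
  | .set _ _ => []
  | .put a _ _ => [a]
  | .seq p q => p.ma ++ q.ma
  | .ite _ _ p q => p.ma ++ q.ma
  | .whl _ _ p => p.ma

def ok : Cmd → Bool
  | .skip => true
  | .set x e => x < NV && e.ok
  | .put a e f => a < NA && e.ok && f.ok && e.deg ≤ 8
  | .seq p q => p.ok && q.ok
  | .ite e f p q => e.ok && f.ok && p.ok && q.ok
  | .whl e f p => e.ok && f.ok && p.ok

def code : Cmd → Prog
  | .skip => .skip
  -- The machine has no move instruction; adding `0` copies the result into the variable.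
  | .set x e => .seq (e.code 0) (.seq (.const (NV + 2) 0) (.op .add x (NV + 1) (NV + 2)))
  | .put a e f => .seq (e.code 0) (.seq (f.code 1) (.seq (.const (NV + 3) NA)
      (.seq (.op .mul (NV + 1) (NV + 1) (NV + 3)) (.seq (.const (NV + 3) a)
      (.seq (.op .add (NV + 1) (NV + 1) (NV + 3)) (.seq (.op .add (NV + 1) (NV + 1) NV)
      (.store (NV + 1) (NV + 2))))))))
  | .seq p q => .seq p.code q.code
  | .ite e f p q => .seq (.seq (e.code 0) (f.code 1)) (.ite (NV + 1) (NV + 2) p.code q.code)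
  | .whl e f p => .seq (.seq (e.code 0) (f.code 1))
      (.loop (NV + 1) (NV + 2) (.seq p.code (.seq (e.code 0) (f.code 1))))

/-- `for x = 0, …, e - 1 do p`. -/
def for_ (x : ℕ) (e : Expr) (p : Cmd) : Cmd :=
  .seq (.set x 0) (.whl (.v x) e (.seq p (.set x (.v x + 1))))

end Cmd

/-- What every run of `p` from `s` to `t` guarantees. -/
structure Fr (M : ℕ) (p : Cmd) (s t : St) : Prop where
  v : ∀ x, x ∉ p.mv → t.v x = s.v x
  a : ∀ a, a ∉ p.ma → t.a a = s.a a
  i : t.i = s.i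
  bd : Bd M s → Bd M t

/-! ### Frame conditions: what a program leaves unchanged. -/

theorem Fr.refl (M : ℕ) (p : Cmd) (s : St) : Fr M p s s :=
  ⟨fun _ _ => rfl, fun _ _ => rfl, rfl, id⟩

theorem Fr.trans {M : ℕ} {p : Cmd} {s t u : St} (h : Fr M p s t) (k : Fr M p t u) : Fr M p s u :=
  ⟨fun x hx => (k.v x hx).trans (h.v x hx), fun x hx => (k.a x hx).trans (h.a x hx),
    k.i.trans h.i, fun b => k.bd (h.bd b)⟩

theorem Fr.mono {M : ℕ} {p q : Cmd} {s t : St} (h : Fr M p s t) (hv : ∀ x, x ∈ p.mv → x ∈ q.mv)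
    (ha : ∀ x, x ∈ p.ma → x ∈ q.ma) : Fr M q s t :=
  ⟨fun x hx => h.v x fun k => hx (hv x k), fun x hx => h.a x fun k => hx (ha x k), h.i, h.bd⟩

theorem Bd.set {M : ℕ} {s : St} (h : Bd M s) {k : ℕ} (hk : k < M) (x : ℕ) : Bd M (s.set x k) := by
  refine ⟨fun y => ?_, h.a, h.i⟩
  rw [St.set_v]; split
  · exact hk
  · exact h.v y

theorem Bd.put {M : ℕ} {s : St} (h : Bd M s) {k : ℕ} (hk : k < M) (a j : ℕ) :
    Bd M (s.put a j k) := by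
  refine ⟨h.v, fun b l => ?_, h.i⟩
  rw [St.put_a]; split
  · rw [Function.update_apply]; split
    · exact hk
    · exact h.a _ _
  · exact h.a b l

theorem Big.fr {M : ℕ} {p : Cmd} {s t : St} {c : ℕ} (h : Big M p s t c) : Fr M p s t := by
  induction h with
  | skip s => exact Fr.refl _ _ _
  | set s x e h =>
    refine ⟨fun y hy => ?_, fun _ _ => rfl, rfl, fun b => b.set h x⟩
    have : y ≠ x := by simpa [Cmd.mv] using hy
    simp [this]
  | put s a e f h =>
    refine ⟨fun _ _ => rfl, fun y hy => ?_, rfl, fun b => b.put h _ _⟩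
    have : y ≠ a := by simpa [Cmd.ma] using hy
    simp [this]
  | seq _ _ h1 h2 =>
    exact (h1.mono (by simp +contextual [Cmd.mv]) (by simp +contextual [Cmd.ma])).trans
      (h2.mono (by simp +contextual [Cmd.mv]) (by simp +contextual [Cmd.ma]))
  | iteT _ _ h1 => exact h1.mono (by simp +contextual [Cmd.mv]) (by simp +contextual [Cmd.ma])
  | iteF _ _ h1 => exact h1.mono (by simp +contextual [Cmd.mv]) (by simp +contextual [Cmd.ma])
  | whlT _ _ _ h1 h2 => exact (h1.mono (by simp [Cmd.mv]) (by simp [Cmd.ma])).trans h2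
  | whlF _ => exact Fr.refl _ _ _

/-- Weakest precondition: `p` ends from `s`, in a state and with a cost that satisfy `Q`. -/
def wp (M : ℕ) (p : Cmd) (s : St) (Q : St → ℕ → Prop) : Prop := ∃ t c, Big M p s t c ∧ Q t c

/-! ### Rules for weakest preconditions with costs. -/

section wp

variable {M : ℕ} {s : St} {Q : St → ℕ → Prop}

theorem wp_mono {p : Cmd} {Q' : St → ℕ → Prop} (h : wp M p s Q)
    (hQ : ∀ t c, Fr M p s t → Q t c → Q' t c) : wp M p s Q' := by
  obtain ⟨t, c, h, q⟩ := h
  exact ⟨t, c, h, hQ t c h.fr q⟩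

@[simp] theorem wp_skip : wp M .skip s Q ↔ Q s 1 :=
  ⟨fun ⟨_, _, h, q⟩ => by cases h; exact q, fun q => ⟨_, _, .skip s, q⟩⟩

@[simp] theorem wp_set {x : ℕ} {e : Expr} :
    wp M (.set x e) s Q ↔ e.eval s < M ∧ Q (s.set x (e.eval s)) (e.cost + 2) :=
  ⟨fun ⟨_, _, h, q⟩ => by cases h with | set _ _ _ h => exact ⟨h, q⟩,
    fun ⟨h, q⟩ => ⟨_, _, .set s x e h, q⟩⟩

@[simp] theorem wp_put {a : ℕ} {e f : Expr} :
    wp M (.put a e f) s Q ↔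
      f.eval s < M ∧ Q (s.put a (e.eval s) (f.eval s)) (e.cost + f.cost + 6) :=
  ⟨fun ⟨_, _, h, q⟩ => by cases h with | put _ _ _ _ h => exact ⟨h, q⟩,
    fun ⟨h, q⟩ => ⟨_, _, .put s a e f h, q⟩⟩

@[simp] theorem wp_seq {p q : Cmd} :
    wp M (.seq p q) s Q ↔ wp M p s fun t c => wp M q t fun u d => Q u (c + d) :=
  ⟨fun ⟨_, _, h, k⟩ => by cases h with | seq h1 h2 => exact ⟨_, _, h1, _, _, h2, k⟩,
    fun ⟨_, _, h1, _, _, h2, k⟩ => ⟨_, _, .seq h1 h2, k⟩⟩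

@[simp] theorem wp_ite {e f : Expr} {p q : Cmd} :
    wp M (.ite e f p q) s Q ↔
      (e.eval s < f.eval s → wp M p s fun t c => Q t (c + (e.cost + f.cost + 1))) ∧
      (¬ e.eval s < f.eval s → wp M q s fun t c => Q t (c + (e.cost + f.cost + 1))) := by
  constructor
  · rintro ⟨_, _, h, k⟩
    cases h with
    | iteT h1 h2 => exact ⟨fun _ => ⟨_, _, h2, k⟩, fun h => absurd h1 h⟩
    | iteF h1 h2 => exact ⟨fun h => absurd h h1, fun _ => ⟨_, _, h2, k⟩⟩
  · rintro ⟨h1, h2⟩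
    by_cases h : e.eval s < f.eval s
    · obtain ⟨_, _, k, q⟩ := h1 h; exact ⟨_, _, .iteT h k, q⟩
    · obtain ⟨_, _, k, q⟩ := h2 h; exact ⟨_, _, .iteF h k, q⟩

/-- The loop rule; the invariant carries the remaining budget of steps. -/
theorem wp_whl {e f : Expr} {p : Cmd} {k : ℕ} (I : St → ℕ → Prop) (h0 : I s k)
    (h : ∀ s' k', Fr M p s s' → I s' k' → e.eval s' < f.eval s' →
      wp M p s' fun t c => ∃ k'', I t k'' ∧ c + k'' + (e.cost + f.cost + 1) ≤ k') :
    wp M (.whl e f p) s fun t c => Fr M p s t ∧ ¬ e.eval t < f.eval t ∧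
      ∃ k', I t k' ∧ c + k' ≤ k + (e.cost + f.cost + 1) := by
  have main : ∀ k s', Fr M p s s' → I s' k → wp M (.whl e f p) s' fun t c => Fr M p s t ∧
      ¬ e.eval t < f.eval t ∧ ∃ k', I t k' ∧ c + k' ≤ k + (e.cost + f.cost + 1) := by
    intro k
    -- Each test costs at least one step, so the remaining budget strictly decreases and also proves
    -- termination.
    induction k using Nat.strong_induction_on with
    | _ k ih =>
      intro s' hs hI
      by_cases hc : e.eval s' < f.eval s'
      · obtain ⟨t, c, h1, k'', h2, h3⟩ := h s' k hs hI hc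
        obtain ⟨u, d, h4, h5, h6, k', h7, h8⟩ := ih k'' (by omega) t (hs.trans h1.fr) h2
        exact ⟨u, _, .whlT hc h1 h4, h5, h6, k', h7, by omega⟩
      · exact ⟨s', _, .whlF hc, hs, hc, k, hI, by omega⟩
  exact main k s (Fr.refl _ _ _) h0

/-- The rule for counting loops. -/
theorem wp_for {x : ℕ} {e : Expr} {p : Cmd} (n b : ℕ) (I : ℕ → St → Prop) (hn : n < M)
    (hx : x ∉ p.mv) (he : ∀ t, Fr M (.for_ x e p) s t → e.eval t = n) (h0 : I 0 (s.set x 0))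
    (h : ∀ j < n, ∀ t, Fr M (.for_ x e p) s t → t.v x = j → I j t →
      wp M p t fun u c => c ≤ b ∧ I (j + 1) (u.set x (j + 1))) :
    wp M (.for_ x e p) s fun t c => Fr M (.for_ x e p) s t ∧ t.v x = n ∧ I n t ∧
      c ≤ n * (b + e.cost + 9) + e.cost + 6 := by
  have hM : 0 < M := by omega
  suffices wp M (.for_ x e p) s fun t c => t.v x = n ∧ I n t ∧
      c ≤ n * (b + e.cost + 9) + e.cost + 6 from wp_mono this fun t c h1 h2 => ⟨h1, h2⟩
  have fr0 : ∀ {t}, Fr M (.seq p (.set x (.v x + 1))) (s.set x 0) t → Fr M (.for_ x e p) s t := by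
    intro t ht
    refine ⟨fun y hy => ?_, fun y hy => ?_, ht.i, fun b => ht.bd (b.set hM x)⟩
    · simp only [Cmd.for_, Cmd.mv, List.mem_append, List.mem_singleton, not_or] at hy
      rw [ht.v y (by simp [Cmd.mv, hy])]; simp [hy]
    · simp only [Cmd.for_, Cmd.ma, List.mem_append, not_or] at hy
      rw [ht.a y (by simp [Cmd.ma, hy])]; simp
  unfold Cmd.for_
  rw [wp_seq, wp_set]
  refine ⟨hM, ?_⟩
  refine wp_mono (wp_whl (k := n * (b + e.cost + 9)) (fun t k => t.v x ≤ n ∧ I (t.v x) t ∧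
    (n - t.v x) * (b + e.cost + 9) = k) ?_ ?_) ?_
  · simpa using h0
  · rintro t k ht ⟨h1, h2, h3⟩ hlt
    rw [he t (fr0 ht), Expr.eval_v] at hlt
    rw [wp_seq]
    refine wp_mono (h _ hlt t (fr0 ht) rfl h2) ?_
    rintro u c hu ⟨hc, hI⟩
    rw [wp_set]
    have hux : u.v x = t.v x := hu.v x hx
    refine ⟨by simp only [Expr.eval_add, Expr.eval_v, Expr.eval_one]; omega, _, ⟨?_, ?_, rfl⟩, ?_⟩
    · simp [hux]; omega
    · simpa [hux] using hI
    · simp only [St.set_v, if_true, Expr.eval_add, Expr.eval_v, Expr.eval_one, hux, ← h3,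
        Expr.cost_add, Expr.cost_v, Expr.cost_one]
      have : n - t.v x = (n - (t.v x + 1)) + 1 := by omega
      rw [this, Nat.add_mul]
      omega
  · rintro t c _ ⟨h1, h2, k, ⟨h3, h4, h5⟩, h6⟩
    rw [he t (fr0 h1), Expr.eval_v] at h2
    have : t.v x = n := by omega
    rw [this] at h4
    refine ⟨this, h4, ?_⟩
    simp only [Expr.cost_v, Expr.cost_zero] at *
    omega

end wp

/-! ### Correctness of the compiler -/

/-- The machine state `σ` represents `s`; the arrays start at address `X`. -/
structure Rep (X : ℕ) (s : St) (σ : State) : Prop where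
  v : ∀ x < NV, σ.reg x = s.v x
  base : σ.reg NV = X
  a : ∀ a < NA, ∀ j, σ.mem (X + NA * j + a) = s.a a j
  i : ∀ j < X, σ.mem j = s.i j
  i' : ∀ j, X ≤ j → s.i j = 0

theorem Rep.setReg {X : ℕ} {s : St} {σ : State} (h : Rep X s σ) {d : ℕ} (hd : NV < d)
    (k : ℕ) : Rep X s (σ.setReg d k) := by
  refine ⟨fun x hx => ?_, ?_, h.a, h.i, h.i'⟩
  · simp [State.setReg, Function.update_of_ne (show x ≠ d by omega), h.v x hx]
  · simp [State.setReg, Function.update_of_ne (show NV ≠ d by omega), h.base]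

/-- For sums: both operands are below powers of `M` with exponent at least `1`, and two numbers of
size at least `M` have a sum below their product. Truncated subtraction and division never exceed
the first operand. -/
theorem Expr.eval_lt {M : ℕ} (hM : 1000 ≤ M) {s : St} (hs : Bd M s) :
    ∀ e : Expr, e.ok → e.eval s < M ^ e.deg ∧ 1 ≤ e.deg
  | .c k, h => by
    have : k < 1000 := by simpa [Expr.ok] using h
    simp [Expr.deg]; omega
  | .v x, _ => by simp [Expr.deg, hs.v x]
  | .g a e, _ => by simp [Expr.deg, hs.a]
  | .inp e, _ => by simp [Expr.deg, hs.i]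
  | .o p e f, h => by
    simp only [Expr.ok, Bool.and_eq_true] at h
    obtain ⟨h1, h2⟩ := Expr.eval_lt hM hs e h.1.1
    obtain ⟨h3, h4⟩ := Expr.eval_lt hM hs f h.1.2
    have he : M ≤ M ^ e.deg := by
      calc M = M ^ 1 := (pow_one M).symm
        _ ≤ M ^ e.deg := Nat.pow_le_pow_right (by omega) h2
    have hf : M ≤ M ^ f.deg := by
      calc M = M ^ 1 := (pow_one M).symm
        _ ≤ M ^ f.deg := Nat.pow_le_pow_right (by omega) h4
    cases p with
    | add => refine ⟨?_, by simp [Expr.deg]; omega⟩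
             simp only [Expr.eval, Op.eval, Expr.deg, pow_add]; nlinarith
    | mul => refine ⟨?_, by simp [Expr.deg]; omega⟩
             simp only [Expr.eval, Op.eval, Expr.deg, pow_add]; exact Nat.mul_lt_mul'' h1 h3
    | sub => exact ⟨lt_of_le_of_lt (Nat.sub_le _ _) h1, h2⟩
    | div => exact ⟨lt_of_le_of_lt (Nat.div_le_self _ _) h1, h2⟩

theorem Expr.eval_lt_pow {M : ℕ} (hM : 1000 ≤ M) {s : St} (hs : Bd M s) {e : Expr} (h : e.ok)
    (hd : e.deg ≤ 8) : e.eval s < M ^ 8 :=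
  (Expr.eval_lt hM hs e h).1.trans_le (Nat.pow_le_pow_right (by omega) hd)

theorem Expr.deg_le {e : Expr} (h : e.ok) : e.deg ≤ 8 := by
  cases e with
  | c => simp [Expr.deg]
  | v => simp [Expr.deg]
  | g => simp [Expr.deg]
  | inp => simp [Expr.deg]
  | o p e f => simp only [Expr.ok, Bool.and_eq_true, decide_eq_true_eq] at h; exact h.2

/-- An index below `M ^ 8`, times the number `40` of arrays, plus an array number and the base
address: the factor `M ^ 4 ≥ 1000` absorbs all of it. -/
theorem pow_facts {M x : ℕ} (hM : 1000 ≤ M) (hx : x < M ^ 8) :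
    x * 40 < M ^ 12 ∧ x * 40 + 40 + M < M ^ 12 ∧ M < M ^ 12 ∧ M ^ 8 ≤ M ^ 12 := by
  have h1 : M ^ 12 = M ^ 8 * M ^ 4 := by ring
  have h2 : M ^ 8 = M * M ^ 7 := by ring
  have h3 : 1 ≤ M ^ 7 := Nat.one_le_pow _ _ (by omega)
  have h4 : 1000 ≤ M ^ 4 := hM.trans (Nat.le_self_pow (by norm_num) M)
  have h5 : M ≤ M ^ 8 := Nat.le_self_pow (by norm_num) M
  have h6 : M ^ 8 * 1000 ≤ M ^ 12 := by rw [h1]; exact Nat.mul_le_mul_left _ h4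
  omega

/-- The induction needs the stack discipline of the last clause: code at depth `d` leaves the
registers below its result register alone, so a left operand survives the evaluation of the right
one at depth `d + 1`. -/
theorem Expr.exec {M X : ℕ} (hM : 1000 ≤ M) (hX : X < M) {s : St} (hs : Bd M s) :
    ∀ (e : Expr), e.ok → ∀ (d : ℕ) (σ : State), Rep X s σ →
      ∃ τ, Exec (M ^ 12) (e.code d) σ τ e.cost ∧ Rep X s τ ∧ τ.reg (NV + 1 + d) = e.eval s ∧
        ∀ j, NV ≤ j → j < NV + 1 + d → τ.reg j = σ.reg j := by
  have hM1 : 1000 < M ^ 12 := lt_of_le_of_lt hM (pow_facts hM (x := 0) (by positivity)).2.2.1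
  intro e
  induction e with
  | c k =>
    intro h d σ hσ
    have : k < 1000 := by simpa [Expr.ok] using h
    refine ⟨_, Exec.const σ _ k (by omega), hσ.setReg (by omega) _, ?_, fun j _ hj => ?_⟩
    · simp [State.setReg]
    · simp [State.setReg, Function.update_of_ne (show j ≠ NV + 1 + d by omega)]
  | v x =>
    intro h d σ hσ
    have hx : x < NV := by simpa [Expr.ok] using h
    have hv := hs.v x
    have hpf := (pow_facts hM (x := 0) (by positivity)).2.2.1
    have e1 : (σ.setReg (NV + 1 + d) 0).reg x = s.v x := by
      rw [← hσ.v x hx]; simp [State.setReg, Function.update_of_ne (show x ≠ NV + 1 + d by omega)]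
    have e2 : (σ.setReg (NV + 1 + d) 0).reg (NV + 1 + d) = 0 := by simp [State.setReg]
    refine ⟨_, Exec.seq (Exec.const σ _ 0 (by omega)) (Exec.op _ .add _ _ _ ?_),
      (hσ.setReg (by omega) _).setReg (by omega) _, ?_, fun j _ hj => ?_⟩
    · rw [e1, e2]; simp only [Op.eval]; omega
    · rw [e1, e2]; simp [State.setReg, Op.eval]
    · simp [State.setReg, Function.update_of_ne (show j ≠ NV + 1 + d by omega)]
  | g a e ih =>
    intro h d σ hσ
    simp only [Expr.ok, Bool.and_eq_true, decide_eq_true_eq] at h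
    obtain ⟨τ, h1, h2, h3, h4⟩ := ih h.1.2 d σ hσ
    have hlt := Expr.eval_lt_pow hM hs h.1.2 h.2
    obtain ⟨f1, f2, f3, f4⟩ := pow_facts hM hlt
    have ha := h.1.1
    have hmem := h2.a a ha (e.eval s)
    have hbase := h2.base
    have hld := hs.a a (e.eval s)
    set y := e.eval s
    have hne : (NV + 1 + d) ≠ NV + 2 + d := by omega
    have hne' : NV ≠ NV + 1 + d := by omega
    have hne'' : NV ≠ NV + 2 + d := by omega
    let τ1 := τ.setReg (NV + 2 + d) NA
    let τ2 := τ1.setReg (NV + 1 + d) (y * NA)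
    let τ3 := τ2.setReg (NV + 2 + d) a
    let τ4 := τ3.setReg (NV + 1 + d) (y * NA + a)
    let τ5 := τ4.setReg (NV + 1 + d) (y * NA + a + X)
    let τ6 := τ5.setReg (NV + 1 + d) (s.a a y)
    have x1 : Exec (M ^ 12) (.const (NV + 2 + d) NA) τ τ1 1 := Exec.const _ _ _ (by omega)
    have x2 : Exec (M ^ 12) (.op .mul (NV + 1 + d) (NV + 1 + d) (NV + 2 + d)) τ1 τ2 1 := by
      have q : Op.mul.eval (τ1.reg (NV + 1 + d)) (τ1.reg (NV + 2 + d)) = y * NA := by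
        simp [τ1, State.setReg, Op.eval, h3]
      have := Exec.op (B := M ^ 12) τ1 .mul (NV + 1 + d) (NV + 1 + d) (NV + 2 + d)
      rw [q] at this; exact this (by omega)
    have x3 : Exec (M ^ 12) (.const (NV + 2 + d) a) τ2 τ3 1 := Exec.const _ _ _ (by omega)
    have x4 : Exec (M ^ 12) (.op .add (NV + 1 + d) (NV + 1 + d) (NV + 2 + d)) τ3 τ4 1 := by
      have q : Op.add.eval (τ3.reg (NV + 1 + d)) (τ3.reg (NV + 2 + d)) = y * NA + a := by
        simp [τ3, τ2, State.setReg, Op.eval]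
      have := Exec.op (B := M ^ 12) τ3 .add (NV + 1 + d) (NV + 1 + d) (NV + 2 + d)
      rw [q] at this; exact this (by omega)
    have x5 : Exec (M ^ 12) (.op .add (NV + 1 + d) (NV + 1 + d) NV) τ4 τ5 1 := by
      have q : Op.add.eval (τ4.reg (NV + 1 + d)) (τ4.reg NV) = y * NA + a + X := by
        simp [τ4, τ3, τ2, τ1, State.setReg, Op.eval, Function.update_of_ne hne',
          Function.update_of_ne hne'', hbase]
      have := Exec.op (B := M ^ 12) τ4 .add (NV + 1 + d) (NV + 1 + d) NV
      rw [q] at this; exact this (by omega)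
    have x6 : Exec (M ^ 12) (.load (NV + 1 + d) (NV + 1 + d)) τ5 τ6 1 := by
      have q : τ5.reg (NV + 1 + d) = y * NA + a + X := by simp [τ5, State.setReg]
      have q2 : τ5.mem (τ5.reg (NV + 1 + d)) = s.a a y := by
        rw [q, ← hmem, show y * NA + a + X = X + NA * y + a by ring]; rfl
      have := Exec.load (B := M ^ 12) τ5 (NV + 1 + d) (NV + 1 + d)
      rw [q2, q] at this; exact this (by omega) (by omega)
    refine ⟨τ6, ?_, ?_, ?_, fun j hj0 hj => ?_⟩
    · exact Exec.seq h1 (Exec.seq x1 (Exec.seq x2 (Exec.seq x3 (Exec.seq x4 (Exec.seq x5 x6)))))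
    · exact (((((h2.setReg (by omega) _).setReg (by omega) _).setReg (by omega) _).setReg
        (by omega) _).setReg (by omega) _).setReg (by omega) _
    · simp [τ6, State.setReg, Expr.eval, y]
    · rw [← h4 j hj0 hj]
      simp [τ6, τ5, τ4, τ3, τ2, τ1, State.setReg, Function.update_of_ne (show j ≠ NV + 1 + d by omega),
        Function.update_of_ne (show j ≠ NV + 2 + d by omega)]
  | inp e ih =>
    intro h d σ hσ
    simp only [Expr.ok, Bool.and_eq_true, decide_eq_true_eq] at h
    obtain ⟨τ, h1, h2, h3, h4⟩ := ih h.1 d σ hσ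
    have hlt := Expr.eval_lt_pow hM hs h.1 h.2
    obtain ⟨f1, f2, f3, f4⟩ := pow_facts hM hlt
    have hi := hs.i (e.eval s)
    by_cases hc : e.eval s < X
    · have q := h2.i _ hc
      refine ⟨_, Exec.seq h1 (Exec.iteTrue (by rw [h3, h2.base]; exact hc)
        (Exec.load _ _ _ (by rw [h3]; omega) (by rw [h3, q]; omega))), h2.setReg (by omega) _, ?_,
        fun j hj0 hj => ?_⟩
      · simp only [State.setReg, Function.update_self, h3, q, Expr.eval]
      · rw [← h4 j hj0 hj]
        simp [State.setReg, Function.update_of_ne (show j ≠ NV + 1 + d by omega)]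
    · refine ⟨_, Exec.seq h1 (Exec.iteFalse (by rw [h3, h2.base]; exact hc)
        (Exec.const _ _ _ (by omega))), h2.setReg (by omega) _, ?_,
        fun j hj0 hj => ?_⟩
      · simp only [State.setReg, Function.update_self, Expr.eval, h2.i' _ (not_lt.1 hc)]
      · rw [← h4 j hj0 hj]
        simp [State.setReg, Function.update_of_ne (show j ≠ NV + 1 + d by omega)]
  | o p e f ihe ihf =>
    intro h d σ hσ
    have hlt := Expr.eval_lt_pow hM hs h (Expr.deg_le h)
    have f4 := (pow_facts hM hlt).2.2.2
    simp only [Expr.ok, Bool.and_eq_true, decide_eq_true_eq] at h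
    obtain ⟨τ, h1, h2, h3, h4⟩ := ihe h.1.1 d σ hσ
    obtain ⟨ρ, k1, k2, k3, k4⟩ := ihf h.1.2 (d + 1) τ h2
    have e1 : ρ.reg (NV + 1 + d) = e.eval s := by rw [k4 _ (by omega) (by omega), h3]
    have e2 : ρ.reg (NV + 2 + d) = f.eval s := by
      rw [← k3]; congr 1; omega
    have q : p.eval (ρ.reg (NV + 1 + d)) (ρ.reg (NV + 2 + d)) = (Expr.o p e f).eval s := by
      rw [e1, e2]; rfl
    have x := Exec.op (B := M ^ 12) ρ p (NV + 1 + d) (NV + 1 + d) (NV + 2 + d)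
    rw [q] at x
    have := Exec.seq h1 (Exec.seq k1 (x (by omega)))
    refine ⟨_, this.cast (by simp only [Expr.cost]; omega), k2.setReg (by omega) _, ?_, fun j hj0 hj => ?_⟩
    · simp [State.setReg]
    · rw [← h4 j hj0 hj, ← k4 j hj0 (by omega)]
      simp [State.setReg, Function.update_of_ne (show j ≠ NV + 1 + d by omega)]

theorem Expr.exec₂ {M X : ℕ} (hM : 1000 ≤ M) (hX : X < M) {s : St} (hs : Bd M s) {e f : Expr}
    (he : e.ok) (hf : f.ok) {σ : State} (hσ : Rep X s σ) :
    ∃ π τ, Exec (M ^ 12) (e.code 0) σ π e.cost ∧ Exec (M ^ 12) (f.code 1) π τ f.cost ∧ Rep X s τ ∧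
      τ.reg (NV + 1) = e.eval s ∧ τ.reg (NV + 2) = f.eval s := by
  obtain ⟨τ, h1, h2, h3, h4⟩ := Expr.exec hM hX hs e he 0 σ hσ
  obtain ⟨ρ, k1, k2, k3, k4⟩ := Expr.exec hM hX hs f hf 1 τ h2
  refine ⟨τ, ρ, h1, k1, k2, ?_, k3⟩
  rw [k4 _ (by omega) (by omega)]; exact h3

/-- Simulation with exactly the same number of steps. Words of the source program stay below `M`;
only the compiled temporaries and addresses need the larger bound `M ^ 12`. -/
theorem Big.exec {M X : ℕ} (hM : 1000 ≤ M) (hX : X < M) {p : Cmd} {s t : St} {c : ℕ}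
    (h : Big M p s t c) : p.ok → Bd M s → ∀ σ, Rep X s σ →
      ∃ τ, Exec (M ^ 12) p.code σ τ c ∧ Rep X t τ := by
  have hM0 := (pow_facts hM (x := 0) (by positivity)).2.2.1
  have hM1 : 1000 < M ^ 12 := lt_of_le_of_lt hM hM0
  induction h with
  | skip s => exact fun _ _ σ hσ => ⟨σ, Exec.skip σ, hσ⟩
  | set s x e h =>
    intro hok hs σ hσ
    simp only [Cmd.ok, Bool.and_eq_true, decide_eq_true_eq] at hok
    obtain ⟨τ, h1, h2, h3, h4⟩ := Expr.exec hM hX hs e hok.2 0 σ hσ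
    have x1 : Exec (M ^ 12) (.const (NV + 2) 0) τ (τ.setReg (NV + 2) 0) 1 :=
      Exec.const _ _ _ (by omega)
    have q : Op.add.eval ((τ.setReg (NV + 2) 0).reg (NV + 1)) ((τ.setReg (NV + 2) 0).reg (NV + 2))
        = e.eval s := by
      simpa [State.setReg, Op.eval, Function.update_of_ne] using h3
    have x2 := Exec.op (B := M ^ 12) (τ.setReg (NV + 2) 0) .add x (NV + 1) (NV + 2)
    rw [q] at x2
    refine ⟨_, Exec.seq h1 (Exec.seq x1 (x2 (by omega))), ?_⟩
    refine ⟨fun y hy => ?_, ?_, h2.a, h2.i, h2.i'⟩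
    · rw [St.set_v]
      by_cases hyx : y = x
      · simp [State.setReg, hyx]
      · simp [State.setReg, hyx, Function.update_of_ne (show y ≠ NV + 2 by omega), h2.v y hy]
    · simp [State.setReg, Function.update_of_ne (show NV ≠ x by omega), h2.base]
  | put s a e f h =>
    intro hok hs σ hσ
    simp only [Cmd.ok, Bool.and_eq_true, decide_eq_true_eq] at hok
    obtain ⟨⟨⟨ha, he⟩, hf⟩, hd⟩ := hok
    obtain ⟨π, τ, u1, u2, h2, h3, h4⟩ := Expr.exec₂ hM hX hs he hf hσ
    have hlt := Expr.eval_lt_pow hM hs he hd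
    obtain ⟨f1, f2, f3, f4⟩ := pow_facts hM hlt
    have hbase := h2.base
    have hmem := h2.a
    set y := e.eval s
    set z := f.eval s
    let τ1 := τ.setReg (NV + 3) NA
    let τ2 := τ1.setReg (NV + 1) (y * NA)
    let τ3 := τ2.setReg (NV + 3) a
    let τ4 := τ3.setReg (NV + 1) (y * NA + a)
    let τ5 := τ4.setReg (NV + 1) (y * NA + a + X)
    let τ6 := τ5.setMem (y * NA + a + X) z
    have x1 : Exec (M ^ 12) (.const (NV + 3) NA) τ τ1 1 := Exec.const _ _ _ (by omega)
    have x2 : Exec (M ^ 12) (.op .mul (NV + 1) (NV + 1) (NV + 3)) τ1 τ2 1 := by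
      have q : Op.mul.eval (τ1.reg (NV + 1)) (τ1.reg (NV + 3)) = y * NA := by
        simp [τ1, State.setReg, Op.eval, h3]
      have := Exec.op (B := M ^ 12) τ1 .mul (NV + 1) (NV + 1) (NV + 3)
      rw [q] at this; exact this (by omega)
    have x3 : Exec (M ^ 12) (.const (NV + 3) a) τ2 τ3 1 := Exec.const _ _ _ (by omega)
    have x4 : Exec (M ^ 12) (.op .add (NV + 1) (NV + 1) (NV + 3)) τ3 τ4 1 := by
      have q : Op.add.eval (τ3.reg (NV + 1)) (τ3.reg (NV + 3)) = y * NA + a := by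
        simp [τ3, τ2, State.setReg, Op.eval]
      have := Exec.op (B := M ^ 12) τ3 .add (NV + 1) (NV + 1) (NV + 3)
      rw [q] at this; exact this (by omega)
    have x5 : Exec (M ^ 12) (.op .add (NV + 1) (NV + 1) NV) τ4 τ5 1 := by
      have q : Op.add.eval (τ4.reg (NV + 1)) (τ4.reg NV) = y * NA + a + X := by
        simp [τ4, τ3, τ2, τ1, State.setReg, Op.eval, hbase]
      have := Exec.op (B := M ^ 12) τ4 .add (NV + 1) (NV + 1) NV
      rw [q] at this; exact this (by omega)
    have x6 : Exec (M ^ 12) (.store (NV + 1) (NV + 2)) τ5 τ6 1 := by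
      have q : τ5.reg (NV + 1) = y * NA + a + X := by simp [τ5, State.setReg]
      have q2 : τ5.reg (NV + 2) = z := by
        simp [τ5, τ4, τ3, τ2, τ1, State.setReg, h4]
      have := Exec.store (B := M ^ 12) τ5 (NV + 1) (NV + 2)
      rw [q2, q] at this; exact this (by omega) (by omega)
    refine ⟨τ6, ?_, ?_⟩
    · exact (Exec.seq u1 (Exec.seq u2 (Exec.seq x1 (Exec.seq x2 (Exec.seq x3 (Exec.seq x4
        (Exec.seq x5 x6))))))).cast (by omega)
    · have hreg : Rep X s τ5 := ((((h2.setReg (by omega) _).setReg (by omega) _).setReg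
        (by omega) _).setReg (by omega) _).setReg (by omega) _
      refine ⟨hreg.v, hreg.base, fun b hb j => ?_, fun j hj => ?_, hreg.i'⟩
      · have hm := hreg.a b hb j
        rw [St.put_a]
        by_cases hq : X + NA * j + b = y * NA + a + X
        -- Both array numbers are below `40`, so an address determines array and index.
        · have hjy : j = y ∧ b = a := by omega
          obtain ⟨rfl, rfl⟩ := hjy
          simp [τ6, State.setMem, hq]
        · rw [show τ6.mem (X + NA * j + b) = τ5.mem (X + NA * j + b) by
            simp [τ6, State.setMem, Function.update_of_ne hq], hm]
          split
          · subst b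
            rw [Function.update_of_ne]
            rintro rfl; exact hq (by ring)
          · rfl
      · rw [show τ6.mem j = τ5.mem j by
            simp [τ6, State.setMem, Function.update_of_ne (show j ≠ y * NA + a + X by omega)]]
        exact hreg.i j hj
  | seq h1 h2 ih1 ih2 =>
    intro hok hs σ hσ
    simp only [Cmd.ok, Bool.and_eq_true] at hok
    obtain ⟨τ, k1, k2⟩ := ih1 hok.1 hs σ hσ
    obtain ⟨ρ, k3, k4⟩ := ih2 hok.2 (h1.fr.bd hs) τ k2
    exact ⟨ρ, Exec.seq k1 k3, k4⟩
  | @iteT e f p q s t c hc h1 ih =>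
    intro hok hs σ hσ
    simp only [Cmd.ok, Bool.and_eq_true] at hok
    obtain ⟨π, τ, v1, v2, k2, k3, k4⟩ := Expr.exec₂ hM hX hs hok.1.1.1 hok.1.1.2 hσ
    obtain ⟨ρ, k5, k6⟩ := ih hok.1.2 hs τ k2
    have := Exec.seq (Exec.seq v1 v2) (Exec.iteTrue (q := q.code) (a := NV + 1) (b := NV + 2)
      (by rw [k3, k4]; exact hc) k5)
    exact ⟨ρ, this.cast (by omega), k6⟩
  | @iteF e f p q s t c hc h1 ih =>
    intro hok hs σ hσ
    simp only [Cmd.ok, Bool.and_eq_true] at hok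
    obtain ⟨π, τ, v1, v2, k2, k3, k4⟩ := Expr.exec₂ hM hX hs hok.1.1.1 hok.1.1.2 hσ
    obtain ⟨ρ, k5, k6⟩ := ih hok.2 hs τ k2
    have := Exec.seq (Exec.seq v1 v2) (Exec.iteFalse (p := p.code) (a := NV + 1) (b := NV + 2)
      (by rw [k3, k4]; exact hc) k5)
    exact ⟨ρ, this.cast (by omega), k6⟩
  | @whlT e f p s t u c d hc h1 h2 ih1 ih2 =>
    intro hok hs σ hσ
    have hok' := hok
    simp only [Cmd.ok, Bool.and_eq_true] at hok
    obtain ⟨π, τ, v1, v2, k2, k3, k4⟩ := Expr.exec₂ hM hX hs hok.1.1 hok.1.2 hσ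
    obtain ⟨ρ, k5, k6⟩ := ih1 hok.2 hs τ k2
    obtain ⟨ζ, k7, k8⟩ := ih2 hok' (h1.fr.bd hs) ρ k6
    refine ⟨ζ, ?_, k8⟩
    -- The compiled loop evaluates its test once before the loop and again at the end of the body.
    -- The run of the remaining iterations is therefore taken apart into test and loop, and the test
    -- is attached to the body of the current iteration.
    generalize hn : d = n at k7
    cases k7 with
    | seq u1 u2 =>
      exact (Exec.seq (Exec.seq v1 v2) (Exec.loopTrue (a := NV + 1) (b := NV + 2)
        (by rw [k3, k4]; exact hc) (Exec.seq k5 u1) u2)).cast (by omega)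
  | @whlF e f p s hc =>
    intro hok hs σ hσ
    simp only [Cmd.ok, Bool.and_eq_true] at hok
    obtain ⟨π, τ, v1, v2, k2, k3, k4⟩ := Expr.exec₂ hM hX hs hok.1.1 hok.1.2 hσ
    exact ⟨τ, Exec.seq (Exec.seq v1 v2) (Exec.loopFalse (by rw [k3, k4]; exact hc)), k2⟩

end RAM

/-! ## Walks -/

/-- There is a walk from `c` to the given vertex with the given total weight. -/
inductive Wk {α : Type} (A : α → α → ℕ → Prop) (c : α) : α → ℕ → Prop
  | refl : Wk A c c 0
  | snoc {u v : α} {x w : ℕ} : Wk A c u x → A u v w → Wk A c v (x + w)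

namespace Wk

variable {α : Type} {A B : α → α → ℕ → Prop} {c u v : α} {x y : ℕ}

theorem cast (h : Wk A c v x) (e : x = y) : Wk A c v y := e ▸ h

theorem mono (h : Wk A c v x) (hAB : ∀ u v w, A u v w → B u v w) : Wk B c v x := by
  induction h with
  | refl => exact .refl
  | snoc _ h ih => exact ih.snoc (hAB _ _ _ h)

theorem trans (h : Wk A c u x) (k : Wk A u v y) : Wk A c v (x + y) := by
  induction k with
  | refl => exact h
  | snoc _ k ih => exact (ih.snoc k).cast (by omega)

theorem single {w : ℕ} (h : A u v w) : Wk A u v w := (Wk.refl.snoc h).cast (by omega)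

theorem cons {w : ℕ} (h : A c u w) (k : Wk A u v y) : Wk A c v (w + y) := (single h).trans k

theorem symm (h : Wk A c v x) (hAB : ∀ u v w, A u v w → B v u w) : Wk B v c x := by
  induction h with
  | refl => exact .refl
  | snoc _ h ih => exact (cons (hAB _ _ _ h) ih).cast (by omega)

theorem cases_head (h : Wk A c v x) :
    (v = c ∧ x = 0) ∨ ∃ u w y, A c u w ∧ Wk A u v y ∧ x = w + y := by
  induction h with
  | refl => exact .inl ⟨rfl, rfl⟩
  | @snoc u v x w _ h ih =>
    right
    rcases ih with ⟨rfl, rfl⟩ | ⟨u', w', y, h1, h2, rfl⟩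
    · exact ⟨v, w, 0, h, .refl, by omega⟩
    · exact ⟨u', w', y + w, h1, h2.snoc h, by omega⟩

end Wk

/-! ## Departing replacement paths, combinatorially -/

/-- A weighted graph on numbers with the distances `d` from `p 0` and a shortest path `p`. -/
structure Scene where
  E : ℕ → ℕ → ℕ → Bool → Prop
  N : ℕ
  p : ℕ → ℕ
  L : ℕ
  d : ℕ → ℕ
  lt : ∀ {u v w κ}, E u v w κ → u < N ∧ v < N
  symm : ∀ {u v w κ}, E u v w κ → E v u w κ
  pos : ∀ {u v w κ}, E u v w κ → 0 < w
  one : ∀ {u v w}, E u v w false → w = 1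
  d0 : d (p 0) = 0
  d_le : ∀ {u v w κ}, E u v w κ → d v ≤ d u + w
  d_ex : ∀ v < N, Wk (fun u v w => ∃ κ, E u v w κ) (p 0) v (d v)
  path : ∀ j, j + 1 < L → ∃ w κ, E (p j) (p (j + 1)) w κ ∧ d (p (j + 1)) = d (p j) + w
  L_pos : 0 < L

namespace Scene

variable (S : Scene)

def Step (u v w : ℕ) : Prop := ∃ κ, S.E u v w κ

def OnP (v : ℕ) : Prop := ∃ a < S.L, S.p a = v

/-- Steps whose end is off the path. -/
def DStep (u v w : ℕ) : Prop := S.Step u v w ∧ ¬ S.OnP v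

/-- Unweighted steps whose end is off the path. -/
def UStep (u v w : ℕ) : Prop := S.E u v w false ∧ ¬ S.OnP v

/-- Steps that start at `c` or off the path. -/
def XStep (c u v w : ℕ) : Prop := S.Step u v w ∧ (¬ S.OnP u ∨ u = c)

/-- Steps that are left when the `i`-th edge of the path fails. -/
def AStep (i u v w : ℕ) : Prop :=
  S.E u v w true ∨ (S.E u v w false ∧ s(u, v) ≠ s(S.p i, S.p (i + 1)))

/-- The vertices of the path after its `i`-th edge. -/
def After (i v : ℕ) : Prop := ∃ j, i < j ∧ j < S.L ∧ S.p j = v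

def SStep (i u v w : ℕ) : Prop := S.AStep i u v w ∧ ¬ S.After i u ∧ ¬ S.After i v

/-- A departing replacement path is a walk of this kind whose weight is minimal among all `AStep`
walks, including those that do use vertices after the edge. -/
abbrev Safe (i v x : ℕ) : Prop := Wk (S.SStep i) (S.p 0) v x

/-- `u` is the last vertex before `t` of a path of weight at most `y` that avoids the `i`-th edge
and the vertices after it. -/
def Out (i t y u : ℕ) : Prop := ∃ x w, S.Safe i u x ∧ S.SStep i u t w ∧ x + w ≤ y

variable {S}

theorem step_symm {u v w : ℕ} (h : S.Step u v w) : S.Step v u w := h.imp fun _ h => S.symm h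

theorem d_le_walk {u v x : ℕ} (h : Wk S.Step u v x) : S.d v ≤ S.d u + x := by
  induction h with
  | refl => omega
  | snoc _ h ih => obtain ⟨κ, h⟩ := h; have := S.d_le h; omega

theorem d_lt {j k : ℕ} (hjk : j < k) (hk : k < S.L) : S.d (S.p j) < S.d (S.p k) := by
  induction k with
  | zero => omega
  | succ k ih =>
    obtain ⟨w, κ, h, e⟩ := S.path k hk
    have := S.pos h
    rcases Nat.lt_succ_iff_lt_or_eq.1 hjk with h | rfl
    · have := ih h (by omega); omega
    · omega

theorem d_mono {j k : ℕ} (hjk : j ≤ k) (hk : k < S.L) : S.d (S.p j) ≤ S.d (S.p k) := by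
  rcases hjk.eq_or_lt with rfl | h
  · rfl
  · exact (d_lt h hk).le

theorem p_inj {j k : ℕ} (hj : j < S.L) (hk : k < S.L) (h : S.p j = S.p k) : j = k := by
  rcases lt_trichotomy j k with hlt | he | hlt
  · have := d_lt hlt hk; rw [h] at this; omega
  · exact he
  · have := d_lt hlt hj; rw [h] at this; omega

theorem AStep.step {i u v w : ℕ} (h : S.AStep i u v w) : S.Step u v w :=
  h.elim (fun h => ⟨_, h⟩) fun h => ⟨_, h.1⟩

theorem AStep.symm {i u v w : ℕ} (h : S.AStep i u v w) : S.AStep i v u w :=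
  h.imp (fun h => S.symm h) fun h => ⟨S.symm h.1, by rw [Sym2.eq_swap]; exact h.2⟩

theorem not_after_of_not_onP {i v : ℕ} (h : ¬ S.OnP v) : ¬ S.After i v :=
  fun ⟨j, _, h2, h3⟩ => h ⟨j, h2, h3⟩

theorem not_after {i a : ℕ} (h : a ≤ i) (hi : i < S.L) : ¬ S.After i (S.p a) := by
  rintro ⟨j, h1, h2, h3⟩
  have := p_inj h2 (by omega) h3; omega

/-- The failing edge joins two different vertices of the path, whereas here at most the one vertex
`c` can be on the path. -/
theorem xx_astep {i c u v w : ℕ} (hi : i + 1 < S.L) (h : S.Step u v w)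
    (hu : ¬ S.OnP u ∨ u = c) (hv : ¬ S.OnP v ∨ v = c) : S.AStep i u v w := by
  obtain ⟨κ, h⟩ := h
  cases κ with
  | true => exact .inl h
  | false =>
    refine .inr ⟨h, fun he => ?_⟩
    have hne : S.p i ≠ S.p (i + 1) := fun h => by have := p_inj (by omega) hi h; omega
    have h1 : S.OnP (S.p i) := ⟨i, by omega, rfl⟩
    have h2 : S.OnP (S.p (i + 1)) := ⟨i + 1, hi, rfl⟩
    rcases Sym2.eq_iff.1 he with ⟨rfl, rfl⟩ | ⟨rfl, rfl⟩
    · exact hne ((hu.resolve_left (not_not.2 h1)).trans (hv.resolve_left (not_not.2 h2)).symm)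
    · exact hne ((hv.resolve_left (not_not.2 h1)).trans (hu.resolve_left (not_not.2 h2)).symm)

theorem xx_sstep {i c u v w : ℕ} (hi : i + 1 < S.L) (h : S.Step u v w)
    (hu : ¬ S.OnP u ∨ u = c) (hv : ¬ S.OnP v ∨ v = c) (hc : ¬ S.After i c) : S.SStep i u v w := by
  have key : ∀ u, (¬ S.OnP u ∨ u = c) → ¬ S.After i u := by
    rintro u (h | rfl)
    · exact not_after_of_not_onP h
    · exact hc
  exact ⟨xx_astep hi h hu hv, key u hu, key v hv⟩

/-- `XStep` restricts the start of each step, hence every vertex of the walk except the last; the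
hypothesis on the end vertex supplies what is missing. -/
theorem xwalk_mono {c u x : ℕ} {B : ℕ → ℕ → ℕ → Prop} (h : Wk (S.XStep c) c u x)
    (hu : ¬ S.OnP u ∨ u = c)
    (hB : ∀ u v w, S.Step u v w → (¬ S.OnP u ∨ u = c) → (¬ S.OnP v ∨ v = c) → B u v w) :
    Wk B c u x := by
  induction h with
  | refl => exact .refl
  | snoc _ h ih => exact (ih h.2).snoc (hB _ _ _ h.1 h.2 hu)

theorem safe_p {i a : ℕ} (hi : i + 1 < S.L) (ha : a ≤ i) : S.Safe i (S.p a) (S.d (S.p a)) := by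
  induction a with
  | zero => rw [S.d0]; exact .refl
  | succ a ih =>
    obtain ⟨w, κ, h, e⟩ := S.path a (by omega)
    rw [e]
    refine (ih (by omega)).snoc ⟨?_, not_after (by omega) (by omega), not_after ha (by omega)⟩
    cases κ with
    | true => exact .inl h
    | false =>
      refine .inr ⟨h, fun he => ?_⟩
      rcases Sym2.eq_iff.1 he with ⟨h1, h2⟩ | ⟨h1, h2⟩
      · have := p_inj (by omega) (by omega) h1; omega
      · have := p_inj (by omega) (by omega) h1; have := p_inj (by omega) (by omega) h2; omega

theorem astep_p {i j k : ℕ} (hij : i < j) (hjk : j ≤ k) (hk : k < S.L) :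
    Wk (S.AStep i) (S.p j) (S.p k) (S.d (S.p k) - S.d (S.p j)) := by
  induction k with
  | zero => obtain rfl : j = 0 := by omega
            simpa using Wk.refl
  | succ k ih =>
    rcases hjk.eq_or_lt with rfl | hlt
    · simpa using Wk.refl
    · obtain ⟨w, κ, h, e⟩ := S.path k hk
      have := d_mono (S := S) (show j ≤ k by omega) (by omega)
      refine ((ih (by omega) (by omega)).snoc (w := w) ?_).cast (by omega)
      cases κ with
      | true => exact .inl h
      | false =>
        refine .inr ⟨h, fun he => ?_⟩
        rcases Sym2.eq_iff.1 he with ⟨h1, h2⟩ | ⟨h1, h2⟩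
        · have := p_inj (by omega) (by omega) h1; omega
        · have := p_inj (by omega) (by omega) h2; omega

theorem dwalk_xwalk {c t y : ℕ} (h : Wk S.DStep c t y) :
    Wk (S.XStep c) c t y ∧ (¬ S.OnP t ∨ t = c) := by
  induction h with
  | refl => exact ⟨.refl, .inr rfl⟩
  | snoc _ h ih => exact ⟨ih.1.snoc ⟨h.1, ih.2⟩, .inl h.2⟩

theorem dwalk_safe {i c t y : ℕ} (hi : i + 1 < S.L) (hc : ¬ S.After i c)
    (h : Wk S.DStep c t y) : Wk (S.SStep i) c t y :=
  xwalk_mono (dwalk_xwalk h).1 (dwalk_xwalk h).2 fun _ _ _ h hu hv => xx_sstep hi h hu hv hc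

theorem dwalk_astep {i c t y : ℕ} (hi : i + 1 < S.L) (h : Wk S.DStep c t y) :
    Wk (S.AStep i) c t y :=
  xwalk_mono (dwalk_xwalk h).1 (dwalk_xwalk h).2 fun _ _ _ h hu hv => xx_astep hi h hu hv

theorem uwalk_dwalk {c t y : ℕ} (h : Wk S.UStep c t y) : Wk S.DStep c t y :=
  h.mono fun _ _ _ h => ⟨⟨_, h.1⟩, h.2⟩

theorem dwalk_reverse {c v x : ℕ} (h : Wk S.DStep c v x) :
    Wk (S.XStep v) v c x :=
  h.symm fun _ _ _ h => ⟨step_symm h.1, .inl h.2⟩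

/-- A walk that starts at `c` off the path and ends on the path, reversed. -/
theorem xwalk_reverse {c h v x : ℕ} (hc : ¬ S.OnP c) (k : Wk (S.XStep c) h v x) :
    Wk S.DStep v h x :=
  k.symm fun _ _ _ h => ⟨step_symm h.1, h.2.elim id fun e => e ▸ hc⟩

/-- Cut the walk at its last vertex on the path. The part before it weighs at least the distance of
that vertex. -/
theorem exists_detour {t x : ℕ} (h : Wk S.Step (S.p 0) t x) :
    ∃ a < S.L, ∃ y, Wk S.DStep (S.p a) t y ∧ S.d (S.p a) + y ≤ x := by
  induction h with
  | refl => exact ⟨0, S.L_pos, 0, .refl, by rw [S.d0]⟩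
  | @snoc u v x w h1 h2 ih =>
    by_cases hv : S.OnP v
    · obtain ⟨a, ha, rfl⟩ := hv
      refine ⟨a, ha, 0, .refl, ?_⟩
      have := d_le_walk (h1.snoc h2)
      rw [S.d0] at this; omega
    · obtain ⟨a, ha, y, k1, k2⟩ := ih
      exact ⟨a, ha, y + w, k1.snoc ⟨h2, hv⟩, by omega⟩

/-- The same cut; the vertex where the walk leaves the path is not after the failing edge, so its
index is at most `i`. -/
theorem Safe.exists_detour {i t x : ℕ} (h : S.Safe i t x) :
    ∃ a ≤ i, a < S.L ∧ ∃ y, Wk S.DStep (S.p a) t y ∧ S.d (S.p a) + y ≤ x := by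
  induction h with
  | refl => exact ⟨0, by omega, S.L_pos, 0, .refl, by rw [S.d0]⟩
  | @snoc u v x w h1 h2 ih =>
    by_cases hv : S.OnP v
    · obtain ⟨a, ha, rfl⟩ := hv
      refine ⟨a, ?_, ha, 0, .refl, ?_⟩
      · by_contra hlt; exact h2.2.2 ⟨a, by omega, ha, rfl⟩
      · have := d_le_walk ((h1.mono fun _ _ _ h => h.1.step).snoc h2.1.step)
        rw [S.d0] at this; omega
    · obtain ⟨a, ha, haL, y, k1, k2⟩ := ih
      exact ⟨a, ha, haL, y + w, k1.snoc ⟨h2.1.step, hv⟩, by omega⟩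

/-- A detour is unweighted or meets the cover of the weighted edges. -/
theorem unweighted_or_meets {C : ℕ → Prop} (hC : ∀ u v w, S.E u v w true → C u ∨ C v) {a t y : ℕ}
    (h : Wk S.DStep (S.p a) t y) :
    Wk S.UStep (S.p a) t y ∨ ∃ c, C c ∧ ∃ y₁ y₂, y₁ + y₂ = y ∧ Wk S.DStep (S.p a) c y₁ ∧
      (¬ S.OnP c ∨ c = S.p a ∧ y₁ = 0) ∧ Wk S.DStep c t y₂ := by
  have pt : ∀ {u x}, Wk S.DStep (S.p a) u x → (¬ S.OnP u ∨ u = S.p a ∧ x = 0) := by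
    intro u x h
    cases h with
    | refl => exact .inr ⟨rfl, rfl⟩
    | snoc _ h => exact .inl h.2
  induction h with
  | refl => exact .inl .refl
  | @snoc u v x w h1 h2 ih =>
    obtain ⟨⟨κ, hE⟩, hv⟩ := h2
    rcases ih with ih | ⟨c, hc, y₁, y₂, e, k1, k2, k3⟩
    · cases κ with
      | false => exact .inl (ih.snoc ⟨hE, hv⟩)
      | true =>
        right
        rcases hC _ _ _ hE with hu | hu
        · exact ⟨u, hu, x, w, rfl, h1, pt h1, Wk.single ⟨⟨_, hE⟩, hv⟩⟩
        · exact ⟨v, hu, x + w, 0, rfl, h1.snoc ⟨⟨_, hE⟩, hv⟩, .inl hv, .refl⟩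
    · exact .inr ⟨c, hc, y₁, y₂ + w, by omega, k1, k2, k3.snoc ⟨⟨κ, hE⟩, hv⟩⟩

/-- Near the path the replacement path cannot be beyond the failing edge. -/
theorem no_jump {i a b t u f x yb ρ l : ℕ} (hi : i + 1 < S.L) (hib : i < b) (hb : b < S.L)
    (hyb : Wk S.DStep (S.p b) t yb) (hdb : S.d (S.p b) + yb = S.d t)
    (hmin : ∀ x, Wk (S.AStep i) (S.p 0) t x → l ≤ x) (hlong : S.d t + 4 * ρ < l)
    (hf : Wk (S.AStep i) (S.p 0) u f) (hfi : f ≤ S.d (S.p i) + ρ)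
    (hia : i < a) (ha : a < S.L) (hx : Wk (S.AStep i) (S.p a) u x) (hxρ : x ≤ ρ) : False := by
  have hback : Wk (S.AStep i) u (S.p a) x := hx.symm fun _ _ _ h => h.symm
  have h1 : S.d (S.p a) ≤ f + x := by
    have := d_le_walk ((hf.trans hback).mono fun _ _ _ h => h.step)
    rwa [S.d0, zero_add] at this
  have h2 := d_mono (S := S) hia.le ha
  have h3 := d_mono (S := S) hib.le hb
  have hlast := dwalk_astep hi hyb
  rcases le_total a b with hab | hab
  · have h4 := d_mono (S := S) hab hb
    have := hmin _ (((hf.trans hback).trans (astep_p hia hab hb)).trans hlast)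
    omega
  -- This case needs the constant `4`: reaching `p a` costs at most `d (p i) + 2 ρ`, hence `p a` is
  -- at most `2 ρ` farther than `p b`, and walking back to `p b` costs up to another `2 ρ`.
  · have h4 := d_mono (S := S) hab ha
    have := hmin _ (((hf.trans hback).trans
      ((astep_p hib hab ha).symm fun _ _ _ h => h.symm)).trans hlast)
    omega

/-- A long unweighted replacement path passes a vertex at distance `lam` from the path, and it is
there not longer than a shortest path. -/
theorem exists_pivot {q : ℕ → ℕ} {ρ lam : ℕ} (hlam : 1 ≤ lam) (hρ : lam ≤ ρ)
    (hq0 : ∀ a < S.L, q (S.p a) = 0) (hq_le : ∀ {u v w κ}, S.E u v w κ → q v ≤ q u + w)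
    (hq_ex : ∀ v < S.N, ∃ a < S.L, Wk (S.XStep (S.p a)) (S.p a) v (q v))
    {i a t y : ℕ} (hi : i + 1 < S.L) (hai : a ≤ i) (ht : t < S.N)
    (hy : Wk S.UStep (S.p a) t y)
    (hmin : ∀ x, Wk (S.AStep i) (S.p 0) t x → S.d (S.p a) + y ≤ x)
    (hlong : S.d t + 4 * ρ < S.d (S.p a) + y) :
    ∃ β k y', q β = lam ∧ Wk S.UStep (S.p a) β k ∧ S.d (S.p a) + k = S.d β ∧
      Wk S.UStep β t y' ∧ k + y' = y := by
  obtain ⟨b, hb, yb, hyb, hle⟩ := exists_detour (S.d_ex t ht)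
  have hdb : S.d (S.p b) + yb = S.d t := by
    have := d_le_walk (hyb.mono fun _ _ _ h => h.1); omega
  -- A shortest path to `t` must leave the primary path beyond the failing edge; otherwise it would
  -- survive and leave no excess.
  have hib : i < b := by
    by_contra hlt
    have h1 := ((safe_p (S := S) hi (show b ≤ i by omega)).mono fun _ _ _ h => h.1).trans
      (dwalk_astep hi hyb)
    have := hmin _ h1; omega
  have hdib := d_mono (S := S) hib.le hb
  have hsafe : ∀ {b v x}, b ≤ i → Wk (S.AStep i) (S.p b) v x →
      Wk (S.AStep i) (S.p 0) v (S.d (S.p b) + x) := fun hb h =>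
    ((safe_p (S := S) hi hb).mono fun _ _ _ h => h.1).trans h
  -- Follow the detour vertex by vertex. While the distance `q v` to the path is below `lam`, the
  -- length so far is at most `d (p i) + q v`; since `q` grows by at most `1` per unweighted edge,
  -- the value `lam` cannot be jumped over.
  suffices main : ∀ y' v k, Wk S.UStep (S.p a) v k → Wk S.UStep v t y' → k + y' = y →
      q v < lam → S.d (S.p a) + k ≤ S.d (S.p i) + q v →
      ∃ β k y', q β = lam ∧ Wk S.UStep (S.p a) β k ∧ S.d (S.p a) + k = S.d β ∧
        Wk S.UStep β t y' ∧ k + y' = y by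
    refine main y (S.p a) 0 .refl hy (by omega) ?_ ?_
    · rw [hq0 a (by omega)]; omega
    · have := d_mono (S := S) hai (by omega); omega
  intro y'
  induction y' with
  | zero =>
    intro v k h1 h2 h3 h4 h5
    have : t = v := by
      rcases h2.cases_head with ⟨h, _⟩ | ⟨u, w, y, h, _, h'⟩
      · exact h
      · have := S.pos h.1; omega
    subst this; omega
  | succ y' ih =>
    intro v k h1 h2 h3 h4 h5
    obtain ⟨u, hvu, hut⟩ : ∃ u, S.UStep v u 1 ∧ Wk S.UStep u t y' := by
      rcases h2.cases_head with ⟨_, h⟩ | ⟨u, w, z, h, h', e⟩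
      · omega
      · obtain rfl := S.one h.1
        exact ⟨u, h, h'.cast (by omega)⟩
    have hu := (S.lt hvu.1).2
    have hqu := hq_le hvu.1
    have h1u := h1.snoc hvu
    have hfu := hsafe hai (dwalk_astep hi (uwalk_dwalk h1u))
    have hrest := dwalk_astep hi (uwalk_dwalk hut)
    have hmin' : ∀ x, Wk (S.AStep i) (S.p 0) u x → S.d (S.p a) + (k + 1) ≤ x := by
      intro x hx
      have := hmin _ (hx.trans hrest); omega
    obtain ⟨a', ha', hw⟩ := hq_ex u hu
    have hwA := xwalk_mono hw (.inl hvu.2) fun _ _ _ h hu hv => xx_astep (i := i) hi h hu hv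
    -- The path vertex nearest to `u` lies before the failing edge. Reaching `u` from it is
    -- therefore a competitor, and minimality renews the invariant.
    have hai' : a' ≤ i := by
      by_contra hlt
      exact no_jump hi hib hb hyb hdb hmin hlong hfu (by omega) (by omega) ha' hwA (by omega)
    have hnear := hmin' _ (hsafe hai' hwA)
    have hdi := d_mono (S := S) hai' (by omega)
    by_cases hql : q u = lam
    · refine ⟨u, k + 1, y', hql, h1u, ?_, hut, by omega⟩
      have hdu := d_le_walk (hfu.mono fun _ _ _ h => h.step)
      rw [S.d0] at hdu
      -- At the pivot, a strictly shorter path would leave the primary path at some `a₂`: before the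
      -- edge this contradicts minimality, beyond it the rest has length at most `ρ` and `no_jump`
      -- applies.
      by_contra hne
      obtain ⟨a₂, ha₂, y₂, k1, k2⟩ := exists_detour (S.d_ex u hu)
      have k1A := dwalk_astep hi k1
      rcases le_or_gt a₂ i with h6 | h6
      · have := hmin' _ (hsafe h6 k1A); omega
      · have := d_mono (S := S) h6.le ha₂
        exact no_jump hi hib hb hyb hdb hmin hlong hfu (by omega) h6 ha₂ k1A (by omega)
    · exact ih u (k + 1) h1u hut (by omega) (by omega) (by omega)

/-! ### Sound answers -/

theorem out_path {i a : ℕ} (hi : i + 1 < S.L) (ha : a + 1 ≤ i) :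
    S.Out i (S.p (a + 1)) (S.d (S.p (a + 1))) (S.p a) := by
  obtain ⟨w, κ, h, e⟩ := S.path a (by omega)
  refine ⟨_, w, safe_p hi (show a ≤ i by omega), ⟨?_, not_after (by omega) (by omega),
    not_after ha (by omega)⟩, by omega⟩
  cases κ with
  | true => exact .inl h
  | false =>
    refine .inr ⟨h, fun he => ?_⟩
    rcases Sym2.eq_iff.1 he with ⟨h1, h2⟩ | ⟨h1, h2⟩
    · have := p_inj (by omega) (by omega) h1; omega
    · have := p_inj (by omega) (by omega) h2; have := p_inj (by omega) (by omega) h1; omega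

theorem out_detour {i a t u y w z : ℕ} (hi : i + 1 < S.L) (ha : a ≤ i)
    (h : Wk S.DStep (S.p a) u y) (hs : S.Step u t w) (ht : ¬ S.OnP t)
    (hz : S.d (S.p a) + y + w ≤ z) : S.Out i t z u := by
  have hc := not_after (S := S) ha (by omega)
  exact ⟨_, w, (safe_p hi ha).trans (dwalk_safe hi hc h),
    xx_sstep hi hs (dwalk_xwalk h).2 (.inl ht) hc, hz⟩

/-- Via a vertex `c` that is reached safely. -/
theorem out_via {i c t u x y w z : ℕ} (hi : i + 1 < S.L) (hc : S.Safe i c x)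
    (hca : ¬ S.After i c) (h : Wk (S.XStep c) c u y) (hs : S.XStep c u t w) (ht : ¬ S.OnP t)
    (hz : x + y + w ≤ z) : S.Out i t z u :=
  ⟨_, w, hc.trans (xwalk_mono h hs.2 fun _ _ _ h hu hv => xx_sstep hi h hu hv hca),
    xx_sstep hi hs.1 hs.2 (.inl ht) hca, hz⟩

theorem safe_of_xwalk {i a c x : ℕ} (hi : i + 1 < S.L) (ha : a ≤ i) (hc : ¬ S.OnP c)
    (h : Wk (S.XStep c) c (S.p a) x) : S.Safe i c (S.d (S.p a) + x) :=
  (safe_p hi ha).trans (dwalk_safe hi (not_after ha (by omega)) (xwalk_reverse hc h))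

end Scene

/-! ## Shortest paths on the machine -/

namespace RAM

infixr:55 " ;; " => Cmd.seq

notation "vN" => (3 : ℕ)
notation "vM" => (4 : ℕ)
notation "vI" => (5 : ℕ)
notation "vL" => (6 : ℕ)
notation "vRho" => (7 : ℕ)
notation "vK" => (8 : ℕ)
notation "vLam" => (9 : ℕ)
notation "vNb" => (10 : ℕ)
notation "vNc" => (11 : ℕ)
notation "vSrc" => (12 : ℕ)
notation "vU" => (20 : ℕ)
notation "vE" => (21 : ℕ)
notation "vV" => (22 : ℕ)
notation "vD" => (23 : ℕ)
notation "vX" => (24 : ℕ)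
notation "vCnt" => (27 : ℕ)
notation "vJ" => (28 : ℕ)

notation "aHead" => (0 : ℕ)
notation "aNxt" => (1 : ℕ)
notation "aTo" => (2 : ℕ)
notation "aWt" => (3 : ℕ)
notation "aFl" => (4 : ℕ)
notation "aDist" => (5 : ℕ)
notation "aKey" => (6 : ℕ)
notation "aT" => (7 : ℕ)
notation "aPrd" => (8 : ℕ)
notation "aHop" => (9 : ℕ)
notation "aOrd" => (10 : ℕ)
notation "aIni" => (11 : ℕ)
notation "aEx" => (12 : ℕ)

/-- A graph given by numbered arcs `1, …, 2 m`. -/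
structure Ar where
  N : ℕ
  m : ℕ
  fr : ℕ → ℕ
  en : ℕ → ℕ
  wt : ℕ → ℕ
  fl : ℕ → ℕ
  fr_lt : ∀ e, 1 ≤ e → e ≤ 2 * m → fr e < N
  en_lt : ∀ e, 1 ≤ e → e ≤ 2 * m → en e < N

namespace Ar

variable (G : Ar)

/-- The last of the first `k` arcs that leave `u`; `0` if there is none. -/
def last (u : ℕ) : ℕ → ℕ
  | 0 => 0
  | k + 1 => if G.fr (k + 1) = u then k + 1 else last u k

/-- The number of the first `k` arcs that leave `u`. -/
def dg (u : ℕ) : ℕ → ℕ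
  | 0 => 0
  | k + 1 => dg u k + if G.fr (k + 1) = u then 1 else 0

abbrev deg (u : ℕ) : ℕ := G.dg u (2 * G.m)

theorem last_le (u k : ℕ) : G.last u k ≤ k := by
  induction k with
  | zero => simp [last]
  | succ k ih => simp only [last]; split <;> omega

theorem fr_last {u k : ℕ} (h : 0 < G.last u k) : G.fr (G.last u k) = u := by
  induction k with
  | zero => simp [last] at h
  | succ k ih =>
    simp only [last] at h ⊢
    split at h
    · next he => simp [he]
    · next he => simp [he, ih h]

theorem dg_last (u k : ℕ) : G.dg u (G.last u k) = G.dg u k := by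
  induction k with
  | zero => simp [last]
  | succ k ih =>
    simp only [last]
    split
    · rfl
    · next he => simp [dg, he, ih]

theorem sum_dg (k : ℕ) (hk : k ≤ 2 * G.m) : ∑ u ∈ Finset.range G.N, G.dg u k = k := by
  induction k with
  | zero => simp [dg]
  | succ k ih =>
    simp only [dg, Finset.sum_add_distrib, ih (by omega)]
    have := G.fr_lt (k + 1) (by omega) hk
    simp [this]

def Arc (u v w : ℕ) : Prop := ∃ e, 1 ≤ e ∧ e ≤ 2 * G.m ∧ G.fr e = u ∧ G.en e = v ∧ G.wt e = w

end Ar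

/-- The state holds the graph as linked lists of arcs. -/
structure GSt (G : Ar) (s : St) : Prop where
  N : s.v vN = G.N
  head : ∀ v < G.N, s.a aHead v = G.last v (2 * G.m)
  nxt : ∀ e, 1 ≤ e → e ≤ 2 * G.m → s.a aNxt e = G.last (G.fr e) (e - 1)
  en : ∀ e, 1 ≤ e → e ≤ 2 * G.m → s.a aTo e = G.en e
  wt : ∀ e, 1 ≤ e → e ≤ 2 * G.m → s.a aWt e = G.wt e
  fl : ∀ e, 1 ≤ e → e ≤ 2 * G.m → s.a aFl e = G.fl e

theorem GSt.congr {G : Ar} {s t : St} (h : GSt G s) (hN : t.v vN = s.v vN)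
    (ha : ∀ a < 5, t.a a = s.a a) : GSt G t := by
  refine ⟨hN.trans h.N, ?_, ?_, ?_, ?_, ?_⟩
  · rw [ha 0 (by omega)]; exact h.head
  · rw [ha 1 (by omega)]; exact h.nxt
  · rw [ha 2 (by omega)]; exact h.en
  · rw [ha 3 (by omega)]; exact h.wt
  · rw [ha 4 (by omega)]; exact h.fl

theorem GSt.fr {G : Ar} {s t : St} {M : ℕ} {p : Cmd} (h : GSt G s) (hF : Fr M p s t)
    (hN : vN ∉ p.mv) (ha : ∀ a < 5, a ∉ p.ma) : GSt G t :=
  h.congr (hF.v _ hN) fun a h => hF.a _ (ha a h)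

/-- For all arcs that leave the vertex in variable `y`, from the last to the first. -/
def arcs (y : ℕ) (p : Cmd) : Cmd :=
  .set vE (.g aHead (.v y)) ;; .whl 0 (.v vE) (p ;; .set vE (.g aNxt (.v vE)))

/-- `I k` says that the arcs with numbers above `k` have been dealt with. Arcs that leave other
vertices are passed in the proof by `hskip` at no cost, so a caller argues over all arc numbers but
pays only for the degree of `u`. -/
theorem wp_arcs {M : ℕ} {G : Ar} {s : St} {y u b : ℕ} {p : Cmd} (hG : GSt G s) (hB : Bd M s)
    (hy : s.v y = u) (hu : u < G.N) (hp : vE ∉ p.mv) (hpN : vN ∉ p.mv)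
    (hpa : ∀ a < 5, a ∉ p.ma) (I : ℕ → St → Prop)
    (hI : ∀ k t z, I k t → I k (t.set vE z)) (h0 : I (2 * G.m) s)
    (hskip : ∀ k t, k < 2 * G.m → G.fr (k + 1) ≠ u → I (k + 1) t → I k t)
    (hstep : ∀ k t, k < 2 * G.m → G.fr (k + 1) = u → Fr M (arcs y p) s t → t.v vE = k + 1 →
      I (k + 1) t → wp M p t fun t' c => c ≤ b ∧ I k t') :
    wp M (arcs y p) s fun t c => I 0 t ∧ c ≤ G.deg u * (b + 14) + 14 := by
  have toLast : ∀ k t, k ≤ 2 * G.m → I k t → I (G.last u k) t := by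
    intro k t
    induction k with
    | zero => exact fun _ h => h
    | succ k ih =>
      intro hk h
      simp only [Ar.last]
      split
      · exact h
      · next he => exact ih (by omega) (hskip k t (by omega) he h)
  have hFr : ∀ {t z}, Fr M (p ;; .set vE (.g aNxt (.v vE))) (s.set vE z) t → z < M →
      Fr M (arcs y p) s t := by
    intro t z ht hz
    refine ⟨fun x hx => ?_, fun a ha => ?_, ht.i, fun b => ht.bd (b.set hz _)⟩
    · simp only [arcs, Cmd.mv, List.mem_append, List.mem_singleton, not_or] at hx
      rw [ht.v x (by simp [Cmd.mv, hx])]; simp [hx]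
    · simp only [arcs, Cmd.ma, List.mem_append, not_or] at ha
      rw [ht.a a (by simp [Cmd.ma, ha])]; simp
  unfold arcs
  rw [wp_seq, wp_set]
  have hz : Expr.eval (.g aHead (.v y)) s = G.last u (2 * G.m) := by simp [hy, hG.head u hu]
  have hzM : Expr.eval (.g aHead (.v y)) s < M := by simpa using hB.a _ _
  refine ⟨hzM, ?_⟩
  refine wp_mono (wp_whl (k := G.deg u * (b + 14)) (fun t k => ∃ j ≤ 2 * G.m,
    t.v vE = G.last u j ∧ I j t ∧ k = G.dg u j * (b + 14)) ?_ ?_) ?_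
  · exact ⟨2 * G.m, le_rfl, by simpa using hz, hI _ _ _ h0, rfl⟩
  · rintro t k ht ⟨j, hj, h1, h2, rfl⟩ hlt
    rw [Expr.eval_zero, Expr.eval_v, h1] at hlt
    have hlast := toLast j t hj h2
    have hfr := G.fr_last hlt
    have hdg := G.dg_last u j
    have hle := G.last_le u j
    obtain ⟨i, hi⟩ : ∃ i, G.last u j = i + 1 := ⟨G.last u j - 1, by omega⟩
    rw [hi] at hlast hfr hdg hlt h1 hle
    have hFt := hFr ht hzM
    have hsm := hFt.bd hB
    rw [wp_seq]
    refine wp_mono (hstep i t (by omega) hfr hFt h1 hlast) ?_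
    rintro t' c hF ⟨hc, hIt⟩
    rw [wp_set]
    have hG' : GSt G t' := (hG.congr (t := t) (by
      rw [ht.v _ (by simp [Cmd.mv, hpN])]; simp)
      (fun a ha => by rw [ht.a a (by simp [Cmd.ma, hpa a ha])]; simp)).fr hF hpN hpa
    have hE : t'.v vE = i + 1 := by rw [hF.v _ hp, h1]
    have hnx : t'.a aNxt (i + 1) = G.last u i := by
      rw [hG'.nxt _ (by omega) (by omega), hfr]; simp
    refine ⟨by simpa using (hF.bd hsm).a _ _, G.dg u i * (b + 14), ⟨i, by omega, ?_, hI _ _ _ hIt, rfl⟩, ?_⟩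
    · simp [hE, hnx]
    · rw [← hdg]; simp only [Ar.dg, hfr, if_true, Expr.cost_g, Expr.cost_v, Expr.cost_zero]
      rw [Nat.add_mul]; omega
  · rintro t c _ ⟨_, h2, k, ⟨j, hj, h3, h4, h5⟩, h6⟩
    simp only [Expr.eval_zero, Expr.eval_v, not_lt, Nat.le_zero] at h2
    have := toLast j t hj h4
    rw [← h3, h2] at this
    refine ⟨this, ?_⟩
    simp only [Expr.cost_g, Expr.cost_v, Expr.cost_zero] at h6 ⊢
    omega

/-! ### The tournament tree -/

/-- The leaves are the vertices, and the value at a node from `lo` on is a vertex below it. -/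
structure TreeI (N lo : ℕ) (T : ℕ → ℕ) : Prop where
  leaf : ∀ v < N, T (N + v) = v
  desc : ∀ j, lo ≤ j → j < 2 * N → T j < N ∧ ∃ k, (N + T j) / 2 ^ k = j

def NodeOK (key T : ℕ → ℕ) (j : ℕ) : Prop :=
  (T j = T (2 * j) ∨ T j = T (2 * j + 1)) ∧ key (T j) ≤ key (T (2 * j)) ∧
    key (T j) ≤ key (T (2 * j + 1))

/-- Going from the leaf of `v` up to the root, the key of the stored vertex never increases. -/
theorem TreeI.root_le {N : ℕ} {key T : ℕ → ℕ} (h : TreeI N 1 T)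
    (hk : ∀ j, 1 ≤ j → j < N → NodeOK key T j) {v : ℕ} (hv : v < N) : key (T 1) ≤ key v := by
  suffices ∀ i, 1 ≤ i → i < 2 * N → key (T 1) ≤ key (T i) by
    have := this (N + v) (by omega) (by omega)
    rwa [h.leaf v hv] at this
  intro i
  induction i using Nat.strong_induction_on with
  | _ i ih =>
    intro h1 h2
    rcases h1.eq_or_lt with rfl | h3
    · rfl
    · refine (ih (i / 2) (by omega) (by omega) (by omega)).trans ?_
      have := hk (i / 2) (by omega) (by omega)
      rcases Nat.even_or_odd' i with ⟨c, rfl | rfl⟩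
      · rw [show 2 * c / 2 = c by omega] at this ⊢; exact this.2.1
      · rw [show (2 * c + 1) / 2 = c by omega] at this ⊢; exact this.2.2

/-- Changing the key of a vertex concerns only its ancestors. -/
theorem TreeI.update_key {N : ℕ} {key T : ℕ → ℕ} (h : TreeI N 1 T)
    (hk : ∀ j, 1 ≤ j → j < N → NodeOK key T j) (v x : ℕ) {j : ℕ} (h1 : 1 ≤ j) (h2 : j < N) :
    NodeOK (Function.update key v x) T j ∨ ∃ k, (N + v) / 2 / 2 ^ k = j := by
  by_cases ha : ∃ k, (N + v) / 2 / 2 ^ k = j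
  · exact .inr ha
  left
  have hc : ∀ i, i / 2 = j → 1 ≤ i → i < 2 * N → T i ≠ v := by
    rintro i hi h1 h2 rfl
    obtain ⟨_, k, hk⟩ := h.desc i h1 h2
    refine ha ⟨k, ?_⟩
    rw [← hi]
    conv_rhs => rw [← hk]
    rw [Nat.div_div_eq_div_mul, Nat.div_div_eq_div_mul, mul_comm]
  have e1 := hc (2 * j) (by omega) (by omega) (by omega)
  have e2 := hc (2 * j + 1) (by omega) (by omega) (by omega)
  have := hk j h1 h2
  have e3 : T j ≠ v := by rcases this.1 with h | h <;> rw [h] <;> assumption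
  unfold NodeOK
  rw [Function.update_of_ne e1, Function.update_of_ne e2, Function.update_of_ne e3]
  exact this

def node (x : ℕ) : Cmd :=
  .ite (.g aKey (.g aT (.c 2 * .v x + 1))) (.g aKey (.g aT (.c 2 * .v x)))
    (.put aT (.v x) (.g aT (.c 2 * .v x + 1))) (.put aT (.v x) (.g aT (.c 2 * .v x)))

/-- Two bounds `lo` and `lo'` let the same statement serve the bottom-up construction, where the
valid range grows by one node, and repairs of a complete tree, where both are `1`. Rewriting one
node can only disturb that node and its parent. -/
theorem wp_node {M N : ℕ} {s : St} {x lo lo' : ℕ} (hB : Bd M s)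
    (hT : TreeI N lo (s.a aT)) (hlo : lo ≤ 2 * s.v x) (hlo' : ∀ j, lo' ≤ j → j ≠ s.v x → lo ≤ j)
    (hx1 : 1 ≤ s.v x) (hxN : s.v x < N) :
    wp M (node x) s fun t c => c ≤ 60 ∧ t.v = s.v ∧ TreeI N lo' (t.a aT) ∧
      NodeOK (s.a aKey) (t.a aT) (s.v x) ∧
      ∀ j, j ≠ s.v x → j ≠ s.v x / 2 → NodeOK (s.a aKey) (s.a aT) j →
        NodeOK (s.a aKey) (t.a aT) j := by
  have key : ∀ i, i / 2 = s.v x →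
      s.a aKey (s.a aT i) ≤ s.a aKey (s.a aT (2 * s.v x)) →
      s.a aKey (s.a aT i) ≤ s.a aKey (s.a aT (2 * s.v x + 1)) →
      TreeI N lo' (Function.update (s.a aT) (s.v x) (s.a aT i)) ∧
      NodeOK (s.a aKey) (Function.update (s.a aT) (s.v x) (s.a aT i)) (s.v x) ∧
      ∀ j, j ≠ s.v x → j ≠ s.v x / 2 → NodeOK (s.a aKey) (s.a aT) j →
        NodeOK (s.a aKey) (Function.update (s.a aT) (s.v x) (s.a aT i)) j := by
    intro i hi h1 h2
    refine ⟨⟨fun v hv => ?_, fun j h3 h4 => ?_⟩, ?_, fun j h3 h4 h5 => ?_⟩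
    · rw [Function.update_of_ne (by omega)]; exact hT.leaf v hv
    · by_cases hj : j = s.v x
      · subst hj
        rw [Function.update_self]
        obtain ⟨h5, k, h6⟩ := hT.desc i (by omega) (by omega)
        refine ⟨h5, k + 1, ?_⟩
        rw [pow_succ, ← Nat.div_div_eq_div_mul, h6, hi]
      · rw [Function.update_of_ne hj]; exact hT.desc j (hlo' j h3 hj) h4
    · unfold NodeOK
      rw [Function.update_self, Function.update_of_ne (by omega), Function.update_of_ne (by omega)]
      refine ⟨?_, h1, h2⟩
      rcases Nat.even_or_odd' i with ⟨c, rfl | rfl⟩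
      · left; congr 1; omega
      · right; congr 1; omega
    · unfold NodeOK
      rw [Function.update_of_ne h3, Function.update_of_ne (by omega),
        Function.update_of_ne (by omega)]
      exact h5
  simp only [node, wp_ite, wp_put, Expr.eval_g, Expr.eval_add, Expr.eval_mul, Expr.eval_c,
    Expr.eval_v, Expr.eval_one, St.put_v, St.put_a, if_true, not_lt]
  refine ⟨fun h => ⟨hB.a _ _, by simp, trivial, key _ (by omega) h.le le_rfl⟩,
    fun h => ⟨hB.a _ _, by simp, trivial, key _ (by omega) le_rfl h⟩⟩

/-- Restores the tree on the path from the leaf of the vertex in `vV` to the root. -/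
def fixT : Cmd :=
  .set vX ((.v vN + .v vV) / .c 2) ;; .whl 0 (.v vX) (node vX ;; .set vX (.v vX / .c 2))

/-- All faulty nodes are ancestors of the current one throughout. Repairing a node passes the
suspicion to its parent; above the root the variable is `0`, which has no positive ancestors. -/
theorem wp_fixT {M N v lg : ℕ} {s : St} (hN : s.v vN = N) (hv : s.v vV = v) (hvN : v < N)
    (hM : N < M) (hB : Bd M s) (hlg : N ≤ 2 ^ lg) (hT : TreeI N 1 (s.a aT))
    (hk : ∀ j, 1 ≤ j → j < N → NodeOK (s.a aKey) (s.a aT) j ∨ ∃ k, (N + v) / 2 / 2 ^ k = j) :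
    wp M fixT s fun t c => c ≤ lg * 80 + 20 ∧ TreeI N 1 (t.a aT) ∧
      ∀ j, 1 ≤ j → j < N → NodeOK (s.a aKey) (t.a aT) j := by
  unfold fixT
  rw [wp_seq, wp_set]
  have he : Expr.eval ((.v vN + .v vV) / .c 2) s = (N + v) / 2 := by simp [hN, hv]
  rw [he]
  have hzM : (N + v) / 2 < M := by omega
  refine ⟨hzM, ?_⟩
  refine wp_mono (wp_whl (k := lg * 80) (fun t k => t.v vX < N ∧ TreeI N 1 (t.a aT) ∧
    (∃ l, k = l * 80 ∧ t.v vX < 2 ^ l) ∧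
    ∀ j, 1 ≤ j → j < N → NodeOK (s.a aKey) (t.a aT) j ∨ ∃ k, t.v vX / 2 ^ k = j) ?_ ?_) ?_
  · refine ⟨by simp; omega, by simpa using hT, ⟨lg, rfl, by simp; omega⟩, ?_⟩
    simpa using hk
  · rintro t k ht ⟨h1, h2, ⟨l, rfl, h3⟩, h4⟩ hlt
    simp only [Expr.eval_zero, Expr.eval_v] at hlt
    have hBt := ht.bd (hB.set hzM _)
    have hkey : t.a aKey = s.a aKey := by
      rw [ht.a _ (by decide)]; simp
    rw [wp_seq]
    refine wp_mono (wp_node hBt h2 (lo' := 1) (by omega) (by omega) hlt h1) ?_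
    rintro t' c hF ⟨hc, hv', hT', hnode, hrest⟩
    rw [hkey] at hnode hrest
    rw [wp_set]
    have hl : l ≠ 0 := by rintro rfl; simp at h3; omega
    obtain ⟨l, rfl⟩ := Nat.exists_eq_succ_of_ne_zero hl
    rw [Nat.pow_succ] at h3
    refine ⟨?_, l * 80, ⟨?_, ?_, ⟨l, rfl, ?_⟩, ?_⟩, ?_⟩
    · simp only [Expr.eval_div, Expr.eval_v, Expr.eval_c, hv']
      have := hBt.v vX; omega
    · simp [hv']; omega
    · simpa using hT'
    · simp [hv']; omega
    · intro j h5 h6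
      simp only [St.set_a, St.set_v, if_true, Expr.eval_div, Expr.eval_v, Expr.eval_c, hv']
      by_cases hj : j = t.v vX
      · exact .inl (hj ▸ hnode)
      by_cases hj2 : j = t.v vX / 2
      · exact .inr ⟨0, by simp [hj2]⟩
      rcases h4 j h5 h6 with h7 | ⟨k, h7⟩
      · exact .inl (hrest j hj hj2 h7)
      · right
        cases k with
        | zero => simp at h7; omega
        | succ k => exact ⟨k, by rw [← h7, pow_succ', Nat.div_div_eq_div_mul]⟩
    · simp; omega
  · rintro t c _ ⟨_, h2, k, ⟨h3, h4, _, h5⟩, h6⟩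
    simp only [Expr.eval_zero, Expr.eval_v, not_lt, Nat.le_zero] at h2
    refine ⟨by simp at h6 ⊢; omega, h4, fun j h7 h8 => ?_⟩
    rcases h5 j h7 h8 with h9 | ⟨k, h9⟩
    · exact h9
    · simp [h2] at h9; omega

end RAM

/-! ### The invariant of Dijkstra's algorithm. -/

namespace RAM

/-- The labels that a shortest path computation may assign: distance, last vertex before the end,
and first vertex after the start. -/
inductive WT (G : Ar) (ini : ℕ → ℕ) (I : ℕ) (X : ℕ → Prop) : ℕ → ℕ → ℕ → ℕ → Prop
  | init (v p h : ℕ) : ini v < I → WT G ini I X v (ini v) p h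
  | step {u v w x p h : ℕ} : WT G ini I X u x p h → X u → G.Arc u v w →
      WT G ini I X v (x + w) u (if x = 0 then v else h)

/-- Invariant of Dijkstra's algorithm: the first `cnt` vertices of `ord` are settled, and of the
last one the arcs after `k` have been relaxed. -/
structure DI (G : Ar) (I : ℕ) (ini : ℕ → ℕ) (X : ℕ → Prop) (dist key prd hop ord : ℕ → ℕ)
    (cnt k : ℕ) : Prop where
  ord_lt : ∀ j < cnt, ord j < G.N
  ord_inj : ∀ j < cnt, ∀ j' < cnt, ord j = ord j' → j = j'
  key_done : ∀ j < cnt, key (ord j) = I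
  key_eq : ∀ v < G.N, (∀ j < cnt, ord j ≠ v) → key v = dist v
  le_ini : ∀ v < G.N, dist v ≤ ini v
  le_I : ∀ v < G.N, dist v ≤ I
  sound : ∀ v < G.N, dist v < I → WT G ini I X v (dist v) (prd v) (hop v)
  low : ∀ v < G.N, (∀ j < cnt, ord j ≠ v) → ∀ j < cnt, dist (ord j) ≤ dist v
  lt_I : ∀ j < cnt, dist (ord j) < I
  mono : ∀ j j', j ≤ j' → j' < cnt → dist (ord j) ≤ dist (ord j')
  closed : ∀ j < cnt, X (ord j) → ∀ e, 1 ≤ e → e ≤ 2 * G.m → G.fr e = ord j →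
    (j + 1 = cnt → k < e) → dist (G.en e) ≤ dist (ord j) + G.wt e

namespace DI

variable {G : Ar} {I : ℕ} {ini : ℕ → ℕ} {X : ℕ → Prop} {dist key prd hop ord : ℕ → ℕ}
  {cnt k : ℕ}

theorem cnt_le (h : DI G I ini X dist key prd hop ord cnt k) : cnt ≤ G.N := by
  have := Finset.card_le_card_of_injOn (s := Finset.range cnt) (t := Finset.range G.N) ord
    (fun j hj => by simpa using h.ord_lt j (by simpa using hj))
    (fun j hj j' hj' e => h.ord_inj j (by simpa using hj) j' (by simpa using hj') e)
  simpa using this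

/-- The key `I` marks settled vertices, so a minimal key below `I` belongs to an unsettled vertex
and is its label. Minimality against the other unsettled vertices preserves the order of settling.
-/
theorem extract (h : DI G I ini X dist key prd hop ord cnt 0) {u : ℕ} (hu : u < G.N)
    (hI : key u < I) (hmin : ∀ v < G.N, key u ≤ key v) :
    (∀ j < cnt, ord j ≠ u) ∧
    DI G I ini X dist (Function.update key u I) prd hop (Function.update ord cnt u) (cnt + 1)
      (2 * G.m) := by
  have hnd : ∀ j < cnt, ord j ≠ u := by
    rintro j hj rfl
    have := h.key_done j hj; omega
  have hk := h.key_eq u hu hnd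
  have ho : ∀ j < cnt, Function.update ord cnt u j = ord j := fun j hj =>
    Function.update_of_ne (by omega) _ _
  have hc : Function.update ord cnt u cnt = u := Function.update_self _ _ _
  have low' : ∀ j < cnt, dist (ord j) ≤ dist u := h.low u hu hnd
  have nd : ∀ v, (∀ j < cnt + 1, Function.update ord cnt u j ≠ v) →
      (∀ j < cnt, ord j ≠ v) ∧ u ≠ v := fun v hv =>
    ⟨fun j hj => by rw [← ho j hj]; exact hv j (by omega), by
      have := hv cnt (by omega); rwa [hc] at this⟩
  refine ⟨hnd, ⟨fun j hj => ?_, fun j hj j' hj' e => ?_, fun j hj => ?_, fun v hv hd => ?_,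
    h.le_ini, h.le_I, h.sound, fun v hv hd j hj => ?_, fun j hj => ?_, fun j j' hjj hj' => ?_,
    fun j hj hX e h1 h2 h3 h4 => ?_⟩⟩
  · rcases Nat.lt_succ_iff_lt_or_eq.1 hj with hj | rfl
    · rw [ho j hj]; exact h.ord_lt j hj
    · rwa [hc]
  · rcases Nat.lt_succ_iff_lt_or_eq.1 hj with hj | rfl <;>
      rcases Nat.lt_succ_iff_lt_or_eq.1 hj' with hj' | rfl
    · rw [ho j hj, ho j' hj'] at e; exact h.ord_inj j hj j' hj' e
    · rw [ho j hj, hc] at e; exact absurd e (hnd j hj)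
    · rw [ho j' hj', hc] at e; exact absurd e.symm (hnd j' hj')
    · rfl
  · rcases Nat.lt_succ_iff_lt_or_eq.1 hj with hj | rfl
    · rw [ho j hj, Function.update_of_ne (hnd j hj)]; exact h.key_done j hj
    · rw [hc, Function.update_self]
  · obtain ⟨h1, h2⟩ := nd v hd
    rw [Function.update_of_ne (Ne.symm h2)]; exact h.key_eq v hv h1
  · obtain ⟨h1, h2⟩ := nd v hd
    rcases Nat.lt_succ_iff_lt_or_eq.1 hj with hj | rfl
    · rw [ho j hj]; exact h.low v hv h1 j hj
    · rw [hc, ← hk, ← h.key_eq v hv h1]; exact hmin v hv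
  · rcases Nat.lt_succ_iff_lt_or_eq.1 hj with hj | rfl
    · rw [ho j hj]; exact h.lt_I j hj
    · rw [hc]; omega
  · rcases Nat.lt_succ_iff_lt_or_eq.1 hj' with hj' | rfl
    · rw [ho j' hj', ho j (by omega)]; exact h.mono j j' hjj hj'
    · rcases hjj.eq_or_lt with rfl | hlt
      · rfl
      · rw [hc, ho j hlt]; exact low' j hlt
  · rcases Nat.lt_succ_iff_lt_or_eq.1 hj with hj | rfl
    · rw [ho j hj] at hX h3 ⊢; exact h.closed j hj hX e h1 h2 h3 (by omega)
    · have := h4 rfl; omega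

theorem skip (h : DI G I ini X dist key prd hop ord (cnt + 1) (k + 1))
    (hs : G.fr (k + 1) ≠ ord cnt ∨ dist (G.en (k + 1)) ≤ dist (ord cnt) + G.wt (k + 1)) :
    DI G I ini X dist key prd hop ord (cnt + 1) k := by
  refine { h with closed := fun j hj hX e h1 h2 h3 h4 => ?_ }
  by_cases hc : j = cnt ∧ e = k + 1
  · obtain ⟨rfl, rfl⟩ := hc
    exact hs.resolve_left (not_not.2 h3)
  · exact h.closed j hj hX e h1 h2 h3 (by omega)

theorem noexp (h : DI G I ini X dist key prd hop ord (cnt + 1) k) (hX : ¬ X (ord cnt)) :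
    DI G I ini X dist key prd hop ord (cnt + 1) 0 := by
  refine { h with closed := fun j hj hXj e h1 h2 h3 h4 => ?_ }
  refine h.closed j hj hXj e h1 h2 h3 fun hc => ?_
  obtain rfl : j = cnt := by omega
  exact absurd hXj hX

/-- Settled vertices have labels at most that of `u`, so only an unsettled vertex can be improved;
thus keys and labels are changed together and the relaxed arcs of settled vertices stay relaxed. -/
theorem relax (h : DI G I ini X dist key prd hop ord (cnt + 1) (k + 1)) {u v nd : ℕ}
    (hk : k < 2 * G.m) (hu : ord cnt = u) (hX : X u) (hfr : G.fr (k + 1) = u)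
    (hv : G.en (k + 1) = v) (hnd : nd = dist u + G.wt (k + 1)) (hlt : nd < dist v) :
    v ≠ u ∧ DI G I ini X (Function.update dist v nd) (Function.update key v nd)
      (Function.update prd v u) (Function.update hop v (if dist u = 0 then v else hop u)) ord
      (cnt + 1) k := by
  have hvN : v < G.N := hv ▸ G.en_lt _ (by omega) (by omega)
  have huN : u < G.N := hu ▸ h.ord_lt cnt (by omega)
  have hI := h.le_I v hvN
  have hnot : ∀ j < cnt + 1, ord j ≠ v := by
    rintro j hj rfl
    have := h.mono j cnt (by omega) (by omega)
    rw [hu] at this; omega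
  have hvu : v ≠ u := fun e => hnot cnt (by omega) (hu.trans e.symm)
  have hdo : ∀ j < cnt + 1, Function.update dist v nd (ord j) = dist (ord j) := fun j hj =>
    Function.update_of_ne (hnot j hj) _ _
  have hle : ∀ x, Function.update dist v nd x ≤ dist x := by
    intro x
    by_cases hx : x = v
    · subst hx; rw [Function.update_self]; omega
    · rw [Function.update_of_ne hx]
  refine ⟨hvu, h.ord_lt, h.ord_inj, fun j hj => ?_, fun x hx hd => ?_, fun x hx => ?_,
    fun x hx => ?_, fun x hx hxI => ?_, fun x hx hd j hj => ?_, fun j hj => ?_,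
    fun j j' hjj hj' => ?_, fun j hj hXj e h1 h2 h3 h4 => ?_⟩
  · rw [Function.update_of_ne (hnot j hj)]; exact h.key_done j hj
  · by_cases hxv : x = v
    · subst hxv; simp
    · rw [Function.update_of_ne hxv, Function.update_of_ne hxv]; exact h.key_eq x hx hd
  · exact (hle x).trans (h.le_ini x hx)
  · exact (hle x).trans (h.le_I x hx)
  · by_cases hxv : x = v
    · subst hxv
      simp only [Function.update_self]
      rw [hnd]
      exact WT.step (h.sound u huN (by omega)) hX ⟨k + 1, by omega, by omega, hfr, hv, rfl⟩
    · simp only [Function.update_of_ne hxv] at hxI ⊢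
      exact h.sound x hx hxI
  · rw [hdo j hj]
    by_cases hxv : x = v
    · subst hxv
      rw [Function.update_self]
      have := h.mono j cnt (by omega) (by omega)
      rw [hu] at this; omega
    · rw [Function.update_of_ne hxv]; exact h.low x hx hd j hj
  · rw [hdo j hj]; exact h.lt_I j hj
  · rw [hdo j (by omega), hdo j' hj']; exact h.mono j j' hjj hj'
  · rw [hdo j hj]
    by_cases hc : j = cnt ∧ e = k + 1
    · obtain ⟨rfl, rfl⟩ := hc
      rw [hv, Function.update_self, hu, hnd]
    · exact (hle _).trans (h.closed j hj hXj e h1 h2 h3 (by omega))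

end DI

/-- The result of a shortest path computation. -/
structure DistSpec (G : Ar) (I : ℕ) (ini : ℕ → ℕ) (X : ℕ → Prop) (dist prd hop ord : ℕ → ℕ)
    (cnt : ℕ) : Prop where
  cnt_le : cnt ≤ G.N
  ord_lt : ∀ j < cnt, ord j < G.N
  le_ini : ∀ v < G.N, dist v ≤ ini v
  le_I : ∀ v < G.N, dist v ≤ I
  sound : ∀ v < G.N, dist v < I → WT G ini I X v (dist v) (prd v) (hop v)
  mono : ∀ j j', j ≤ j' → j' < cnt → dist (ord j) ≤ dist (ord j')
  mem : ∀ v < G.N, dist v < I → ∃ j < cnt, ord j = v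
  inj : ∀ j < cnt, ∀ j' < cnt, ord j = ord j' → j = j'
  closed : ∀ u v w, X u → G.Arc u v w → dist v ≤ dist u + w

/-- An unsettled vertex has its label as key, so when all keys have reached `I` every label below
`I` is settled. Arcs that leave a vertex with label `I` are relaxed for the trivial reason that no
label exceeds `I`. -/
theorem DI.finish {G : Ar} {I : ℕ} {ini : ℕ → ℕ} {X : ℕ → Prop} {dist key prd hop ord : ℕ → ℕ}
    {cnt : ℕ} (h : DI G I ini X dist key prd hop ord cnt 0) (hk : ∀ v < G.N, I ≤ key v) :
    DistSpec G I ini X dist prd hop ord cnt := by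
  have mem : ∀ v < G.N, dist v < I → ∃ j < cnt, ord j = v := by
    intro v hv hd
    by_contra hc
    push Not at hc
    have := h.key_eq v hv hc
    have := hk v hv; omega
  refine ⟨h.cnt_le, h.ord_lt, h.le_ini, h.le_I, h.sound, h.mono, mem, h.ord_inj, ?_⟩
  rintro u v w hX ⟨e, h1, h2, rfl, rfl, rfl⟩
  by_cases hd : dist (G.fr e) < I
  · obtain ⟨j, hj, he⟩ := mem _ (G.fr_lt e h1 h2) hd
    rw [← he]
    exact h.closed j hj (he ▸ hX) e h1 h2 he.symm (by omega)
  · have := h.le_I _ (G.en_lt e h1 h2); omega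

/-! ### Dijkstra's algorithm -/

def relax : Cmd :=
  .set vV (.g aTo (.v vE)) ;; .set vD (.g aDist (.v vU) + .g aWt (.v vE)) ;;
  .ite (.v vD) (.g aDist (.v vV))
    (.put aDist (.v vV) (.v vD) ;; .put aKey (.v vV) (.v vD) ;; .put aPrd (.v vV) (.v vU) ;;
      -- In the graphs at hand weights are positive, so distance `0` marks a start vertex; then `v`
      -- itself is the first vertex after the start.
      .ite (.g aDist (.v vU)) 1 (.put aHop (.v vV) (.v vV)) (.put aHop (.v vV) (.g aHop (.v vU))) ;;
      fixT)
    .skip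

def settle : Cmd :=
  .set vU (.g aT 1) ;; .put aOrd (.v vCnt) (.v vU) ;; .set vCnt (.v vCnt + 1) ;;
  -- There is no deletion from the tree; raising the key to `I` retires the vertex.
  .put aKey (.v vU) (.v vI) ;; .set vV (.v vU) ;; fixT ;;
  .ite 0 (.g aEx (.v vU)) (arcs vU relax) .skip

def dijInit : Cmd :=
  .for_ vJ (.v vN) (.put aDist (.v vJ) (.g aIni (.v vJ)) ;; .put aKey (.v vJ) (.g aIni (.v vJ)) ;;
    .put aT (.v vN + .v vJ) (.v vJ)) ;;
  .set vX (.v vN) ;; .whl 1 (.v vX) (.set vX (.v vX - 1) ;; node vX)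

def dij : Cmd :=
  dijInit ;; .set vCnt 0 ;; .whl (.g aKey (.g aT 1)) (.v vI) settle

/-- The hypotheses of Dijkstra's algorithm. -/
structure DPre (M : ℕ) (G : Ar) (I lg : ℕ) (s : St) : Prop where
  g : GSt G s
  bd : Bd M s
  inf : s.v vI = I
  pos : 0 < G.N
  ini : ∀ v < G.N, s.a aIni v ≤ I
  wt : ∀ e, 1 ≤ e → e ≤ 2 * G.m → G.wt e ≤ I
  hN : G.N + 1 < M
  hI : 2 * I < M
  lg : G.N ≤ 2 ^ lg

theorem DPre.congr {M : ℕ} {G : Ar} {I lg : ℕ} {s t : St} (h : DPre M G I lg s)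
    (hN : t.v vN = s.v vN) (hI : t.v vI = s.v vI) (ha : ∀ a < 5, t.a a = s.a a)
    (hi : ∀ v < G.N, t.a aIni v ≤ I) (hB : Bd M t) : DPre M G I lg t :=
  ⟨h.g.congr hN ha, hB, hI.trans h.inf, h.pos, hi, h.wt, h.hN, h.hI, h.lg⟩

abbrev St.DI (s : St) (G : Ar) (I cnt k : ℕ) (ini ex : ℕ → ℕ) : Prop :=
  RAM.DI G I ini (fun v => 0 < ex v) (s.a aDist) (s.a aKey) (s.a aPrd) (s.a aHop)
    (s.a aOrd) cnt k

theorem wp_relax {M : ℕ} {G : Ar} {I lg : ℕ} {s : St} {cnt k u : ℕ} (h : DPre M G I lg s)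
    (hD : s.DI G I (cnt + 1) (k + 1) (s.a aIni) (s.a aEx)) (hk : k < 2 * G.m)
    (hfr : G.fr (k + 1) = u) (hu : s.a aOrd cnt = u) (hX : 0 < s.a aEx u) (hvU : s.v vU = u)
    (hvE : s.v vE = k + 1)
    (hT : TreeI G.N 1 (s.a aT)) (hn : ∀ j, 1 ≤ j → j < G.N → NodeOK (s.a aKey) (s.a aT) j) :
    wp M relax s fun t c => c ≤ lg * 80 + 150 ∧
      t.DI G I (cnt + 1) k (s.a aIni) (s.a aEx) ∧ t.a aOrd = s.a aOrd ∧
      TreeI G.N 1 (t.a aT) ∧ ∀ j, 1 ≤ j → j < G.N → NodeOK (t.a aKey) (t.a aT) j := by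
  have e1 : s.a aTo (k + 1) = G.en (k + 1) := h.g.en _ (by omega) (by omega)
  have e2 : s.a aWt (k + 1) = G.wt (k + 1) := h.g.wt _ (by omega) (by omega)
  have huN : u < G.N := hu ▸ hD.ord_lt cnt (by omega)
  have hvN : G.en (k + 1) < G.N := G.en_lt _ (by omega) (by omega)
  have hdu : s.a aDist u < I := hu ▸ hD.lt_I cnt (by omega)
  have hw := h.wt (k + 1) (by omega) (by omega)
  have hM := h.hI
  have hMN := h.hN
  unfold relax
  simp only [wp_seq, wp_set, wp_ite, Expr.eval_g, Expr.eval_v, Expr.eval_add, St.set_v, St.set_a,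
    hvU, hvE, e1, e2, if_true, Nat.reduceEqDiff, if_false]
  refine ⟨by omega, by omega, fun hlt => ?_, fun hlt => ?_⟩
  · obtain ⟨hvu, hD'⟩ := hD.relax hk hu hX hfr rfl rfl hlt
    have hfix : ∀ t : St, t.v = (((s.set vV (G.en (k + 1))).set vD
          (s.a aDist u + G.wt (k + 1)))).v → Bd M t →
        t.a aT = s.a aT → t.a aKey = Function.update (s.a aKey) (G.en (k + 1))
          (s.a aDist u + G.wt (k + 1)) →
        wp M fixT t fun t' c => c ≤ lg * 80 + 20 ∧ TreeI G.N 1 (t'.a aT) ∧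
          (∀ j, 1 ≤ j → j < G.N → NodeOK (t.a aKey) (t'.a aT) j) := by
      intro t h1 h2 h3 h4
      refine wp_fixT (lg := lg) (v := G.en (k + 1)) ?_ ?_ hvN (by omega) h2 h.lg (h3 ▸ hT) ?_
      · rw [h1]; simpa using h.g.N
      · rw [h1]; simp
      · intro j h5 h6
        rw [h3, h4]
        exact hT.update_key hn _ _ h5 h6
    have hB : ∀ x < M, ∀ y, y < M → Bd M ((((((s.set vV (G.en (k + 1))).set vD
          (s.a aDist u + G.wt (k + 1))).put aDist (G.en (k + 1))
          (s.a aDist u + G.wt (k + 1))).put aKey (G.en (k + 1))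
          (s.a aDist u + G.wt (k + 1))).put aPrd (G.en (k + 1)) x).put aHop (G.en (k + 1)) y) :=
      fun x hx y hy => ((((((h.bd.set (by omega) _).set (by omega) _).put (by omega) _ _).put
        (by omega) _ _).put hx _ _).put hy _ _)
    have hub := h.bd.v vU
    rw [hvU] at hub
    simp only [wp_put, Expr.eval_g, Expr.eval_v, Expr.eval_one, St.set_v, St.set_a,
      hvU, if_true, Nat.reduceEqDiff, if_false, St.put_v, St.put_a]
    refine ⟨by omega, by omega, hub, ?_, ?_⟩
    · intro h0
      rw [Function.update_of_ne (Ne.symm hvu)] at h0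
      refine ⟨by omega, wp_mono (hfix _ (by simp) (hB u hub _ (by omega)) (by simp) (by simp)) ?_⟩
      rintro t c hF ⟨hc, hT', hn'⟩
      have g := hF.a
      refine ⟨?_, ?_, ?_, hT', ?_⟩
      · simp only [Expr.cost_g, Expr.cost_v, Expr.cost_add, Expr.cost_one]; omega
      · unfold St.DI
        rw [g aDist (by decide), g aKey (by decide), g aPrd (by decide), g aHop (by decide),
          g aOrd (by decide)]
        simpa [show s.a aDist u = 0 by omega] using hD'
      · rw [g aOrd (by decide)]; simp
      · rw [g aKey (by decide)]; simpa using hn'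
    · intro h0
      rw [Function.update_of_ne (Ne.symm hvu)] at h0
      refine ⟨h.bd.a _ _, wp_mono (hfix _ (by simp) (hB u hub _ (h.bd.a _ _)) (by simp) (by simp)) ?_⟩
      rintro t c hF ⟨hc, hT', hn'⟩
      have g := hF.a
      refine ⟨?_, ?_, ?_, hT', ?_⟩
      · simp only [Expr.cost_g, Expr.cost_v, Expr.cost_add, Expr.cost_one]; omega
      · unfold St.DI
        rw [g aDist (by decide), g aKey (by decide), g aPrd (by decide), g aHop (by decide),
          g aOrd (by decide)]
        simpa [show s.a aDist u ≠ 0 by omega] using hD'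
      · rw [g aOrd (by decide)]; simp
      · rw [g aKey (by decide)]; simpa using hn'
  · rw [wp_skip]
    refine ⟨by simp, ?_, by simp, by simpa using hT, by simpa using hn⟩
    have := hD.skip (.inr (by rw [hu]; omega))
    simpa [St.DI] using this

end RAM

/-! ### One round, the initialization and the whole run of Dijkstra's algorithm. -/

namespace RAM

theorem wp_settle {M : ℕ} {G : Ar} {I lg : ℕ} {s : St} {cnt : ℕ} (h : DPre M G I lg s)
    (hD : s.DI G I cnt 0 (s.a aIni) (s.a aEx)) (hcnt : s.v vCnt = cnt)
    (hT : TreeI G.N 1 (s.a aT)) (hn : ∀ j, 1 ≤ j → j < G.N → NodeOK (s.a aKey) (s.a aT) j)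
    (hlt : s.a aKey (s.a aT 1) < I) :
    wp M settle s fun t c => t.v vCnt = cnt + 1 ∧
      t.DI G I (cnt + 1) 0 (s.a aIni) (s.a aEx) ∧
      TreeI G.N 1 (t.a aT) ∧ (∀ j, 1 ≤ j → j < G.N → NodeOK (t.a aKey) (t.a aT) j) ∧
      ∃ u < G.N, (∀ j < cnt, s.a aOrd j ≠ u) ∧ t.a aOrd = Function.update (s.a aOrd) cnt u ∧
        c ≤ (G.deg u + 1) * (lg * 80 + 200) := by
  have hNpos := h.pos
  obtain ⟨u, hTu⟩ : ∃ u, u = s.a aT 1 := ⟨_, rfl⟩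
  have huN : u < G.N := hTu ▸ (hT.desc 1 le_rfl (by omega)).1
  rw [← hTu] at hlt
  obtain ⟨hnew, hD'⟩ := hD.extract huN hlt fun v hv => hTu ▸ hT.root_le hn hv
  have hc1 := hD'.cnt_le
  have hMN := h.hN
  have hMI := h.hI
  unfold settle
  simp only [wp_seq, wp_set, wp_put, Expr.eval_g, Expr.eval_v, Expr.eval_add, Expr.eval_one, St.set_v,
    St.put_v, if_true, Nat.reduceEqDiff, if_false, ← hTu, hcnt, h.inf]
  have hb : Bd M (((((s.set vU u).put aOrd cnt u).set vCnt (cnt + 1)).put aKey u I).set vV u) :=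
    ((((h.bd.set (by omega) _).put (by omega) _ _).set (by omega) _).put (by omega) _ _).set
      (by omega) _
  refine ⟨by omega, by omega, by omega, by omega, by omega, ?_⟩
  refine wp_mono (wp_fixT (lg := lg) (N := G.N) (v := u) (by simpa using h.g.N) (by simp) huN
    (by omega) hb h.lg (by simpa using hT) ?_) ?_
  · intro j h1 h2
    simpa using hT.update_key hn u I h1 h2
  rintro t c hF ⟨hc, hTt, hnt⟩
  have ga : ∀ a, a ∉ [aT, aT] → t.a a = _ := fun a ha => hF.a a ha
  have tD : t.DI G I (cnt + 1) (2 * G.m) (s.a aIni) (s.a aEx) := by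
    unfold St.DI
    rw [ga aDist (by decide), ga aKey (by decide), ga aPrd (by decide), ga aHop (by decide),
      ga aOrd (by decide)]
    simpa using hD'
  have tOrd : t.a aOrd = Function.update (s.a aOrd) cnt u := by
    rw [ga aOrd (by decide)]; simp
  have tOrdc : t.a aOrd cnt = u := by rw [tOrd]; simp
  have tU : t.v vU = u := by rw [hF.v vU (by decide)]; simp
  have tCnt : t.v vCnt = cnt + 1 := by rw [hF.v vCnt (by decide)]; simp
  have tEx : t.a aEx = s.a aEx := by rw [ga aEx (by decide)]; simp
  have tIni : t.a aIni = s.a aIni := by rw [ga aIni (by decide)]; simp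
  have tKey : t.a aKey = Function.update (s.a aKey) u I := by rw [ga aKey (by decide)]; simp
  have tP : DPre M G I lg t := by
    refine h.congr ?_ ?_ ?_ ?_ (hF.bd hb)
    · rw [hF.v _ (by decide)]; simp
    · rw [hF.v _ (by decide)]; simp
    · intro a ha
      rw [ga a (by simp; omega)]
      simp only [St.set_a, St.put_a]
      rw [if_neg (by omega), if_neg (by omega)]
    · rw [tIni]; exact h.ini
  have hnt' : ∀ j, 1 ≤ j → j < G.N → NodeOK (t.a aKey) (t.a aT) j := by
    rw [tKey]; simpa using hnt
  rw [wp_ite]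
  simp only [Expr.eval_zero, Expr.eval_g, Expr.eval_v, tU, tEx, Expr.cost_g, Expr.cost_v,
    Expr.cost_zero, Expr.cost_add, Expr.cost_one]
  constructor
  · intro hX
    refine wp_mono (wp_arcs (u := u) (b := lg * 80 + 150) tP.g tP.bd tU huN (by decide) (by decide)
      (by decide) (fun k r => r.DI G I (cnt + 1) k (s.a aIni) (s.a aEx) ∧ r.a aOrd = t.a aOrd ∧
        TreeI G.N 1 (r.a aT) ∧ ∀ j, 1 ≤ j → j < G.N → NodeOK (r.a aKey) (r.a aT) j)
      (fun k r z hr => by simpa [St.DI] using hr) ⟨tD, rfl, hTt, hnt'⟩ ?_ ?_) ?_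
    · rintro k r hk hfr ⟨h1, h2, h3⟩
      refine ⟨h1.skip (.inl ?_), h2, h3⟩
      rwa [h2, tOrdc]
    · rintro k r hk hfr hFr hE ⟨h1, h2, h3, h4⟩
      have rIni : r.a aIni = s.a aIni := (hFr.a _ (by decide)).trans tIni
      have rEx : r.a aEx = s.a aEx := (hFr.a _ (by decide)).trans tEx
      have rP : DPre M G I lg r := by
        refine tP.congr (hFr.v _ (by decide)) (hFr.v _ (by decide)) ?_ ?_ (hFr.bd tP.bd)
        · intro a ha
          refine hFr.a _ ?_
          have : (arcs vU relax).ma = [aDist, aKey, aPrd, aHop, aHop, aT, aT] := rfl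
          rw [this]; simp; omega
        · rw [rIni]; exact h.ini
      rw [← rIni, ← rEx] at h1
      refine wp_mono (wp_relax (u := u) rP h1 hk hfr (by rw [h2, tOrdc]) (by rw [rEx]; exact hX)
        ((hFr.v _ (by decide)).trans tU) hE h3 h4) ?_
      rintro r' c' _ ⟨k1, k2, k3, k4, k5⟩
      rw [rIni, rEx] at k2
      exact ⟨k1, k2, k3.trans h2, k4, k5⟩
    · rintro r c' hFr ⟨⟨h1, h2, h3, h4⟩, h5⟩
      refine ⟨(hFr.v _ (by decide)).trans tCnt, h1, h3, h4, u, huN, hnew, h2.trans tOrd, ?_⟩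
      rw [Nat.add_mul]
      have : G.deg u * (lg * 80 + 150 + 14) ≤ G.deg u * (lg * 80 + 200) :=
        Nat.mul_le_mul_left _ (by omega)
      omega
  · intro hX
    rw [wp_skip]
    refine ⟨tCnt, ?_, hTt, hnt', u, huN, hnew, tOrd, ?_⟩
    · exact RAM.DI.noexp tD (by rw [tOrdc]; exact hX)
    · rw [Nat.add_mul]
      omega

theorem wp_dijInit {M : ℕ} {G : Ar} {I lg : ℕ} {s : St} (h : DPre M G I lg s) :
    wp M dijInit s fun t c => c ≤ G.N * 200 + 50 ∧
      (∀ v < G.N, t.a aDist v = s.a aIni v ∧ t.a aKey v = s.a aIni v) ∧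
      TreeI G.N 1 (t.a aT) ∧ ∀ j, 1 ≤ j → j < G.N → NodeOK (t.a aKey) (t.a aT) j := by
  have hMN := h.hN
  have hMI := h.hI
  have hNp := h.pos
  have hN := h.g.N
  unfold dijInit
  rw [wp_seq]
  refine wp_mono (wp_for G.N 60 (fun i t => (∀ v < i, t.a aDist v = s.a aIni v ∧
    t.a aKey v = s.a aIni v ∧ t.a aT (G.N + v) = v)) (by omega) (by decide) ?_ ?_ ?_) ?_
  · intro t ht; rw [Expr.eval_v, ht.v _ (by decide), hN]
  · intro v hv; omega
  · intro j hj t ht hJ hI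
    have e : t.a aIni = s.a aIni := ht.a _ (by decide)
    have e2 : t.v vN = G.N := (ht.v _ (by decide)).trans hN
    have := (ht.bd h.bd).a aIni j
    have hmin := h.ini j hj
    simp only [wp_seq, wp_put, Expr.eval_g, Expr.eval_v, Expr.eval_add, St.put_v, St.put_a,
      Nat.reduceEqDiff, if_false, hJ, e, e2]
    refine ⟨by omega, by omega, by omega, by simp, fun v hv => ?_⟩
    simp only [St.set_a, St.put_a, if_true, Nat.reduceEqDiff, if_false, Function.update_apply]
    rcases Nat.lt_succ_iff_lt_or_eq.1 hv with hv | rfl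
    · have := hI v hv
      rw [if_neg (by omega), if_neg (by omega), if_neg (by omega)]; exact this
    · simp
  rintro t c hF ⟨-, -, hI, hc⟩
  have tN : t.v vN = G.N := (hF.v _ (by decide)).trans hN
  have tB := hF.bd h.bd
  simp only [wp_seq, wp_set, Expr.eval_v, tN]
  refine ⟨by omega, ?_⟩
  refine wp_mono (wp_whl (k := G.N * 90) (fun r k => 1 ≤ r.v vX ∧ r.v vX ≤ G.N ∧
    TreeI G.N (r.v vX) (r.a aT) ∧ (∀ j, r.v vX ≤ j → j < G.N → NodeOK (r.a aKey) (r.a aT) j) ∧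
    k = r.v vX * 90) ?_ ?_) ?_
  · refine ⟨by simp; omega, by simp, ?_, by simp; omega, by simp⟩
    simp only [St.set_v, if_true, St.set_a]
    refine ⟨fun v hv => (hI v hv).2.2, fun j h1 h2 => ?_⟩
    obtain ⟨v, rfl⟩ := Nat.exists_eq_add_of_le h1
    rw [(hI v (by omega)).2.2]
    exact ⟨by omega, 0, by simp⟩
  · rintro r k hr ⟨h1, h2, h3, h4, rfl⟩ hlt
    simp only [Expr.eval_one, Expr.eval_v] at hlt
    have rB := hr.bd (tB.set (show G.N < M by omega) _)
    simp only [wp_seq, wp_set, Expr.eval_v, Expr.eval_sub, Expr.eval_one]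
    refine ⟨by omega, ?_⟩
    refine wp_mono (wp_node (lo := r.v vX) (lo' := r.v vX - 1) (rB.set (show r.v vX - 1 < M by omega) _) (by simpa using h3)
      (by simp; omega) (by simp; omega) (by simp; omega) (by simp; omega)) ?_
    rintro q c' hq ⟨k1, k2, k3, k4, k5⟩
    have qX : q.v vX = r.v vX - 1 := by rw [k2]; simp
    have qK : q.a aKey = r.a aKey := by rw [hq.a _ (by decide)]; simp
    refine ⟨(r.v vX - 1) * 90, ⟨by omega, by omega, by rwa [qX], fun j h5 h6 => ?_, by rw [qX]⟩, ?_⟩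
    · rw [qX] at h5
      simp only [St.set_v, if_true, St.set_a] at k4 k5
      rw [qK]
      by_cases hj : j = r.v vX - 1
      · rw [hj]; exact k4
      · exact k5 j hj (by omega) (h4 j (by omega) h6)
    · simp only [Expr.cost_sub, Expr.cost_v, Expr.cost_one]
      omega
  · rintro r c' hr ⟨-, h2, k, ⟨h3, h4, h5, h6, rfl⟩, h7⟩
    simp only [Expr.eval_one, Expr.eval_v, not_lt] at h2
    have hX : r.v vX = 1 := by omega
    rw [hX] at h5 h6
    refine ⟨?_, fun v hv => ?_, h5, h6⟩
    · simp only [Expr.cost_v, Expr.cost_one] at *; omega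
    · rw [hr.a aDist (by decide), hr.a aKey (by decide)]
      simpa using ⟨(hI v hv).1, (hI v hv).2.1⟩

theorem wp_dij {M : ℕ} {G : Ar} {I lg : ℕ} {s : St} (h : DPre M G I lg s) :
    wp M dij s fun t c => c ≤ (2 * G.m + G.N + 1) * (lg * 80 + 500) ∧
      DistSpec G I (s.a aIni) (fun v => 0 < s.a aEx v) (t.a aDist) (t.a aPrd) (t.a aHop)
        (t.a aOrd) (t.v vCnt) := by
  have hMN := h.hN
  have hMI := h.hI
  have hNp := h.pos
  unfold dij
  rw [wp_seq]
  refine wp_mono (wp_dijInit h) ?_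
  rintro t c hF ⟨hc, hI, hT, hn⟩
  simp only [wp_seq, wp_set, Expr.eval_zero]
  refine ⟨by omega, ?_⟩
  have tIni : t.a aIni = s.a aIni := hF.a _ (by decide)
  have tEx : t.a aEx = s.a aEx := hF.a _ (by decide)
  -- Potential of the main loop: the unsettled vertices, each with its degree plus one. It starts at
  -- the number of arcs plus vertices and pays for each round.
  let rem : (ℕ → ℕ) → ℕ → ℕ := fun ord cnt =>
    ∑ v ∈ Finset.range G.N \ (Finset.range cnt).image ord, (G.deg v + 1)
  have hrem0 : ∀ ord, rem ord 0 = 2 * G.m + G.N := by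
    intro ord
    simp [rem, Finset.sum_add_distrib, Ar.deg, G.sum_dg _ le_rfl]
  have hrem : ∀ ord cnt u, u < G.N → (∀ j < cnt, ord j ≠ u) →
      rem (Function.update ord cnt u) (cnt + 1) + (G.deg u + 1) = rem ord cnt := by
    intro ord cnt u hu hne
    have e1 : (Finset.range (cnt + 1)).image (Function.update ord cnt u) =
        insert u ((Finset.range cnt).image ord) := by
      rw [Finset.range_add_one, Finset.image_insert, Function.update_self]
      congr 1
      refine Finset.image_congr fun j hj => ?_
      have : j < cnt := by simpa using hj
      exact Function.update_of_ne (by omega) _ _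
    simp only [rem, e1]
    rw [Finset.sdiff_insert]
    refine Finset.sum_erase_add _ (fun v => G.deg v + 1) (a := u) ?_
    simp only [Finset.mem_sdiff, Finset.mem_range, hu, Finset.mem_image, true_and, not_exists, not_and]
    exact fun j hj => hne j hj
  refine wp_mono (wp_whl (k := (2 * G.m + G.N) * (lg * 80 + 220)) (fun r k => ∃ cnt,
    r.v vCnt = cnt ∧ r.DI G I cnt 0 (s.a aIni) (s.a aEx) ∧ TreeI G.N 1 (r.a aT) ∧
    (∀ j, 1 ≤ j → j < G.N → NodeOK (r.a aKey) (r.a aT) j) ∧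
    k = rem (r.a aOrd) cnt * (lg * 80 + 220)) ?_ ?_) ?_
  · refine ⟨0, by simp, ?_, by simpa using hT, by simpa using hn, by rw [hrem0]⟩
    refine ⟨by omega, by omega, by omega, ?_, ?_, ?_, ?_, by omega, by omega, by omega, by omega⟩
    · intro v hv _; simp [hI v hv]
    · intro v hv; simp [hI v hv]
    · intro v hv; simpa [hI v hv] using h.ini v hv
    · intro v hv hlt
      simp only [St.set_a, hI v hv] at hlt ⊢
      exact WT.init _ _ _ hlt
  · rintro r k hr ⟨cnt, h1, h2, h3, h4, rfl⟩ hlt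
    have rIni : r.a aIni = s.a aIni := (hr.a _ (by decide)).trans (by simpa using tIni)
    have rEx : r.a aEx = s.a aEx := (hr.a _ (by decide)).trans (by simpa using tEx)
    have rP : DPre M G I lg r := by
      refine h.congr ?_ ?_ ?_ ?_ (hr.bd ((hF.bd h.bd).set (by omega) _))
      · rw [hr.v _ (by decide)]; simpa using hF.v _ (by decide)
      · rw [hr.v _ (by decide)]; simpa using hF.v _ (by decide)
      · intro a ha
        have e1 : dijInit.ma = [aDist, aKey, aT, aT, aT] := rfl
        have e2 : settle.ma = [aOrd, aKey, aT, aT, aDist, aKey, aPrd, aHop, aHop, aT, aT] := rfl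
        rw [hr.a a (by simp only [e2]; simp; omega)]
        simpa using hF.a a (by rw [e1]; simp; omega)
      · rw [rIni]; exact h.ini
    simp only [Expr.eval_g, Expr.eval_v, Expr.eval_one, rP.inf] at hlt
    rw [← rIni, ← rEx] at h2
    refine wp_mono (wp_settle rP h2 h1 h3 h4 hlt) ?_
    rintro q c' hq ⟨k1, k2, k3, k4, u, huN, k5, k6, k7⟩
    rw [rIni, rEx] at k2
    refine ⟨_, ⟨cnt + 1, k1, k2, k3, k4, rfl⟩, ?_⟩
    rw [k6, ← hrem _ cnt u huN k5]
    simp only [Expr.cost_g, Expr.cost_v, Expr.cost_one]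
    have : (G.deg u + 1) * (lg * 80 + 220) = (G.deg u + 1) * (lg * 80 + 200) +
      (G.deg u + 1) * 20 := by ring
    rw [Nat.add_mul (rem _ _)]
    omega
  · rintro r c' hr ⟨-, h2, k, ⟨cnt, h3, h4, h5, h6, rfl⟩, h7⟩
    have rI : r.v vI = I := by
      rw [hr.v _ (by decide)]; simp [hF.v vI (by decide), h.inf]
    simp only [Expr.eval_g, Expr.eval_v, Expr.eval_one, not_lt, rI] at h2
    refine ⟨?_, ?_⟩
    · simp only [Expr.cost_g, Expr.cost_v, Expr.cost_one, Expr.cost_zero] at *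
      have e1 : (2 * G.m + G.N + 1) * (lg * 80 + 500) = (2 * G.m + G.N) * (lg * 80 + 220) +
        (2 * G.m + G.N) * 280 + lg * 80 + 500 := by ring
      omega
    · rw [h3]
      exact RAM.DI.finish h4 fun v hv => h2.trans (h5.root_le h6 hv)

end RAM

namespace RAM

notation "vO" => (29 : ℕ)
notation "aPos" => (13 : ℕ)
notation "aP" => (14 : ℕ)
notation "aD" => (15 : ℕ)
notation "aOd" => (16 : ℕ)
notation "aQ" => (17 : ℕ)
notation "aA" => (18 : ℕ)
notation "aPA" => (19 : ℕ)
notation "aC" => (20 : ℕ)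
notation "aMk" => (21 : ℕ)
notation "aCt" => (22 : ℕ)
notation "aBl" => (23 : ℕ)
notation "aSB" => (24 : ℕ)
notation "aBe" => (25 : ℕ)
notation "aBp" => (26 : ℕ)
notation "aKc" => (27 : ℕ)
notation "aCd" => (28 : ℕ)
notation "aCp" => (29 : ℕ)
notation "aCm" => (30 : ℕ)
notation "aCh" => (31 : ℕ)
notation "aHd" => (32 : ℕ)

/-! ### Expressions with case distinctions, loops that fill arrays, and running minima -/

namespace Expr

/-- The smaller of two values. -/
def mn (e f : Expr) : Expr := e - (e - f)

/-- `1` if `e < f`, otherwise `0`. -/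
def lt (e f : Expr) : Expr := 1 - (1 - (f - e))

/-- `x` if `e < f`, otherwise `y`. -/
def sel (e f x y : Expr) : Expr := lt e f * x + (1 - lt e f) * y

@[simp] theorem eval_mn (e f : Expr) (s : St) : (mn e f).eval s = min (e.eval s) (f.eval s) := by
  simp [mn]; omega

@[simp] theorem eval_lt' (e f : Expr) (s : St) :
    (lt e f).eval s = if e.eval s < f.eval s then 1 else 0 := by
  simp only [lt, eval_sub, eval_one]; split <;> omega

@[simp] theorem eval_sel (e f x y : Expr) (s : St) :
    (sel e f x y).eval s = if e.eval s < f.eval s then x.eval s else y.eval s := by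
  simp only [sel, eval_add, eval_mul, eval_lt', eval_sub, eval_one]; split <;> simp

end Expr

/-- `a[idx] := e` for all values of `x` below that of `y`. -/
def fill (x y a : ℕ) (idx e : Expr) : Cmd := .for_ x (.v y) (.put a idx e)

/-- The hypothesis on the body exposes that all cells outside the range are untouched; this allows a
row of a table to be computed from the preceding row of the same array. -/
theorem wp_fill {M : ℕ} {s : St} {x y a : ℕ} {idx e : Expr} (n off : ℕ) (f : ℕ → ℕ)
    (hy : s.v y = n) (hxy : y ≠ x) (hn : n < M)
    (h : ∀ j < n, ∀ t, Fr M (fill x y a idx e) s t → t.v x = j →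
      (∀ l, (l < off ∨ off + j ≤ l) → t.a a l = s.a a l) → (∀ l < j, t.a a (off + l) = f l) →
      idx.eval t = off + j ∧ e.eval t = f j ∧ f j < M) :
    wp M (fill x y a idx e) s fun t c => c ≤ n * (idx.cost + e.cost + 17) + 8 ∧
      (∀ l < n, t.a a (off + l) = f l) ∧ ∀ l, (l < off ∨ off + n ≤ l) → t.a a l = s.a a l := by
  unfold fill
  refine wp_mono (wp_for n (idx.cost + e.cost + 6) (fun j t =>
    (∀ l, (l < off ∨ off + j ≤ l) → t.a a l = s.a a l) ∧ ∀ l < j, t.a a (off + l) = f l) hn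
    (by simp [Cmd.mv]) ?_ ?_ ?_) ?_
  · intro t ht
    rw [Expr.eval_v, ht.v y (by simp [Cmd.for_, Cmd.mv, hxy]), hy]
  · simp
  · rintro j hj t ht hx ⟨h1, h2⟩
    obtain ⟨e1, e2, e3⟩ := h j hj t ht hx h1 h2
    rw [wp_put, e1, e2]
    refine ⟨e3, le_rfl, fun l hl => ?_, fun l hl => ?_⟩
    · simp only [St.set_a, St.put_a, if_true]
      rw [Function.update_of_ne (by omega)]
      exact h1 l (by omega)
    · simp only [St.set_a, St.put_a, if_true]
      rcases Nat.lt_succ_iff_lt_or_eq.1 hl with hl | rfl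
      · rw [Function.update_of_ne (by omega)]; exact h2 l hl
      · rw [Function.update_self]
  · rintro t c _ ⟨-, -, ⟨h1, h2⟩, hc⟩
    refine ⟨hc.trans ?_, h2, h1⟩
    simp only [Expr.cost_v]
    have : idx.cost + e.cost + 6 + 2 + 9 = idx.cost + e.cost + 17 := by omega
    rw [this]

/-- The least of `I` and the first `k` values of `g`. -/
def runMin (I : ℕ) (g : ℕ → ℕ) : ℕ → ℕ
  | 0 => I
  | k + 1 => min (runMin I g k) (g k)

/-- What `h` assigns to the index where the least value is attained first. -/
def runArg (I : ℕ) (g h : ℕ → ℕ) : ℕ → ℕ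
  | 0 => 0
  | k + 1 => if g k < runMin I g k then h k else runArg I g h k

theorem runMin_le (I : ℕ) (g : ℕ → ℕ) (k : ℕ) : runMin I g k ≤ I := by
  induction k with
  | zero => exact le_rfl
  | succ k ih => exact (min_le_left _ _).trans ih

theorem runMin_le_of_lt (I : ℕ) (g : ℕ → ℕ) {j k : ℕ} (h : j < k) : runMin I g k ≤ g j := by
  induction k with
  | zero => omega
  | succ k ih =>
    rcases Nat.lt_succ_iff_lt_or_eq.1 h with h | rfl
    · exact (min_le_left _ _).trans (ih h)
    · exact min_le_right _ _

theorem exists_runMin {I : ℕ} {g : ℕ → ℕ} (h : ℕ → ℕ) {k : ℕ} (hk : runMin I g k < I) :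
    ∃ j < k, g j = runMin I g k ∧ h j = runArg I g h k := by
  induction k with
  | zero => simp [runMin] at hk
  | succ k ih =>
    simp only [runMin, runArg] at hk ⊢
    by_cases hlt : g k < runMin I g k
    · exact ⟨k, by omega, by omega, by simp [hlt]⟩
    · obtain ⟨j, h1, h2, h3⟩ := ih (by omega)
      exact ⟨j, by omega, by omega, by simp [hlt, h3]⟩

/-! ### The graph of a scene -/

/-- The arcs of `G` are the edges of the scene `S`, and `I` is larger than all distances. -/
structure Env (M : ℕ) (S : Scene) (G : Ar) (I lg : ℕ) : Prop where
  N : G.N = S.N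
  E : ∀ u v w κ, S.E u v w κ ↔
    ∃ e, 1 ≤ e ∧ e ≤ 2 * G.m ∧ G.fr e = u ∧ G.en e = v ∧ G.wt e = w ∧ G.fl e = κ.toNat
  fl : ∀ e, 1 ≤ e → e ≤ 2 * G.m → G.fl e ≤ 1
  src : S.p 0 < S.N
  d : ∀ v < S.N, S.d v < I
  LI : S.L ≤ I
  wt : ∀ e, 1 ≤ e → e ≤ 2 * G.m → G.wt e ≤ I
  hN : G.N + 1 < M
  hI : 2 * I < M
  lg : G.N ≤ 2 ^ lg

namespace Env

variable {M : ℕ} {S : Scene} {G : Ar} {I lg : ℕ}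

theorem arc (h : Env M S G I lg) {u v w : ℕ} : G.Arc u v w ↔ S.Step u v w := by
  constructor
  · rintro ⟨e, h1, h2, h3, h4, h5⟩
    have := h.fl e h1 h2
    refine ⟨decide (G.fl e = 1), (h.E _ _ _ _).2 ⟨e, h1, h2, h3, h4, h5, ?_⟩⟩
    rcases (show G.fl e = 0 ∨ G.fl e = 1 by omega) with h | h <;> simp [h]
  · rintro ⟨κ, hE⟩
    obtain ⟨e, h1, h2, h3, h4, h5, -⟩ := (h.E _ _ _ _).1 hE
    exact ⟨e, h1, h2, h3, h4, h5⟩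

theorem p_lt (h : Env M S G I lg) {a : ℕ} (ha : a < S.L) : S.p a < S.N := by
  cases a with
  | zero => exact h.src
  | succ a =>
    obtain ⟨w, κ, hE, -⟩ := S.path a ha
    exact (S.lt hE).2

theorem I_pos (h : Env M S G I lg) : 0 < I := by
  have := h.d _ h.src; omega

theorem L_le (h : Env M S G I lg) : S.L ≤ S.N := by
  have := Finset.card_le_card_of_injOn (s := Finset.range S.L) (t := Finset.range S.N) S.p
    (fun j hj => by simpa using h.p_lt (by simpa using hj))
    (fun j hj k hk e => Scene.p_inj (by simpa using hj) (by simpa using hk) e)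
  simpa using this

end Env

/-! ### What a finished Dijkstra computation says about the scene. -/

theorem WT.congr {G : Ar} {ini ini' : ℕ → ℕ} {I : ℕ} {X X' : ℕ → Prop} {v x p h : ℕ}
    (hw : WT G ini I X v x p h) (hi : ∀ v < G.N, ini v = ini' v) (hX : ∀ v < G.N, X v → X' v)
    (hv : v < G.N) : WT G ini' I X' v x p h := by
  induction hw with
  | init v p h hlt => rw [hi v hv] at hlt ⊢; exact .init v p h hlt
  | step _ hXu ha ih =>
    have hu := ha
    obtain ⟨e, h1, h2, rfl, -⟩ := hu
    have := G.fr_lt e h1 h2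
    exact .step (ih this) (hX _ this hXu) ha

theorem DistSpec.congr {G : Ar} {I : ℕ} {ini ini' : ℕ → ℕ} {X X' : ℕ → Prop}
    {dist prd hop ord : ℕ → ℕ} {cnt : ℕ} (h : DistSpec G I ini X dist prd hop ord cnt)
    (hi : ∀ v < G.N, ini v = ini' v) (hX : ∀ v < G.N, X v ↔ X' v) :
    DistSpec G I ini' X' dist prd hop ord cnt := by
  refine ⟨h.cnt_le, h.ord_lt, fun v hv => ?_, h.le_I, fun v hv hd => ?_, h.mono, h.mem, h.inj, ?_⟩
  · rw [← hi v hv]; exact h.le_ini v hv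
  · exact (h.sound v hv hd).congr hi (fun v hv => (hX v hv).1) hv
  · intro u v w hu ha
    have hu' := ha
    obtain ⟨e, h1, h2, rfl, -⟩ := hu'
    exact h.closed _ v w ((hX _ (G.fr_lt e h1 h2)).2 hu) ha

theorem DistSpec.le_walk {G : Ar} {I : ℕ} {ini : ℕ → ℕ} {X : ℕ → Prop}
    {dist prd hop ord : ℕ → ℕ} {cnt : ℕ} (h : DistSpec G I ini X dist prd hop ord cnt)
    {c v x : ℕ} (hw : Wk (fun u v w => G.Arc u v w ∧ X u) c v x) : dist v ≤ dist c + x := by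
  induction hw with
  | refl => omega
  | snoc _ h1 ih => have := h.closed _ _ _ h1.2 h1.1; omega

/-- Start labels for a single source. -/
def iniAt (I c v : ℕ) : ℕ := if v = c then 0 else I

section

variable {M : ℕ} {S : Scene} {G : Ar} {I lg : ℕ} {dist prd hop ord : ℕ → ℕ} {cnt : ℕ}

theorem Env.dist_eq (h : Env M S G I lg)
    (hD : DistSpec G I (iniAt I (S.p 0)) (fun _ => True) dist prd hop ord cnt) {v : ℕ}
    (hv : v < S.N) : dist v = S.d v := by
  have h0 : dist (S.p 0) = 0 := by
    have := hD.le_ini (S.p 0) (by rw [h.N]; exact h.src); simpa [iniAt] using this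
  have hle : dist v ≤ S.d v := by
    have := hD.le_walk ((S.d_ex v hv).mono fun _ _ _ hs => ⟨h.arc.2 hs, trivial⟩); omega
  have hd := h.d v hv
  have key : ∀ {v x p q}, WT G (iniAt I (S.p 0)) I (fun _ => True) v x p q → S.d v ≤ x := by
    intro v x p q hw
    induction hw with
    | init v p h hlt =>
      by_cases hv : v = S.p 0
      · rw [hv, S.d0]; omega
      · simp [iniAt, hv] at hlt
    | step _ _ ha ih =>
      obtain ⟨κ, hE⟩ := h.arc.1 ha
      have := S.d_le hE; omega
  have := key (hD.sound v (by rw [h.N]; exact hv) (by omega))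
  omega

/-- The properties of the distances from the path. -/
structure QSpec (S : Scene) (q : ℕ → ℕ) : Prop where
  zero : ∀ a < S.L, q (S.p a) = 0
  le : ∀ {u v w κ}, S.E u v w κ → q v ≤ q u + w
  ex : ∀ v < S.N, ∃ a < S.L, Wk (S.XStep (S.p a)) (S.p a) v (q v)

/-- Restarting the labelled walk at its last path vertex gives a walk that leaves the path at once
and is not heavier than the label; since the label is a lower bound for such walks, they agree. -/
theorem Env.qSpec (h : Env M S G I lg) {ini : ℕ → ℕ} (hi0 : ∀ a < S.L, ini (S.p a) = 0)
    (hi1 : ∀ v < S.N, ¬ S.OnP v → ini v = I)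
    (hD : DistSpec G I ini (fun _ => True) dist prd hop ord cnt) : QSpec S dist := by
  have h0 : ∀ a < S.L, dist (S.p a) = 0 := by
    intro a ha
    have := hD.le_ini (S.p a) (by rw [h.N]; exact h.p_lt ha)
    rw [hi0 a ha] at this; omega
  have hcl : ∀ {u v w κ}, S.E u v w κ → dist v ≤ dist u + w := fun hE =>
    hD.closed _ _ _ trivial (h.arc.2 ⟨_, hE⟩)
  refine ⟨h0, hcl, fun v hv => ?_⟩
  have hle : dist v ≤ S.d v := by
    have := hD.le_walk ((S.d_ex v hv).mono fun _ _ _ hs => ⟨h.arc.2 hs, trivial⟩)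
    rw [h0 0 S.L_pos] at this; omega
  have hd := h.d v hv
  have key : ∀ {v x p q}, WT G ini I (fun _ => True) v x p q → v < S.N →
      ∃ a < S.L, ∃ y ≤ x, Wk (S.XStep (S.p a)) (S.p a) v y := by
    intro v x p q hw
    induction hw with
    | init v p h hlt =>
      intro hv
      by_cases hP : S.OnP v
      · obtain ⟨a, ha, rfl⟩ := hP
        exact ⟨a, ha, 0, Nat.zero_le _, .refl⟩
      · rw [hi1 v hv hP] at hlt; omega
    | @step u v w x p q _ _ ha ih =>
      intro _
      have hs := h.arc.1 ha
      obtain ⟨a, ha, y, hy, hk⟩ := ih (by obtain ⟨κ, hE⟩ := hs; exact (S.lt hE).1)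
      by_cases hP : S.OnP u
      · obtain ⟨b, hb, rfl⟩ := hP
        exact ⟨b, hb, w, by omega, Wk.single ⟨hs, .inr rfl⟩⟩
      · exact ⟨a, ha, y + w, by omega, hk.snoc ⟨hs, .inl hP⟩⟩
  obtain ⟨a, ha, y, hy, hk⟩ := key (hD.sound v (by rw [h.N]; exact hv) (by omega)) hv
  refine ⟨a, ha, hk.cast (le_antisymm hy ?_)⟩
  have := hD.le_walk (hk.mono fun _ _ _ hs => ⟨h.arc.2 hs.1, trivial⟩)
  rw [h0 a ha] at this; omega

/-- The properties of the distances from `c` along walks off the path. -/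
structure XSpec (S : Scene) (I c : ℕ) (dist prd hop : ℕ → ℕ) : Prop where
  self : dist c = 0
  le_I : ∀ v < S.N, dist v ≤ I
  walk : ∀ v < S.N, dist v < I → Wk (S.XStep c) c v (dist v)
  ne : ∀ v < S.N, v ≠ c → 0 < dist v
  prd : ∀ v < S.N, v ≠ c → dist v < I →
    ∃ y w, Wk (S.XStep c) c (prd v) y ∧ S.XStep c (prd v) v w ∧ y + w = dist v
  hop : ∀ v < S.N, v ≠ c → dist v < I →
    ∃ y w, S.Step c (hop v) w ∧ Wk (S.XStep c) (hop v) v y ∧ w + y = dist v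
  le : ∀ {v x}, Wk (S.XStep c) c v x → dist v ≤ x

/-- Only `c` and vertices off the path are expanded, so a labelled walk may end on the path but not
continue from it, unless from `c`. The first vertex after `c` is recorded because these walks are
later reversed: on a detour from the path to `c` it is the last vertex before the end. -/
theorem Env.xSpec (h : Env M S G I lg) {c : ℕ} (hc : c < S.N)
    (hD : DistSpec G I (iniAt I c) (fun v => ¬ S.OnP v ∨ v = c) dist prd hop ord cnt) :
    XSpec S I c dist prd hop := by
  have hI := h.I_pos
  have h0 : dist c = 0 := by
    have := hD.le_ini c (by rw [h.N]; exact hc); simpa [iniAt] using this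
  have key : ∀ {v x p q}, WT G (iniAt I c) I (fun v => ¬ S.OnP v ∨ v = c) v x p q →
      Wk (S.XStep c) c v x ∧ (x = 0 → v = c) ∧ (v ≠ c → 0 < x →
        (∃ y w, Wk (S.XStep c) c p y ∧ S.XStep c p v w ∧ y + w = x)) ∧
        (0 < x → ∃ y w, S.Step c q w ∧ Wk (S.XStep c) q v y ∧ w + y = x) := by
    intro v x p q hw
    induction hw with
    | init v p h hlt =>
      by_cases hv : v = c
      · subst hv
        simp only [iniAt, if_true]
        exact ⟨.refl, fun _ => trivial, fun h => absurd rfl h, by omega⟩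
      · simp [iniAt, hv] at hlt
    | @step u v w x p q _ hX ha ih =>
      obtain ⟨k1, k2, k3, k4⟩ := ih
      have hs := h.arc.1 ha
      have hpos : 0 < w := by obtain ⟨κ, hE⟩ := hs; exact S.pos hE
      refine ⟨k1.snoc ⟨hs, hX⟩, by omega, fun _ _ => ⟨x, w, k1, ⟨hs, hX⟩, rfl⟩, fun _ => ?_⟩
      by_cases hx : x = 0
      · obtain rfl := k2 hx
        exact ⟨0, w, by simpa [hx] using hs, by simpa [hx] using Wk.refl, by omega⟩
      · obtain ⟨y, w', l1, l2, l3⟩ := k4 (by omega)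
        simp only [hx, if_false]
        exact ⟨y + w, w', l1, l2.snoc ⟨hs, hX⟩, by omega⟩
  have snd : ∀ v < S.N, dist v < I → _ := fun v hv hd => key (hD.sound v (by rw [h.N]; exact hv) hd)
  have hne : ∀ v < S.N, v ≠ c → 0 < dist v := by
    intro v hv hvc
    by_contra h0
    exact hvc ((snd v hv (by omega)).2.1 (by omega))
  refine ⟨h0, fun v hv => hD.le_I v (by rw [h.N]; exact hv), fun v hv hd => (snd v hv hd).1, hne,
    fun v hv hvc hd => (snd v hv hd).2.2.1 hvc (hne v hv hvc),
    fun v hv hvc hd => (snd v hv hd).2.2.2 (hne v hv hvc), fun hw => ?_⟩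
  have := hD.le_walk (hw.mono fun _ _ _ hs => ⟨h.arc.2 hs.1, hs.2⟩)
  omega

end

/-! ### Distances on the machine -/

/-- What all parts of the program rely on. -/
structure Base (M : ℕ) (S : Scene) (G : Ar) (I : ℕ) (s : St) : Prop where
  g : GSt G s
  bd : Bd M s
  inf : s.v vI = I
  L : s.v vL = S.L
  src : s.v vSrc = S.p 0

theorem Base.fr {M : ℕ} {S : Scene} {G : Ar} {I : ℕ} {s t : St} {p : Cmd} (h : Base M S G I s)
    (hF : Fr M p s t) (hv : ∀ x ∈ [vN, vI, vL, vSrc], x ∉ p.mv) (ha : ∀ a < 5, a ∉ p.ma) :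
    Base M S G I t :=
  ⟨h.g.fr hF (hv _ (by simp)) ha, hF.bd h.bd, (hF.v _ (hv _ (by simp))).trans h.inf,
    (hF.v _ (hv _ (by simp))).trans h.L, (hF.v _ (hv _ (by simp))).trans h.src⟩

/-- Distances with start labels `e`, where the vertices with `f > 0` are expanded. -/
def dijFrom (e f : Expr) : Cmd :=
  fill vJ vN aIni (.v vJ) e ;; fill vJ vN aEx (.v vJ) f ;; dij

theorem wp_dijFrom {M : ℕ} {S : Scene} {G : Ar} {I lg : ℕ} {s : St} {e f : Expr}
    (hE : Env M S G I lg) (hB : Base M S G I s) (ini ex : ℕ → ℕ) (hini : ∀ v < S.N, ini v ≤ I)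
    (hex : ∀ v < S.N, ex v < M) (he : e.cost ≤ 50) (hf : f.cost ≤ 50)
    (h : ∀ j < S.N, ∀ t : St, (∀ x, x ≠ vJ → t.v x = s.v x) →
      (∀ a, a ≠ aIni → a ≠ aEx → t.a a = s.a a) → t.v vJ = j →
      e.eval t = ini j ∧ f.eval t = ex j) :
    wp M (dijFrom e f) s fun t c => c ≤ (2 * G.m + G.N + 1) * (lg * 80 + 700) ∧
      DistSpec G I ini (0 < ex ·) (t.a aDist) (t.a aPrd) (t.a aHop) (t.a aOrd) (t.v vCnt) := by
  have hN := hE.N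
  have hMN := hE.hN
  have hMI := hE.hI
  have hsN := hB.g.N
  unfold dijFrom
  rw [wp_seq]
  refine wp_mono (wp_fill S.N 0 ini (by rw [hsN, hN]) (by decide) (by omega) ?_) ?_
  · intro j hj t ht hJ _ _
    have := hini j hj
    refine ⟨by simpa using hJ, (h j hj t (fun x hx => ht.v x (by simpa [fill, Cmd.for_, Cmd.mv] using hx))
      (fun a ha _ => ht.a a (by simpa [fill, Cmd.for_, Cmd.ma] using ha)) hJ).1, by omega⟩
  rintro t c hF ⟨hc, hi, -⟩
  have hBt := hB.fr hF (show ∀ x ∈ [vN, vI, vL, vSrc], x ∉ [vJ, vJ] by decide)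
    (show ∀ a < 5, a ∉ [aIni] by decide)
  rw [wp_seq]
  refine wp_mono (wp_fill S.N 0 ex (by rw [hBt.g.N, hN]) (by decide) (by omega) ?_) ?_
  · intro j hj r hr hJ _ _
    refine ⟨by simpa using hJ, (h j hj r (fun x hx => ?_) (fun a ha ha' => ?_) hJ).2, hex j hj⟩
    · rw [hr.v x (by simpa [fill, Cmd.for_, Cmd.mv] using hx),
        hF.v x (by simpa [fill, Cmd.for_, Cmd.mv] using hx)]
    · rw [hr.a a (by simpa [fill, Cmd.for_, Cmd.ma] using ha'),
        hF.a a (by simpa [fill, Cmd.for_, Cmd.ma] using ha)]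
  rintro r c' hF' ⟨hc', hx, -⟩
  have hBr := hBt.fr hF' (show ∀ x ∈ [vN, vI, vL, vSrc], x ∉ [vJ, vJ] by decide)
    (show ∀ a < 5, a ∉ [aEx] by decide)
  simp only [Nat.zero_add] at hi hx
  have hir : ∀ v < G.N, r.a aIni v = ini v := fun v hv => by
    rw [hF'.a _ (by simp [fill, Cmd.for_, Cmd.ma]), hi v (by omega)]
  have hpos : 0 < G.N := by have := hE.src; omega
  refine wp_mono (wp_dij ⟨hBr.g, hBr.bd, hBr.inf, hpos, fun v hv => by rw [hir v hv]; exact hini v (by omega),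
    hE.wt, hE.hN, hE.hI, hE.lg⟩) ?_
  rintro q c'' _ ⟨k1, k2⟩
  refine ⟨?_, k2.congr hir fun v hv => by rw [hx v (by omega)]⟩
  simp only [Expr.cost_v] at hc hc'
  have e1 : S.N * (2 + e.cost + 17) ≤ S.N * 70 := Nat.mul_le_mul_left _ (by omega)
  have e2 : S.N * (2 + f.cost + 17) ≤ S.N * 70 := Nat.mul_le_mul_left _ (by omega)
  have e3 : (2 * G.m + G.N + 1) * (lg * 80 + 700) = (2 * G.m + G.N + 1) * (lg * 80 + 500) +
      (2 * G.m + G.N + 1) * 200 := by ring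
  omega

end RAM

namespace RAM

/-! ### Queries -/

/-- What the data structure guarantees to a query. -/
structure QData (S : Scene) (I K nc W : ℕ) (D : ℕ → ℕ → ℕ) : Prop where
  hN : D aHd 0 = S.N
  hK : D aHd 1 = K
  hC : D aHd 2 = nc
  hI : D aHd 3 = I
  LI : S.L ≤ I
  LN : S.L ≤ S.N
  pos : ∀ a < S.L, D aPos (S.p a) = a
  pos' : ∀ v < S.N, ¬ S.OnP v → D aPos v = I
  P : ∀ a < S.L, D aP a = S.p a
  d : ∀ v < S.N, D aD v = S.d v
  d_lt : ∀ v < S.N, S.d v < I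
  p_lt : ∀ a < S.L, S.p a < S.N
  -- Each of the three tables `A`, `B`, `C` has a soundness clause, which turns an entry into an
  -- actual walk, and an optimality clause for the kind of detour that it is responsible for.
  Aout : ∀ i t δ, i + 1 < S.L → t < S.N → ¬ S.OnP t → δ ≤ K → D aA (δ * S.N + t) ≤ i →
    S.Out i t (S.d t + δ) (D aPA (δ * S.N + t))
  Ale : ∀ i a t y δ, i + 1 < S.L → a ≤ i → t < S.N → ¬ S.OnP t → δ ≤ K → Wk S.UStep (S.p a) t y →
    S.d (S.p a) + y ≤ S.d t + δ → D aA (δ * S.N + t) ≤ i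
  kc : ∀ i < S.L, (D aKc i + 1) * S.N ≤ W
  Bout : ∀ i t, i + 1 < S.L → t < S.N → ¬ S.OnP t → D aBe (D aKc i * S.N + t) < I →
    S.Out i t (D aBe (D aKc i * S.N + t)) (D aBp (D aKc i * S.N + t))
  Ble : ∀ i a t y, i + 1 < S.L → a ≤ i → t < S.N → ¬ S.OnP t → Wk S.UStep (S.p a) t y →
    (∀ x, Wk (S.AStep i) (S.p 0) t x → S.d (S.p a) + y ≤ x) → S.d t + K < S.d (S.p a) + y →
    D aBe (D aKc i * S.N + t) ≤ S.d (S.p a) + y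
  Cout : ∀ j < nc, ∀ i t, i + 1 < S.L → t < S.N → ¬ S.OnP t →
    D aCm (j * S.N + i) + D aCd (j * S.N + t) < I →
    S.Out i t (D aCm (j * S.N + i) + D aCd (j * S.N + t))
      (if 0 < D aCd (j * S.N + t) then D aCp (j * S.N + t) else D aCh (j * S.N + i))
  Cle : ∀ i a t y, i + 1 < S.L → a ≤ i → t < S.N → ¬ S.OnP t → Wk S.DStep (S.p a) t y →
    ¬ Wk S.UStep (S.p a) t y → S.d (S.p a) + y < I →
    ∃ j < nc, D aCm (j * S.N + i) + D aCd (j * S.N + t) ≤ S.d (S.p a) + y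
  W4 : 4 ≤ W
  WN : S.N ≤ W
  WK : (K + 1) * S.N ≤ W
  WC : nc * S.N ≤ W

theorem row_lt {N a j k W : ℕ} (h : k * N ≤ W) (hj : j < k) (ha : a < N) : j * N + a < W := by
  have : (j + 1) * N ≤ k * N := Nat.mul_le_mul_right _ hj
  rw [Nat.add_mul] at this; omega

/-- Only indices below `W` are ever read, so the guarantees survive cutting memory down to the first
`W` entries of each array. -/
theorem QData.congr {S : Scene} {I K nc W : ℕ} {D D' : ℕ → ℕ → ℕ} (h : QData S I K nc W D)
    (e : ∀ a, ∀ j < W, D' a j = D a j) : QData S I K nc W D' := by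
  have w4 := h.W4
  have wn := h.WN
  have eK : ∀ a δ t, δ ≤ K → t < S.N → D' a (δ * S.N + t) = D a (δ * S.N + t) := fun a δ t h1 h2 =>
    e a _ (row_lt h.WK (by omega) h2)
  have eC : ∀ a j t, j < nc → t < S.N → D' a (j * S.N + t) = D a (j * S.N + t) := fun a j t h1 h2 =>
    e a _ (row_lt h.WC h1 h2)
  have LN := h.LN
  have ekc : ∀ i < S.L, D' aKc i = D aKc i := fun i hi => e _ _ (by omega)
  have eB : ∀ a i t, i < S.L → t < S.N → D' a (D' aKc i * S.N + t) = D a (D aKc i * S.N + t) := by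
    intro a i t h1 h2
    rw [ekc i h1]
    exact e a _ (row_lt (h.kc i h1) (Nat.lt_succ_self _) h2)
  constructor
  · rw [e _ _ (by omega)]; exact h.hN
  · rw [e _ _ (by omega)]; exact h.hK
  · rw [e _ _ (by omega)]; exact h.hC
  · rw [e _ _ (by omega)]; exact h.hI
  · exact h.LI
  · exact h.LN
  · intro a ha; have := h.p_lt a ha; rw [e _ _ (by omega)]; exact h.pos a ha
  · intro v hv; rw [e _ _ (by omega)]; exact h.pos' v hv
  · intro a ha; rw [e _ _ (by omega)]; exact h.P a ha
  · intro v hv; rw [e _ _ (by omega)]; exact h.d v hv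
  · exact h.d_lt
  · exact h.p_lt
  · intro i t δ h1 h2 h3 h4; rw [eK _ _ _ h4 h2, eK _ _ _ h4 h2]; exact h.Aout i t δ h1 h2 h3 h4
  · intro i a t y δ h1 h2 h3 h4 h5; rw [eK _ _ _ h5 h3]; exact h.Ale i a t y δ h1 h2 h3 h4 h5
  · intro i hi; rw [ekc i hi]; exact h.kc i hi
  · intro i t h1 h2; rw [eB _ _ _ (by omega) h2, eB _ _ _ (by omega) h2]; exact h.Bout i t h1 h2
  · intro i a t y h1 h2 h3; rw [eB _ _ _ (by omega) h3]; exact h.Ble i a t y h1 h2 h3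
  · intro j hj i t h1 h2
    rw [eC _ _ _ hj h2, eC _ _ _ hj h2, eC _ _ _ hj (by omega), eC _ _ _ hj (by omega)]
    exact h.Cout j hj i t h1 h2
  · intro i a t y h1 h2 h3 h4 h5 h6 h7
    obtain ⟨j, hj, hh⟩ := h.Cle i a t y h1 h2 h3 h4 h5 h6 h7
    refine ⟨j, hj, ?_⟩
    rwa [eC _ _ _ hj h3, eC _ _ _ hj (by omega)]
  · exact h.W4
  · exact h.WN
  · exact h.WK
  · exact h.WC

notation "qT" => (30 : ℕ)
notation "qI" => (31 : ℕ)
notation "qVal" => (32 : ℕ)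
notation "qPr" => (33 : ℕ)
notation "qLo" => (34 : ℕ)
notation "qHi" => (35 : ℕ)
notation "qMid" => (36 : ℕ)

/-- Keeps the better of the current answer and the answer `e`, with last vertex `f`. -/
def better (e f : Expr) : Cmd :=
  .ite e (.v qVal) (.set qPr f ;; .set qVal e) .skip

/-- The current answer is correct. -/
def Snd (S : Scene) (I i t : ℕ) (s : St) : Prop :=
  s.v qVal ≤ I ∧ (s.v qVal < I → S.Out i t (s.v qVal) (s.v qPr))

theorem wp_better {M : ℕ} {S : Scene} {I i t : ℕ} {s : St} {e f : Expr} (x y : ℕ)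
    (he : ∀ z, e.eval (s.set qPr z) = x) (hf : f.eval s = y) (hy : y < M) (hM : I < M)
    (hs : Snd S I i t s) (ho : x < I → S.Out i t x y) :
    wp M (better e f) s fun s' c => c ≤ 2 * e.cost + f.cost + 7 ∧ Snd S I i t s' ∧ s'.v qVal ≤ x ∧
      s'.v qVal ≤ s.v qVal := by
  have he' : e.eval s = x := by
    rw [← he (s.v qPr)]; congr 1; cases s; simp [St.set]
  obtain ⟨h1, h2⟩ := hs
  unfold better
  simp only [wp_ite, wp_seq, wp_set, wp_skip, he', he, hf, Expr.eval_v, Expr.cost_v]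
  refine ⟨fun h => ⟨hy, by omega, by omega, ⟨?_, ?_⟩, ?_, ?_⟩, fun h => ⟨by omega, ⟨h1, h2⟩, by omega, le_rfl⟩⟩
  · simp; omega
  · simp; exact ho
  · simp
  · simp; omega

def bisect : Cmd :=
  .set qLo 0 ;; .set qHi (.v vK + 1) ;;
  .whl (.v qLo) (.v qHi) (.set qMid ((.v qLo + .v qHi) / .c 2) ;;
    .ite (.v qI) (.g aA (.v qMid * .v vN + .v qT)) (.set qLo (.v qMid + 1)) (.set qHi (.v qMid)))

/-- The loop uses no monotonicity of the table: it only keeps an entry above `i` directly before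
`qLo` and an entry at most `i` at `qHi`, where `K + 1` is a sentinel. That the boundary found is the
optimal excess follows later from `QData.Ale`. -/
theorem wp_bisect {M K N i t lg : ℕ} {s : St} (hK : s.v vK = K) (hN : s.v vN = N)
    (hi : s.v qI = i) (ht : s.v qT = t) (hM : 2 * K + 2 < M) (hlg : K + 1 ≤ 2 ^ lg) :
    wp M bisect s fun s' c => c ≤ lg * 50 + 80 ∧ s'.v qLo ≤ K + 1 ∧
      (0 < s'.v qLo → i < s.a aA ((s'.v qLo - 1) * N + t)) ∧
      (s'.v qLo ≤ K → s.a aA (s'.v qLo * N + t) ≤ i) := by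
  unfold bisect
  simp only [wp_seq, wp_set, Expr.eval_zero, Expr.eval_add, Expr.eval_v, Expr.eval_one, St.set_v, hK,
    Nat.reduceEqDiff, if_false]
  refine ⟨by omega, by omega, ?_⟩
  refine wp_mono (wp_whl (k := (lg + 1) * 50) (fun r k => r.v qHi ≤ K + 1 ∧ r.v qLo ≤ r.v qHi ∧
    (∃ l, k = l * 50 ∧ r.v qHi - r.v qLo < 2 ^ l) ∧
    (0 < r.v qLo → i < s.a aA ((r.v qLo - 1) * N + t)) ∧
    (r.v qHi ≤ K → s.a aA (r.v qHi * N + t) ≤ i)) ?_ ?_) ?_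
  · refine ⟨by simp, by simp, ⟨lg + 1, rfl, ?_⟩, by simp, by simp⟩
    simp only [St.set_v, if_true, Nat.reduceEqDiff, if_false, pow_succ]; omega
  · rintro r k hr ⟨h1, h2, ⟨l, rfl, h3⟩, h4, h5⟩ hlt
    simp only [Expr.eval_v] at hlt
    have rN : r.v vN = N := by rw [hr.v _ (by decide)]; simp [hN]
    have rI : r.v qI = i := by rw [hr.v _ (by decide)]; simp [hi]
    have rT : r.v qT = t := by rw [hr.v _ (by decide)]; simp [ht]
    have rA : r.a aA = s.a aA := by rw [hr.a _ (by decide)]; simp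
    have hl : l ≠ 0 := by rintro rfl; simp at h3; omega
    obtain ⟨l, rfl⟩ := Nat.exists_eq_succ_of_ne_zero hl
    rw [Nat.pow_succ] at h3
    simp only [wp_ite, wp_seq, wp_set, Expr.eval_g, Expr.eval_add, Expr.eval_mul, Expr.eval_div, Expr.eval_v,
      Expr.eval_one, Expr.eval_c, St.set_v, St.set_a, if_true, Nat.reduceEqDiff, if_false, rN, rI, rT, rA]
    refine ⟨by omega, fun h => ⟨by omega, l * 50, ⟨by omega, by omega, ⟨l, rfl, by omega⟩, fun _ => h, h5⟩, ?_⟩,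
      fun h => ⟨by omega, l * 50, ⟨by omega, by omega, ⟨l, rfl, by omega⟩, h4, fun _ => by omega⟩, ?_⟩⟩
    · simp; omega
    · simp; omega
  · rintro r c hr ⟨_, h2, k, ⟨h3, h4, _, h5, h6⟩, h7⟩
    simp only [Expr.eval_v, not_lt] at h2
    have e : r.v qHi = r.v qLo := by omega
    rw [e] at h6
    refine ⟨by simp at h7 ⊢; omega, by omega, h5, h6⟩

/-- The search for a vertex off the path. -/
def search : Cmd :=
  bisect ;;
  .ite (.v vK) (.v qLo) .skip
    (better (.g aD (.v qT) + .v qLo) (.g aPA (.v qLo * .v vN + .v qT))) ;;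
  better (.g aBe (.g aKc (.v qI) * .v vN + .v qT)) (.g aBp (.g aKc (.v qI) * .v vN + .v qT)) ;;
  .for_ vJ (.v vNc)
    (better (.g aCm (.v vJ * .v vN + .v qI) + .g aCd (.v vJ * .v vN + .v qT))
      (Expr.sel 0 (.g aCd (.v vJ * .v vN + .v qT)) (.g aCp (.v vJ * .v vN + .v qT))
        (.g aCh (.v vJ * .v vN + .v qI))))

theorem Snd.congr {S : Scene} {I i t : ℕ} {s s' : St} (h : Snd S I i t s)
    (h1 : s'.v qVal = s.v qVal) (h2 : s'.v qPr = s.v qPr) : Snd S I i t s' := by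
  unfold Snd; rw [h1, h2]; exact h

/-- Soundness is an invariant, since each candidate is the weight bound of a walk. Optimality takes
the detour of the given path and finds a candidate at least as good in the table for its kind. -/
theorem wp_search {M I K nc W lg i t : ℕ} {S : Scene} {s : St} (hQ : QData S I K nc W s.a)
    (hB : Bd M s) (hi : i + 1 < S.L) (ht : t < S.N) (hoff : ¬ S.OnP t)
    (h1 : s.v qT = t) (h2 : s.v qI = i) (h3 : s.v vN = S.N) (h4 : s.v vK = K) (h5 : s.v vNc = nc)
    (h7 : s.v qVal = I)
    (hKM : 2 * K + 2 < M) (hIK : I + K + 2 < M) (hlg : K + 1 ≤ 2 ^ lg) :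
    wp M search s fun s' c => c ≤ lg * 50 + nc * 200 + 400 ∧ Snd S I i t s' ∧
      ∀ ℓ, S.Safe i t ℓ → (∀ x, Wk (S.AStep i) (S.p 0) t x → ℓ ≤ x) → ℓ < I → s'.v qVal ≤ ℓ := by
  have hncM : nc < M := by have := hB.v vNc; rwa [h5] at this
  unfold search
  rw [wp_seq]
  refine wp_mono (wp_bisect h4 h3 h2 h1 hKM hlg) ?_
  rintro s1 c1 F1 ⟨k1, k2, k3, k4⟩
  have a1 : s1.a = s.a := funext fun a => F1.a a (by simp [bisect, Cmd.ma])
  have v1 : ∀ x, x < 34 → s1.v x = s.v x := fun x hx => F1.v x (by simp [bisect, Cmd.mv]; omega)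
  have B1 := F1.bd hB
  have S1 : Snd S I i t s1 := by
    refine ⟨by rw [v1 _ (by omega), h7], ?_⟩
    rw [v1 _ (by omega), h7]; omega
  rw [wp_seq]
  have stepA : wp M (.ite (.v vK) (.v qLo) .skip
      (better (.g aD (.v qT) + .v qLo) (.g aPA (.v qLo * .v vN + .v qT)))) s1 fun s' c =>
      c ≤ 100 ∧ Snd S I i t s' ∧ ∀ a y, a ≤ i → Wk S.UStep (S.p a) t y →
        S.d (S.p a) + y ≤ S.d t + K → s'.v qVal ≤ S.d (S.p a) + y := by
    rw [wp_ite]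
    simp only [Expr.eval_v, v1 vK (by omega), h4, wp_skip]
    refine ⟨fun hlt => ⟨by simp, S1, fun a y ha hw hle => ?_⟩, fun hle => ?_⟩
    · have e1 := hQ.Ale i a t y K hi ha ht hoff le_rfl hw hle
      have e2 := k3 (by omega)
      rw [show s1.v qLo - 1 = K by omega] at e2; omega
    · obtain ⟨δ, hδ⟩ : ∃ δ, δ = s1.v qLo := ⟨_, rfl⟩
      rw [← hδ] at k2 k3 k4 hle
      have hdt := hQ.d_lt t ht
      refine wp_mono (wp_better (S.d t + δ) (s.a aPA (δ * S.N + t)) ?_ ?_ (hB.a _ _) (by omega) S1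
        fun _ => ?_) ?_
      · intro z; simp [a1, v1, h1, ← hδ, hQ.d t ht]
      · simp [a1, v1, h1, h3, ← hδ]
      · exact hQ.Aout i t δ hi ht hoff (by omega) (k4 (by omega))
      · rintro s2 c2 F2 ⟨l1, l2, l3, l4⟩
        refine ⟨by simp at l1 ⊢; omega, l2, fun a y ha hw hy => l3.trans ?_⟩
        -- A shorter unweighted detour would have excess at most `δ - 1`, so the entry before the
        -- boundary would be at most `i`, contrary to the bisection.
        by_contra hlt
        have e1 := hQ.Ale i a t y (δ - 1) hi ha ht hoff (by omega) hw (by omega)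
        have e2 := Scene.d_le_walk ((Scene.uwalk_dwalk hw).mono fun _ _ _ h => h.1)
        have e3 := k3 (by omega)
        omega
  refine wp_mono stepA ?_
  rintro s2 c2 F2 ⟨l1, l2, l3⟩
  have a2 : s2.a = s.a := funext fun a => (F2.a a (by simp [better, Cmd.ma])).trans (by rw [a1])
  have v2 : ∀ x, x < 32 → s2.v x = s.v x := fun x hx =>
    (F2.v x (by simp [better, Cmd.mv]; omega)).trans (v1 x (by omega))
  rw [wp_seq]
  refine wp_mono (wp_better (s.a aBe (s.a aKc i * S.N + t)) (s.a aBp (s.a aKc i * S.N + t)) ?_ ?_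
    (hB.a _ _) (by omega) l2 (hQ.Bout i t hi ht hoff)) ?_
  · intro z; simp [a2, v2, h1, h2, h3]
  · simp [a2, v2, h1, h2, h3]
  rintro s3 c3 F3 ⟨m1, m2, m3, m4⟩
  have a3 : s3.a = s.a := funext fun a => (F3.a a (by simp [better, Cmd.ma])).trans (by rw [a2])
  have v3 : ∀ x, x < 32 → s3.v x = s.v x := fun x hx =>
    (F3.v x (by simp [better, Cmd.mv]; omega)).trans (v2 x hx)
  refine wp_mono (wp_for nc 150 (fun j r => Snd S I i t r ∧ r.v qVal ≤ s3.v qVal ∧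
    ∀ j' < j, r.v qVal ≤ s.a aCm (j' * S.N + i) + s.a aCd (j' * S.N + t)) hncM
    (by simp [better, Cmd.mv]) ?_ ?_ ?_) ?_
  · intro r hr
    rw [Expr.eval_v, hr.v _ (by simp [better, Cmd.mv, Cmd.for_]), v3 _ (by omega), h5]
  · exact ⟨m2.congr (by simp) (by simp), by simp, by omega⟩
  · rintro j hj r hr hJ ⟨n1, n2, n3⟩
    have a4 : r.a = s.a := funext fun a =>
      (hr.a a (by simp [better, Cmd.ma, Cmd.for_])).trans (by rw [a3])
    have v4 : ∀ x, x < 32 → x ≠ vJ → r.v x = s.v x := fun x hx hx' =>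
      (hr.v x (by simp [better, Cmd.mv, Cmd.for_]; omega)).trans (v3 x hx)
    refine wp_mono (wp_better (s.a aCm (j * S.N + i) + s.a aCd (j * S.N + t))
      (if 0 < s.a aCd (j * S.N + t) then s.a aCp (j * S.N + t) else s.a aCh (j * S.N + i)) ?_ ?_
      ?_ (by omega) n1 (hQ.Cout j hj i t hi ht hoff)) ?_
    · intro z; simp [a4, v4, h1, h2, h3, hJ]
    · simp [a4, v4, h1, h2, h3, hJ]
    · split <;> exact hB.a _ _
    · rintro r' c' F' ⟨o1, o2, o3, o4⟩
      refine ⟨o1.trans ?_, o2.congr (by simp) (by simp), by simp; omega, fun j' hj' => ?_⟩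
      · simp [Expr.sel, Expr.lt]
      · simp only [St.set_v, Nat.reduceEqDiff, if_false]
        rcases Nat.lt_succ_iff_lt_or_eq.1 hj' with hj' | rfl
        · exact o4.trans (n3 j' hj')
        · exact o3
  rintro s4 c4 F4 ⟨-, -, ⟨n1, n2, n3⟩, n4⟩
  refine ⟨?_, n1, fun ℓ hs hm hl => ?_⟩
  · simp only [Expr.cost_add, Expr.cost_mul, Expr.cost_v, Expr.cost_g] at *; omega
  obtain ⟨a, ha, haL, y, hw, hy⟩ := hs.exists_detour
  -- The three kinds of detours: unweighted with small excess, unweighted with large excess, and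
  -- those for which the cover is needed.
  by_cases hU : Wk S.UStep (S.p a) t y
  · by_cases hK : S.d (S.p a) + y ≤ S.d t + K
    · have := l3 a y ha hU hK; omega
    · have := hQ.Ble i a t y hi ha ht hoff hU (fun x hx => hy.trans (hm x hx)) (by omega)
      omega
  · obtain ⟨j, hj, hh⟩ := hQ.Cle i a t y hi ha ht hoff hw hU (by omega)
    have := n3 j hj; omega

/-- The ends of the edge may come in either order; the smaller position is the index of the edge.
The flag is `I` minus the value, which is nonzero exactly when something below `I` was found. -/
def queryC : Cmd :=
  .set qT (.v 0) ;; .set qI (Expr.mn (.g aPos (.v 1)) (.g aPos (.v 2))) ;;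
  .set vN (.g aHd 0) ;; .set vK (.g aHd 1) ;; .set vNc (.g aHd (.c 2)) ;; .set vI (.g aHd (.c 3)) ;;
  .set qVal (.v vI) ;;
  .ite (.g aPos (.v qT)) (.v vI)
    (.ite (.v qI) (.g aPos (.v qT)) .skip
      (.set qVal (.g aD (.v qT)) ;; .set qPr (.g aP (.g aPos (.v qT) - 1))))
    search ;;
  .set 0 (.v vI - .v qVal) ;; .set 1 (.v qVal) ;; .set 2 (.v qPr)

theorem queryC_ok : queryC.ok = true := by decide

theorem wp_query {M I K nc W lg i t : ℕ} {S : Scene} {s : St} (hQ : QData S I K nc W s.a)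
    (hB : Bd M s) (hi : i + 1 < S.L) (ht : t < S.N) (h0 : s.v 0 = t)
    (h12 : (s.v 1 = S.p i ∧ s.v 2 = S.p (i + 1)) ∨ (s.v 1 = S.p (i + 1) ∧ s.v 2 = S.p i))
    (hI : 2 * I < M) (hKM : 2 * K + 2 < M) (hIK : I + K + 2 < M) (hlg : K + 1 ≤ 2 ^ lg) :
    wp M queryC s fun s' c => c ≤ lg * 50 + nc * 200 + 600 ∧
      (s'.v 0 ≠ 0 → (t = S.p 0 ∧ s'.v 1 = 0) ∨ (t ≠ S.p 0 ∧ S.Out i t (s'.v 1) (s'.v 2))) ∧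
      ∀ ℓ, S.Safe i t ℓ → (∀ x, Wk (S.AStep i) (S.p 0) t x → ℓ ≤ x) → ℓ < I →
        s'.v 0 ≠ 0 ∧ s'.v 1 ≤ ℓ := by
  have pi := hQ.pos i (by omega)
  have pi' := hQ.pos (i + 1) hi
  have hmin : min (s.a aPos (s.v 1)) (s.a aPos (s.v 2)) = i := by
    rcases h12 with ⟨h1, h2⟩ | ⟨h1, h2⟩ <;> rw [h1, h2, pi, pi'] <;> omega
  have hLI := hQ.LI
  have hLN := hQ.LN
  have hWN := hQ.WN
  have hNM : S.N < M := by have := hB.a aHd 0; rwa [hQ.hN] at this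
  have hncM : nc < M := by have := hB.a aHd 2; rwa [hQ.hC] at this
  have b0 := hB.v 0
  unfold queryC
  simp only [wp_seq, wp_set, Expr.eval_v, Expr.eval_mn, Expr.eval_g, Expr.eval_zero,
    Expr.eval_one, Expr.eval_c, St.set_v, St.set_a, if_true, Nat.reduceEqDiff, if_false,
    hmin, hQ.hN, hQ.hK, hQ.hC, hQ.hI, h0, OfNat.zero_ne_ofNat, OfNat.one_ne_ofNat]
  refine ⟨by omega, by omega, hNM, by omega, hncM, by omega, by omega, ?_⟩
  generalize hs1 : ((((((s.set qT t).set qI i).set vN S.N).set vK K).set vNc nc).set vI I).set qVal I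
    = s1
  have B1 : Bd M s1 := by
    rw [← hs1]
    exact ((((((hB.set (by omega) _).set (by omega) _).set (by omega) _).set (by omega) _).set
      (by omega) _).set (by omega) _).set (by omega) _
  have a1 : s1.a = s.a := by rw [← hs1]; simp
  have w1 : s1.v qT = t := by rw [← hs1]; simp
  have w2 : s1.v qI = i := by rw [← hs1]; simp
  have w3 : s1.v vN = S.N := by rw [← hs1]; simp
  have w4 : s1.v vK = K := by rw [← hs1]; simp
  have w5 : s1.v vNc = nc := by rw [← hs1]; simp
  have w6 : s1.v vI = I := by rw [← hs1]; simp
  have w7 : s1.v qVal = I := by rw [← hs1]; simp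
  suffices mid : wp M (.ite (.g aPos (.v qT)) (.v vI)
      (.ite (.v qI) (.g aPos (.v qT)) .skip
        (.set qVal (.g aD (.v qT)) ;; .set qPr (.g aP (.g aPos (.v qT) - 1))))
      search) s1 fun s' c => c ≤ lg * 50 + nc * 200 + 450 ∧ s'.v qVal ≤ I ∧
      (s'.v qVal < I → (t = S.p 0 ∧ s'.v qVal = 0) ∨
        (t ≠ S.p 0 ∧ S.Out i t (s'.v qVal) (s'.v qPr))) ∧
      ∀ ℓ, S.Safe i t ℓ → (∀ x, Wk (S.AStep i) (S.p 0) t x → ℓ ≤ x) → ℓ < I → s'.v qVal ≤ ℓ by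
    refine wp_mono mid ?_
    rintro s2 c2 F2 ⟨k1, k2, k3, k4⟩
    have B2 := F2.bd B1
    have v2 : s2.v vI = I := by rw [F2.v _ (by decide), w6]
    simp only [Expr.eval_sub, Expr.eval_v, v2]
    refine ⟨by omega, B2.v _, B2.v _, ?_, fun h => k3 (by omega), fun ℓ h1 h2 h3 => ?_⟩
    · simp [Expr.mn]; omega
    · have := k4 ℓ h1 h2 h3; omega
  rw [wp_ite]
  simp only [Expr.eval_g, Expr.eval_v, w1, w6, a1]
  refine ⟨fun hp => ?_, fun hp => ?_⟩
  · have hon : S.OnP t := by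
      by_contra h
      rw [hQ.pos' t ht h] at hp; omega
    obtain ⟨b, hb, rfl⟩ := hon
    have hd := hQ.d_lt _ ht
    simp only [wp_ite, wp_skip, wp_seq, wp_set, Expr.eval_g, Expr.eval_v, Expr.eval_sub, Expr.eval_one,
      w1, w2, a1, hQ.pos b hb, St.set_v, St.set_a, if_true, Nat.reduceEqDiff, if_false, hQ.d _ ht, w7]
    refine ⟨fun hlt => ⟨by simp, le_rfl, by omega, fun ℓ hs _ _ => ?_⟩, fun hlt =>
      ⟨by omega, hB.a _ _, by simp, hd.le, fun _ => ?_, fun ℓ hs _ _ => ?_⟩⟩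
    · exfalso
      have hA : S.After i (S.p b) := ⟨b, hlt, hb, rfl⟩
      generalize S.p b = v at hs hA
      cases hs with
      | refl => exact Scene.not_after (Nat.zero_le _) (by omega) hA
      | snoc _ h => exact h.2.2 hA
    · cases b with
      | zero => exact .inl ⟨rfl, S.d0⟩
      | succ b =>
        refine .inr ⟨fun h => ?_, ?_⟩
        · have := Scene.p_inj hb S.L_pos h; omega
        · rw [Nat.add_sub_cancel, hQ.P b (by omega)]
          exact Scene.out_path hi (by omega)
    · have := Scene.d_le_walk (hs.mono fun _ _ _ h => h.1.step)
      rwa [S.d0, zero_add] at this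
  · have hoff : ¬ S.OnP t := by
      rintro ⟨b, hb, rfl⟩
      rw [hQ.pos b hb] at hp; omega
    refine wp_mono (wp_search (a1 ▸ hQ) B1 hi ht hoff w1 w2 w3 w4 w5 w7 hKM hIK hlg) ?_
    rintro s2 c2 F2 ⟨k1, ⟨k2, k3⟩, k4⟩
    refine ⟨by simp; omega, k2, fun h => .inr ⟨?_, k3 h⟩, k4⟩
    rintro rfl
    exact hoff ⟨0, S.L_pos, rfl⟩

end RAM

/-! ### Loops with a cost that varies between rounds. -/

namespace RAM

/-- Counting loops whose bodies have different costs. -/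
theorem wp_for_sum {M : ℕ} {s : St} {x : ℕ} {e : Expr} {p : Cmd} (n : ℕ) (b : ℕ → ℕ)
    (I : ℕ → St → Prop) (hn : n < M)
    (hx : x ∉ p.mv) (he : ∀ t, Fr M (.for_ x e p) s t → e.eval t = n) (h0 : I 0 (s.set x 0))
    (h : ∀ j < n, ∀ t, Fr M (.for_ x e p) s t → t.v x = j → I j t →
      wp M p t fun u c => c ≤ b j ∧ I (j + 1) (u.set x (j + 1))) :
    wp M (.for_ x e p) s fun t c => I n t ∧
      c ≤ ∑ j ∈ Finset.range n, b j + n * (e.cost + 9) + e.cost + 6 := by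
  have hM : 0 < M := by omega
  have fr0 : ∀ {t}, Fr M (.seq p (.set x (.v x + 1))) (s.set x 0) t → Fr M (.for_ x e p) s t := by
    intro t ht
    refine ⟨fun y hy => ?_, fun y hy => ?_, ht.i, fun b => ht.bd (b.set hM x)⟩
    · simp only [Cmd.for_, Cmd.mv, List.mem_append, List.mem_singleton, not_or] at hy
      rw [ht.v y (by simp [Cmd.mv, hy])]; simp [hy]
    · simp only [Cmd.for_, Cmd.ma, List.mem_append, not_or] at hy
      rw [ht.a y (by simp [Cmd.ma, hy])]; simp
  let B : ℕ → ℕ := fun j => ∑ l ∈ Finset.range n \ Finset.range j, (b l + e.cost + 9)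
  have hB0 : B 0 = ∑ j ∈ Finset.range n, b j + n * (e.cost + 9) := by
    simp [B, Finset.sum_add_distrib, add_assoc, mul_add]
  have hB : ∀ j < n, B (j + 1) + (b j + e.cost + 9) = B j := by
    intro j hj
    simp only [B, Finset.range_add_one, Finset.sdiff_insert]
    exact Finset.sum_erase_add _ (fun l => b l + e.cost + 9) (by simp [hj])
  unfold Cmd.for_
  rw [wp_seq, wp_set]
  refine ⟨hM, ?_⟩
  refine wp_mono (wp_whl (k := B 0) (fun t k => t.v x ≤ n ∧ I (t.v x) t ∧
    B (t.v x) = k) ?_ ?_) ?_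
  · simpa using h0
  · rintro t k ht ⟨h1, h2, h3⟩ hlt
    rw [he t (fr0 ht), Expr.eval_v] at hlt
    rw [wp_seq]
    refine wp_mono (h _ hlt t (fr0 ht) rfl h2) ?_
    rintro u c hu ⟨hc, hI⟩
    rw [wp_set]
    have hux : u.v x = t.v x := hu.v x hx
    refine ⟨by simp only [Expr.eval_add, Expr.eval_v, Expr.eval_one]; omega, _, ⟨?_, ?_, rfl⟩, ?_⟩
    · simp [hux]; omega
    · simpa [hux] using hI
    · simp only [St.set_v, if_true, Expr.eval_add, Expr.eval_v, Expr.eval_one, hux, ← h3,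
        Expr.cost_add, Expr.cost_v, Expr.cost_one]
      have := hB _ hlt
      omega
  · rintro t c _ ⟨h1, h2, k, ⟨h3, h4, h5⟩, h6⟩
    rw [he t (fr0 h1), Expr.eval_v] at h2
    have : t.v x = n := by omega
    rw [this] at h4
    refine ⟨h4, ?_⟩
    simp only [Expr.cost_v, Expr.cost_zero] at *
    omega

/-! ### Short unweighted detours -/

end RAM

/-! ### The recurrence for the first index with a short unweighted detour. -/

namespace Scene

variable {S : Scene} {I : ℕ}

/-- There is an unweighted detour from the `a`-th vertex of the path to `t`, and the whole path to
`t` has at most the weight `z`. -/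
def Reach (S : Scene) (a t z : ℕ) : Prop := ∃ y, Wk S.UStep (S.p a) t y ∧ S.d (S.p a) + y ≤ z

/-- The first vertex of the path from which there is a detour to `t` of excess at most `δ`; `I` if
there is none. -/
noncomputable def fst (S : Scene) (I δ t : ℕ) : ℕ :=
  sInf (insert I {a | a < S.L ∧ S.Reach a t (S.d t + δ)})

theorem fst_le_I (δ t : ℕ) : S.fst I δ t ≤ I := Nat.sInf_le (Set.mem_insert _ _)

theorem fst_le {δ a t : ℕ} (ha : a < S.L) (h : S.Reach a t (S.d t + δ)) : S.fst I δ t ≤ a :=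
  Nat.sInf_le (Set.mem_insert_of_mem _ ⟨ha, h⟩)

theorem fst_spec {δ t : ℕ} (h : S.fst I δ t < I) :
    S.fst I δ t < S.L ∧ S.Reach (S.fst I δ t) t (S.d t + δ) := by
  have := Nat.sInf_mem (s := insert I {a | a < S.L ∧ S.Reach a t (S.d t + δ)}) ⟨I, by simp⟩
  rcases this with h1 | h1
  · rw [fst, h1] at h; omega
  · exact h1

theorem uwalk_onP {a b y : ℕ} (h : Wk S.UStep (S.p a) (S.p b) y) (ha : a < S.L) (hb : b < S.L) :
    b = a := by
  generalize hv : S.p b = v at h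
  cases h with
  | refl => exact p_inj hb ha hv
  | snoc _ h => exact absurd ⟨b, hb, hv⟩ h.2

theorem fst_p {δ b : ℕ} (hb : b < S.L) (hLI : S.L ≤ I) : S.fst I δ (S.p b) = b := by
  have h1 : S.fst I δ (S.p b) ≤ b := fst_le hb ⟨0, .refl, by omega⟩
  obtain ⟨h2, y, h3, -⟩ := fst_spec (S := S) (I := I) (δ := δ) (t := S.p b) (by omega)
  exact (uwalk_onP h3 h2 hb).symm

/-- Extend a detour to `u` by the edge to `t`. The condition on `d u` makes the truncated
subtraction exact: the budget of total length `d t + δ` leaves `d t + δ - 1` for `u`. -/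
theorem fst_le_of_edge {δ t u : ℕ} (ht : ¬ S.OnP t) (h : S.E t u 1 false) (hd : S.d u < S.d t + δ) :
    S.fst I δ t ≤ S.fst I (S.d t + δ - 1 - S.d u) u := by
  rcases (fst_le_I (S := S) (I := I) (S.d t + δ - 1 - S.d u) u).eq_or_lt with h1 | h1
  · rw [h1]; exact fst_le_I _ _
  · obtain ⟨h2, y, h3, h4⟩ := fst_spec h1
    exact fst_le h2 ⟨y + 1, h3.snoc ⟨S.symm h, ht⟩, by omega⟩

/-- The converse half of the recurrence: since `t` is off the path, an optimal detour has a last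
edge, and what precedes it is a candidate for its neighbour. -/
theorem le_fst {δ t c : ℕ} (ht : ¬ S.OnP t) (hc : c ≤ I)
    (h : ∀ u, S.E t u 1 false → S.d u < S.d t + δ → c ≤ S.fst I (S.d t + δ - 1 - S.d u) u) :
    c ≤ S.fst I δ t := by
  rcases (fst_le_I (S := S) (I := I) δ t).eq_or_lt with h1 | h1
  · rwa [h1]
  · obtain ⟨h2, y, h3, h4⟩ := fst_spec h1
    generalize S.fst I δ t = a at *
    cases h3 with
    | refl => exact absurd ⟨a, h2, rfl⟩ ht
    | @snoc u _ y w h5 h6 =>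
      obtain rfl := S.one h6.1
      have h7 := d_le_walk (h5.mono fun _ _ _ h => ⟨_, h.1⟩)
      refine (h u (S.symm h6.1) (by omega)).trans (fst_le h2 ⟨y, h5, by omega⟩)

/-- The entries `x` and `u` for excess `δ` and vertex `t` are correct. -/
def FstOK (S : Scene) (I δ t x u : ℕ) : Prop :=
  x = S.fst I δ t ∧ (¬ S.OnP t → x < I → S.E t u 1 false ∧ S.d u < S.d t + δ ∧
    S.fst I (S.d t + δ - 1 - S.d u) u = x)

theorem FstOK.out {i δ t x u : ℕ} (h : S.FstOK I δ t x u) (hi : i + 1 < S.L) (hLI : S.L ≤ I)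
    (ht : ¬ S.OnP t) (hx : x ≤ i) : S.Out i t (S.d t + δ) u := by
  obtain ⟨h1, h2, h3⟩ := h.2 ht (by omega)
  obtain ⟨-, y, h4, h5⟩ := fst_spec (by rw [h3]; omega)
  rw [h3] at h4 h5
  exact out_detour hi hx (uwalk_dwalk h4) ⟨_, S.symm h1⟩ ht (by omega)

end Scene

/-! ### The dynamic program for short unweighted detours. -/

namespace RAM

/-- The arrays that describe the path and the distances from the source. -/
structure Geo (S : Scene) (I : ℕ) (s : St) : Prop where
  pos : ∀ a < S.L, s.a aPos (S.p a) = a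
  pos' : ∀ v < S.N, ¬ S.OnP v → s.a aPos v = I
  P : ∀ a < S.L, s.a aP a = S.p a
  d : ∀ v < S.N, s.a aD v = S.d v
  od_lt : ∀ j < S.N, s.a aOd j < S.N
  od_ex : ∀ v < S.N, ∃ j < S.N, s.a aOd j = v
  od_inj : ∀ j < S.N, ∀ j' < S.N, s.a aOd j = s.a aOd j' → j = j'
  od_mono : ∀ j j', j ≤ j' → j' < S.N → S.d (s.a aOd j) ≤ S.d (s.a aOd j')

theorem Geo.congr {S : Scene} {I : ℕ} {s t : St} (h : Geo S I s)
    (ha : ∀ a ∈ [aPos, aP, aD, aOd], t.a a = s.a a) : Geo S I t := by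
  have e1 := ha aPos (by simp)
  have e2 := ha aP (by simp)
  have e3 := ha aD (by simp)
  have e4 := ha aOd (by simp)
  exact ⟨by rw [e1]; exact h.pos, by rw [e1]; exact h.pos', by rw [e2]; exact h.P,
    by rw [e3]; exact h.d, by rw [e4]; exact h.od_lt, by rw [e4]; exact h.od_ex,
    by rw [e4]; exact h.od_inj, by rw [e4]; exact h.od_mono⟩

theorem Geo.fr {S : Scene} {I M : ℕ} {s t : St} {p : Cmd} (h : Geo S I s) (hF : Fr M p s t)
    (ha : ∀ a ∈ [aPos, aP, aD, aOd], a ∉ p.ma) : Geo S I t :=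
  h.congr fun a h => hF.a a (ha a h)

theorem Geo.sum_od {S : Scene} {I : ℕ} {s : St} (h : Geo S I s) (f : ℕ → ℕ) :
    ∑ j ∈ Finset.range S.N, f (s.a aOd j) = ∑ v ∈ Finset.range S.N, f v := by
  refine Finset.sum_bij (fun j _ => s.a aOd j) ?_ ?_ ?_ ?_
  · intro j hj; simpa using h.od_lt j (by simpa using hj)
  · intro j hj k hk e; exact h.od_inj j (by simpa using hj) k (by simpa using hk) e
  · intro v hv
    obtain ⟨j, h1, h2⟩ := h.od_ex v (by simpa using hv)
    exact ⟨j, by simpa using h1, h2⟩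
  · intros; rfl

notation "vDe" => (37 : ℕ)
notation "vIx" => (38 : ℕ)
notation "vT" => (39 : ℕ)

def aCell : Expr := .v vDe * .v vN + .v vT

def aArc : Cmd :=
  .set vV (.g aTo (.v vE)) ;; .set vD (.g aD (.v vT) + .v vDe) ;;
  .ite (.g aFl (.v vE)) 1
    (.ite (.g aD (.v vV)) (.v vD)
      (.set vX (.g aA ((.v vD - 1 - .g aD (.v vV)) * .v vN + .v vV)) ;;
        .ite (.v vX) (.g aA aCell) (.put aA aCell (.v vX) ;; .put aPA aCell (.v vV)) .skip) .skip)
    .skip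

def aBody : Cmd :=
  .set vT (.g aOd (.v vIx)) ;;
  .ite (.g aPos (.v vT)) (.v vI) (.put aA aCell (.g aPos (.v vT)))
    (.put aA aCell (.v vI) ;; arcs vT aArc)

/-- Order of computation: by excess, and for equal excess by distance from the source. The
recurrence refers to a smaller excess, or to the same excess at a vertex one step closer. -/
def aTable : Cmd := .for_ vDe (.v vK + 1) (.for_ vIx (.v vN) aBody)

/-- The table is correct up to the vertex with number `ix` for the excess `δ`. -/
def ADone (S : Scene) (I δ ix : ℕ) (s : St) : Prop :=
  ∀ δ' t', t' < S.N → (δ' < δ ∨ δ' = δ ∧ ∃ j < ix, s.a aOd j = t') →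
    S.FstOK I δ' t' (s.a aA (δ' * S.N + t')) (s.a aPA (δ' * S.N + t'))

theorem row_inj {N a b j k : ℕ} (ha : a < N) (hb : b < N) (h : j * N + a = k * N + b) :
    j = k ∧ a = b := by
  rcases lt_trichotomy j k with h1 | h1 | h1
  · have : (j + 1) * N ≤ k * N := Nat.mul_le_mul_right _ h1
    rw [Nat.add_mul] at this; omega
  · subst h1; omega
  · have : (k + 1) * N ≤ j * N := Nat.mul_le_mul_right _ h1
    rw [Nat.add_mul] at this; omega

theorem ADone.congr {S : Scene} {I δ ix : ℕ} {s r : St} (h : ADone S I δ ix s)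
    (ho : r.a aOd = s.a aOd) {t : ℕ} (ht : t < S.N) (hn : ∀ j < ix, s.a aOd j ≠ t)
    (hA : ∀ l, l ≠ δ * S.N + t → r.a aA l = s.a aA l ∧ r.a aPA l = s.a aPA l) :
    ADone S I δ ix r := by
  intro δ' t' ht' hc
  rw [ho] at hc
  have hne : δ' * S.N + t' ≠ δ * S.N + t := by
    intro e
    obtain ⟨rfl, rfl⟩ := row_inj ht' ht e
    rcases hc with hc | ⟨_, j, hj, h2⟩
    · omega
    · exact hn j hj h2
  rw [(hA _ hne).1, (hA _ hne).2]
  exact h δ' t' ht' hc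

/-- The arcs after the `k`-th have been taken into account at the vertex `t`. -/
structure ACell (S : Scene) (G : Ar) (I δ ix t k : ℕ) (s : St) : Prop where
  done : ADone S I δ ix s
  le_I : s.a aA (δ * S.N + t) ≤ I
  par : s.a aA (δ * S.N + t) < I → S.E t (s.a aPA (δ * S.N + t)) 1 false ∧
    S.d (s.a aPA (δ * S.N + t)) < S.d t + δ ∧
    S.fst I (S.d t + δ - 1 - S.d (s.a aPA (δ * S.N + t))) (s.a aPA (δ * S.N + t)) =
      s.a aA (δ * S.N + t)
  le : ∀ e, k < e → e ≤ 2 * G.m → G.fr e = t → G.fl e = 0 → S.d (G.en e) < S.d t + δ →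
    s.a aA (δ * S.N + t) ≤ S.fst I (S.d t + δ - 1 - S.d (G.en e)) (G.en e)

theorem wp_aArc {M I lg δ ix t k : ℕ} {S : Scene} {G : Ar} {s : St} (hE : Env M S G I lg)
    (hB : Base M S G I s) (hG : Geo S I s) (hδ : s.v vDe = δ) (ht : s.v vT = t) (htN : t < S.N)
    (hix : ix < S.N) (hod : s.a aOd ix = t)
    (hIδ : I + δ < M) (hk : k < 2 * G.m) (hfr : G.fr (k + 1) = t)
    (hvE : s.v vE = k + 1) (h : ACell S G I δ ix t (k + 1) s) :
    wp M aArc s fun r c => c ≤ 200 ∧ ACell S G I δ ix t k r := by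
  obtain ⟨hdone, h1, h2, h3⟩ := h
  have hN := hE.N
  obtain ⟨u, hu⟩ : ∃ u, u = G.en (k + 1) := ⟨_, rfl⟩
  have huN : u < S.N := by rw [hu, ← hN]; exact G.en_lt _ (by omega) (by omega)
  have e1 : s.a aTo (k + 1) = u := by rw [hu]; exact hB.g.en _ (by omega) (by omega)
  have e2 : s.a aFl (k + 1) = G.fl (k + 1) := hB.g.fl _ (by omega) (by omega)
  have hdt := hE.d t htN
  have hsN : s.v vN = S.N := by rw [hB.g.N, hN]
  have hMN := hE.hN
  have h3' : (G.fl (k + 1) = 0 → S.d u < S.d t + δ →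
      s.a aA (δ * S.N + t) ≤ S.fst I (S.d t + δ - 1 - S.d u) u) →
      ∀ e, k < e → e ≤ 2 * G.m → G.fr e = t → G.fl e = 0 → S.d (G.en e) < S.d t + δ →
        s.a aA (δ * S.N + t) ≤ S.fst I (S.d t + δ - 1 - S.d (G.en e)) (G.en e) := by
    intro h e k1 k2 k3 k4 k5
    by_cases he : e = k + 1
    · subst he; rw [← hu] at k5 ⊢; exact h k4 k5
    · exact h3 e (by omega) k2 k3 k4 k5
  -- The entry referred to is already final: if its excess is not smaller than `δ`, then `u` is
  -- strictly closer to the source and precedes `t` in the order `aOd`.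
  have edge : G.fl (k + 1) < 1 → S.d u < S.d t + δ → S.E t u 1 false ∧
      s.a aA ((S.d t + δ - 1 - S.d u) * S.N + u) = S.fst I (S.d t + δ - 1 - S.d u) u := by
    intro hf hd
    have hE0 := (hE.E t u (G.wt (k + 1)) false).2
      ⟨k + 1, by omega, by omega, hfr, hu.symm, rfl, by simpa using hf⟩
    have hE' := hE0
    rw [S.one hE0] at hE'
    refine ⟨hE', (hdone _ u huN ?_).1⟩
    have h4 := S.d_le (S.symm hE')
    by_cases h5 : S.d t + δ - 1 - S.d u < δ
    · exact .inl h5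
    · refine .inr ⟨by omega, ?_⟩
      obtain ⟨j, h6, h7⟩ := hG.od_ex u huN
      refine ⟨j, ?_, h7⟩
      by_contra h8
      have := hG.od_mono ix j (by omega) h6
      rw [hod, h7] at this; omega
  unfold aArc aCell
  simp only [wp_seq, wp_set, wp_ite, wp_put, wp_skip, Expr.eval_g, Expr.eval_v, Expr.eval_add, Expr.eval_mul,
    Expr.eval_sub, Expr.eval_one, St.set_v, St.set_a, St.put_v, if_true, Nat.reduceEqDiff, if_false,
    hvE, e1, e2, ht, hδ, hsN, hG.d t htN, hG.d u huN]
  refine ⟨by omega, by omega, fun hf => ⟨fun hd => ⟨hB.bd.a _ _, fun hlt => ?_, fun hlt => ?_⟩, fun hd => ?_⟩,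
    fun hf => ?_⟩
  · obtain ⟨hE', hval⟩ := edge hf hd
    rw [hval] at hlt ⊢
    refine ⟨by omega, by omega, by simp, ?_, ?_, ?_, ?_⟩
    · refine hdone.congr (by simp) htN ?_ ?_
      · intro j hj e
        have := hG.od_inj j (by omega) ix hix (e.trans hod.symm); omega
      · intro l hl
        simp [Function.update_of_ne hl]
    · simp; omega
    · simpa using fun _ => ⟨hE', hd⟩
    · intro e k1 k2 k3 k4 k5
      simp only [St.put_a, Nat.reduceEqDiff, if_true, if_false, Function.update_self]
      by_cases he : e = k + 1
      · subst he; rw [← hu]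
      · have := h3 e (by omega) k2 k3 k4 k5; omega
  · refine ⟨by simp, hdone, h1, h2, h3' fun _ _ => ?_⟩
    obtain ⟨hE', hval⟩ := edge (by omega) hd
    rw [hval] at hlt
    omega
  · exact ⟨by simp, hdone, h1, h2, h3' fun _ h => absurd h hd⟩
  · exact ⟨by simp, hdone, h1, h2, h3' fun h _ => absurd h (by omega)⟩

theorem wp_aBody {M I lg δ ix : ℕ} {S : Scene} {G : Ar} {s : St} (hE : Env M S G I lg)
    (hB : Base M S G I s) (hG : Geo S I s) (hδ : s.v vDe = δ) (hvx : s.v vIx = ix)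
    (hix : ix < S.N) (hIδ : I + δ < M) (h : ADone S I δ ix s) :
    wp M aBody s fun r c => c ≤ G.deg (s.a aOd ix) * 220 + 100 ∧ ADone S I δ (ix + 1) r := by
  have hN := hE.N
  obtain ⟨t, ht⟩ : ∃ t, t = s.a aOd ix := ⟨_, rfl⟩
  have htN : t < S.N := ht ▸ hG.od_lt ix hix
  have hsN : s.v vN = S.N := by rw [hB.g.N, hN]
  have htM : t < M := by have := hE.hN; omega
  have hnew : ∀ j < ix, s.a aOd j ≠ t := by
    intro j hj e
    have := hG.od_inj j (by omega) ix hix (by rw [e, ht]); omega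
  have fin : ∀ r : St, r.a aOd = s.a aOd → ADone S I δ ix r →
      S.FstOK I δ t (r.a aA (δ * S.N + t)) (r.a aPA (δ * S.N + t)) → ADone S I δ (ix + 1) r := by
    intro r ho hd hok δ' t' ht' hc
    rw [ho] at hc
    rcases hc with hc | ⟨rfl, j, hj, rfl⟩
    · exact hd δ' t' ht' (.inl hc)
    · rcases Nat.lt_succ_iff_lt_or_eq.1 hj with hj | rfl
      · exact hd _ _ ht' (.inr ⟨rfl, j, hj, by rw [ho]⟩)
      · rw [← ht]; exact hok
  unfold aBody
  rw [wp_seq, wp_set, wp_ite]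
  have e0 : Expr.eval (.g aOd (.v vIx)) s = t := by simp [hvx, ht]
  rw [e0]
  simp only [Expr.eval_g, Expr.eval_v, St.set_v, St.set_a, if_true, Nat.reduceEqDiff, if_false, hB.inf]
  refine ⟨htM, fun hp => ?_, fun hp => ?_⟩
  · have hon : S.OnP t := by
      by_contra h
      rw [hG.pos' t htN h] at hp; omega
    obtain ⟨b, hb, hbt⟩ := hon
    have hpos : s.a aPos t = b := by rw [← hbt]; exact hG.pos b hb
    simp only [wp_put, aCell, Expr.eval_g, Expr.eval_v, Expr.eval_add, Expr.eval_mul, St.set_v, St.set_a,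
      if_true, Nat.reduceEqDiff, if_false, hδ, hsN, hpos]
    refine ⟨by rw [← hpos]; exact hB.bd.a _ _, by simp, fin _ (by simp) ?_ ?_⟩
    · refine h.congr (by simp) htN hnew fun l hl => ?_
      simp [Function.update_of_ne hl]
    · refine ⟨?_, fun hoff => absurd ⟨b, hb, hbt⟩ hoff⟩
      simp only [St.put_a, if_true, Function.update_self]
      rw [← hbt]; exact (Scene.fst_p hb hE.LI).symm
  · have hoff : ¬ S.OnP t := by
      rintro ⟨b, hb, rfl⟩
      rw [hG.pos b hb] at hp
      have := hE.LI; omega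
    rw [wp_seq, wp_put]
    simp only [aCell, Expr.eval_v, Expr.eval_add, Expr.eval_mul, St.set_v,
      if_true, Nat.reduceEqDiff, if_false, hδ, hsN, hB.inf]
    refine ⟨by omega, ?_⟩
    generalize hr : (s.set vT t).put aA (δ * S.N + t) I = r
    have Br : Base M S G I r := by
      rw [← hr]
      refine ⟨hB.g.congr (by simp) fun a ha => ?_, (hB.bd.set htM _).put (by omega) _ _, ?_, ?_, ?_⟩
      · simp; omega
      · simpa using hB.inf
      · simpa using hB.L
      · simpa using hB.src
    have aod : r.a aOd = s.a aOd := by rw [← hr]; simp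
    have Gr : Geo S I r := by
      rw [← hr]; exact hG.congr (by simp)
    have rt : r.v vT = t := by rw [← hr]; simp
    have rδ : r.v vDe = δ := by rw [← hr]; simpa using hδ
    refine wp_mono (wp_arcs (u := t) (b := 200) Br.g Br.bd rt (by omega) (by decide) (by decide)
      (by decide) (fun k q => ACell S G I δ ix t k q) ?_ ?_ ?_ ?_) ?_
    · intro k q z hq
      obtain ⟨q1, q2, q3, q4⟩ := hq
      exact ⟨q1, q2, q3, q4⟩
    · refine ⟨?_, ?_, ?_, by omega⟩
      · rw [← hr]
        refine h.congr (by simp) htN hnew fun l hl => ?_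
        simp [Function.update_of_ne hl]
      · rw [← hr]; simp
      · rw [← hr]; simp
    · intro k q hk hfr hq
      refine { hq with le := fun e h1 h2 h3 => ?_ }
      by_cases he : e = k + 1
      · subst he; exact absurd h3 hfr
      · exact hq.le e (by omega) h2 h3
    · intro k q hk hfr hF hvE hq
      have aq : q.a aOd = s.a aOd := (hF.a _ (by decide)).trans aod
      exact wp_aArc hE (Br.fr hF (by decide) (by decide)) (Gr.fr hF (by decide))
        ((hF.v _ (by decide)).trans rδ) ((hF.v _ (by decide)).trans rt) htN hix
        (by rw [aq, ht]) hIδ hk hfr hvE hq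
    · rintro q c hF ⟨hq, hc⟩
      have aq : q.a aOd = s.a aOd := (hF.a _ (by decide)).trans aod
      refine ⟨?_, fin q aq hq.done ⟨?_, fun _ => hq.par⟩⟩
      · rw [← ht]; simp; omega
      · refine le_antisymm (Scene.le_fst hoff hq.le_I fun u hu hd => ?_) ?_
        · obtain ⟨e, h1, h2, h3, rfl, -, h5⟩ := (hE.E _ _ _ _).1 hu
          exact hq.le e (by omega) h2 h3 (by simpa using h5) hd
        · rcases hq.le_I.eq_or_lt with h1 | h1
          · rw [h1]; exact Scene.fst_le_I _ _
          · obtain ⟨h2, h3, h4⟩ := hq.par h1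
            rw [← h4]
            exact Scene.fst_le_of_edge hoff h2 h3

theorem wp_aTable {M I lg K : ℕ} {S : Scene} {G : Ar} {s : St} (hE : Env M S G I lg)
    (hB : Base M S G I s) (hG : Geo S I s) (hK : s.v vK = K) (hIK : I + K + 2 < M) :
    wp M aTable s fun r c => c ≤ (K + 1) * ((2 * G.m + G.N + 1) * 220) + 20 ∧
      ∀ δ ≤ K, ∀ t < S.N,
        S.FstOK I δ t (r.a aA (δ * S.N + t)) (r.a aPA (δ * S.N + t)) := by
  have hN := hE.N
  have hMN := hE.hN
  obtain ⟨b, hb⟩ : ∃ b, b = 2 * G.m * 220 + S.N * 111 + 8 := ⟨_, rfl⟩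
  unfold aTable
  refine wp_mono (wp_for (K + 1) b
    (fun δ r => ADone S I δ 0 r) (by omega) (by decide) ?_ ?_ ?_) ?_
  · intro t ht
    rw [Expr.eval_add, Expr.eval_v, ht.v _ (by decide), hK]; rfl
  · intro δ' t' _ h; omega
  · intro δ hδ r hr hrδ hI
    have Br := hB.fr hr (by decide) (by decide)
    have Gr := hG.fr hr (by decide)
    have rN : r.v vN = S.N := by rw [Br.g.N, hN]
    refine wp_mono (wp_for_sum S.N (fun j => G.deg (r.a aOd j) * 220 + 100)
      (fun ix q => ADone S I δ ix q) (by omega) (by decide) ?_ ?_ ?_) ?_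
    · intro t ht
      rw [Expr.eval_v, ht.v _ (by decide), rN]
    · exact hI
    · intro ix hix q hq hvx hD
      refine wp_mono (wp_aBody hE (Br.fr hq (by decide) (by decide)) (Gr.fr hq (by decide))
        ((hq.v _ (by decide)).trans hrδ) hvx hix (by omega) hD) ?_
      rintro q' c' _ ⟨h1, h2⟩
      rw [hq.a aOd (by decide)] at h1
      exact ⟨h1, h2⟩
    · rintro q c hq ⟨h1, h2⟩
      refine ⟨?_, ?_⟩
      · rw [Gr.sum_od (fun v => G.deg v * 220 + 100), Finset.sum_add_distrib, ← Finset.sum_mul,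
          ← hN, show ∑ v ∈ Finset.range G.N, G.deg v = 2 * G.m from G.sum_dg _ le_rfl] at h2
        simp at h2 ⊢; omega
      · intro δ' t' ht' hc
        have Gq := Gr.fr hq (by decide)
        rcases hc with hc | ⟨_, j, hj, _⟩
        · by_cases he : δ' = δ
          · obtain ⟨j, h3, h4⟩ := Gq.od_ex t' ht'
            exact h1 δ' t' ht' (.inr ⟨he, j, h3, h4⟩)
          · exact h1 δ' t' ht' (.inl (by omega))
        · omega
  · rintro r c hr ⟨-, -, h1, h2⟩
    refine ⟨h2.trans ?_, fun δ hδ t ht => h1 δ t ht (.inl (by omega))⟩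
    simp only [Expr.cost_add, Expr.cost_v, Expr.cost_one]
    have : (K + 1) * (b + (2 + 1 + 1) + 9) ≤ (K + 1) * ((2 * G.m + G.N + 1) * 220) :=
      Nat.mul_le_mul_left _ (by omega)
    omega

end RAM

namespace RAM

/-! ### Searches from a single vertex -/

notation "vCc" => (40 : ℕ)
notation "vMi" => (41 : ℕ)
notation "vAr" => (42 : ℕ)
notation "vCa" => (43 : ℕ)

/-- The sum of the two truncated differences vanishes only for equal values, so the product is `0`
at the start vertex and `I` elsewhere. -/
def iniE (x : ℕ) : Expr := .v vI * Expr.lt 0 ((.v vJ - .v x) + (.v x - .v vJ))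

/-- Positive exactly off the path, where the position is `I`, and at the start vertex itself. -/
def exE : Expr := (1 - (.v vI - .g aPos (.v vJ))) + (1 - ((.v vJ - .v vCc) + (.v vCc - .v vJ)))

theorem eval_iniE {x I c j : ℕ} {t : St} (h1 : t.v vI = I) (h2 : t.v x = c) (h3 : t.v vJ = j) :
    (iniE x).eval t = iniAt I c j := by
  simp only [iniE, Expr.eval_mul, Expr.eval_v, Expr.eval_lt', Expr.eval_add, Expr.eval_sub,
    Expr.eval_zero, h1, h2, h3, iniAt]
  split <;> split <;> omega

theorem wp_dijAt {M : ℕ} {S : Scene} {G : Ar} {I lg c : ℕ} {s : St} (hE : Env M S G I lg)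
    (hB : Base M S G I s) (hG : Geo S I s) (hc : s.v vCc = c) (hcN : c < S.N) :
    wp M (dijFrom (iniE vCc) exE) s fun t k => k ≤ (2 * G.m + G.N + 1) * (lg * 80 + 700) ∧
      XSpec S I c (t.a aDist) (t.a aPrd) (t.a aHop) := by
  let ex : ℕ → ℕ := fun v => (1 - (I - s.a aPos v)) + (1 - ((v - c) + (c - v)))
  have hMN := hE.hN
  have hNp := hE.src
  have hN := hE.N
  refine wp_mono (wp_dijFrom hE hB (iniAt I c) ex ?_ ?_ (by simp [iniE, Expr.lt])
    (by simp [exE]) ?_) ?_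
  · intro v _; simp only [iniAt]; split <;> omega
  · intro v hv; simp only [ex]; omega
  · intro j hj t hv ha hJ
    have e1 : t.v vI = I := (hv _ (by decide)).trans hB.inf
    have e2 : t.v vCc = c := (hv _ (by decide)).trans hc
    refine ⟨eval_iniE e1 e2 hJ, ?_⟩
    simp [exE, ex, e1, e2, hJ, ha aPos (by decide) (by decide)]
  · rintro t k _ ⟨h1, h2⟩
    refine ⟨h1, hE.xSpec hcN (h2.congr (fun _ _ => rfl) fun v hv => ?_)⟩
    by_cases hP : S.OnP v
    · obtain ⟨b, hb, rfl⟩ := hP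
      have := hG.pos b hb
      have hLI := hE.LI
      simp only [ex, this, show S.OnP (S.p b) from ⟨b, hb, rfl⟩, not_true, false_or]
      omega
    · have := hG.pos' v (by omega) hP
      simp only [ex, this, hP, not_false_iff, true_or, iff_true]
      omega

/-! ### Centers -/

/-- The weight of the path to `c` through the `a`-th vertex of the path. -/
def viaW (S : Scene) (I : ℕ) (pos dist : ℕ → ℕ) (c a : ℕ) : ℕ :=
  -- The last summand is a penalty. Off the path the position of `c` is `I` and it vanishes; on the
  -- path it is at least `I` unless `a` is the position of `c`, so that a center on the path is
  -- entered only at itself.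
  S.d (S.p a) + dist (S.p a) + (I - pos c) * ((a - pos c) + (pos c - a)) * I

/-- The entries for the center `c`. -/
def CenOK (S : Scene) (I : ℕ) (pos : ℕ → ℕ) (c : ℕ) (cd cp cm ch : ℕ → ℕ) : Prop :=
  ∃ dist prd hop, XSpec S I c dist prd hop ∧ (∀ t < S.N, cd t = dist t ∧ cp t = prd t) ∧
    ∀ a < S.L, cm a = runMin I (viaW S I pos dist c) (a + 1) ∧
      ch a = runArg I (viaW S I pos dist c) (fun a => hop (S.p a)) (a + 1)

/-- If `c` is on the path, the penalty forces the minimizing index to be its position, and `c` is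
reached along the path. Otherwise the walk from `c` to `p a`, reversed, is a detour that reaches `c`
safely. The last vertex is the predecessor of `t`, except for `t = c`, where it is the first vertex
after `c` on the walk to `p a`. -/
theorem CenOK.out {S : Scene} {I c i t : ℕ} {pos cd cp cm ch : ℕ → ℕ}
    (h : CenOK S I pos c cd cp cm ch) (hpos : ∀ a < S.L, pos (S.p a) = a)
    (hpN : ∀ a < S.L, S.p a < S.N) (hLI : S.L ≤ I) (hi : i + 1 < S.L)
    (ht : t < S.N) (hoff : ¬ S.OnP t) (hlt : cm i + cd t < I) :
    S.Out i t (cm i + cd t) (if 0 < cd t then cp t else ch i) := by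
  obtain ⟨dist, prd, hop, hX, h1, h2⟩ := h
  obtain ⟨e1, e2⟩ := h1 t ht
  obtain ⟨e3, e4⟩ := h2 i (by omega)
  rw [e1, e3] at hlt
  rw [e1, e2, e3, e4]
  obtain ⟨a, ha, h3, h4⟩ := exists_runMin (fun a => hop (S.p a)) (show runMin I (viaW S I pos dist c) (i + 1) < I by omega)
  rw [← h3] at hlt ⊢
  rw [← h4]
  have ha' : a ≤ i := by omega
  have far : t ≠ c → ∀ {x}, S.Safe i c x → ¬ S.After i c → x + dist t ≤ viaW S I pos dist c a + dist t →
      S.Out i t (viaW S I pos dist c a + dist t) (if 0 < dist t then prd t else hop (S.p a)) := by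
    intro htc x hs hA hx
    rw [if_pos (hX.ne t ht htc)]
    obtain ⟨y, w, k1, k2, k3⟩ := hX.prd t ht htc (by omega)
    exact Scene.out_via hi hs hA k1 k2 hoff (by omega)
  by_cases hc : S.OnP c
  · obtain ⟨b, hb, rfl⟩ := hc
    have hab : a = b := by
      by_contra hne
      have : viaW S I pos dist (S.p b) a ≥ I := by
        unfold viaW
        rw [hpos b hb]
        have h5 : 1 ≤ (I - b) * ((a - b) + (b - a)) := Nat.mul_pos (by omega) (by omega)
        have := Nat.mul_le_mul_right I h5
        omega
      omega
    subst hab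
    refine far (by rintro rfl; exact hoff ⟨a, hb, rfl⟩) (Scene.safe_p hi ha')
      (Scene.not_after ha' (by omega)) ?_
    unfold viaW; omega
  · have hda : dist (S.p a) < I := by unfold viaW at hlt; omega
    have hac : S.p a ≠ c := by rintro rfl; exact hc ⟨a, by omega, rfl⟩
    by_cases htc : t = c
    · subst htc
      rw [hX.self, if_neg (by omega)]
      obtain ⟨y, w, k1, k2, k3⟩ := hX.hop (S.p a) (hpN a (by omega)) hac hda
      refine Scene.out_detour hi ha' (Scene.xwalk_reverse hc k2) (Scene.step_symm k1) hoff ?_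
      unfold viaW; omega
    · refine far htc (Scene.safe_of_xwalk hi ha' hc (hX.walk _ (hpN a (by omega)) hda))
        (Scene.not_after_of_not_onP hc) ?_
      unfold viaW; omega

/-- The two parts of a detour through `c` compete separately: the first, reversed, bounds the prefix
minimum at an index `a ≤ i`, the second bounds the distance from `c` to `t`. -/
theorem CenOK.le {S : Scene} {I c i a t y₁ y₂ : ℕ} {pos cd cp cm ch : ℕ → ℕ}
    (h : CenOK S I pos c cd cp cm ch) (hpos : ∀ a < S.L, pos (S.p a) = a) (hc : c < S.N)
    (hpos' : ∀ v < S.N, ¬ S.OnP v → pos v = I) (hi : i + 1 < S.L) (ha : a ≤ i) (ht : t < S.N)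
    (h1 : Wk S.DStep (S.p a) c y₁) (h2 : ¬ S.OnP c ∨ c = S.p a ∧ y₁ = 0) (h3 : Wk S.DStep c t y₂) :
    cm i + cd t ≤ S.d (S.p a) + y₁ + y₂ := by
  obtain ⟨dist, prd, hop, hX, k1, k2⟩ := h
  rw [(k1 t ht).1, (k2 i (by omega)).1]
  have l1 : dist t ≤ y₂ := hX.le (Scene.dwalk_xwalk h3).1
  have l2 := runMin_le_of_lt I (viaW S I pos dist c) (show a < i + 1 by omega)
  have l3 : viaW S I pos dist c a ≤ S.d (S.p a) + y₁ := by
    unfold viaW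
    rcases h2 with h2 | ⟨rfl, rfl⟩
    · rw [hpos' c hc h2]
      have := hX.le (Scene.dwalk_reverse h1)
      simpa using this
    · rw [hpos a (by omega), hX.self]; simp
  omega

def cenRow : Expr := .v vO * .v vN + .v vJ

def cenW : Expr := .g aD (.g aP (.v vJ)) + .g aDist (.g aP (.v vJ)) +
  (.v vI - .g aPos (.v vCc)) * ((.v vJ - .g aPos (.v vCc)) + (.g aPos (.v vCc) - .v vJ)) * .v vI

def cenMin : Cmd :=
  .set vMi (.v vI) ;; .set vAr 0 ;;
  .for_ vJ (.v vL)
    -- The running minimum starts at `I`, so capping the candidate changes nothing but keeps the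
    -- large penalty out of the stored words.
    (.set vCa (Expr.mn (.v vI) cenW) ;;
      .ite (.v vCa) (.v vMi) (.set vMi (.v vCa) ;; .set vAr (.g aHop (.g aP (.v vJ)))) .skip ;;
      .put aCm cenRow (.v vMi) ;; .put aCh cenRow (.v vAr))

theorem wp_cenMin {M : ℕ} {S : Scene} {G : Ar} {I lg c o : ℕ} {s : St} (hE : Env M S G I lg)
    (hB : Base M S G I s) (hG : Geo S I s) (hc : s.v vCc = c) (ho : s.v vO = o) :
    wp M cenMin s fun t k => k ≤ G.N * 200 + 50 ∧
      (∀ a < S.L, t.a aCm (o * S.N + a) = runMin I (viaW S I (s.a aPos) (s.a aDist) c) (a + 1) ∧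
        t.a aCh (o * S.N + a) = runArg I (viaW S I (s.a aPos) (s.a aDist) c)
          (fun a => s.a aHop (S.p a)) (a + 1)) ∧
      ∀ l < o * S.N, t.a aCm l = s.a aCm l ∧ t.a aCh l = s.a aCh l := by
  have hN := hE.N
  have hMI := hE.hI
  have hMN := hE.hN
  have hLN := hE.L_le
  set g := viaW S I (s.a aPos) (s.a aDist) c with hg
  set hp : ℕ → ℕ := fun a => s.a aHop (S.p a) with hhp
  unfold cenMin
  simp only [wp_seq, wp_set, Expr.eval_v, Expr.eval_zero, hB.inf]
  refine ⟨by omega, by omega, ?_⟩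
  refine wp_mono (wp_for S.L 150 (fun j t => t.v vMi = runMin I g j ∧ t.v vAr = runArg I g hp j ∧
    (∀ a < j, t.a aCm (o * S.N + a) = runMin I g (a + 1) ∧
      t.a aCh (o * S.N + a) = runArg I g hp (a + 1)) ∧
    ∀ l < o * S.N, t.a aCm l = s.a aCm l ∧ t.a aCh l = s.a aCh l) (by omega) (by decide) ?_ ?_ ?_) ?_
  · intro t ht
    rw [Expr.eval_v, ht.v _ (by decide)]; simp [hB.L]
  · simp [runMin, runArg]
  · rintro j hj t ht hJ ⟨h1, h2, h3, h4⟩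
    have tv : ∀ x ∈ [vN, vI, vCc, vO], t.v x = s.v x := by
      intro x hx
      rw [ht.v x (by revert x; decide)]
      simp only [List.mem_cons, List.not_mem_nil, or_false] at hx
      rcases hx with rfl | rfl | rfl | rfl <;> simp
    have ta : ∀ a ∈ [aPos, aP, aD, aDist, aHop], t.a a = s.a a := by
      intro a ha
      rw [ht.a a (by revert a; decide)]; simp
    have tB : Bd M t := ht.bd ((hB.bd.set (by omega) _).set (by omega) _)
    have eN : t.v vN = S.N := by rw [tv _ (by simp), hB.g.N, hN]
    have eI : t.v vI = I := by rw [tv _ (by simp), hB.inf]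
    have eC : t.v vCc = c := by rw [tv _ (by simp), hc]
    have eO : t.v vO = o := by rw [tv _ (by simp), ho]
    have eW : cenW.eval t = g j := by
      simp only [cenW, Expr.eval_add, Expr.eval_mul, Expr.eval_sub, Expr.eval_g, Expr.eval_v, hJ, eI,
        eC, ta aPos (by simp), ta aP (by simp), ta aD (by simp), ta aDist (by simp), hG.P j hj,
        hG.d _ (hE.p_lt hj), hg, viaW]
    have eH : Expr.eval (.g aHop (.g aP (.v vJ))) t = hp j := by
      simp only [Expr.eval_g, Expr.eval_v, hJ, ta aP (by simp), ta aHop (by simp), hG.P j hj, hhp]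
    have hle := runMin_le I g j
    have fin : ∀ r : St, r.a = t.a → r.v vN = S.N → r.v vO = o → r.v vJ = j → Bd M r →
        r.v vMi = runMin I g (j + 1) → r.v vAr = runArg I g hp (j + 1) →
        wp M (.put aCm cenRow (.v vMi) ;; .put aCh cenRow (.v vAr)) r fun u c => c ≤ 40 ∧
          ((u.set vJ (j + 1)).v vMi = runMin I g (j + 1) ∧ (u.set vJ (j + 1)).v vAr = runArg I g hp (j + 1) ∧
          (∀ a < j + 1, (u.set vJ (j + 1)).a aCm (o * S.N + a) = runMin I g (a + 1) ∧
            (u.set vJ (j + 1)).a aCh (o * S.N + a) = runArg I g hp (a + 1)) ∧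
          ∀ l < o * S.N, (u.set vJ (j + 1)).a aCm l = s.a aCm l ∧ (u.set vJ (j + 1)).a aCh l = s.a aCh l) := by
      intro r r1 r2 r3 r4 rB r5 r6
      simp only [wp_seq, wp_put, cenRow, Expr.eval_add, Expr.eval_mul, Expr.eval_v, r2, r3, r4, St.put_v, St.put_a,
        St.set_v, St.set_a, Nat.reduceEqDiff, if_true, if_false, r1]
      refine ⟨rB.v _, rB.v _, by simp, r5, r6, fun a ha => ?_, fun l hl => ?_⟩
      · rcases Nat.lt_succ_iff_lt_or_eq.1 ha with ha | rfl
        · rw [Function.update_of_ne (by omega), Function.update_of_ne (by omega)]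
          exact h3 a ha
        · simp [r5, r6]
      · rw [Function.update_of_ne (by omega), Function.update_of_ne (by omega)]
        exact h4 l hl
    rw [wp_seq, wp_set, Expr.eval_mn, eW, Expr.eval_v, eI, wp_seq, wp_ite]
    simp only [Expr.eval_v, St.set_v, if_true, Nat.reduceEqDiff, if_false, h1]
    refine ⟨by omega, fun hlt => ?_, fun hlt => ?_⟩
    · have hlt' : g j < runMin I g j := by omega
      rw [wp_seq, wp_set, wp_set]
      simp only [Expr.eval_v, St.set_v, if_true]
      refine ⟨by omega, ?_, ?_⟩
      · simp only [Expr.eval_g, Expr.eval_v, St.set_v, St.set_a, Nat.reduceEqDiff, if_false]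
        exact tB.a _ _
      · have e5 : Expr.eval (.g aHop (.g aP (.v vJ))) ((t.set vCa (min I (g j))).set vMi (min I (g j))) = hp j := by
          rw [← eH]; simp
        rw [e5]
        refine wp_mono (fin _ (by simp) (by simpa using eN) (by simpa using eO) (by simpa using hJ)
          (((tB.set (by omega) _).set (by omega) _).set ?_ _) ?_ ?_) ?_
        · rw [← eH]; simp only [Expr.eval_g]; exact tB.a _ _
        · simp [runMin]; omega
        · simp [runArg, hlt']
        · rintro u k _ ⟨l1, l2⟩
          refine ⟨?_, l2⟩
          simp [Expr.mn, cenW]; omega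
    · have hlt' : ¬ g j < runMin I g j := by omega
      rw [wp_skip]
      refine wp_mono (fin _ (by simp) (by simpa using eN) (by simpa using eO) (by simpa using hJ)
          (tB.set (by omega) _) ?_ ?_) ?_
      · simp [runMin, h1]; omega
      · simp [runArg, hlt', h2]
      · rintro u k _ ⟨l1, l2⟩
        refine ⟨?_, l2⟩
        simp [Expr.mn, cenW]; omega
  · rintro t k ht ⟨-, -, ⟨-, -, h3, h4⟩, h5⟩
    refine ⟨?_, h3, h4⟩
    simp only [Expr.cost_v, Expr.cost_zero] at *
    have := Nat.mul_le_mul_right (150 + 2 + 9) hLN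
    omega

end RAM

namespace RAM

theorem CenOK.congr {S : Scene} {I c : ℕ} {pos cd cp cm ch cd' cp' cm' ch' : ℕ → ℕ}
    (h : CenOK S I pos c cd cp cm ch) (h1 : ∀ t < S.N, cd' t = cd t) (h2 : ∀ t < S.N, cp' t = cp t)
    (h3 : ∀ a < S.L, cm' a = cm a) (h4 : ∀ a < S.L, ch' a = ch a) :
    CenOK S I pos c cd' cp' cm' ch' := by
  obtain ⟨dist, prd, hop, hX, k1, k2⟩ := h
  refine ⟨dist, prd, hop, hX, fun t ht => ?_, fun a ha => ?_⟩
  · rw [h1 t ht, h2 t ht]; exact k1 t ht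
  · rw [h3 a ha, h4 a ha]; exact k2 a ha

def centers : Cmd :=
  .for_ vO (.v vNc)
    (.set vCc (.g aC (.v vO)) ;; dijFrom (iniE vCc) exE ;;
      fill vJ vN aCd cenRow (.g aDist (.v vJ)) ;; fill vJ vN aCp cenRow (.g aPrd (.v vJ)) ;; cenMin)

theorem wp_centers {M nc : ℕ} {S : Scene} {G : Ar} {I lg : ℕ} {s : St} (hE : Env M S G I lg)
    (hB : Base M S G I s) (hG : Geo S I s) (hnc : s.v vNc = nc)
    (hC : ∀ j < nc, s.a aC j < S.N) :
    wp M centers s fun t k => k ≤ nc * ((2 * G.m + G.N + 1) * (lg * 80 + 1200)) + 10 ∧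
      ∀ j < nc, CenOK S I (s.a aPos) (s.a aC j) (fun v => t.a aCd (j * S.N + v))
        (fun v => t.a aCp (j * S.N + v)) (fun v => t.a aCm (j * S.N + v))
        (fun v => t.a aCh (j * S.N + v)) := by
  have hN := hE.N
  have hMN := hE.hN
  have hLN := hE.L_le
  have hNp := hE.src
  have hncM : nc < M := by have := hB.bd.v vNc; rwa [hnc] at this
  obtain ⟨b, hb⟩ : ∃ b, b = (2 * G.m + G.N + 1) * (lg * 80 + 700) + G.N * 300 + 150 := ⟨_, rfl⟩
  unfold centers
  refine wp_mono (wp_for nc b (fun j t =>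
    ∀ j' < j, CenOK S I (s.a aPos) (s.a aC j') (fun v => t.a aCd (j' * S.N + v))
        (fun v => t.a aCp (j' * S.N + v)) (fun v => t.a aCm (j' * S.N + v))
        (fun v => t.a aCh (j' * S.N + v))) hncM (by decide) ?_ ?_ ?_) ?_
  · intro t ht; rw [Expr.eval_v, ht.v _ (by decide), hnc]
  · intro j hj; omega
  · intro j hj t0 ht0 hJ hI
    have B0 := hB.fr ht0 (by decide) (by decide)
    have G0 := hG.fr ht0 (by decide)
    have C0 : t0.a aC = s.a aC := ht0.a _ (by decide)
    have P0 : t0.a aPos = s.a aPos := ht0.a _ (by decide)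
    obtain ⟨c, hc⟩ : ∃ c, c = s.a aC j := ⟨_, rfl⟩
    have hcN : c < S.N := hc ▸ hC j hj
    rw [wp_seq, wp_set]
    have e0 : Expr.eval (.g aC (.v vO)) t0 = c := by simp [hJ, C0, hc]
    rw [e0]
    refine ⟨by omega, ?_⟩
    generalize hr : t0.set vCc c = t
    have ht : Fr M (.set vCc (.c 0)) t0 t := by
      rw [← hr]
      exact ⟨fun x hx => by simp [Cmd.mv] at hx; simp [hx], fun _ _ => rfl, rfl,
        fun b => b.set (by omega) _⟩
    have Bt := B0.fr ht (by decide) (by decide)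
    have Gt := G0.fr ht (by decide)
    have tc : t.v vCc = c := by rw [← hr]; simp
    have tO : t.v vO = j := by rw [← hr]; simpa using hJ
    have at0 : t.a = t0.a := by rw [← hr]; rfl
    rw [wp_seq]
    refine wp_mono (wp_dijAt hE Bt Gt tc hcN) ?_
    rintro t1 k1 F1 ⟨l1, hX⟩
    have B1 := Bt.fr F1 (by decide) (by decide)
    have N1 : t1.v vN = S.N := by rw [B1.g.N, hN]
    have O1 : t1.v vO = j := (F1.v _ (by decide)).trans tO
    rw [wp_seq]
    refine wp_mono (wp_fill S.N (j * S.N) (t1.a aDist) N1 (by decide) (by omega) ?_) ?_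
    · intro v hv r hr hv' _ _
      simp only [cenRow, Expr.eval_add, Expr.eval_mul, Expr.eval_v, Expr.eval_g, hv',
        hr.v vO (by decide), hr.v vN (by decide), hr.a aDist (by decide), N1, O1, true_and]
      exact B1.bd.a _ _
    rintro t2 k2 F2 ⟨l2, c2, d2⟩
    have B2 := B1.fr F2 (by decide) (by decide)
    have N2 : t2.v vN = S.N := by rw [B2.g.N, hN]
    have O2 : t2.v vO = j := (F2.v _ (by decide)).trans O1
    rw [wp_seq]
    refine wp_mono (wp_fill S.N (j * S.N) (t2.a aPrd) N2 (by decide) (by omega) ?_) ?_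
    · intro v hv r hr hv' _ _
      simp only [cenRow, Expr.eval_add, Expr.eval_mul, Expr.eval_v, Expr.eval_g, hv',
        hr.v vO (by decide), hr.v vN (by decide), hr.a aPrd (by decide), N2, O2, true_and]
      exact B2.bd.a _ _
    rintro t3 k3 F3 ⟨l3, c3, d3⟩
    have B3 := B2.fr F3 (by decide) (by decide)
    have G3 := ((Gt.fr F1 (by decide)).fr F2 (by decide)).fr F3 (by decide)
    have O3 : t3.v vO = j := (F3.v _ (by decide)).trans O2
    have C3 : t3.v vCc = c := ((F3.v _ (by decide)).trans (F2.v _ (by decide))).trans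
      ((F1.v _ (by decide)).trans tc)
    refine wp_mono (wp_cenMin hE B3 G3 C3 O3) ?_
    rintro t4 k4 F4 ⟨l4, c4, d4⟩
    have pos3 : t3.a aPos = s.a aPos := by
      rw [F3.a _ (by decide), F2.a _ (by decide), F1.a _ (by decide), at0, P0]
    have dist3 : t3.a aDist = t1.a aDist := by rw [F3.a _ (by decide), F2.a _ (by decide)]
    have hop3 : t3.a aHop = t1.a aHop := by rw [F3.a _ (by decide), F2.a _ (by decide)]
    have cd4 : t4.a aCd = t2.a aCd := by rw [F4.a _ (by decide), F3.a _ (by decide)]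
    have cp4 : t4.a aCp = t3.a aCp := by rw [F4.a _ (by decide)]
    have prd2 : t2.a aPrd = t1.a aPrd := by rw [F2.a _ (by decide)]
    have cd1 : t1.a aCd = t0.a aCd := by rw [F1.a _ (by decide), at0]
    have cp2 : t2.a aCp = t0.a aCp := by rw [F2.a _ (by decide), F1.a _ (by decide), at0]
    have cm3 : t3.a aCm = t0.a aCm := by
      rw [F3.a _ (by decide), F2.a _ (by decide), F1.a _ (by decide), at0]
    have ch3 : t3.a aCh = t0.a aCh := by
      rw [F3.a _ (by decide), F2.a _ (by decide), F1.a _ (by decide), at0]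
    refine ⟨?_, fun j' hj' => ?_⟩
    · simp [cenRow] at l2 l3
      simp only [Expr.cost_g, Expr.cost_v]
      omega
    · simp only [St.set_a]
      rcases Nat.lt_succ_iff_lt_or_eq.1 hj' with hj' | rfl
      · have hrow : ∀ v < S.N, j' * S.N + v < j * S.N := fun v hv => row_lt le_rfl hj' hv
        refine (hI j' hj').congr (fun v hv => ?_) (fun v hv => ?_) (fun v hv => ?_) fun v hv => ?_
        · rw [cd4, d2 _ (.inl (hrow v hv)), cd1]
        · rw [cp4, d3 _ (.inl (hrow v hv)), cp2]
        · rw [(d4 _ (hrow v (by omega))).1, cm3]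
        · rw [(d4 _ (hrow v (by omega))).2, ch3]
      · rw [pos3, dist3, hop3] at c4
        rw [← hc]
        refine ⟨t1.a aDist, t1.a aPrd, t1.a aHop, hX, fun v hv => ⟨?_, ?_⟩, c4⟩
        · change t4.a aCd _ = _
          rw [cd4, c2 v hv]
        · change t4.a aCp _ = _
          rw [cp4, c3 v hv, prd2]
  · rintro t k _ ⟨-, -, h1, h2⟩
    refine ⟨h2.trans ?_, h1⟩
    simp only [Expr.cost_v]
    have e3 : (2 * G.m + G.N + 1) * (lg * 80 + 1200) = (2 * G.m + G.N + 1) * (lg * 80 + 700) +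
      (2 * G.m + G.N + 1) * 500 := by ring
    have : nc * (b + 2 + 9) ≤ nc * ((2 * G.m + G.N + 1) * (lg * 80 + 1200)) :=
      Nat.mul_le_mul_left _ (by omega)
    omega

/-! ### Pivots -/

/-- The entries for `t` after the first `k` pivots `β`. -/
structure PivOK (S : Scene) (I : ℕ) (β : ℕ → ℕ) (k t x u : ℕ) : Prop where
  le_I : x ≤ I
  ex : x < I → ∃ k' < k, ∃ y w, Wk (S.XStep (β k')) (β k') u y ∧ S.XStep (β k') u t w ∧
    S.d (β k') + y + w ≤ x
  le : ∀ k' < k, ∀ y, t ≠ β k' → Wk (S.XStep (β k')) (β k') t y → x ≤ S.d (β k') + y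

def pivRow (e : Expr) : Expr := e * .v vN + .v vJ

/-- The product with `I` disables a pivot as its own destination, where no predecessor exists.
Nothing is lost: an optimal path through the pivot has excess `0` there and belongs to the table of
short detours. -/
def pivW : Expr := .g aD (.v vCc) + .g aDist (.v vJ) + .v vI * (1 - .g aDist (.v vJ))

/-- Row `k` holds the best value over the first `k` pivots. As the pivots are sorted by the index
from which they can be reached without excess, the row for a failing edge is found by counting the
admissible pivots. -/
def pivots : Cmd :=
  fill vJ vN aBe (.v vJ) (.v vI) ;;
  .for_ vO (.v vNb)
    (.set vCc (.g aSB (.v vO)) ;; dijFrom (iniE vCc) exE ;;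
      fill vJ vN aBp (pivRow (.v vO + 1))
        (Expr.sel pivW (.g aBe (pivRow (.v vO))) (.g aPrd (.v vJ)) (.g aBp (pivRow (.v vO)))) ;;
      fill vJ vN aBe (pivRow (.v vO + 1)) (Expr.mn (.g aBe (pivRow (.v vO))) pivW))

theorem PivOK.step {S : Scene} {I k t x u x' u' : ℕ} {β dist prd hop : ℕ → ℕ}
    (h : PivOK S I β k t x u) (hX : XSpec S I (β k) dist prd hop) (ht : t < S.N)
    (hx : x' = min x (S.d (β k) + dist t + I * (1 - dist t)))
    (hu : u' = if S.d (β k) + dist t + I * (1 - dist t) < x then prd t else u) :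
    PivOK S I β (k + 1) t x' u' := by
  have h1 := h.le_I
  refine ⟨by omega, fun hlt => ?_, fun k' hk' y hne hw => ?_⟩
  · split at hu
    · next hc =>
      have h2 : dist t ≠ 0 := fun h => by rw [h] at hc; omega
      have h3 : t ≠ β k := by rintro rfl; exact h2 hX.self
      obtain ⟨y, w, k1, k2, k3⟩ := hX.prd t ht h3 (by omega)
      exact ⟨k, by omega, y, w, hu ▸ k1, hu ▸ k2, by omega⟩
    · next hc =>
      have hxx : x' = x := by omega
      obtain ⟨k', h2, y, w, h3, h4, h5⟩ := h.ex (by omega)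
      exact ⟨k', by omega, y, w, hu ▸ h3, hu ▸ h4, by omega⟩
  · rcases Nat.lt_succ_iff_lt_or_eq.1 hk' with hk' | rfl
    · have := h.le k' hk' y hne hw; omega
    · have h2 := hX.le hw
      have h3 := hX.ne t ht hne
      have : 1 - dist t = 0 := by omega
      rw [this] at hx; omega

theorem wp_pivots {M nb : ℕ} {S : Scene} {G : Ar} {I lg : ℕ} {s : St} (hE : Env M S G I lg)
    (hB : Base M S G I s) (hG : Geo S I s) (hnb : s.v vNb = nb)
    (hC : ∀ j < nb, s.a aSB j < S.N) :
    wp M pivots s fun t k => k ≤ (nb + 1) * ((2 * G.m + G.N + 1) * (lg * 80 + 1200)) ∧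
      ∀ j ≤ nb, ∀ v < S.N, PivOK S I (s.a aSB) j v (t.a aBe (j * S.N + v)) (t.a aBp (j * S.N + v)) := by
  have hN := hE.N
  have hMN := hE.hN
  have hMI := hE.hI
  have hNp := hE.src
  have hnbM : nb < M := by have := hB.bd.v vNb; rwa [hnb] at this
  obtain ⟨b, hb⟩ : ∃ b, b = (2 * G.m + G.N + 1) * (lg * 80 + 700) + G.N * 300 + 150 := ⟨_, rfl⟩
  unfold pivots
  rw [wp_seq]
  refine wp_mono (wp_fill S.N 0 (fun _ => I) (by rw [hB.g.N, hN]) (by decide) (by omega) ?_) ?_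
  · intro v hv r hr hv' _ _
    exact ⟨by simpa using hv', by rw [Expr.eval_v, hr.v vI (by decide), hB.inf], by omega⟩
  rintro si ki Fi ⟨li, ci, -⟩
  have Bi := hB.fr Fi (by decide) (by decide)
  have Gi := hG.fr Fi (by decide)
  refine wp_mono (wp_for nb b (fun j t => ∀ j' ≤ j, ∀ v < S.N,
    PivOK S I (s.a aSB) j' v (t.a aBe (j' * S.N + v)) (t.a aBp (j' * S.N + v)))
    hnbM (by decide) ?_ ?_ ?_) ?_
  · intro t ht; rw [Expr.eval_v, ht.v _ (by decide), Fi.v _ (by decide), hnb]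
  · intro j hj v hv
    obtain rfl : j = 0 := by omega
    have := ci v hv
    simp only [St.set_a, Nat.zero_mul, this]
    exact ⟨le_rfl, by omega, by omega⟩
  · intro j hj t0 ht0 hJ hI
    have B0 := Bi.fr ht0 (by decide) (by decide)
    have G0 := Gi.fr ht0 (by decide)
    have C0 : t0.a aSB = s.a aSB := (ht0.a _ (by decide)).trans (Fi.a _ (by decide))
    obtain ⟨c, hc⟩ : ∃ c, c = s.a aSB j := ⟨_, rfl⟩
    have hcN : c < S.N := hc ▸ hC j hj
    rw [wp_seq, wp_set]
    have e0 : Expr.eval (.g aSB (.v vO)) t0 = c := by simp [hJ, C0, hc]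
    rw [e0]
    refine ⟨by omega, ?_⟩
    generalize hr : t0.set vCc c = t
    have ht : Fr M (.set vCc (.c 0)) t0 t := by
      rw [← hr]
      exact ⟨fun x hx => by simp [Cmd.mv] at hx; simp [hx], fun _ _ => rfl, rfl,
        fun b => b.set (by omega) _⟩
    have Bt := B0.fr ht (by decide) (by decide)
    have Gt := G0.fr ht (by decide)
    have tc : t.v vCc = c := by rw [← hr]; simp
    have tO : t.v vO = j := by rw [← hr]; simpa using hJ
    have at0 : t.a = t0.a := by rw [← hr]; rfl
    rw [wp_seq]
    refine wp_mono (wp_dijAt hE Bt Gt tc hcN) ?_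
    rintro t1 k1 F1 ⟨l1, hX⟩
    have B1 := Bt.fr F1 (by decide) (by decide)
    have G1 := Gt.fr F1 (by decide)
    have N1 : t1.v vN = S.N := by rw [B1.g.N, hN]
    have O1 : t1.v vO = j := (F1.v _ (by decide)).trans tO
    have C1 : t1.v vCc = c := (F1.v _ (by decide)).trans tc
    obtain ⟨W, hW⟩ : ∃ W : ℕ → ℕ, W = fun v => S.d c + t1.a aDist v + I * (1 - t1.a aDist v) := ⟨_, rfl⟩
    have eW : ∀ r : St, ∀ v < S.N, r.v vCc = c → r.v vJ = v → r.v vI = I → r.a aD = t1.a aD →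
        r.a aDist = t1.a aDist → pivW.eval r = W v := by
      intro r v hv h1 h2 h3 h4 h5
      simp only [pivW, Expr.eval_add, Expr.eval_mul, Expr.eval_sub, Expr.eval_g, Expr.eval_v,
        Expr.eval_one, h1, h2, h3, h4, h5, G1.d c hcN, hW]
    have hrow : ∀ v < S.N, j * S.N + v < (j + 1) * S.N := fun v hv => by rw [Nat.add_mul]; omega
    rw [wp_seq]
    refine wp_mono (wp_fill S.N ((j + 1) * S.N) (fun v => if W v < t0.a aBe (j * S.N + v) then
      t1.a aPrd v else t0.a aBp (j * S.N + v)) N1 (by decide) (by omega) ?_) ?_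
    · intro v hv r hr hv' hun _
      have e3 := eW r v hv ((hr.v _ (by decide)).trans C1) hv' ((hr.v _ (by decide)).trans B1.inf)
        (hr.a _ (by decide)) (hr.a _ (by decide))
      have e4 : r.a aBe = t0.a aBe := by rw [hr.a _ (by decide), F1.a _ (by decide), at0]
      have e5 : t1.a aBp = t0.a aBp := by rw [F1.a _ (by decide), at0]
      simp only [pivRow, Expr.eval_sel, e3, Expr.eval_add, Expr.eval_mul, Expr.eval_v, Expr.eval_g,
        Expr.eval_one, hv', hr.v vO (by decide), hr.v vN (by decide), hr.a aPrd (by decide), N1, O1, e4,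
        hun _ (.inl (hrow v hv)), e5, true_and]
      split
      · exact B1.bd.a _ _
      · exact B0.bd.a _ _
    rintro t2 k2 F2 ⟨l2, c2, d2⟩
    have B2 := B1.fr F2 (by decide) (by decide)
    have N2 : t2.v vN = S.N := by rw [B2.g.N, hN]
    have O2 : t2.v vO = j := (F2.v _ (by decide)).trans O1
    have C2 : t2.v vCc = c := (F2.v _ (by decide)).trans C1
    have e6 : t2.a aBe = t0.a aBe := by rw [F2.a _ (by decide), F1.a _ (by decide), at0]
    refine wp_mono (wp_fill S.N ((j + 1) * S.N) (fun v => min (t0.a aBe (j * S.N + v)) (W v)) N2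
      (by decide) (by omega) ?_) ?_
    · intro v hv r hr hv' hun _
      have e3 := eW r v hv ((hr.v _ (by decide)).trans C2) hv' ((hr.v _ (by decide)).trans B2.inf)
        ((hr.a _ (by decide)).trans (F2.a _ (by decide)))
        ((hr.a _ (by decide)).trans (F2.a _ (by decide)))
      simp only [pivRow, Expr.eval_mn, e3, Expr.eval_add, Expr.eval_mul, Expr.eval_v, Expr.eval_g,
        Expr.eval_one, hv', hr.v vO (by decide), hr.v vN (by decide), N2, O2,
        hun _ (.inl (hrow v hv)), e6, true_and]
      have := B0.bd.a aBe (j * S.N + v); omega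
    rintro t3 k3 F3 ⟨l3, c3, d3⟩
    have bp3 : t3.a aBp = t2.a aBp := F3.a _ (by decide)
    have bp1 : t1.a aBp = t0.a aBp := by rw [F1.a _ (by decide), at0]
    refine ⟨?_, fun j' hj' v hv => ?_⟩
    · simp [pivRow, pivW, Expr.sel, Expr.lt, Expr.mn] at l2 l3
      simp only [Expr.cost_g, Expr.cost_v]
      omega
    · simp only [St.set_a, bp3]
      rcases Nat.le_succ_iff_eq_or_le.1 hj' with rfl | hj'
      · rw [c3 v hv, c2 v hv]
        have hc' : S.d c = S.d (s.a aSB j) := by rw [hc]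
        refine (hI j le_rfl v hv).step (hc ▸ hX) hv ?_ ?_
        · rw [hW, ← hc]
        · rw [hW, ← hc]
      · have h1 : j' * S.N + v < (j + 1) * S.N := row_lt le_rfl (by omega) hv
        rw [d3 _ (.inl h1), d2 _ (.inl h1), e6, bp1]
        exact hI j' hj' v hv
  · rintro t k _ ⟨-, -, h1, h2⟩
    refine ⟨?_, h1⟩
    simp only [Expr.cost_v] at *
    have e3 : (2 * G.m + G.N + 1) * (lg * 80 + 1200) = (2 * G.m + G.N + 1) * (lg * 80 + 700) +
      (2 * G.m + G.N + 1) * 500 := by ring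
    have : nb * (b + 2 + 9) ≤ nb * ((2 * G.m + G.N + 1) * (lg * 80 + 1200)) :=
      Nat.mul_le_mul_left _ (by omega)
    rw [Nat.add_mul]
    omega

end RAM

namespace RAM

/-! ### Distances from the source and from the path -/

notation "vNB" => (44 : ℕ)

def distP : Cmd :=
  dijFrom (iniE vSrc) 1 ;; fill vJ vN aD (.v vJ) (.g aDist (.v vJ)) ;;
  fill vJ vN aOd (.v vJ) (.g aOrd (.v vJ))

theorem wp_distP {M : ℕ} {S : Scene} {G : Ar} {I lg : ℕ} {s : St} (hE : Env M S G I lg)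
    (hB : Base M S G I s) (h1 : ∀ a < S.L, s.a aPos (S.p a) = a)
    (h2 : ∀ v < S.N, ¬ S.OnP v → s.a aPos v = I) (h3 : ∀ a < S.L, s.a aP a = S.p a) :
    wp M distP s fun t k => k ≤ (2 * G.m + G.N + 1) * (lg * 80 + 800) ∧ Geo S I t := by
  have hN := hE.N
  have hMN := hE.hN
  have hNp := hE.src
  unfold distP
  rw [wp_seq]
  refine wp_mono (wp_dijFrom hE hB (iniAt I (S.p 0)) (fun _ => 1) ?_ ?_ (by simp [iniE, Expr.lt])
    (by simp) ?_) ?_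
  · intro v _; simp only [iniAt]; split <;> omega
  · intro v hv; omega
  · intro j hj t hv ha hJ
    exact ⟨eval_iniE ((hv _ (by decide)).trans hB.inf) ((hv _ (by decide)).trans hB.src) hJ, rfl⟩
  rintro t k F ⟨l1, hD⟩
  have hD := hD.congr (X' := fun _ => True) (fun _ _ => rfl) (by simp)
  have Bt := hB.fr F (by decide) (by decide)
  rw [wp_seq]
  refine wp_mono (wp_fill S.N 0 (t.a aDist) (by rw [Bt.g.N, hN]) (by decide) (by omega) ?_) ?_
  · intro v hv r hr hv' _ _
    exact ⟨by simpa using hv', by rw [Expr.eval_g, Expr.eval_v, hv', hr.a _ (by decide)],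
      Bt.bd.a _ _⟩
  rintro t1 k1 F1 ⟨l2, c1, -⟩
  have B1 := Bt.fr F1 (by decide) (by decide)
  refine wp_mono (wp_fill S.N 0 (t1.a aOrd) (by rw [B1.g.N, hN]) (by decide) (by omega) ?_) ?_
  · intro v hv r hr hv' _ _
    exact ⟨by simpa using hv', by rw [Expr.eval_g, Expr.eval_v, hv', hr.a _ (by decide)],
      B1.bd.a _ _⟩
  rintro t2 k2 F2 ⟨l3, c2, -⟩
  simp only [Nat.zero_add] at c1 c2
  have eO : t1.a aOrd = t.a aOrd := F1.a _ (by decide)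
  have eP : ∀ a ∈ [aPos, aP], t2.a a = s.a a := by
    intro a ha
    simp only [List.mem_cons, List.not_mem_nil, or_false] at ha
    rcases ha with rfl | rfl <;>
      rw [F2.a _ (by decide), F1.a _ (by decide), F.a _ (by decide)]
  have eD : ∀ v < S.N, t2.a aD v = S.d v := fun v hv => by
    rw [F2.a _ (by decide), c1 v hv, hE.dist_eq hD hv]
  have hmem : ∀ v < S.N, ∃ j < t.v vCnt, t.a aOrd j = v := fun v hv =>
    hD.mem v (by omega) (by rw [hE.dist_eq hD hv]; exact hE.d v hv)
  -- Every vertex is reachable from the source, so the order of settling lists all vertices and can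
  -- serve as the order of the dynamic program.
  have hcnt : t.v vCnt = S.N := by
    refine le_antisymm (hN ▸ hD.cnt_le) ?_
    have : Finset.range S.N ⊆ (Finset.range (t.v vCnt)).image (t.a aOrd) := by
      intro v hv
      obtain ⟨j, h4, h5⟩ := hmem v (by simpa using hv)
      exact Finset.mem_image.2 ⟨j, by simpa using h4, h5⟩
    simpa using (Finset.card_le_card this).trans Finset.card_image_le
  have eo : ∀ j < S.N, t2.a aOd j = t.a aOrd j := fun j hj => by rw [c2 j hj, eO]
  rw [hcnt] at hmem
  refine ⟨?_, ?_, ?_, ?_, eD, ?_, ?_, ?_, ?_⟩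
  · simp at l2 l3
    have e3 : (2 * G.m + G.N + 1) * (lg * 80 + 800) = (2 * G.m + G.N + 1) * (lg * 80 + 700) +
      (2 * G.m + G.N + 1) * 100 := by ring
    omega
  · rw [eP _ (by simp)]; exact h1
  · rw [eP _ (by simp)]; exact h2
  · rw [eP _ (by simp)]; exact h3
  · intro j hj; rw [eo j hj, ← hN]; exact hD.ord_lt j (by omega)
  · intro v hv
    obtain ⟨j, h4, h5⟩ := hmem v hv
    exact ⟨j, h4, (eo j h4).trans h5⟩
  · intro j hj j' hj' e
    rw [eo j hj, eo j' hj'] at e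
    exact hD.inj j (by omega) j' (by omega) e
  · intro j j' h4 h5
    rw [eo j (by omega), eo j' h5, ← hE.dist_eq hD (by rw [← hN]; exact hD.ord_lt j (by omega)),
      ← hE.dist_eq hD (by rw [← hN]; exact hD.ord_lt j' (by omega))]
    exact hD.mono j j' h4 (by omega)

def qP : Cmd :=
  dijFrom (Expr.sel (.g aPos (.v vJ)) (.v vI) 0 (.v vI)) 1 ;;
  fill vJ vN aQ (.v vJ) (.g aDist (.v vJ))

theorem QSpec.congr {S : Scene} {q q' : ℕ → ℕ} (h : QSpec S q) (hp : ∀ a < S.L, S.p a < S.N)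
    (e : ∀ v < S.N, q' v = q v) : QSpec S q' := by
  refine ⟨fun a ha => ?_, fun {u v w κ} hE => ?_, fun v hv => ?_⟩
  · rw [e _ (hp a ha)]; exact h.zero a ha
  · rw [e _ (S.lt hE).1, e _ (S.lt hE).2]; exact h.le hE
  · rw [e v hv]; exact h.ex v hv

theorem wp_qP {M : ℕ} {S : Scene} {G : Ar} {I lg : ℕ} {s : St} (hE : Env M S G I lg)
    (hB : Base M S G I s) (hG : Geo S I s) :
    wp M qP s fun t k => k ≤ (2 * G.m + G.N + 1) * (lg * 80 + 800) ∧ QSpec S (t.a aQ) := by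
  have hN := hE.N
  have hMN := hE.hN
  have hMI := hE.hI
  have hNp := hE.src
  unfold qP
  rw [wp_seq]
  refine wp_mono (wp_dijFrom hE hB (fun v => if s.a aPos v < I then 0 else I) (fun _ => 1) ?_ ?_
    (by simp [Expr.sel, Expr.lt]) (by simp) ?_) ?_
  · intro v _; split <;> omega
  · intro v hv; omega
  · intro j hj t hv ha hJ
    refine ⟨?_, rfl⟩
    simp [hJ, ha aPos (by decide) (by decide), (hv vI (by decide)).trans hB.inf]
  rintro t k F ⟨l1, hD⟩
  have hD := hD.congr (X' := fun _ => True) (fun _ _ => rfl) (by simp)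
  have Bt := hB.fr F (by decide) (by decide)
  have hQ := hE.qSpec (fun a ha => by
      have := hE.LI
      simp only [hG.pos a ha, show a < I by omega, if_true])
    (fun v hv hP => by simp [hG.pos' v hv hP]) hD
  refine wp_mono (wp_fill S.N 0 (t.a aDist) (by rw [Bt.g.N, hN]) (by decide) (by omega) ?_) ?_
  · intro v hv r hr hv' _ _
    exact ⟨by simpa using hv', by rw [Expr.eval_g, Expr.eval_v, hv', hr.a _ (by decide)],
      Bt.bd.a _ _⟩
  rintro t1 k1 F1 ⟨l2, c1, -⟩
  simp only [Nat.zero_add] at c1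
  refine ⟨?_, hQ.congr (fun a ha => hE.p_lt ha) c1⟩
  simp at l2
  have e3 : (2 * G.m + G.N + 1) * (lg * 80 + 800) = (2 * G.m + G.N + 1) * (lg * 80 + 700) +
    (2 * G.m + G.N + 1) * 100 := by ring
  omega

/-! ### The choice of the pivots -/

/-- Linear search for the square root, rounded up. The factor `4` is the one from `Scene.no_jump`.
-/
def rhoP : Cmd :=
  .set vRho 0 ;; .whl (.v vRho * .v vRho) (.v vN) (.set vRho (.v vRho + 1)) ;;
  .set vK (.c 4 * .v vRho)

theorem wp_rhoP {M N : ℕ} {s : St} (hN : s.v vN = N) (h1 : 0 < N) (hM : 4 * N + 4 < M) :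
    wp M rhoP s fun t k => k ≤ N * 20 + 40 ∧ 1 ≤ t.v vRho ∧ N ≤ t.v vRho * t.v vRho ∧
      (t.v vRho - 1) * (t.v vRho - 1) < N ∧ t.v vK = 4 * t.v vRho ∧ t.v vRho ≤ N := by
  unfold rhoP
  simp only [wp_seq, wp_set, Expr.eval_zero]
  refine ⟨by omega, ?_⟩
  refine wp_mono (wp_whl (k := N * 20) (fun t k => t.v vN = N ∧ t.v vRho ≤ N ∧
    (t.v vRho - 1) * (t.v vRho - 1) < N ∧ k = (N - t.v vRho) * 20) ?_ ?_) ?_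
  · simp [hN, h1]
  · rintro t k ht ⟨e1, e2, e3, rfl⟩ hlt
    simp only [Expr.eval_mul, Expr.eval_v, e1] at hlt
    have h4 : t.v vRho < N := by
      by_contra h
      have : t.v vRho = N := by omega
      rw [this] at hlt
      have := Nat.mul_le_mul_left N (show 1 ≤ N from h1); omega
    rw [wp_set]
    simp only [Expr.eval_add, Expr.eval_v, Expr.eval_one, St.set_v, if_true, Nat.reduceEqDiff, if_false,
      Nat.add_sub_cancel]
    refine ⟨by omega, _, ⟨e1, by omega, hlt, rfl⟩, ?_⟩
    simp; omega
  · rintro t k ht ⟨-, h2, k', ⟨e1, e2, e3, rfl⟩, h5⟩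
    simp only [Expr.eval_mul, Expr.eval_v, e1, not_lt] at h2
    simp only [Expr.eval_mul, Expr.eval_c, Expr.eval_v, St.set_v, if_true, Nat.reduceEqDiff, if_false]
    refine ⟨by omega, ?_, ?_, h2, e3, trivial, e2⟩
    · simp at h5 ⊢; omega
    · by_contra h
      have : t.v vRho = 0 := by omega
      rw [this] at h2; omega

/-- The number of `v < n` with `q v = l`. -/
def cntq (q : ℕ → ℕ) (l n : ℕ) : ℕ := ∑ v ∈ Finset.range n, if q v = l then 1 else 0

theorem cntq_le (q : ℕ → ℕ) (l n : ℕ) : cntq q l n ≤ n := by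
  calc cntq q l n ≤ ∑ v ∈ Finset.range n, 1 := Finset.sum_le_sum fun v _ => by split <;> omega
    _ = n := by simp

/-- Each vertex has only one distance from the path, so it is counted at most once. -/
theorem sum_cntq_le (q : ℕ → ℕ) (r n : ℕ) : ∑ l ∈ Finset.range r, cntq q (l + 1) n ≤ n := by
  unfold cntq
  rw [Finset.sum_comm]
  calc _ ≤ ∑ v ∈ Finset.range n, 1 := Finset.sum_le_sum fun v _ => ?_
    _ = n := by simp
  rw [Finset.sum_ite, Finset.sum_const, Finset.sum_const_zero, add_zero, smul_eq_mul, mul_one]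
  refine Finset.card_le_one.2 fun a ha b hb => ?_
  simp only [Finset.mem_filter] at ha hb
  omega

def lamP : Cmd :=
  .for_ vJ (.v vN) (.put aCt (.g aQ (.v vJ)) (.g aCt (.g aQ (.v vJ)) + 1)) ;;
  .set vLam 1 ;;
  .for_ vJ (.v vRho) (.ite (.g aCt (.v vJ + 1)) (.g aCt (.v vLam)) (.set vLam (.v vJ + 1)) .skip)

/-- Pigeonhole: the `ρ` classes at distances `1, …, ρ` have together at most `N ≤ ρ * ρ` vertices,
so the smallest class has at most `ρ`. -/
theorem wp_lamP {M N ρ : ℕ} {s : St} (hN : s.v vN = N) (hρ : s.v vRho = ρ) (h1 : 1 ≤ ρ)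
    (hNρ : N ≤ ρ * ρ) (hρN : ρ ≤ N) (hM : N + 2 < M) (h0 : ∀ l, s.a aCt l = 0) :
    wp M lamP s fun t k => k ≤ N * 200 + 50 ∧ 1 ≤ t.v vLam ∧ t.v vLam ≤ ρ ∧
      cntq (s.a aQ) (t.v vLam) N ≤ ρ := by
  unfold lamP
  rw [wp_seq]
  refine wp_mono (wp_for N 60 (fun j t => ∀ l, t.a aCt l = cntq (s.a aQ) l j) (by omega)
    (by decide) ?_ ?_ ?_) ?_
  · intro t ht; rw [Expr.eval_v, ht.v _ (by decide), hN]
  · intro l; simp [h0, cntq]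
  · intro j hj t ht hJ hI
    have e1 : t.a aQ = s.a aQ := ht.a _ (by decide)
    have := cntq_le (s.a aQ) (s.a aQ j) j
    simp only [wp_put, Expr.eval_add, Expr.eval_g, Expr.eval_v, Expr.eval_one, hJ, e1, hI]
    refine ⟨by omega, by simp, fun l => ?_⟩
    simp only [St.set_a, St.put_a, if_true, Function.update_apply]
    have hs : cntq (s.a aQ) l (j + 1) = cntq (s.a aQ) l j + if s.a aQ j = l then 1 else 0 := by
      rw [cntq, Finset.sum_range_succ, ← cntq]
    rw [hs]
    by_cases hl : l = s.a aQ j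
    · simp [hl]
    · simp [hl, hI, Ne.symm hl]
  rintro t k F ⟨-, -, hI, hk⟩
  have tρ : t.v vRho = ρ := by rw [F.v _ (by decide), hρ]
  rw [wp_seq, wp_set]
  refine ⟨by simp; omega, ?_⟩
  refine wp_mono (wp_for ρ 60 (fun j r => 1 ≤ r.v vLam ∧ r.v vLam ≤ ρ ∧
    ∀ l < j, cntq (s.a aQ) (r.v vLam) N ≤ cntq (s.a aQ) (l + 1) N) (by omega) (by decide) ?_ ?_ ?_) ?_
  · intro r hr; rw [Expr.eval_v, hr.v _ (by decide)]; simp [tρ]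
  · simp [h1]
  · rintro j hj r hr hJ ⟨k1, k2, k3⟩
    have e1 : r.a aCt = t.a aCt := by rw [hr.a _ (by decide)]; simp
    simp only [wp_ite, wp_set, wp_skip, Expr.eval_add, Expr.eval_g, Expr.eval_v, Expr.eval_one, hJ, e1, hI]
    refine ⟨fun hlt => ⟨by omega, by simp, ?_⟩, fun hlt => ⟨by simp, ?_⟩⟩
    · simp only [St.set_v, if_true, Nat.reduceEqDiff, if_false]
      refine ⟨by omega, by omega, fun l hl => ?_⟩
      rcases Nat.lt_succ_iff_lt_or_eq.1 hl with hl | rfl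
      · have := k3 l hl; omega
      · rfl
    · simp only [St.set_v, Nat.reduceEqDiff, if_false]
      refine ⟨k1, k2, fun l hl => ?_⟩
      rcases Nat.lt_succ_iff_lt_or_eq.1 hl with hl | rfl
      · exact k3 l hl
      · omega
  · rintro r k' _ ⟨-, -, ⟨k1, k2, k3⟩, k4⟩
    refine ⟨by simp at hk k4 ⊢; omega, k1, k2, ?_⟩
    by_contra hlt
    have h2 : ∑ l ∈ Finset.range ρ, (ρ + 1) ≤ ∑ l ∈ Finset.range ρ, cntq (s.a aQ) (l + 1) N :=
      Finset.sum_le_sum fun l hl => by have := k3 l (by simpa using hl); omega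
    have h3 := sum_cntq_le (s.a aQ) ρ N
    rw [Finset.sum_const, Finset.card_range, smul_eq_mul, Nat.mul_add] at h2
    omega

def eqE (e f : Expr) : Expr := 1 - ((e - f) + (f - e))

@[simp] theorem eval_eqE (e f : Expr) (s : St) :
    (eqE e f).eval s = if e.eval s = f.eval s then 1 else 0 := by
  simp only [eqE, Expr.eval_sub, Expr.eval_add, Expr.eval_one]; split <;> omega

/-- The candidate is always written to the next free slot; the counter advances only if it is to be
kept. -/
def pickP : Cmd :=
  .set vNB 0 ;; .for_ vJ (.v vN) (.put aBl (.v vNB) (.v vJ) ;;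
    .set vNB (.v vNB + eqE (.g aQ (.v vJ)) (.v vLam)))

theorem wp_pickP {M N l : ℕ} {s : St} (hN : s.v vN = N) (hl : s.v vLam = l) (hM : N + 2 < M) :
    wp M pickP s fun t k => k ≤ N * 100 + 50 ∧ t.v vNB = cntq (s.a aQ) l N ∧
      (∀ j < t.v vNB, t.a aBl j < N ∧ s.a aQ (t.a aBl j) = l) ∧
      ∀ v < N, s.a aQ v = l → ∃ j < t.v vNB, t.a aBl j = v := by
  unfold pickP
  rw [wp_seq, wp_set]
  refine ⟨by simp; omega, ?_⟩
  refine wp_mono (wp_for N 60 (fun i t => t.v vNB = cntq (s.a aQ) l i ∧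
      (∀ j < t.v vNB, t.a aBl j < N ∧ s.a aQ (t.a aBl j) = l) ∧
      ∀ v < i, s.a aQ v = l → ∃ j < t.v vNB, t.a aBl j = v) (by omega) (by decide) ?_ ?_ ?_) ?_
  · intro t ht; rw [Expr.eval_v, ht.v _ (by decide)]; simp [hN]
  · simp [cntq]
  · rintro i hi t ht hJ ⟨h1, h2, h3⟩
    have e1 : t.a aQ = s.a aQ := by rw [ht.a _ (by decide)]; simp
    have e2 : t.v vLam = l := by rw [ht.v _ (by decide)]; simp [hl]
    have h4 := cntq_le (s.a aQ) l i
    have h5 : cntq (s.a aQ) l (i + 1) = cntq (s.a aQ) l i + if s.a aQ i = l then 1 else 0 := by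
      rw [cntq, Finset.sum_range_succ, ← cntq]
    simp only [wp_seq, wp_put, wp_set, Expr.eval_add, Expr.eval_g, Expr.eval_v, eval_eqE, hJ, e1, e2,
      St.put_v, St.put_a, St.set_v, St.set_a, if_true, Nat.reduceEqDiff, if_false, ← h1] at h5 ⊢
    rw [h5]
    refine ⟨by omega, by split <;> omega, by simp [eqE], rfl, fun j hj => ?_, fun v hv hq => ?_⟩
    · rw [Function.update_apply]
      split
      · next he => exact ⟨hi, by subst he; by_contra hne; simp [hne] at hj⟩
      · next he => exact h2 j (by split at hj <;> omega)
    · rcases Nat.lt_succ_iff_lt_or_eq.1 hv with hv | rfl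
      · obtain ⟨j, h6, h7⟩ := h3 v hv hq
        exact ⟨j, by omega, by rw [Function.update_of_ne (by omega)]; exact h7⟩
      · exact ⟨t.v vNB, by simp [hq], by simp⟩
  · rintro t k _ ⟨-, -, ⟨h1, h2, h3⟩, h4⟩
    exact ⟨by simp at h4 ⊢; omega, h1, h2, h3⟩

/-- One pass over the candidates for each path index, about `L * ρ` steps, which is within the
budget. Candidates without an unweighted excess-free detour have key `I` and are never taken. -/
def sortP : Cmd :=
  .set vNb 0 ;;
  .for_ vO (.v vL) (
    .for_ vJ (.v vNB) (.put aSB (.v vNb) (.g aBl (.v vJ)) ;;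
      .set vNb (.v vNb + eqE (.g aA (.g aBl (.v vJ))) (.v vO))) ;;
    .put aKc (.v vO) (.v vNb))

/-- The first `nb` entries of `sB` are the entries of `bl` whose key is below `a`, in order, and
`kc i` of them have a key of at most `i`. -/
structure Sorted (key bl : ℕ → ℕ) (n a nb : ℕ) (sB kc : ℕ → ℕ) : Prop where
  mem : ∀ k < nb, ∃ j < n, sB k = bl j ∧ key (bl j) < a
  ex : ∀ j < n, key (bl j) < a → ∃ k < nb, sB k = bl j
  kc_le : ∀ i < a, kc i ≤ nb
  key_le : ∀ i < a, ∀ k < kc i, key (sB k) ≤ i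
  kc_ex : ∀ i < a, ∀ j < n, key (bl j) ≤ i → ∃ k < kc i, sB k = bl j

theorem wp_sortP {M n L : ℕ} {s : St} (hL : s.v vL = L) (hn : s.v vNB = n) (hB : Bd M s)
    (hM : 2 * n + 2 < M) :
    wp M sortP s fun t k => k ≤ L * (n * 100 + 100) + 50 ∧ t.v vNb ≤ n ∧
      Sorted (s.a aA) (s.a aBl) n L (t.v vNb) (t.a aSB) (t.a aKc) := by
  have hLM : L < M := by have := hB.v vL; rwa [hL] at this
  let key : ℕ → ℕ := fun j => s.a aA (s.a aBl j)
  have sle : ∀ (f : ℕ → Prop) [DecidablePred f] (j : ℕ),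
      ∑ i ∈ Finset.range j, (if f i then 1 else 0) ≤ j := by
    intro f _ j
    calc _ ≤ ∑ i ∈ Finset.range j, 1 := Finset.sum_le_sum fun v _ => by split <;> omega
      _ = j := by simp
  have step : ∀ a, ∑ i ∈ Finset.range n, (if key i < a + 1 then 1 else 0) =
      ∑ i ∈ Finset.range n, (if key i < a then 1 else 0) +
      ∑ i ∈ Finset.range n, (if key i = a then 1 else 0) := by
    intro a
    rw [← Finset.sum_add_distrib]
    refine Finset.sum_congr rfl fun i _ => ?_
    rcases lt_trichotomy (key i) a with h | h | h
    · rw [if_pos (by omega), if_pos h, if_neg (by omega)]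
    · rw [if_pos (by omega), if_neg (by omega), if_pos h]
    · rw [if_neg (by omega), if_neg (by omega), if_neg (by omega)]
  unfold sortP
  rw [wp_seq, wp_set]
  refine ⟨by simp; omega, ?_⟩
  have hB' := hB.set (show Expr.eval 0 s < M by simp; omega) vNb
  refine wp_mono (wp_for L (n * 80 + 50) (fun a t =>
      t.v vNb = ∑ i ∈ Finset.range n, (if key i < a then 1 else 0) ∧
      Sorted (s.a aA) (s.a aBl) n a (t.v vNb) (t.a aSB) (t.a aKc)) hLM (by decide) ?_ ?_ ?_) ?_
  · intro t ht; rw [Expr.eval_v, ht.v _ (by decide)]; simp [hL]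
  · refine ⟨by simp, ?_⟩
    constructor <;> simp
  · rintro a ha t ht hO ⟨h1, hS⟩
    have Bt := ht.bd hB'
    have tA : t.a aA = s.a aA := by rw [ht.a _ (by decide)]; simp
    have tBl : t.a aBl = s.a aBl := by rw [ht.a _ (by decide)]; simp
    have tn : t.v vNB = n := by rw [ht.v _ (by decide)]; simp [hn]
    rw [wp_seq]
    refine wp_mono (wp_for n 60 (fun j r =>
      r.v vNb = t.v vNb + ∑ i ∈ Finset.range j, (if key i = a then 1 else 0) ∧
      (∀ k < t.v vNb, r.a aSB k = t.a aSB k) ∧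
      (∀ k < r.v vNb, ∃ j < n, r.a aSB k = s.a aBl j ∧ key j ≤ a) ∧
      ∀ j' < j, key j' = a → ∃ k < r.v vNb, r.a aSB k = s.a aBl j') (by omega) (by decide) ?_ ?_ ?_) ?_
    · intro r hr; rw [Expr.eval_v, hr.v _ (by decide), tn]
    · refine ⟨by simp, by simp, ?_, by simp⟩
      intro k hk
      obtain ⟨j, hj, e, hlt⟩ := hS.mem k hk
      exact ⟨j, hj, e, hlt.le⟩
    · rintro j hj r hr hJ ⟨k1, k2, k3, k4⟩
      have rA : r.a aA = s.a aA := by rw [hr.a _ (by decide), tA]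
      have rBl : r.a aBl = s.a aBl := by rw [hr.a _ (by decide), tBl]
      have rO : r.v vO = a := by rw [hr.v _ (by decide), hO]
      have h5 := Finset.sum_range_succ (fun i => if key i = a then 1 else 0) j
      have b1 := sle (fun i => key i < a) n
      have b2 := sle (fun i => key i = a) j
      have hkj : s.a aA (s.a aBl j) = key j := rfl
      simp only [wp_seq, wp_put, wp_set, Expr.eval_add, Expr.eval_g, Expr.eval_v, eval_eqE, hJ, rA, rBl, rO,
        St.put_v, St.put_a, St.set_v, St.set_a, if_true, Nat.reduceEqDiff, if_false, hkj]
      refine ⟨hB.a _ _, by split <;> omega, by simp [eqE], by rw [h5]; omega, fun k hk => ?_,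
        fun k hk => ?_, fun j' hj' hk => ?_⟩
      · rw [Function.update_of_ne (by omega)]; exact k2 k hk
      · rw [Function.update_apply]
        split
        · next he =>
          refine ⟨j, hj, rfl, ?_⟩
          subst he
          by_contra hne
          rw [if_neg (by omega)] at hk; omega
        · next he => exact k3 k (by split at hk <;> omega)
      · rcases Nat.lt_succ_iff_lt_or_eq.1 hj' with hj' | rfl
        · obtain ⟨k, h6, h7⟩ := k4 j' hj' hk
          exact ⟨k, by omega, by rw [Function.update_of_ne (by omega)]; exact h7⟩
        · exact ⟨r.v vNb, by simp [hk], by simp⟩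
    · rintro r k F ⟨-, -, ⟨k1, k2, k3, k4⟩, k5⟩
      have rO : r.v vO = a := by rw [F.v _ (by decide), hO]
      have rkc : r.a aKc = t.a aKc := F.a _ (by decide)
      simp only [wp_put, Expr.eval_v, rO, St.set_v, St.set_a, St.put_v, St.put_a, if_true, Nat.reduceEqDiff,
        if_false, rkc]
      refine ⟨(F.bd Bt).v _, by simp at k5 ⊢; omega, by rw [step]; omega, ?_⟩
      have hle : t.v vNb ≤ r.v vNb := by omega
      have hex : ∀ j < n, key j ≤ a → ∃ k < r.v vNb, r.a aSB k = s.a aBl j := by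
        intro j hj hk
        rcases hk.lt_or_eq with hk | hk
        · obtain ⟨k', h6, h7⟩ := hS.ex j hj hk
          exact ⟨k', by omega, by rw [k2 k' h6, h7]⟩
        · exact k4 j hj hk
      refine ⟨fun k' hk => ?_, fun j hj hk => hex j hj (Nat.le_of_lt_succ hk), fun i hi => ?_, fun i hi k' hk => ?_,
        fun i hi j hj hk => ?_⟩
      · obtain ⟨j, h6, h7, h8⟩ := k3 k' hk
        exact ⟨j, h6, h7, Nat.lt_succ_of_le h8⟩
      all_goals
        rcases Nat.lt_succ_iff_lt_or_eq.1 hi with hi | rfl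
      · rw [Function.update_of_ne (by omega)]; exact (hS.kc_le i hi).trans hle
      · simp
      · rw [Function.update_of_ne (by omega)] at hk
        rw [k2 k' (hk.trans_le (hS.kc_le i hi))]
        exact hS.key_le i hi k' hk
      · rw [Function.update_self] at hk
        obtain ⟨j, h6, h7, h8⟩ := k3 k' hk
        rw [h7]; exact h8
      · obtain ⟨k', h6, h7⟩ := hS.kc_ex i hi j hj hk
        refine ⟨k', by rwa [Function.update_of_ne (by omega)], ?_⟩
        rw [k2 k' (h6.trans_le (hS.kc_le i hi)), h7]
      · rw [Function.update_self]; exact hex j hj hk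
  · rintro t k _ ⟨-, -, ⟨h1, h2⟩, h3⟩
    refine ⟨?_, h1 ▸ sle _ n, h2⟩
    have : L * (n * 80 + 50 + 2 + 9) ≤ L * (n * 100 + 100) := Nat.mul_le_mul_left _ (by omega)
    simp at h3 ⊢; omega

end RAM

namespace RAM

/-! ### A vertex cover of the weighted edges -/

/-- Greedy maximal matching: a weighted edge with two unmarked ends contributes both ends. -/
def coverStep : Cmd :=
  .set vU (.g aTo (.v vJ + .v vJ + .c 2)) ;; .set vV (.g aTo (.v vJ + .v vJ + 1)) ;;
  .ite 0 (.g aFl (.v vJ + .v vJ + 1))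
    (.ite (.g aMk (.v vU) + .g aMk (.v vV)) 1
      (.put aC (.v vNc) (.v vU) ;; .put aC (.v vNc + 1) (.v vV) ;; .put aMk (.v vU) 1 ;;
        .put aMk (.v vV) 1 ;; .set vNc (.v vNc + .c 2)) .skip) .skip

def coverP : Cmd := .set vNc 0 ;; .for_ vJ (.v vM) coverStep

/-- The arcs `2 j + 1` and `2 j + 2` are the two orientations of an edge. -/
def Ar.Paired (G : Ar) : Prop :=
  ∀ j < G.m, G.fr (2 * j + 1) = G.en (2 * j + 2) ∧ G.fr (2 * j + 2) = G.en (2 * j + 1) ∧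
    G.fl (2 * j + 2) = G.fl (2 * j + 1)

/-- `K` is an arbitrary cover known only to the analysis. Each pair that is added contains a vertex
of `K` that was unmarked before, which gives the factor `2`. -/
structure CoverI (G : Ar) (K : Finset ℕ) (j : ℕ) (t : St) : Prop where
  lt : ∀ i < t.v vNc, t.a aC i < G.N
  le_one : ∀ v, t.a aMk v ≤ 1
  ex : ∀ v, t.a aMk v = 1 → ∃ i < t.v vNc, t.a aC i = v
  card : t.v vNc ≤ 2 * (K.filter fun v => t.a aMk v = 1).card
  cov : ∀ i < j, G.fl (2 * i + 1) = 1 → t.a aMk (G.en (2 * i + 1)) = 1 ∨ t.a aMk (G.en (2 * i + 2)) = 1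

theorem CoverI.of_marked {G : Ar} {K : Finset ℕ} {j z : ℕ} {t t' : St} (h : CoverI G K j t)
    (ha : t'.a = t.a) (hv : t'.v vNc = t.v vNc)
    (hj : G.fl (2 * j + 1) = 1 → t.a aMk (G.en (2 * j + 1)) = 1 ∨ t.a aMk (G.en (2 * j + 2)) = 1) :
    CoverI G K (j + 1) (t'.set vJ z) := by
  constructor
  · simpa [ha, hv] using h.lt
  · simpa [ha] using h.le_one
  · simpa [ha, hv] using h.ex
  · simpa [ha, hv] using h.card
  · intro i hi hf
    simp only [St.set_a, ha]
    rcases Nat.lt_succ_iff_lt_or_eq.1 hi with hi | rfl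
    · exact h.cov i hi hf
    · exact hj hf

theorem wp_coverStep {M : ℕ} {G : Ar} {K : Finset ℕ} {j z : ℕ} {t : St} (hj : j < G.m)
    (hJ : t.v vJ = j) (hG : GSt G t) (hB : Bd M t) (hP : G.Paired) (hK : 2 * K.card + 2 < M)
    (hfl : G.fl (2 * j + 1) = 1 → G.fr (2 * j + 1) ∈ K ∨ G.en (2 * j + 1) ∈ K)
    (hfl1 : G.fl (2 * j + 1) ≤ 1) (h : CoverI G K j t) :
    wp M coverStep t fun t' c => c ≤ 300 ∧ CoverI G K (j + 1) (t'.set vJ z) := by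
  obtain ⟨p1, p2, -⟩ := hP j hj
  have l1 := G.en_lt (2 * j + 1) (by omega) (by omega)
  have l2 := G.en_lt (2 * j + 2) (by omega) (by omega)
  have e1 := hG.en (2 * j + 1) (by omega) (by omega)
  have e2 := hG.en (2 * j + 2) (by omega) (by omega)
  have e3 := hG.fl (2 * j + 1) (by omega) (by omega)
  have b1 := hB.a aTo (2 * j + 1)
  have b2 := hB.a aTo (2 * j + 2)
  rw [e1] at b1
  rw [e2] at b2
  rw [p1] at hfl
  have hcard := h.card
  have hle := Finset.card_filter_le K fun v => t.a aMk v = 1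
  set u := G.en (2 * j + 2) with hu
  set w := G.en (2 * j + 1) with hw
  simp only [coverStep, wp_seq, wp_set, wp_ite, wp_put, wp_skip, Expr.eval_add, Expr.eval_g, Expr.eval_v,
    Expr.eval_c, Expr.eval_zero, Expr.eval_one, hJ, ← two_mul, e1, e2, e3, St.set_v, St.set_a, St.put_v,
    if_true, Nat.reduceEqDiff, if_false]
  refine ⟨b2, b1, fun hf => ⟨fun hm => ?_, fun hm => ?_⟩, fun hf => ?_⟩
  · have hm1 : t.a aMk u = 0 := by omega
    have hm2 : t.a aMk w = 0 := by omega
    -- One end of the new edge lies in `K` and was unmarked, so the number of marked vertices of `K`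
    -- grows when two vertices are added to the list.
    have hlt : (K.filter fun v => t.a aMk v = 1).card + 1 ≤
        (K.filter fun v => Function.update (Function.update (t.a aMk) u 1) w 1 v = 1).card := by
      have : ∃ x ∈ K, x = u ∨ x = w := by
        rcases hfl (by omega) with h | h
        · exact ⟨u, h, .inl rfl⟩
        · exact ⟨w, h, .inr rfl⟩
      obtain ⟨x, hx, hxe⟩ := this
      have hx0 : t.a aMk x = 0 := by rcases hxe with rfl | rfl <;> assumption
      rw [← Finset.card_insert_of_notMem (a := x) (by simp [hx0])]
      refine Finset.card_le_card fun y hy => ?_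
      simp only [Finset.mem_insert, Finset.mem_filter] at hy ⊢
      simp only [Function.update_apply]
      rcases hy with rfl | ⟨hy, hy1⟩
      · exact ⟨hx, by rcases hxe with rfl | rfl <;> simp⟩
      · exact ⟨hy, by split <;> [rfl; (split <;> [rfl; exact hy1])]⟩
    have hle' := Finset.card_filter_le K fun v =>
      Function.update (Function.update (t.a aMk) u 1) w 1 v = 1
    refine ⟨b2, b1, by omega, by omega, by omega, by simp, ?_⟩
    constructor
    · intro i hi
      simp at hi ⊢
      simp only [Function.update_apply]
      split
      · exact l1
      · split
        · exact l2
        · exact h.lt i (by omega)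
    · intro v
      simp only [St.set_a, St.put_a, if_true, Nat.reduceEqDiff, if_false, Function.update_apply]
      have := h.le_one v
      split <;> [omega; (split <;> omega)]
    · intro v hv
      simp [Function.update_apply] at hv ⊢
      by_cases h1 : v = w
      · exact ⟨t.v vNc + 1, by omega, by simp [h1]⟩
      by_cases h2 : v = u
      · exact ⟨t.v vNc, by omega, by simp [h2]⟩
      obtain ⟨i, h3, h4⟩ := h.ex v (by simpa [h1, h2] using hv)
      exact ⟨i, by omega, by rw [if_neg (by omega), if_neg (by omega), h4]⟩
    · simp only [St.set_a, St.put_a, St.set_v, St.put_v, if_true, Nat.reduceEqDiff, if_false]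
      omega
    · intro i hi hf
      simp only [St.set_a, St.put_a, if_true, Nat.reduceEqDiff, if_false, Function.update_apply]
      rcases Nat.lt_succ_iff_lt_or_eq.1 hi with hi | rfl
      · rcases h.cov i hi hf with h | h
        · left; split <;> [rfl; (split <;> [rfl; exact h])]
        · right; split <;> [rfl; (split <;> [rfl; exact h])]
      · left; simp [hw]
  · refine ⟨by simp, h.of_marked (by simp) (by simp) fun _ => ?_⟩
    have := h.le_one u
    have := h.le_one w
    show t.a aMk w = 1 ∨ t.a aMk u = 1
    omega
  · refine ⟨by simp, h.of_marked (by simp) (by simp) fun _ => by omega⟩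

theorem wp_coverP {M : ℕ} {G : Ar} {K : Finset ℕ} {s : St} (hG : GSt G s) (hB : Bd M s)
    (hm : s.v vM = G.m) (hP : G.Paired) (hK : 2 * K.card + 2 < M)
    (hfl : ∀ e, 1 ≤ e → e ≤ 2 * G.m → G.fl e = 1 → G.fr e ∈ K ∨ G.en e ∈ K)
    (hfl1 : ∀ e, 1 ≤ e → e ≤ 2 * G.m → G.fl e ≤ 1) (h0 : ∀ v, s.a aMk v = 0) :
    wp M coverP s fun t c => c ≤ G.m * 400 + 50 ∧ t.v vNc ≤ 2 * K.card ∧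
      (∀ i < t.v vNc, t.a aC i < G.N) ∧
      ∀ e, 1 ≤ e → e ≤ 2 * G.m → G.fl e = 1 →
        (∃ i < t.v vNc, t.a aC i = G.fr e) ∨ ∃ i < t.v vNc, t.a aC i = G.en e := by
  have hmM : G.m < M := by have := hB.v vM; rwa [hm] at this
  unfold coverP
  rw [wp_seq, wp_set]
  refine ⟨by simp; omega, ?_⟩
  have hB' := hB.set (show Expr.eval 0 s < M by simp; omega) vNc
  refine wp_mono (wp_for G.m 300 (CoverI G K) hmM (by decide) ?_ ?_ ?_) ?_
  · intro t ht; rw [Expr.eval_v, ht.v _ (by decide)]; simp [hm]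
  · constructor <;> simp [h0]
  · intro j hj t ht hJ h
    exact wp_coverStep hj hJ ((hG.congr (t := s.set vNc (Expr.eval 0 s)) (by simp) (by simp)).fr ht
      (by decide) (by decide)) (ht.bd hB') hP hK (hfl _ (by omega) (by omega))
      (hfl1 _ (by omega) (by omega)) h
  · rintro t c - ⟨-, -, h, hc⟩
    have := Finset.card_filter_le K fun v => t.a aMk v = 1
    refine ⟨by simp at hc ⊢; omega, by have := h.card; omega, h.lt, fun e h1 h2 hf => ?_⟩
    obtain ⟨j, hj, he⟩ : ∃ j < G.m, e = 2 * j + 1 ∨ e = 2 * j + 2 := ⟨(e - 1) / 2, by omega, by omega⟩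
    obtain ⟨p1, p2, p3⟩ := hP j hj
    rcases he with rfl | rfl
    · rw [p1]
      exact (h.cov j hj hf).symm.imp (h.ex _) (h.ex _)
    · rw [p2]
      exact (h.cov j hj (p3 ▸ hf)).imp (h.ex _) (h.ex _)

/-! ### The construction of the data structure -/

def header : Cmd :=
  .put aHd 0 (.v vN) ;; .put aHd 1 (.v vK) ;; .put aHd (.c 2) (.v vNc) ;; .put aHd (.c 3) (.v vI)

def buildCore : Cmd :=
  distP ;; qP ;; rhoP ;; aTable ;; lamP ;; pickP ;; sortP ;; pivots ;; coverP ;; centers ;; header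

theorem _root_.Scene.uwalk_lt {S : Scene} {u v x : ℕ} (h : Wk S.UStep u v x) (hu : u < S.N) : v < S.N := by
  cases h with
  | refl => exact hu
  | snoc _ h => exact (S.lt h.1).2

/-- What the phases of the construction have computed. -/
structure Built (S : Scene) (I ρ l nb nc : ℕ) (q key sB kc C : ℕ → ℕ) (t : St) : Prop where
  LI : S.L ≤ I
  LN : S.L ≤ S.N
  p_lt : ∀ a < S.L, S.p a < S.N
  d_lt : ∀ v < S.N, S.d v < I
  geo : Geo S I t
  qs : QSpec S q
  l_pos : 1 ≤ l
  l_le : l ≤ ρ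
  tab : ∀ δ ≤ 4 * ρ, ∀ v < S.N, S.FstOK I δ v (t.a aA (δ * S.N + v)) (t.a aPA (δ * S.N + v))
  keys : ∀ v < S.N, key v = S.fst I 0 v
  kc_eq : t.a aKc = kc
  nb_le : nb ≤ ρ
  kc_le : ∀ i < S.L, kc i ≤ nb
  key_le : ∀ i < S.L, ∀ k < kc i, key (sB k) ≤ i
  mem : ∀ k < nb, sB k < S.N ∧ q (sB k) = l
  kc_ex : ∀ i < S.L, ∀ v < S.N, q v = l → key v ≤ i → ∃ k < kc i, sB k = v
  piv : ∀ j ≤ nb, ∀ v < S.N, PivOK S I sB j v (t.a aBe (j * S.N + v)) (t.a aBp (j * S.N + v))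
  C_lt : ∀ j < nc, C j < S.N
  cov : ∀ u v w, S.E u v w true → (∃ j < nc, C j = u) ∨ ∃ j < nc, C j = v
  cen : ∀ j < nc, CenOK S I (t.a aPos) (C j) (fun v => t.a aCd (j * S.N + v))
        (fun v => t.a aCp (j * S.N + v)) (fun v => t.a aCm (j * S.N + v))
        (fun v => t.a aCh (j * S.N + v))
  hN : t.a aHd 0 = S.N
  hK : t.a aHd 1 = 4 * ρ
  hC : t.a aHd 2 = nc
  hI : t.a aHd 3 = I

open _root_.Scene in
-- For the three tables: `A` is `Scene.fst` itself, `B` combines the pivot lemma with the sorted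
-- prefixes, and `C` uses the cover. The `5 * ρ + nc + 6` rows of length `N` exceed the rows of each
-- table as well as the header.
theorem Built.qData {S : Scene} {I ρ l nb nc : ℕ} {q key sB kc C : ℕ → ℕ} {t : St}
    (h : Built S I ρ l nb nc q key sB kc C t) : QData S I (4 * ρ) nc ((5 * ρ + nc + 6) * S.N) t.a := by
  have hN : 1 ≤ S.N := by have := h.p_lt 0 S.L_pos; omega
  have hW : ∀ x, x ≤ 5 * ρ + nc + 6 → x * S.N ≤ (5 * ρ + nc + 6) * S.N := fun x hx =>
    Nat.mul_le_mul_right _ hx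
  have hnb := h.nb_le
  have hLI := h.LI
  have offP : ∀ k < nb, ¬ S.OnP (sB k) := by
    rintro k hk ⟨a, ha, e⟩
    have h1 := (h.mem k hk).2
    rw [← e, h.qs.zero a ha] at h1
    have := h.l_pos; omega
  constructor
  · exact h.hN
  · exact h.hK
  · exact h.hC
  · exact h.hI
  · exact h.LI
  · exact h.LN
  · exact h.geo.pos
  · exact h.geo.pos'
  · exact h.geo.P
  · exact h.geo.d
  · exact h.d_lt
  · exact h.p_lt
  · intro i t' δ hi ht hoff hδ hle
    exact (h.tab δ hδ t' ht).out hi h.LI hoff hle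
  · intro i a t' y δ hi hai ht hoff hδ hy hle
    rw [(h.tab δ hδ t' ht).1]
    exact (fst_le (by omega) ⟨y, hy, hle⟩).trans hai
  · intro i hi
    rw [h.kc_eq]
    have := h.kc_le i hi
    exact hW _ (by omega)
  · intro i t' hi ht hoff hlt
    rw [h.kc_eq] at hlt ⊢
    have hkc := h.kc_le i (by omega)
    obtain ⟨k, hk, y, w, h1, h2, h3⟩ := (h.piv _ hkc t' ht).ex hlt
    have hkn : k < nb := by omega
    have hm := h.mem k hkn
    have hkey := h.key_le i (by omega) k hk
    rw [h.keys _ hm.1] at hkey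
    -- A pivot counted for the edge `i` has a detour of excess `0` that leaves the path at an index
    -- at most `i`; so it is reached safely at the cost of its distance.
    obtain ⟨-, y0, h4, h5⟩ := fst_spec (show S.fst I 0 (sB k) < I by omega)
    refine out_via hi ((safe_p hi hkey).trans (dwalk_safe hi (not_after hkey (by omega))
      (uwalk_dwalk h4))) ?_ h1 h2 hoff (by omega)
    rintro ⟨j, -, hj, e⟩
    exact offP k hkn ⟨j, hj, e⟩
  · intro i a t' y hi hai ht hoff hy hmin hlong
    rw [h.kc_eq]
    obtain ⟨β, k, y', h1, h2, h3, h4, h5⟩ := exists_pivot h.l_pos h.l_le h.qs.zero h.qs.le h.qs.ex hi hai ht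
      hy hmin hlong
    have hβ := uwalk_lt h2 (h.p_lt a (by omega))
    obtain ⟨k', h6, rfl⟩ := h.kc_ex i (by omega) β hβ h1 (by
      rw [h.keys _ hβ]
      exact (fst_le (by omega) ⟨k, h2, by omega⟩).trans hai)
    have := (h.piv _ (h.kc_le i (by omega)) t' ht).le k' h6 y' ?_ (dwalk_xwalk (uwalk_dwalk h4)).1
    · omega
    -- If `t` is the pivot itself, the initial part of the detour already reaches it with excess
    -- `0`, which contradicts the large excess.
    · rintro rfl
      have := hmin _ (((safe_p hi hai).trans (dwalk_safe hi (not_after hai (by omega))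
        (uwalk_dwalk h2))).mono fun _ _ _ h => h.1)
      omega
  · intro j hj i t' hi ht hoff hlt
    exact (h.cen j hj).out h.geo.pos h.p_lt h.LI hi ht hoff hlt
  · intro i a t' y hi hai ht hoff h1 h2 h3
    obtain h4 | ⟨c, ⟨j, hj, rfl⟩, y₁, y₂, rfl, h5, h6, h7⟩ := unweighted_or_meets h.cov h1
    · exact absurd h4 h2
    · have := (h.cen j hj).le h.geo.pos (h.C_lt j hj) h.geo.pos' hi hai ht h5 h6 h7
      exact ⟨j, hj, by rw [← add_assoc]; exact this⟩
  · calc 4 = 4 * 1 := rfl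
      _ ≤ (5 * ρ + nc + 6) * S.N := Nat.mul_le_mul (by omega) hN
  · calc S.N = 1 * S.N := (one_mul _).symm
      _ ≤ _ := hW _ (by omega)
  · exact hW _ (by omega)
  · exact hW _ (by omega)

theorem wp_header {M N K nc I : ℕ} {s : St} (h1 : s.v vN = N) (h2 : s.v vK = K) (h3 : s.v vNc = nc)
    (h4 : s.v vI = I) (hB : Bd M s) :
    wp M header s fun t c => c ≤ 60 ∧ t.a aHd 0 = N ∧ t.a aHd 1 = K ∧ t.a aHd 2 = nc ∧
      t.a aHd 3 = I := by
  have b1 := hB.v vN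
  have b2 := hB.v vK
  have b3 := hB.v vNc
  have b4 := hB.v vI
  simp only [header, wp_seq, wp_put, Expr.eval_v, Expr.eval_c, Expr.eval_zero, Expr.eval_one, St.put_v,
    St.put_a, if_true, h1, h2, h3, h4] at *
  refine ⟨b1, b2, b3, b4, by simp, ?_⟩
  simp

theorem wp_buildCore {M : ℕ} {S : Scene} {G : Ar} {I lg : ℕ} {K : Finset ℕ} {s : St}
    (hE : Env M S G I lg) (hB : Base M S G I s) (h1 : ∀ a < S.L, s.a aPos (S.p a) = a)
    (h2 : ∀ v < S.N, ¬ S.OnP v → s.a aPos v = I) (h3 : ∀ a < S.L, s.a aP a = S.p a)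
    (hm : s.v vM = G.m) (hP : G.Paired) (hct : ∀ l, s.a aCt l = 0) (hmk : ∀ v, s.a aMk v = 0)
    (hK : 2 * K.card + 2 < M) (hIM : I + 8 * S.N + 4 < M)
    (hfl : ∀ e, 1 ≤ e → e ≤ 2 * G.m → G.fl e = 1 → G.fr e ∈ K ∨ G.en e ∈ K) :
    wp M buildCore s fun t c => ∃ ρ nc, 1 ≤ ρ ∧ ρ ≤ S.N ∧ (ρ - 1) * (ρ - 1) < S.N ∧ nc ≤ 2 * K.card ∧
      t.v vN = S.N ∧ t.v vRho = ρ ∧ t.v vNc = nc ∧ c ≤ (2 * G.m + G.N + 1) * (ρ + nc) * (lg * 400 + 8000) ∧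
      QData S I (4 * ρ) nc ((5 * ρ + nc + 6) * S.N) t.a := by
  have hN := hE.N
  have hMN := hE.hN
  have hNp := hE.src
  have hLN := hE.L_le
  have hLI := hE.LI
  unfold buildCore
  rw [wp_seq]
  refine wp_mono (wp_distP hE hB h1 h2 h3) ?_
  rintro t1 c1 F1 ⟨l1, G1⟩
  have B1 := hB.fr F1 (by decide) (by decide)
  rw [wp_seq]
  refine wp_mono (wp_qP hE B1 G1) ?_
  rintro t2 c2 F2 ⟨l2, Q2⟩
  have B2 := B1.fr F2 (by decide) (by decide)
  have G2 := G1.fr F2 (by decide)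
  rw [wp_seq]
  refine wp_mono (wp_rhoP (N := S.N) (B2.g.N.trans hN) (by omega) (by omega)) ?_
  rintro t3 c3 F3 ⟨l3, r1, r2, r3, r4, r5⟩
  have B3 := B2.fr F3 (by decide) (by decide)
  have G3 := G2.fr F3 (by decide)
  obtain ⟨ρ, hρ⟩ : ∃ ρ, t3.v vRho = ρ := ⟨_, rfl⟩
  rw [hρ] at r1 r2 r3 r4 r5
  rw [wp_seq]
  refine wp_mono (wp_aTable hE B3 G3 r4 (by omega)) ?_
  rintro t4 c4 F4 ⟨l4, T4⟩
  have B4 := B3.fr F4 (by decide) (by decide)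
  have G4 := G3.fr F4 (by decide)
  have q4 : t4.a aQ = t2.a aQ := by rw [F4.a _ (by decide), F3.a _ (by decide)]
  rw [wp_seq]
  refine wp_mono (wp_lamP (N := S.N) (ρ := ρ) (B4.g.N.trans hN) ((F4.v _ (by decide)).trans hρ) r1 r2 r5
    (by omega) ?_) ?_
  · intro l
    rw [F4.a _ (by decide), F3.a _ (by decide), F2.a _ (by decide), F1.a _ (by decide), hct]
  rintro t5 c5 F5 ⟨l5, m1, m2, m3⟩
  have B5 := B4.fr F5 (by decide) (by decide)
  have G5 := G4.fr F5 (by decide)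
  rw [q4] at m3
  obtain ⟨l, hl⟩ : ∃ l, t5.v vLam = l := ⟨_, rfl⟩
  rw [hl] at m1 m2 m3
  have q5 : t5.a aQ = t2.a aQ := by rw [F5.a _ (by decide), q4]
  rw [wp_seq]
  refine wp_mono (wp_pickP (N := S.N) (l := l) (B5.g.N.trans hN) hl (by omega)) ?_
  rintro t6 c6 F6 ⟨l6, k1, k2, k3⟩
  rw [q5] at k1 k2 k3
  have B6 := B5.fr F6 (by decide) (by decide)
  have G6 := G5.fr F6 (by decide)
  have A6 : t6.a aA = t4.a aA := by rw [F6.a _ (by decide), F5.a _ (by decide)]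
  rw [wp_seq]
  refine wp_mono (wp_sortP (n := t6.v vNB) (L := S.L) B6.L rfl B6.bd (by omega)) ?_
  rintro t7 c7 F7 ⟨l7, n1, S7⟩
  rw [A6] at S7
  have B7 := B6.fr F7 (by decide) (by decide)
  have G7 := G6.fr F7 (by decide)
  rw [wp_seq]
  refine wp_mono (wp_pivots (nb := t7.v vNb) hE B7 G7 rfl ?_) ?_
  · intro j hj
    obtain ⟨i, hi, e, -⟩ := S7.mem j hj
    rw [e]; exact (k2 i hi).1
  rintro t8 c8 F8 ⟨l8, P8⟩
  have B8 := B7.fr F8 (by decide) (by decide)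
  have G8 := G7.fr F8 (by decide)
  rw [wp_seq]
  refine wp_mono (wp_coverP (K := K) B8.g B8.bd ?_ hP hK hfl hE.fl ?_) ?_
  · rw [F8.v _ (by decide), F7.v _ (by decide), F6.v _ (by decide), F5.v _ (by decide),
      F4.v _ (by decide), F3.v _ (by decide), F2.v _ (by decide), F1.v _ (by decide), hm]
  · intro l
    rw [F8.a _ (by decide), F7.a _ (by decide), F6.a _ (by decide), F5.a _ (by decide),
      F4.a _ (by decide), F3.a _ (by decide), F2.a _ (by decide), F1.a _ (by decide), hmk]
  rintro t9 c9 F9 ⟨l9, v1, v2, v3⟩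
  have B9 := B8.fr F9 (by decide) (by decide)
  have G9 := G8.fr F9 (by decide)
  rw [wp_seq]
  refine wp_mono (wp_centers (nc := t9.v vNc) hE B9 G9 rfl fun j hj => (v2 j hj).trans_eq hN) ?_
  rintro t10 c10 F10 ⟨l10, C10⟩
  have B10 := B9.fr F10 (by decide) (by decide)
  have G10 := G9.fr F10 (by decide)
  refine wp_mono (wp_header (N := S.N) (K := 4 * ρ) (nc := t9.v vNc) (B10.g.N.trans hN) ?_
    (F10.v _ (by decide)) B10.inf B10.bd) ?_
  · rw [F10.v _ (by decide), F9.v _ (by decide), F8.v _ (by decide), F7.v _ (by decide),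
      F6.v _ (by decide), F5.v _ (by decide), F4.v _ (by decide), r4]
  rintro t11 c11 F11 ⟨l11, w1, w2, w3, w4⟩
  have eA : t11.a aA = t4.a aA := by
    rw [F11.a _ (by decide), F10.a _ (by decide), F9.a _ (by decide), F8.a _ (by decide),
      F7.a _ (by decide), A6]
  have ePA : t11.a aPA = t4.a aPA := by
    rw [F11.a _ (by decide), F10.a _ (by decide), F9.a _ (by decide), F8.a _ (by decide),
      F7.a _ (by decide), F6.a _ (by decide), F5.a _ (by decide)]
  have eKc : t11.a aKc = t7.a aKc := by
    rw [F11.a _ (by decide), F10.a _ (by decide), F9.a _ (by decide), F8.a _ (by decide)]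
  have eB : t11.a aBe = t8.a aBe ∧ t11.a aBp = t8.a aBp := by
    constructor <;> rw [F11.a _ (by decide), F10.a _ (by decide), F9.a _ (by decide)]
  have ePos : t11.a aPos = t9.a aPos := by rw [F11.a _ (by decide), F10.a _ (by decide)]
  have eC : t11.a aCd = t10.a aCd ∧ t11.a aCp = t10.a aCp ∧ t11.a aCm = t10.a aCm ∧
      t11.a aCh = t10.a aCh := by
    refine ⟨?_, ?_, ?_, ?_⟩ <;> rw [F11.a _ (by decide)]
  have key : ∀ v < S.N, t4.a aA v = S.fst I 0 v := fun v hv => by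
    simpa using (T4 0 (by omega) v hv).1
  refine ⟨ρ, t9.v vNc, r1, r5, r3, v1, ?_, ?_, ?_, ?_, ?_⟩
  · rw [F11.v _ (by decide), B10.g.N, hN]
  · rw [F11.v _ (by decide), F10.v _ (by decide), F9.v _ (by decide), F8.v _ (by decide),
      F7.v _ (by decide), F6.v _ (by decide), F5.v _ (by decide), F4.v _ (by decide), hρ]
  · rw [F11.v _ (by decide), F10.v _ (by decide)]
  · have a1 : t7.v vNb ≤ ρ := by omega
    have a2 : S.L * (t6.v vNB * 100 + 100) ≤ G.N * (ρ * 100 + 100) := Nat.mul_le_mul (by omega) (by omega)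
    have a3 : (t7.v vNb + 1) * ((2 * G.m + G.N + 1) * (lg * 80 + 1200)) ≤
        (ρ + 1) * ((2 * G.m + G.N + 1) * (lg * 80 + 1200)) := Nat.mul_le_mul_right _ (by omega)
    obtain ⟨b, hb⟩ : ∃ b, 2 * G.m + G.N + 1 = b := ⟨_, rfl⟩
    rw [hb] at l1 l2 l4 l8 l10 a3 ⊢
    have a4 : b ≤ b * ρ := Nat.le_mul_of_pos_right _ r1
    have a5 : b * lg ≤ b * ρ * lg := Nat.mul_le_mul_right _ a4
    have a6 : G.N * ρ ≤ b * ρ := Nat.mul_le_mul_right _ (by omega)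
    have x1 : b * (lg * 80 + 800) = 80 * (b * lg) + 800 * b := by ring
    have x2 : (4 * ρ + 1) * (b * 220) = 880 * (b * ρ) + 220 * b := by ring
    have x3 : G.N * (ρ * 100 + 100) = 100 * (G.N * ρ) + 100 * G.N := by ring
    have x4 : (ρ + 1) * (b * (lg * 80 + 1200)) =
      80 * (b * ρ * lg) + 1200 * (b * ρ) + 80 * (b * lg) + 1200 * b := by ring
    have x5 : t9.v vNc * (b * (lg * 80 + 1200)) =
      80 * (b * t9.v vNc * lg) + 1200 * (b * t9.v vNc) := by ring
    have x6 : b * (ρ + t9.v vNc) * (lg * 400 + 8000) = 400 * (b * ρ * lg) + 8000 * (b * ρ) +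
      400 * (b * t9.v vNc * lg) + 8000 * (b * t9.v vNc) := by ring
    omega
  · refine Built.qData (l := l) (nb := t7.v vNb) (q := t2.a aQ) (key := t4.a aA) (sB := t7.a aSB)
      (kc := t7.a aKc) (C := t9.a aC) ?_
    refine ⟨hLI, hLN, fun a ha => hE.p_lt ha, hE.d, G10.fr F11 (by decide), Q2, m1, m2, ?_, key, eKc,
      by omega, S7.kc_le, S7.key_le, ?_, ?_, ?_, fun j hj => (v2 j hj).trans_eq hN, ?_, ?_, w1, w2, w3, w4⟩
    · rw [eA, ePA]; exact T4
    · intro k hk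
      obtain ⟨i, hi, e, -⟩ := S7.mem k hk
      rw [e]; exact k2 i hi
    · intro i hi v hv hq hk
      obtain ⟨j, hj, rfl⟩ := k3 v hv hq
      exact S7.kc_ex i hi j hj hk
    · rw [eB.1, eB.2]; exact P8
    · intro u v w h
      obtain ⟨e, e1, e2, e3, e4, -, e6⟩ := (hE.E _ _ _ _).1 h
      rw [← e3, ← e4]; exact v3 e e1 e2 (by simpa using e6)
    · rw [ePos, eC.1, eC.2.1, eC.2.2.1, eC.2.2.2]; exact C10

end RAM

namespace RAM

/-! ### Reading the input -/

/-- The state holds the first `k` arcs. -/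
structure ArcsI (G : Ar) (k : ℕ) (s : St) : Prop where
  head : ∀ v, s.a aHead v = G.last v k
  nxt : ∀ e, 1 ≤ e → e ≤ k → s.a aNxt e = G.last (G.fr e) (e - 1)
  en : ∀ e, 1 ≤ e → e ≤ k → s.a aTo e = G.en e
  wt : ∀ e, 1 ≤ e → e ≤ k → s.a aWt e = G.wt e
  fl : ∀ e, 1 ≤ e → e ≤ k → s.a aFl e = G.fl e

/-- Adds the arc number `k` from `x` to `y`, with weight `vD` and flag `vE`. -/
def addArc (k : Expr) (x y : ℕ) : Cmd :=
  .put aTo k (.v y) ;; .put aWt k (.v vD) ;; .put aFl k (.v vE) ;;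
  .put aNxt k (.g aHead (.v x)) ;; .put aHead (.v x) k

theorem wp_addArc {M : ℕ} {G : Ar} {k : ℕ} {s : St} {ke : Expr} {x y : ℕ} (h : ArcsI G k s)
    (hB : Bd M s) (hk : ∀ t : St, t.v = s.v → ke.eval t = k + 1) (hkM : k + 1 < M)
    (hx : s.v x = G.fr (k + 1)) (hy : s.v y = G.en (k + 1)) (hw : s.v vD = G.wt (k + 1))
    (hf : s.v vE = G.fl (k + 1)) :
    wp M (addArc ke x y) s fun t c => c ≤ 5 * ke.cost + 60 ∧ ArcsI G (k + 1) t := by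
  have b1 := hB.v y
  have b2 := hB.v vD
  have b3 := hB.v vE
  have b4 := hB.a aHead (s.v x)
  simp only [addArc, wp_seq, wp_put, Expr.eval_v, Expr.eval_g, St.put_v, St.put_a,
    hk s rfl, Nat.reduceEqDiff, if_false]
  rw [hk _ (by simp), hk _ (by simp), hk _ (by simp), hk _ (by simp)]
  refine ⟨b1, b2, b3, by simpa using b4, hkM, by simp; omega, ?_⟩
  have hl : ∀ e, e ≤ k + 1 → e = k + 1 ∨ e ≤ k := fun e h => by omega
  constructor
  · intro v
    simp only [St.put_a, if_true, Nat.reduceEqDiff, if_false, hx, Function.update_apply, Ar.last, h.head]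
    by_cases hv : v = G.fr (k + 1)
    · simp [hv]
    · simp [hv, Ne.symm hv]
  all_goals
    intro e h1 h2
    rcases hl e h2 with rfl | h3
  · simp [hx, h.head]
  · simp [Function.update_of_ne (show e ≠ k + 1 by omega), h.nxt e h1 h3]
  · simp [hy]
  · simp [Function.update_of_ne (show e ≠ k + 1 by omega), h.en e h1 h3]
  · simp [hw]
  · simp [Function.update_of_ne (show e ≠ k + 1 by omega), h.wt e h1 h3]
  · simp [hf]
  · simp [Function.update_of_ne (show e ≠ k + 1 by omega), h.fl e h1 h3]

def edgeIn (k : ℕ) : Expr := .inp (.v vL + .c 4 * .v vJ + .c k)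

def readEdge : Cmd :=
  .set vU (edgeIn 4) ;; .set vV (edgeIn 5) ;; .set vD (edgeIn 6) ;; .set vE (edgeIn 7) ;;
  addArc (.v vJ + .v vJ + 1) vU vV ;; addArc (.v vJ + .v vJ + .c 2) vV vU ;;
  .set vX (.v vX + .v vD)

/-- While reading, `vX` accumulates the total weight `W`. The value `N * (W + 1) + 1` serves as
infinity: distances are at most `N * W`, since every single weight is at most `W`. It also exceeds
all path positions, so it marks vertices off the path in `aPos`. -/
def readP : Cmd :=
  .set vN (.inp 0) ;; .set vM (.inp 1) ;; .set vSrc (.inp (.c 2)) ;; .set vL (.inp (.c 3)) ;;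
  .for_ vJ (.v vM) readEdge ;; .set vI (.v vN * (.v vX + 1) + 1) ;;
  fill vJ vN aPos (.v vJ) (.v vI) ;;
  .for_ vJ (.v vL) (.put aP (.v vJ) (.inp (.v vJ + .c 4)) ;;
    .put aPos (.inp (.v vJ + .c 4)) (.v vJ))

/-- The graph with edges `U j`, `V j` of weight `W j` and flag `K j`, for `j < m`. -/
def arOf (N m : ℕ) (U V W K : ℕ → ℕ) (hU : ∀ j < m, U j < N) (hV : ∀ j < m, V j < N) : Ar where
  N := N
  m := m
  fr e := if e % 2 = 1 then U ((e - 1) / 2) else V ((e - 1) / 2)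
  en e := if e % 2 = 1 then V ((e - 1) / 2) else U ((e - 1) / 2)
  wt e := W ((e - 1) / 2)
  fl e := K ((e - 1) / 2)
  fr_lt e h1 h2 := by
    split
    · exact hU _ (by omega)
    · exact hV _ (by omega)
  en_lt e h1 h2 := by
    split
    · exact hV _ (by omega)
    · exact hU _ (by omega)

section

variable {N m : ℕ} {U V W K : ℕ → ℕ} (hU : ∀ j < m, U j < N) (hV : ∀ j < m, V j < N)

theorem arOf_odd (j : ℕ) : (arOf N m U V W K hU hV).fr (2 * j + 1) = U j ∧
    (arOf N m U V W K hU hV).en (2 * j + 1) = V j ∧ (arOf N m U V W K hU hV).wt (2 * j + 1) = W j ∧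
    (arOf N m U V W K hU hV).fl (2 * j + 1) = K j := by
  have h1 : (2 * j + 1) % 2 = 1 := by omega
  have h2 : (2 * j + 1 - 1) / 2 = j := by omega
  simp only [arOf, h1, h2, if_true]; simp

theorem arOf_even (j : ℕ) : (arOf N m U V W K hU hV).fr (2 * j + 2) = V j ∧
    (arOf N m U V W K hU hV).en (2 * j + 2) = U j ∧ (arOf N m U V W K hU hV).wt (2 * j + 2) = W j ∧
    (arOf N m U V W K hU hV).fl (2 * j + 2) = K j := by
  have h1 : ¬ (2 * j + 2) % 2 = 1 := by omega
  have h2 : (2 * j + 2 - 1) / 2 = j := by omega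
  simp only [arOf, h1, h2, if_false]; simp

theorem arOf_paired : (arOf N m U V W K hU hV).Paired := by
  intro j _
  obtain ⟨h1, h2, -, h3⟩ := arOf_odd (W := W) (K := K) hU hV j
  obtain ⟨h4, h5, -, h6⟩ := arOf_even (W := W) (K := K) hU hV j
  rw [h1, h2, h3, h4, h5, h6]; simp

end

theorem wp_readEdge {M : ℕ} {G : Ar} {j L x z : ℕ} {t : St} (hL : t.v vL = L) (hJ : t.v vJ = j)
    (hB : Bd M t) (hM : 2 * j + 2 < M) (h : ArcsI G (2 * j) t)
    (h1 : G.fr (2 * j + 1) = t.i (4 + L + 4 * j) ∧ G.en (2 * j + 1) = t.i (4 + L + 4 * j + 1) ∧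
      G.wt (2 * j + 1) = t.i (4 + L + 4 * j + 2) ∧ G.fl (2 * j + 1) = t.i (4 + L + 4 * j + 3))
    (h2 : G.fr (2 * j + 2) = t.i (4 + L + 4 * j + 1) ∧ G.en (2 * j + 2) = t.i (4 + L + 4 * j) ∧
      G.wt (2 * j + 2) = t.i (4 + L + 4 * j + 2) ∧ G.fl (2 * j + 2) = t.i (4 + L + 4 * j + 3))
    (hx : t.v vX = x) (hxM : x + t.i (4 + L + 4 * j + 2) < M) :
    wp M readEdge t fun t' c => c ≤ 400 ∧ ArcsI G (2 * (j + 1)) (t'.set vJ z) ∧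
      (t'.set vJ z).v vX = x + t.i (4 + L + 4 * j + 2) := by
  have e : ∀ k, L + 4 * j + (k + 4) = 4 + L + 4 * j + k := fun k => by omega
  have b0 := hB.i (4 + L + 4 * j)
  have b1 := hB.i (4 + L + 4 * j + 1)
  have b2 := hB.i (4 + L + 4 * j + 2)
  have b3 := hB.i (4 + L + 4 * j + 3)
  unfold readEdge
  rw [wp_seq, wp_set]
  have i0 : ∀ s : St, s.v = t.v ∨ True → s.v vL = L → s.v vJ = j → s.i = t.i →
      (edgeIn 4).eval s = t.i (4 + L + 4 * j) ∧ (edgeIn 5).eval s = t.i (4 + L + 4 * j + 1) ∧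
      (edgeIn 6).eval s = t.i (4 + L + 4 * j + 2) ∧ (edgeIn 7).eval s = t.i (4 + L + 4 * j + 3) := by
    intro s _ h1 h2 h3
    simp only [edgeIn, Expr.eval_inp, Expr.eval_add, Expr.eval_mul, Expr.eval_c, Expr.eval_v, h1, h2, h3]
    exact ⟨congrArg _ (e 0), congrArg _ (e 1), congrArg _ (e 2), congrArg _ (e 3)⟩
  have j0 := (i0 t (.inr trivial) hL hJ rfl).1
  rw [j0]
  refine ⟨b0, ?_⟩
  generalize ht1 : t.set vU (t.i (4 + L + 4 * j)) = t1
  have j1 := (i0 t1 (.inr trivial) (by simp [← ht1, hL]) (by simp [← ht1, hJ]) (by simp [← ht1])).2.1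
  rw [wp_seq, wp_set, j1]
  refine ⟨b1, ?_⟩
  generalize ht2 : t1.set vV (t.i (4 + L + 4 * j + 1)) = t2
  have j2 := (i0 t2 (.inr trivial) (by simp [← ht2, ← ht1, hL]) (by simp [← ht2, ← ht1, hJ])
    (by simp [← ht2, ← ht1])).2.2.1
  rw [wp_seq, wp_set, j2]
  refine ⟨b2, ?_⟩
  generalize ht3 : t2.set vD (t.i (4 + L + 4 * j + 2)) = t3
  have j3 := (i0 t3 (.inr trivial) (by simp [← ht3, ← ht2, ← ht1, hL])
    (by simp [← ht3, ← ht2, ← ht1, hJ]) (by simp [← ht3, ← ht2, ← ht1])).2.2.2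
  rw [wp_seq, wp_set, j3]
  refine ⟨b3, ?_⟩
  have hB4 := (((hB.set b0 vU).set b1 vV).set b2 vD).set b3 vE
  rw [ht1, ht2, ht3] at hB4
  generalize ht4 : t3.set vE (t.i (4 + L + 4 * j + 3)) = t4 at hB4
  have v4 : t4.v vU = t.i (4 + L + 4 * j) ∧ t4.v vV = t.i (4 + L + 4 * j + 1) ∧
      t4.v vD = t.i (4 + L + 4 * j + 2) ∧ t4.v vE = t.i (4 + L + 4 * j + 3) ∧ t4.v vJ = j ∧
      t4.v vX = x := by
    simp [← ht4, ← ht3, ← ht2, ← ht1, hJ, hx]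
  obtain ⟨u1, u2, u3, u4, u5, u6⟩ := v4
  have ha4 : t4.a = t.a := by simp [← ht4, ← ht3, ← ht2, ← ht1]
  have h4 : ArcsI G (2 * j) t4 := by
    constructor
    · rw [ha4]; exact h.head
    · rw [ha4]; exact h.nxt
    · rw [ha4]; exact h.en
    · rw [ha4]; exact h.wt
    · rw [ha4]; exact h.fl
  rw [wp_seq]
  refine wp_mono (wp_addArc h4 hB4 (fun s hs => by simp [hs, u5]; omega) (by omega) (u1.trans h1.1.symm)
    (u2.trans h1.2.1.symm) (u3.trans h1.2.2.1.symm) (u4.trans h1.2.2.2.symm)) ?_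
  rintro t5 c5 F5 ⟨l5, A5⟩
  have w5 : ∀ x ∈ [vU, vV, vD, vE, vJ, vX], t5.v x = t4.v x := fun x _ =>
    F5.v x (by simp [addArc, Cmd.mv])
  rw [wp_seq]
  refine wp_mono (wp_addArc (k := 2 * j + 1) A5 (F5.bd hB4)
    (fun s hs => by simp [hs, w5, u5]; omega) (by omega) ((w5 _ (by simp)).trans (u2.trans h2.1.symm))
    ((w5 _ (by simp)).trans (u1.trans h2.2.1.symm)) ((w5 _ (by simp)).trans (u3.trans h2.2.2.1.symm))
    ((w5 _ (by simp)).trans (u4.trans h2.2.2.2.symm))) ?_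
  rintro t6 c6 F6 ⟨l6, A6⟩
  have w6 : ∀ x ∈ [vU, vV, vD, vE, vJ, vX], t6.v x = t4.v x := fun x hx =>
    (F6.v x (by simp [addArc, Cmd.mv])).trans (w5 x hx)
  have a1 := w6 vX (by simp)
  have a2 := w6 vD (by simp)
  rw [u6] at a1
  rw [u3] at a2
  simp only [wp_set, Expr.eval_add, Expr.eval_v, a1, a2]
  refine ⟨hxM, ?_, ?_, by simp⟩
  · simp [edgeIn] at l5 l6 ⊢; omega
  · rw [show 2 * (j + 1) = 2 * j + 1 + 1 by omega]
    constructor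
    · simpa using A6.head
    · simpa using A6.nxt
    · simpa using A6.en
    · simpa using A6.wt
    · simpa using A6.fl

theorem wp_readP {M : ℕ} {G : Ar} {N m L I : ℕ} {p : ℕ → ℕ} {s : St} (hB : Bd M s)
    (h0 : ∀ a j, s.a a j = 0) (hx : s.v vX = 0)
    (i0 : s.i 0 = N) (i1 : s.i 1 = m) (i3 : s.i 3 = L) (iP : ∀ a < L, s.i (4 + a) = p a)
    (hGN : G.N = N) (hGm : G.m = m)
    (h1 : ∀ j < m, G.fr (2 * j + 1) = s.i (4 + L + 4 * j) ∧ G.en (2 * j + 1) = s.i (4 + L + 4 * j + 1) ∧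
      G.wt (2 * j + 1) = s.i (4 + L + 4 * j + 2) ∧ G.fl (2 * j + 1) = s.i (4 + L + 4 * j + 3))
    (h2 : ∀ j < m, G.fr (2 * j + 2) = s.i (4 + L + 4 * j + 1) ∧ G.en (2 * j + 2) = s.i (4 + L + 4 * j) ∧
      G.wt (2 * j + 2) = s.i (4 + L + 4 * j + 2) ∧ G.fl (2 * j + 2) = s.i (4 + L + 4 * j + 3))
    (hI : I = N * (∑ j ∈ Finset.range m, s.i (4 + L + 4 * j + 2) + 1) + 1) (hIM : I < M) (hN : 1 ≤ N)
    (hmM : 2 * m + 2 < M) (hinj : ∀ a < L, ∀ b < L, p a = p b → a = b) :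
    wp M readP s fun t c => c ≤ m * 500 + N * 100 + L * 100 + 200 ∧ GSt G t ∧ t.v vI = I ∧ t.v vM = m ∧
      t.v vL = L ∧ t.v vSrc = s.i 2 ∧ (∀ a < L, t.a aP a = p a ∧ t.a aPos (p a) = a) ∧
      ∀ v < N, (∀ a < L, p a ≠ v) → t.a aPos v = I := by
  have b0 := hB.i 0
  have b1 := hB.i 1
  have b2 := hB.i 2
  have b3 := hB.i 3
  have hNS : ∑ j ∈ Finset.range m, s.i (4 + L + 4 * j + 2) + 1 ≤
    N * (∑ j ∈ Finset.range m, s.i (4 + L + 4 * j + 2) + 1) := Nat.le_mul_of_pos_left _ hN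
  unfold readP
  rw [wp_seq, wp_set, wp_seq, wp_set, wp_seq, wp_set, wp_seq, wp_set]
  simp only [Expr.eval_inp, Expr.eval_zero, Expr.eval_one, Expr.eval_c, St.set_i]
  refine ⟨b0, b1, b2, b3, ?_⟩
  have hB' := (((hB.set b0 vN).set b1 vM).set b2 vSrc).set b3 vL
  generalize hs1 : (((s.set vN (s.i 0)).set vM (s.i 1)).set vSrc (s.i 2)).set vL (s.i 3) = s1 at hB' ⊢
  have g1 : s1.v vN = N ∧ s1.v vM = m ∧ s1.v vSrc = s.i 2 ∧ s1.v vL = L ∧ s1.i = s.i ∧ s1.a = s.a ∧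
      s1.v vX = 0 := by
    simp [← hs1, i0, i1, i3, hx]
  obtain ⟨g1, g2, g3, g4, g5, g6, g7⟩ := g1
  rw [wp_seq]
  refine wp_mono (wp_for m 400 (fun j t => ArcsI G (2 * j) t ∧
      t.v vX = ∑ j ∈ Finset.range j, s.i (4 + L + 4 * j + 2)) (by omega) (by decide) ?_ ?_ ?_) ?_
  · intro t ht; rw [Expr.eval_v, ht.v _ (by decide), g2]
  · refine ⟨⟨?_, ?_, ?_, ?_, ?_⟩, by simp [g7]⟩
    · intro v; simp [g6, h0, Ar.last]
    all_goals intro e e1 e2; omega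
  · rintro j hj t ht hJ ⟨hA, hX⟩
    have ti : t.i = s.i := ht.i.trans g5
    have hle : ∑ j ∈ Finset.range (j + 1), s.i (4 + L + 4 * j + 2) ≤
        ∑ j ∈ Finset.range m, s.i (4 + L + 4 * j + 2) :=
      Finset.sum_le_sum_of_subset (Finset.range_mono (by omega))
    rw [Finset.sum_range_succ] at hle
    refine wp_mono (wp_readEdge (x := ∑ j ∈ Finset.range j, s.i (4 + L + 4 * j + 2)) (z := j + 1) (L := L)
      ((ht.v _ (by decide)).trans g4) hJ (ht.bd hB') (by omega) hA (ti ▸ h1 j hj) (ti ▸ h2 j hj) hX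
      (by rw [ti]; omega)) ?_
    rintro t' c - ⟨l, k1, k2⟩
    exact ⟨l, k1, by rw [k2, Finset.sum_range_succ, ti]⟩
  rintro t c F ⟨-, -, ⟨hA, hX⟩, l1⟩
  have Bt := F.bd hB'
  have tN : t.v vN = N := by rw [F.v _ (by decide), g1]
  rw [wp_seq, wp_set]
  have eI : Expr.eval (.v vN * (.v vX + 1) + 1) t = I := by simp [tN, hX, hI]
  rw [eI]
  refine ⟨hIM, ?_⟩
  have B2 := Bt.set hIM vI
  generalize hs2 : t.set vI I = t2 at B2 ⊢
  have e2 : t2.v vN = N ∧ t2.v vI = I ∧ t2.v vL = L ∧ t2.v vM = m ∧ t2.v vSrc = s.i 2 ∧ t2.i = s.i ∧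
      t2.a = t.a := by
    rw [← hs2]
    simp [tN, F.v vL (by decide), g4, F.v vM (by decide), g2, F.v vSrc (by decide), g3, F.i, g5]
  obtain ⟨e21, e22, e23, e24, e25, e26, e27⟩ := e2
  have hG2 : GSt G t2 := by
    refine ⟨e21.trans hGN.symm, ?_, ?_, ?_, ?_, ?_⟩ <;> rw [e27, hGm]
    · exact fun v _ => hA.head v
    · exact hA.nxt
    · exact hA.en
    · exact hA.wt
    · exact hA.fl
  rw [wp_seq]
  refine wp_mono (wp_fill N 0 (fun _ => I) e21 (by decide) (by omega) ?_) ?_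
  · intro v hv r hr hv' _ _
    exact ⟨by simpa using hv', by rw [Expr.eval_v, hr.v _ (by decide), e22], hIM⟩
  rintro t3 c3 F3 ⟨l3, c3a, -⟩
  simp only [Nat.zero_add] at c3a
  have B3 := F3.bd B2
  refine wp_mono (wp_for L 60 (fun j r => (∀ a < j, r.a aP a = p a ∧ r.a aPos (p a) = a) ∧
    ∀ v < N, (∀ a < j, p a ≠ v) → r.a aPos v = I) (by omega) (by decide) ?_ ?_ ?_) ?_
  · intro r hr; rw [Expr.eval_v, hr.v _ (by decide), F3.v _ (by decide), e23]
  · exact ⟨fun a ha => by omega, fun v hv _ => by simpa using c3a v hv⟩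
  · rintro j hj r hr hJ ⟨k1, k2⟩
    have ri : r.i = s.i := by rw [hr.i, F3.i, e26]
    have rp : r.i (j + 4) = p j := by rw [ri, add_comm, iP j hj]
    have rb := (hr.bd B3).i (j + 4)
    rw [rp] at rb
    simp only [wp_seq, wp_put, Expr.eval_inp, Expr.eval_add, Expr.eval_v, Expr.eval_c, hJ, St.put_v,
      St.put_i, rp, St.put_a, St.set_a, if_true, Nat.reduceEqDiff, if_false]
    refine ⟨rb, by omega, by simp, fun a ha => ?_, fun v hv hne => ?_⟩
    · simp only [Function.update_apply]
      rcases Nat.lt_succ_iff_lt_or_eq.1 ha with ha | rfl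
      · have : p a ≠ p j := fun e => by have := hinj a (by omega) j hj e; omega
        rw [if_neg (by omega), if_neg this]; exact k1 a ha
      · simp
    · rw [Function.update_of_ne (Ne.symm (hne j (by omega)))]
      exact k2 v hv fun a ha => hne a (by omega)
  · rintro r k F4 ⟨-, -, ⟨k1, k2⟩, k3⟩
    refine ⟨?_, (hG2.fr F3 (by decide) (by decide)).fr F4 (by decide) (by decide), ?_, ?_, ?_, ?_, k1, k2⟩
    · simp at l1 l3 k3 ⊢; omega
    · rw [F4.v _ (by decide), F3.v _ (by decide), e22]
    · rw [F4.v _ (by decide), F3.v _ (by decide), e24]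
    · rw [F4.v _ (by decide), F3.v _ (by decide), e23]
    · rw [F4.v _ (by decide), F3.v _ (by decide), e25]

end RAM

namespace RAM

/-! ### The programs -/

/-- Distances are at most the number of vertices times the largest weight. -/
theorem _root_.Scene.d_le_mul {S : Scene} {W : ℕ} (hW : ∀ u v w κ, S.E u v w κ → w ≤ W) :
    ∀ v < S.N, S.d v ≤ W * S.N := by
  have hp : ∀ {u x}, Wk S.Step (S.p 0) u x → S.d u ≤ x := fun h => by
    have := Scene.d_le_walk h; rw [S.d0] at this; omega
  -- Induction on the distance, with the number of strictly closer vertices in place of the number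
  -- of edges: the predecessor on a shortest walk is strictly closer, so this number grows with
  -- every edge.
  suffices h : ∀ n v, S.d v = n → v < S.N →
      S.d v ≤ W * ((Finset.range S.N).filter fun u => S.d u < S.d v).card from fun v hv =>
    (h _ v rfl hv).trans (Nat.mul_le_mul_left _ ((Finset.card_filter_le _ _).trans (by simp)))
  intro n
  induction n using Nat.strong_induction_on with
  | _ n ih =>
    rintro v rfl hv
    have hw : ∀ {x}, Wk S.Step (S.p 0) v x → x = S.d v →
      S.d v ≤ W * ((Finset.range S.N).filter fun u => S.d u < S.d v).card := by
      intro x h hx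
      cases h with
      | refl => omega
      | @snoc u _ x w h1 h2 =>
        obtain ⟨κ, hE⟩ := h2
        have k1 := hp h1
        have k2 := S.pos hE
        have k3 := hW _ _ _ _ hE
        have k4 := (S.lt hE).1
        have k5 := S.d_le hE
        have k6 := ih (S.d u) (by omega) u rfl k4
        have k7 : ((Finset.range S.N).filter fun z => S.d z < S.d u).card + 1 ≤
            ((Finset.range S.N).filter fun z => S.d z < S.d v).card := by
          rw [← Finset.card_insert_of_notMem (a := u) (by simp)]
          refine Finset.card_le_card fun z hz => ?_
          simp only [Finset.mem_insert, Finset.mem_filter, Finset.mem_range] at hz ⊢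
          rcases hz with rfl | hz
          · exact ⟨k4, by omega⟩
          · exact ⟨hz.1, by omega⟩
        calc S.d v ≤ W * (((Finset.range S.N).filter fun z => S.d z < S.d u).card + 1) := by
              rw [Nat.mul_add]; omega
          _ ≤ _ := Nat.mul_le_mul_left _ k7
    exact hw (S.d_ex v hv) rfl

/-- Puts the length of the input into the base register. -/
def prologue : Prog :=
  .seq (.const 101 3) (.seq (.load 101 101) (.seq (.const 102 1) (.seq (.load 102 102)
    (.seq (.const 103 4) (.seq (.op .mul 102 102 103) (.seq (.op .add 101 101 102)
      (.op .add 100 101 103)))))))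

theorem exec_prologue {B m L : ℕ} {σ : State} (h1 : σ.mem 1 = m) (h3 : σ.mem 3 = L)
    (hB : L + 4 * m + 4 < B) :
    ∃ τ, Exec B prologue σ τ 8 ∧ τ.mem = σ.mem ∧ τ.reg 100 = L + 4 * m + 4 ∧
      ∀ x < 100, τ.reg x = σ.reg x := by
  refine ⟨_, .seq (.const _ _ _ (by omega)) (.seq (.load _ _ _ ?_ ?_) (.seq (.const _ _ _ (by omega))
    (.seq (.load _ _ _ ?_ ?_) (.seq (.const _ _ _ (by omega)) (.seq (.op _ _ _ _ _ ?_)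
    (.seq (.op _ _ _ _ _ ?_) (.op _ _ _ _ _ ?_))))))), ?_, ?_, fun x hx => by
      simp [State.setReg, show x ≠ 100 by omega, show x ≠ 101 by omega, show x ≠ 102 by omega,
        show x ≠ 103 by omega]⟩
  all_goals simp [State.setReg, Op.eval, h1, h3]
  all_goals omega

def copyBody : Prog :=
  .seq (.op .add 102 101 100) (.seq (.load 102 102) (.seq (.store 101 102) (.seq (.const 103 1)
    (.op .add 101 101 103))))

/-- Moves the first cells after the base to the front; their number is in register `45`. -/
def copyProg : Prog := .seq (.const 101 0) (.loop 101 45 copyBody)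

theorem exec_copyBody {B X j : ℕ} {σ : State} (h0 : σ.reg 100 = X) (h1 : σ.reg 101 = j)
    (hB : X + j + 1 < B) (hm : σ.mem (X + j) < B) :
    ∃ τ, Exec B copyBody σ τ 5 ∧ τ.reg 100 = X ∧ τ.reg 101 = j + 1 ∧ τ.reg 45 = σ.reg 45 ∧
      τ.mem = Function.update σ.mem j (σ.mem (X + j)) := by
  refine ⟨_, .seq (.op _ _ _ _ _ ?_) (.seq (.load _ _ _ ?_ ?_) (.seq (.store _ _ _ ?_ ?_)
    (.seq (.const _ _ _ (by omega)) (.op _ _ _ _ _ ?_)))), ?_, ?_, ?_, ?_⟩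
  all_goals simp [State.setReg, State.setMem, Op.eval, h0, h1, add_comm j X]
  all_goals omega

/-- Source and target may overlap. Copying upwards is safe since the source cell `X + l` lies above
every cell that has been overwritten by then. -/
theorem exec_copyLoop {B X Z : ℕ} (hX : 0 < X) (hB : X + Z + 1 < B) :
    ∀ k j σ, j + k = Z → σ.reg 100 = X → σ.reg 101 = j → σ.reg 45 = Z → (∀ l, σ.mem l < B) →
      ∃ τ, Exec B (.loop 101 45 copyBody) σ τ (6 * k + 1) ∧
        (∀ l, l < j → τ.mem l = σ.mem l) ∧ ∀ l, j ≤ l → l < Z → τ.mem l = σ.mem (X + l) := by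
  intro k
  induction k with
  | zero =>
    intro j σ hj h0 h1 h2 _
    exact ⟨σ, .loopFalse (by omega), fun _ _ => rfl, fun l h3 h4 => by omega⟩
  | succ k ih =>
    intro j σ hj h0 h1 h2 hm
    obtain ⟨τ, k1, k2, k3, k4, k5⟩ := exec_copyBody h0 h1 (by omega) (hm (X + j))
    obtain ⟨ρ, k6, k7, k8⟩ := ih (j + 1) τ (by omega) k2 k3 (k4.trans h2) (fun l => by
      rw [k5, Function.update_apply]; split <;> exact hm _)
    refine ⟨ρ, (Exec.loopTrue (by omega) k1 k6).cast (by omega), fun l hl => ?_, fun l h3 h4 => ?_⟩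
    · rw [k7 l (by omega), k5, Function.update_of_ne (by omega)]
    · rcases h3.eq_or_lt with rfl | h3
      · rw [k7 j (by omega), k5, Function.update_self]
      · rw [k8 l h3 h4, k5, Function.update_of_ne (by omega)]

theorem exec_copyProg {B X Z : ℕ} {σ : State} (hX : 0 < X) (hB : X + Z + 1 < B) (h0 : σ.reg 100 = X)
    (h2 : σ.reg 45 = Z) (hm : ∀ l, σ.mem l < B) :
    ∃ τ, Exec B copyProg σ τ (6 * Z + 2) ∧ ∀ l < Z, τ.mem l = σ.mem (X + l) := by
  obtain ⟨τ, k1, -, k2⟩ := exec_copyLoop hX hB Z 0 (σ.setReg 101 0) (by omega)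
    (by simp [State.setReg, h0]) (by simp [State.setReg]) (by simp [State.setReg, h2]) hm
  exact ⟨τ, (Exec.seq (.const _ _ _ (by omega)) k1).cast (by omega), fun l hl => k2 l (by omega) hl⟩

/-- Variable `45` receives the size of the data structure: `40` interleaved arrays, cut off after
`(5 ρ + nc + 6) N` entries each. -/
def buildCmd : Cmd :=
  readP ;; buildCore ;; .set 45 ((.c 5 * .v vRho + .v vNc + .c 6) * .v vN * .c 40)

def buildProg : Prog := .seq prologue (.seq buildCmd.code copyProg)

theorem buildCmd_ok : buildCmd.ok = true := by decide

/-- The list `mem` describes the scene `S` with `m` edges. -/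
structure Input (S : Scene) (m : ℕ) (mem : ℕ → ℕ) : Prop where
  hN : mem 0 = S.N
  hm : mem 1 = m
  hsrc : mem 2 = S.p 0
  hL : mem 3 = S.L
  hP : ∀ a < S.L, mem (4 + a) = S.p a
  E : ∀ u v w κ, S.E u v w κ ↔ ∃ j < m,
    (mem (4 + S.L + 4 * j) = u ∧ mem (4 + S.L + 4 * j + 1) = v ∨
      mem (4 + S.L + 4 * j) = v ∧ mem (4 + S.L + 4 * j + 1) = u) ∧
    mem (4 + S.L + 4 * j + 2) = w ∧ mem (4 + S.L + 4 * j + 3) = κ.toNat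
  fl : ∀ j < m, mem (4 + S.L + 4 * j + 3) ≤ 1
  end_ : ∀ j, 4 + S.L + 4 * m ≤ j → mem j = 0

theorem Input.flag {S : Scene} {m : ℕ} {mem : ℕ → ℕ} (h : Input S m mem) {j : ℕ} (hj : j < m) :
    ∃ κ, S.E (mem (4 + S.L + 4 * j)) (mem (4 + S.L + 4 * j + 1)) (mem (4 + S.L + 4 * j + 2)) κ := by
  refine ⟨decide (mem (4 + S.L + 4 * j + 3) = 1), (h.E _ _ _ _).2 ⟨j, hj, .inl ⟨rfl, rfl⟩, rfl, ?_⟩⟩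
  have := h.fl j hj
  rcases (show mem (4 + S.L + 4 * j + 3) = 0 ∨ mem (4 + S.L + 4 * j + 3) = 1 by omega) with h | h <;>
    simp [h]

theorem Input.lt {S : Scene} {m : ℕ} {mem : ℕ → ℕ} (h : Input S m mem) {j : ℕ} (hj : j < m) :
    mem (4 + S.L + 4 * j) < S.N ∧ mem (4 + S.L + 4 * j + 1) < S.N :=
  let ⟨_, hs⟩ := h.flag hj
  S.lt hs

theorem Input.env {S : Scene} {m M lg : ℕ} {mem : ℕ → ℕ} (h : Input S m mem)
    (hN : S.p 0 < S.N) (hLN : S.L ≤ S.N)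
    (hI : 2 * (S.N * (∑ j ∈ Finset.range m, mem (4 + S.L + 4 * j + 2) + 1) + 1) < M) (hlg : S.N ≤ 2 ^ lg)
    (hU : ∀ j < m, mem (4 + S.L + 4 * j) < S.N) (hV : ∀ j < m, mem (4 + S.L + 4 * j + 1) < S.N) :
    Env M S (arOf S.N m (fun j => mem (4 + S.L + 4 * j)) (fun j => mem (4 + S.L + 4 * j + 1))
      (fun j => mem (4 + S.L + 4 * j + 2)) (fun j => mem (4 + S.L + 4 * j + 3)) hU hV)
      (S.N * (∑ j ∈ Finset.range m, mem (4 + S.L + 4 * j + 2) + 1) + 1) lg := by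
  set Ws := ∑ j ∈ Finset.range m, mem (4 + S.L + 4 * j + 2) with hS
  have hNS : Ws + 1 ≤ S.N * (Ws + 1) := Nat.le_mul_of_pos_left _ (by omega)
  have hNS' : S.N ≤ S.N * (Ws + 1) := Nat.le_mul_of_pos_right _ (by omega)
  have hw : ∀ j < m, mem (4 + S.L + 4 * j + 2) ≤ Ws := fun j hj =>
    Finset.single_le_sum (f := fun j => mem (4 + S.L + 4 * j + 2)) (fun _ _ => Nat.zero_le _)
      (Finset.mem_range.2 hj)
  have hex : ∀ e, 1 ≤ e → e ≤ 2 * m → ∃ j < m, e = 2 * j + 1 ∨ e = 2 * j + 2 := fun e h1 h2 =>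
    ⟨(e - 1) / 2, by omega, by omega⟩
  refine ⟨rfl, fun u v w κ => ?_, fun e h1 h2 => ?_, hN, fun v hv => ?_, by omega, fun e h1 h2 => ?_,
    ?_, hI, hlg⟩
  · rw [h.E]
    constructor
    · rintro ⟨j, hj, ⟨e1, e2⟩ | ⟨e1, e2⟩, e3, e4⟩
      · obtain ⟨k1, k2, k3, k4⟩ := arOf_odd (W := fun j => mem (4 + S.L + 4 * j + 2))
          (K := fun j => mem (4 + S.L + 4 * j + 3)) hU hV j
        exact ⟨2 * j + 1, by omega, by simp only [arOf]; omega, k1.trans e1, k2.trans e2, k3.trans e3,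
          k4.trans e4⟩
      · obtain ⟨k1, k2, k3, k4⟩ := arOf_even (W := fun j => mem (4 + S.L + 4 * j + 2))
          (K := fun j => mem (4 + S.L + 4 * j + 3)) hU hV j
        exact ⟨2 * j + 2, by omega, by simp only [arOf]; omega, k1.trans e2, k2.trans e1, k3.trans e3,
          k4.trans e4⟩
    · rintro ⟨e, h1, h2, e1, e2, e3, e4⟩
      obtain ⟨j, hj, rfl | rfl⟩ := hex e h1 h2
      · obtain ⟨k1, k2, k3, k4⟩ := arOf_odd (W := fun j => mem (4 + S.L + 4 * j + 2))
          (K := fun j => mem (4 + S.L + 4 * j + 3)) hU hV j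
        exact ⟨j, hj, .inl ⟨k1.symm.trans e1, k2.symm.trans e2⟩, k3.symm.trans e3, k4.symm.trans e4⟩
      · obtain ⟨k1, k2, k3, k4⟩ := arOf_even (W := fun j => mem (4 + S.L + 4 * j + 2))
          (K := fun j => mem (4 + S.L + 4 * j + 3)) hU hV j
        exact ⟨j, hj, .inr ⟨k2.symm.trans e2, k1.symm.trans e1⟩, k3.symm.trans e3, k4.symm.trans e4⟩
  · exact h.fl _ (by simp only [arOf] at h2; omega)
  · have := Scene.d_le_mul (W := Ws) (fun u v w κ hE => by
      obtain ⟨j, hj, -, rfl, -⟩ := (h.E _ _ _ _).1 hE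
      exact hw j hj) v hv
    have e : S.N * (Ws + 1) = Ws * S.N + S.N := by ring
    omega
  · have := hw ((e - 1) / 2) (by simp only [arOf] at h2; omega)
    simp only [arOf]; omega
  · simp only [arOf]; omega

/-- The cover `K` bounds the number of centers but is not given to the program. After the final copy
the arrays start at address `0`, without the input in front of them. -/
theorem exec_build {M : ℕ} {S : Scene} {m lg : ℕ} {mem : ℕ → ℕ} {K : Finset ℕ} (hM : 1000 ≤ M)
    (h : Input S m mem) (hN : S.p 0 < S.N) (hLN : S.L ≤ S.N) (hinj : ∀ a < S.L, ∀ b < S.L, S.p a = S.p b → a = b)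
    (hI : 20 * (S.N * (∑ j ∈ Finset.range m, mem (4 + S.L + 4 * j + 2) + 1) + 1) < M)
    (hlg : S.N ≤ 2 ^ lg) (hmem : ∀ j, mem j < M) (hX : 4 + S.L + 4 * m < M)
    (hK : 40 * ((5 * S.N + 2 * K.card + 6) * S.N) < M)
    (hcov : ∀ u v w, S.E u v w true → u ∈ K ∨ v ∈ K) :
    ∃ σ time ρ nc D I, Exec (M ^ 12) buildProg ⟨fun _ => 0, mem⟩ σ time ∧
      1 ≤ ρ ∧ ρ ≤ S.N ∧ (ρ - 1) * (ρ - 1) < S.N ∧ nc ≤ 2 * K.card ∧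
      I = S.N * (∑ j ∈ Finset.range m, mem (4 + S.L + 4 * j + 2) + 1) + 1 ∧
      time ≤ (2 * m + S.N + 1) * (ρ + nc) * (lg * 400 + 12000) ∧ (∀ a j, D a j < M) ∧
      QData S I (4 * ρ) nc ((5 * ρ + nc + 6) * S.N) D ∧
      ∀ a < 40, ∀ j < (5 * ρ + nc + 6) * S.N, σ.mem (40 * j + a) = D a j := by
  obtain ⟨B, hBM⟩ : ∃ B, B = M ^ 12 := ⟨_, rfl⟩
  have hMB : M * 1000 ≤ B := by
    rw [hBM, show M ^ 12 = M * M ^ 11 by ring]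
    exact Nat.mul_le_mul_left _ (hM.trans (Nat.le_self_pow (by norm_num) M))
  obtain ⟨I, hIe⟩ : ∃ I, I = S.N * (∑ j ∈ Finset.range m, mem (4 + S.L + 4 * j + 2) + 1) + 1 := ⟨_, rfl⟩
  have hNI : S.N ≤ S.N * (∑ j ∈ Finset.range m, mem (4 + S.L + 4 * j + 2) + 1) :=
    Nat.le_mul_of_pos_right _ (by omega)
  have hKN : 5 * S.N + 2 * K.card + 6 ≤ (5 * S.N + 2 * K.card + 6) * S.N :=
    Nat.le_mul_of_pos_right _ (by omega)
  have hZ : ∀ ρ nc, ρ ≤ S.N → nc ≤ 2 * K.card → 40 * ((5 * ρ + nc + 6) * S.N) < M := fun ρ nc h1 h2 =>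
    lt_of_le_of_lt (Nat.mul_le_mul_left _ (Nat.mul_le_mul_right _ (by omega))) hK
  rw [← hIe] at hI
  have hIN : S.N + 1 ≤ I := by omega
  obtain ⟨τ, x1, x2, x3, x4⟩ := exec_prologue (B := M ^ 12) (σ := ⟨fun _ => 0, mem⟩) h.hm h.hL (by omega)
  obtain ⟨s, hse⟩ : ∃ s : St, s = ⟨fun _ => 0, fun _ _ => 0, mem⟩ := ⟨_, rfl⟩
  have sv : ∀ x, s.v x = 0 := by simp [hse]
  have sa : ∀ a j, s.a a j = 0 := by simp [hse]
  have si : s.i = mem := by simp [hse]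
  have hs : Bd M s := ⟨fun x => by rw [sv]; omega, fun a j => by rw [sa]; omega, fun j => by
    rw [si]; exact hmem j⟩
  have hR : Rep (S.L + 4 * m + 4) s τ := by
    refine ⟨fun x hx => by rw [x4 x hx, sv], x3, fun a _ j => ?_, fun j _ => by rw [x2, si],
      fun j hj => by rw [si]; exact h.end_ j (by omega)⟩
    rw [x2, sa]; exact h.end_ _ (by omega)
  have hU : ∀ j < m, mem (4 + S.L + 4 * j) < S.N := fun j hj => (h.lt hj).1
  have hV : ∀ j < m, mem (4 + S.L + 4 * j + 1) < S.N := fun j hj => (h.lt hj).2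
  have hE := h.env (M := M) hN hLN (by rw [← hIe]; omega) hlg hU hV
  rw [← hIe] at hE
  have hodd := arOf_odd (W := fun j => mem (4 + S.L + 4 * j + 2)) (K := fun j => mem (4 + S.L + 4 * j + 3))
    hU hV
  have heven := arOf_even (W := fun j => mem (4 + S.L + 4 * j + 2))
    (K := fun j => mem (4 + S.L + 4 * j + 3)) hU hV
  have hpair := arOf_paired (W := fun j => mem (4 + S.L + 4 * j + 2))
    (K := fun j => mem (4 + S.L + 4 * j + 3)) hU hV
  have hGm : (arOf S.N m (fun j => mem (4 + S.L + 4 * j)) (fun j => mem (4 + S.L + 4 * j + 1))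
      (fun j => mem (4 + S.L + 4 * j + 2)) (fun j => mem (4 + S.L + 4 * j + 3)) hU hV).m = m := rfl
  have hGN : (arOf S.N m (fun j => mem (4 + S.L + 4 * j)) (fun j => mem (4 + S.L + 4 * j + 1))
      (fun j => mem (4 + S.L + 4 * j + 2)) (fun j => mem (4 + S.L + 4 * j + 3)) hU hV).N = S.N := rfl
  generalize arOf S.N m (fun j => mem (4 + S.L + 4 * j)) (fun j => mem (4 + S.L + 4 * j + 1))
      (fun j => mem (4 + S.L + 4 * j + 2)) (fun j => mem (4 + S.L + 4 * j + 3)) hU hV = G at *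
  have hcov' : ∀ e, 1 ≤ e → e ≤ 2 * G.m → G.fl e = 1 → G.fr e ∈ K ∨ G.en e ∈ K := fun e h1 h2 h3 =>
    hcov _ _ _ ((hE.E _ _ _ _).2 ⟨e, h1, h2, rfl, rfl, rfl, by simp [h3]⟩)
  have main : wp M buildCmd s fun t c => ∃ ρ nc, 1 ≤ ρ ∧ ρ ≤ S.N ∧ (ρ - 1) * (ρ - 1) < S.N ∧
      nc ≤ 2 * K.card ∧ t.v 45 = 40 * ((5 * ρ + nc + 6) * S.N) ∧
      c ≤ (2 * m + S.N + 1) * (ρ + nc) * (lg * 400 + 9000) ∧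
      QData S I (4 * ρ) nc ((5 * ρ + nc + 6) * S.N) t.a := by
    unfold buildCmd
    rw [wp_seq]
    refine wp_mono (wp_readP (G := G) (N := S.N) (m := m) (L := S.L) (p := S.p) (I := I) hs sa (sv _)
      (by rw [si, h.hN]) (by rw [si, h.hm]) (by rw [si, h.hL]) (fun a ha => by rw [si, h.hP a ha])
      hGN hGm (fun j _ => by rw [si]; exact hodd j) (fun j _ => by rw [si]; exact heven j)
      (by rw [si, hIe]) (by omega) (by omega) (by omega) hinj) ?_
    rintro t1 c1 F1 ⟨l1, g1, g2, g3, g4, g5, g6, g7⟩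
    have B1 : Base M S G I t1 := ⟨g1, F1.bd hs, g2, g4, by rw [g5, si, h.hsrc]⟩
    rw [wp_seq]
    refine wp_mono (wp_buildCore (K := K) hE B1 (fun a ha => (g6 a ha).2) (fun v hv hP => g7 v hv fun a ha e =>
      hP ⟨a, ha, e⟩) (fun a ha => (g6 a ha).1) (g3.trans hGm.symm) hpair
      (fun l => by rw [F1.a _ (by decide), sa]) (fun l => by rw [F1.a _ (by decide), sa]) (by omega)
      (by omega) hcov') ?_
    rintro t2 c2 F2 ⟨ρ, nc, r1, r2, r3, r4, r5, r6, r7, l2, hQ⟩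
    have hz := hZ ρ nc r2 r4
    simp only [wp_set, Expr.eval_mul, Expr.eval_add, Expr.eval_c, Expr.eval_v, r5, r6, r7]
    rw [mul_comm _ 40]
    refine ⟨hz, ρ, nc, r1, r2, r3, r4, by simp, ?_, by simpa using hQ⟩
    rw [hGm, hGN] at l2
    have a1 : 2 * m + S.N + 1 ≤ (2 * m + S.N + 1) * (ρ + nc) := Nat.le_mul_of_pos_right _ (by omega)
    have a2 : (2 * m + S.N + 1) * (ρ + nc) * (lg * 400 + 9000) =
      (2 * m + S.N + 1) * (ρ + nc) * (lg * 400 + 8000) + 1000 * ((2 * m + S.N + 1) * (ρ + nc)) := by ring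
    simp
    omega
  obtain ⟨t, c, hbig, ρ, nc, r1, r2, r3, r4, r5, l1, hQ⟩ := main
  have hz := hZ ρ nc r2 r4
  have Bt := hbig.fr.bd hs
  obtain ⟨τ2, x5, x6⟩ := hbig.exec hM (by omega) buildCmd_ok hs τ hR
  have hmemB : ∀ l, τ2.mem l < M ^ 12 := by
    intro l
    by_cases hl : l < S.L + 4 * m + 4
    · rw [x6.i l hl]; have := Bt.i l; omega
    · have := x6.a ((l - (S.L + 4 * m + 4)) % 40) (Nat.mod_lt _ (by omega)) ((l - (S.L + 4 * m + 4)) / 40)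
      rw [show S.L + 4 * m + 4 + 40 * ((l - (S.L + 4 * m + 4)) / 40) + (l - (S.L + 4 * m + 4)) % 40 = l by
        omega] at this
      rw [this]
      have := Bt.a ((l - (S.L + 4 * m + 4)) % 40) ((l - (S.L + 4 * m + 4)) / 40)
      omega
  obtain ⟨τ3, x7, x8⟩ := exec_copyProg (B := M ^ 12) (X := S.L + 4 * m + 4) (by omega) (by omega) x6.base
    ((x6.v 45 (by omega)).trans r5) hmemB
  refine ⟨τ3, _, ρ, nc, t.a, I, .seq x1 (.seq x5 x7), r1, r2, r3, r4, hIe, ?_, Bt.a, hQ,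
    fun a ha j hj => ?_⟩
  · have a1 : 2 * m + S.N + 1 ≤ (2 * m + S.N + 1) * (ρ + nc) := Nat.le_mul_of_pos_right _ (by omega)
    have a2 : (2 * m + S.N + 1) * (ρ + nc) * (lg * 400 + 12000) =
      (2 * m + S.N + 1) * (ρ + nc) * (lg * 400 + 9000) + 3000 * ((2 * m + S.N + 1) * (ρ + nc)) := by ring
    have a3 : (5 * ρ + nc + 6) * S.N ≤ 11 * ((2 * m + S.N + 1) * (ρ + nc)) := by
      calc (5 * ρ + nc + 6) * S.N ≤ (11 * (ρ + nc)) * (2 * m + S.N + 1) :=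
            Nat.mul_le_mul (by omega) (by omega)
        _ = _ := by ring
    omega
  · rw [x8 _ (by omega), ← x6.a a ha j]
    congr 1; omega

theorem exec_query {M lg I K nc W i t a b : ℕ} {S : Scene} {D : ℕ → ℕ → ℕ} {mem : ℕ → ℕ} (hM : 1000 ≤ M)
    (hQ : QData S I K nc W D) (hD : ∀ a j, D a j < M)
    (hmem : ∀ a < 40, ∀ j < W, mem (40 * j + a) = D a j) (hmM : ∀ l, mem l < M)
    (hi : i + 1 < S.L) (ht : t < S.N)
    (h12 : (a = S.p i ∧ b = S.p (i + 1)) ∨ (a = S.p (i + 1) ∧ b = S.p i))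
    (hN : S.N < M) (hI : 2 * I < M) (hKM : 2 * K + 2 < M) (hIK : I + K + 2 < M) (hlg : K + 1 ≤ 2 ^ lg) :
    ∃ τ time, Exec (M ^ 12) queryC.code ⟨fun x => [t, a, b].getD x 0, mem⟩ τ time ∧
      time ≤ lg * 50 + nc * 200 + 600 ∧
      (τ.reg 0 ≠ 0 → (t = S.p 0 ∧ τ.reg 1 = 0) ∨ (t ≠ S.p 0 ∧ S.Out i t (τ.reg 1) (τ.reg 2))) ∧
      ∀ ℓ, S.Safe i t ℓ → (∀ x, Wk (S.AStep i) (S.p 0) t x → ℓ ≤ x) → ℓ < I →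
        τ.reg 0 ≠ 0 ∧ τ.reg 1 ≤ ℓ := by
  have hab : a < M ∧ b < M := by
    have h1 := hQ.p_lt i (by omega)
    have h2 := hQ.p_lt (i + 1) hi
    omega
  -- The base register is `0` in the initial state of a query, so the arrays start at address `0`
  -- and the input is empty. Arrays numbered from `40` on do not exist in memory and are filled in
  -- from `D`.
  obtain ⟨s, hse⟩ : ∃ s : St, s = ⟨fun x => [t, a, b].getD x 0,
    fun c j => if c < 40 then mem (40 * j + c) else D c j, fun _ => 0⟩ := ⟨_, rfl⟩
  have sv : s.v = fun x => [t, a, b].getD x 0 := by rw [hse]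
  have sa : s.a = fun c j => if c < 40 then mem (40 * j + c) else D c j := by rw [hse]
  have hs : Bd M s := by
    refine ⟨fun x => ?_, fun c j => ?_, fun j => by rw [hse]; show 0 < M; omega⟩
    · rw [sv]
      rcases x with _ | _ | _ | x
      · show t < M; omega
      · exact hab.1
      · exact hab.2
      · show 0 < M; omega
    · rw [sa]; dsimp only; split
      · exact hmM _
      · exact hD _ _
  have hQ' : QData S I K nc W s.a := hQ.congr fun c j hj => by
    rw [sa]; dsimp only; split
    · next hc => exact hmem c hc j hj
    · rfl
  have hR : Rep 0 s ⟨fun x => [t, a, b].getD x 0, mem⟩ := by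
    refine ⟨fun x _ => by rw [sv], rfl, fun c hc j => ?_, fun j hj => by omega, fun j _ => by rw [hse]⟩
    rw [sa]; simp [hc]
  obtain ⟨u, c, hbig, k1, k2, k3⟩ := wp_query hQ' hs hi ht (by rw [sv]; rfl) (by rw [sv]; exact h12) hI hKM hIK
    hlg
  obtain ⟨τ, x1, x2⟩ := hbig.exec hM (by omega) queryC_ok hs _ hR
  refine ⟨τ, c, x1, k1, ?_, ?_⟩
  · rw [x2.v 0 (by omega), x2.v 1 (by omega), x2.v 2 (by omega)]; exact k2
  · rw [x2.v 0 (by omega), x2.v 1 (by omega)]; exact k3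

end RAM

/-! ## Routes -/

namespace Route

variable {α β : Type} {A A' : α → α → ℕ → Prop} {u v t c : α} {l : List α} {ℓ w : ℕ}

theorem mono (h : Route A u v l ℓ) (hA : ∀ x y w, A x y w → A' x y w) : Route A' u v l ℓ := by
  induction h with
  | nil => exact .nil _
  | cons h _ ih => exact .cons (hA _ _ _ h) ih

theorem map {B : β → β → ℕ → Prop} {f : α → β} (h : Route A u v l ℓ)
    (hA : ∀ x y w, A x y w → B (f x) (f y) w) : Route B (f u) (f v) (l.map f) ℓ := by
  induction h with
  | nil => exact .nil _
  | cons h _ ih => exact .cons (hA _ _ _ h) ih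

theorem snoc (h : Route A u v l ℓ) (h' : A v t w) : Route A u t (l ++ [t]) (ℓ + w) := by
  induction h with
  | nil => simpa using Route.cons h' (.nil t)
  | cons h _ ih => rw [add_assoc]; exact .cons h (ih h')

theorem reverse (hs : ∀ x y w, A x y w → A y x w) (h : Route A u v l ℓ) : Route A v u l.reverse ℓ := by
  induction h with
  | nil => exact .nil _
  | cons h _ ih => rw [List.reverse_cons, add_comm]; exact ih.snoc (hs _ _ _ h)

theorem start_mem (h : Route A u v l ℓ) : u ∈ l := by cases h <;> simp

theorem split (h : Route A u t l ℓ) (hc : c ∈ l) : ∃ l₁ l₂ ℓ₁ ℓ₂, l = l₁ ++ c :: l₂ ∧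
    Route A u c (l₁ ++ [c]) ℓ₁ ∧ Route A c t (c :: l₂) ℓ₂ ∧ ℓ₁ + ℓ₂ = ℓ := by
  induction h with
  | nil u =>
    obtain rfl : c = u := by simpa using hc
    exact ⟨[], [], 0, 0, rfl, .nil _, .nil _, rfl⟩
  | @cons u v t w ℓ l h h' ih =>
    by_cases hu : c = u
    · subst hu
      exact ⟨[], l, 0, _, rfl, .nil _, .cons h h', by simp⟩
    · obtain ⟨l₁, l₂, ℓ₁, ℓ₂, rfl, h1, h2, rfl⟩ := ih (by simpa [hu] using hc)
      exact ⟨u :: l₁, l₂, w + ℓ₁, ℓ₂, rfl, .cons h h1, h2, by omega⟩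

theorem exists_nodup (h : Route A u t l ℓ) : ∃ l' ℓ', Route A u t l' ℓ' ∧ ℓ' ≤ ℓ ∧ l'.Nodup := by
  induction h with
  | nil u => exact ⟨[u], 0, .nil _, le_rfl, by simp⟩
  | @cons u v t w ℓ l h h' ih =>
    obtain ⟨l', ℓ', h1, h2, h3⟩ := ih
    by_cases hu : u ∈ l'
    · obtain ⟨l₁, l₂, ℓ₁, ℓ₂, rfl, -, h4, h5⟩ := h1.split hu
      exact ⟨_, _, h4, by omega, (List.nodup_append.1 h3).2.1⟩
    · exact ⟨_, _, .cons h h1, by omega, List.nodup_cons.2 ⟨hu, h3⟩⟩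

theorem mem_of_closed {K : α → Prop} (h : Route A u v l ℓ) (hu : K u)
    (hA : ∀ x y w, A x y w → K y) : ∀ x ∈ l, K x := by
  induction h with
  | nil => simpa using hu
  | cons h _ ih =>
    intro x hx
    rcases List.mem_cons.1 hx with rfl | hx
    · exact hu
    · exact ih (hA _ _ _ h) x hx

theorem dist_le (h : Route A u v l ℓ) : routeDist A u v ≤ ℓ :=
  iInf_le_of_le l (iInf_le_of_le ℓ (iInf_le _ h))

/-- Steps that avoid `c` are steps of `A'`. -/
theorem mono_of_notMem (h : Route A u v l ℓ) (hc : c ∉ l)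
    (hA : ∀ x y w, A x y w → x ≠ c → y ≠ c → A' x y w) : Route A' u v l ℓ := by
  induction h with
  | nil => exact .nil _
  | cons h h' ih =>
    simp only [List.mem_cons, not_or] at hc
    refine .cons (hA _ _ _ h (Ne.symm hc.1) ?_) (ih hc.2)
    rintro rfl
    exact hc.2 h'.start_mem

end Route

/-- A finite infimum of natural numbers is attained: otherwise all routes would weigh at least `w +
1`. -/
theorem exists_route {α : Type} {A : α → α → ℕ → Prop} {u v : α} {w : ℕ}
    (h : routeDist A u v = (w : ℕ∞)) : ∃ l, Route A u v l w := by
  by_contra hne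
  push Not at hne
  have : ((w + 1 : ℕ) : ℕ∞) ≤ routeDist A u v := by
    refine le_iInf fun l => le_iInf fun ℓ => le_iInf fun hr => ?_
    have h1 := hr.dist_le
    rw [h] at h1
    have h1 : w ≤ ℓ := by exact_mod_cast h1
    have h2 : w ≠ ℓ := by rintro rfl; exact hne l hr
    exact_mod_cast (show w + 1 ≤ ℓ by omega)
  rw [h] at this
  have : w + 1 ≤ w := by exact_mod_cast this
  omega

/-- If the edges of `A` are edges of `A'` or end at `c`, then simple routes are not much heavier. -/
theorem Route.nodup_le {α : Type} {A A' : α → α → ℕ → Prop} {B : ℕ} {c : α}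
    (hs : ∀ x y w, A x y w → A y x w)
    (hB : ∀ u v l ℓ, Route A' u v l ℓ → l.Nodup → ℓ ≤ B)
    (hA : ∀ x y w, A x y w → x ≠ c → y ≠ c → A' x y w) (hc : ∀ y w, A c y w → w ≤ B)
    {u v : α} {l : List α} {ℓ : ℕ} (h : Route A u v l ℓ) (hl : l.Nodup) : ℓ ≤ 4 * B := by
  -- A simple route from `c` is one edge at `c` followed by a simple route that avoids `c`, hence
  -- weighs at most `2 * B`. A simple route through `c` consists of two such halves, one of them
  -- reversed.
  have key : ∀ {v l ℓ}, Route A c v (c :: l) ℓ → (c :: l).Nodup → ℓ ≤ 2 * B := by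
    intro v l ℓ h hl
    cases h with
    | nil => omega
    | cons h1 h2 =>
      rw [List.nodup_cons] at hl
      have := hc _ _ h1
      have := hB _ _ _ _ (h2.mono_of_notMem hl.1 hA) hl.2
      omega
  by_cases hcl : c ∈ l
  · obtain ⟨l₁, l₂, ℓ₁, ℓ₂, rfl, h1, h2, rfl⟩ := h.split hcl
    have h3 := h1.reverse hs
    rw [List.reverse_append, List.reverse_singleton, List.singleton_append] at h3
    have := key h2 (List.nodup_append.1 hl).2.1
    have := key h3 (by
      rw [List.nodup_cons, List.nodup_reverse, List.mem_reverse]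
      rw [List.nodup_append] at hl
      exact ⟨fun h => hl.2.2 c h c (by simp) rfl, hl.1⟩)
    omega
  · have := hB _ _ _ _ (h.mono_of_notMem hcl hA) hl
    omega

/-! ## Invariants of the recursion -/

namespace Node

variable {V : Type} {H : Node V}

theorem step_added {u v : Option V} {w : ℕ} (h : H.added u v = w) : H.Step u v w := ⟨true, h⟩

theorem step_plain {u v : Option V} (h : H.plain.Adj u v) : H.Step u v 1 := ⟨false, h, rfl⟩

theorem step_cases {u v : Option V} {w : ℕ} (h : H.Step u v w) :
    H.added u v = w ∨ (H.plain.Adj u v ∧ w = 1) := by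
  obtain ⟨κ, h⟩ := h
  cases κ
  · exact .inr h
  · exact .inl h

/-- The weighted edges are covered by few vertices, and simple routes have a small weight. -/
def Light (H : Node V) (n : ℕ) : Prop :=
  -- Here `e` counts the generations that shrink the node by the factor `8 / 9`. The depth itself
  -- would not do, since a child can have as many vertices as its parent arbitrarily often.
  ∃ (e : ℕ) (C : Finset (Option V)), H.src ∈ C ∧ C.card ≤ e + 1 ∧
    (∀ u v, H.added u v ≠ ⊤ → u ∈ C ∨ v ∈ C) ∧ 9 ^ e * H.verts.card ≤ 8 ^ e * n ∧
    ∀ u v l ℓ, Route H.Step u v l ℓ → l.Nodup → ℓ ≤ n * 4 ^ e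

/-- `none_mem` keeps the name `none` free: when a new source is needed, the old source is not in
`N`, so an old artificial source cannot clash with the new one. -/
structure Good (H : Node V) (n : ℕ) : Prop where
  added_mem : ∀ {u v}, H.added u v ≠ ⊤ → u ∈ H.verts ∧ v ∈ H.verts
  plain_mem : ∀ {u v}, H.plain.Adj u v → u ∈ H.verts ∧ v ∈ H.verts
  symm : ∀ u v, H.added u v = H.added v u
  pos : ∀ u v, H.added u v ≠ 0
  loop : ∀ u, H.added u u = ⊤
  src_mem : H.src ∈ H.verts
  none_mem : none ∈ H.verts → H.src = none
  reach : ∀ v ∈ H.verts, ∃ l ℓ, Route H.Step H.src v l ℓ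
  light : H.Light n

namespace Good

variable {n : ℕ}

theorem step_mem (h : H.Good n) {u v : Option V} {w : ℕ} (hs : H.Step u v w) :
    u ∈ H.verts ∧ v ∈ H.verts := by
  rcases step_cases hs with hs | hs
  · exact h.added_mem (by rw [hs]; exact ENat.natCast_ne_top _)
  · exact h.plain_mem hs.1

theorem step_symm (h : H.Good n) {u v : Option V} {w : ℕ} (hs : H.Step u v w) : H.Step v u w := by
  rcases step_cases hs with hs' | ⟨hs', rfl⟩
  · exact step_added (by rw [h.symm, hs'])
  · exact step_plain hs'.symm

theorem step_pos (h : H.Good n) {u v : Option V} {w : ℕ} (hs : H.Step u v w) : 0 < w := by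
  rcases step_cases hs with hs | ⟨-, rfl⟩
  · rcases Nat.eq_zero_or_pos w with rfl | hw
    · exact absurd (by simpa using hs) (h.pos u v)
    · exact hw
  · omega

theorem step_ne (h : H.Good n) {u v : Option V} {w : ℕ} (hs : H.Step u v w) : u ≠ v := by
  rintro rfl
  rcases step_cases hs with hs | ⟨hs, -⟩
  · rw [h.loop] at hs; exact absurd hs.symm (ENat.natCast_ne_top _)
  · exact H.plain.loopless.irrefl _ hs

theorem exists_dist (h : H.Good n) {v : Option V} (hv : v ∈ H.verts) :
    ∃ k : ℕ, routeDist H.Step H.src v = k := by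
  obtain ⟨l, ℓ, hr⟩ := h.reach v hv
  exact ENat.ne_top_iff_exists.1 (ne_top_of_le_ne_top (ENat.natCast_ne_top ℓ) hr.dist_le) |>.imp
    fun _ e => e.symm

/-- Weights are positive, so the parent in the shortest path tree is strictly closer to the source.
-/
theorem tree_induction (h : H.Good n) (S : H.Split) {K : Finset (Option V)} {z : Option V}
    {Q : Option V → Prop} (hK : K ⊆ H.verts) (hsrc : ∀ v ∈ K, v ≠ z → v ≠ H.src)
    (hpar : ∀ v ∈ K, v ≠ z → S.par v ∈ K) (h0 : Q z)
    (step : ∀ v ∈ K, v ≠ z → S.par v ∈ K → ∀ w, H.Step (S.par v) v w → Q (S.par v) → Q v) :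
    ∀ v ∈ K, Q v := by
  suffices hk : ∀ k : ℕ, ∀ v ∈ K, routeDist H.Step H.src v = k → Q v by
    intro v hv
    obtain ⟨k, e⟩ := h.exists_dist (hK hv)
    exact hk k v hv e
  intro k
  induction k using Nat.strong_induction_on with
  | _ k ih =>
    intro v hv e
    by_cases hz : v = z
    · exact hz ▸ h0
    have hp := hpar v hv hz
    obtain ⟨w, h1, h2⟩ := S.par_dist v (hK hv) (hsrc v hv hz)
    obtain ⟨j, e'⟩ := h.exists_dist (hK hp)
    rw [e, e'] at h2
    have h3 : k = j + w := by exact_mod_cast h2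
    have := h.step_pos h1
    exact step v hv hz hp w h1 (ih j (by omega) _ hp e')

end Good

open Classical in
/-- The common form of the two children. -/
noncomputable def child (H : Node V) (K : Finset (Option V)) (c σ src' : Option V) : Node V where
  verts := insert c K
  src := src'
  plain := H.plainIn K
  added u v := min (H.addedIn K u v) (star c K (fun x => routeDist (H.StepOutside K) σ x) u v)

theorem right_eq (S : H.Split) : H.right S = H.child S.N (H.rightSrc S) H.src (H.rightSrc S) := rfl

theorem Split.r_mem (S : H.Split) : S.r ∈ S.M ∧ S.r ∈ S.N := (S.mem_inter _).2 rfl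

open Classical in
theorem left_eq (S : H.Split) : H.left S = H.child S.M S.r S.r H.src := by
  simp only [left, child, Finset.insert_eq_of_mem S.r_mem.1]

/-! ### Weighted edges, covers and route weights of a child. -/

section child

variable {n : ℕ} {K : Finset (Option V)} {c σ src' : Option V}

theorem star_ne_top {d : Option V → ℕ∞} {u v : Option V} (h : star c K d u v ≠ ⊤) :
    (u = c ∧ v ∈ K ∧ v ≠ c ∧ star c K d u v = d v) ∨ (v = c ∧ u ∈ K ∧ u ≠ c ∧ star c K d u v = d u) := by
  unfold star at h ⊢
  split_ifs at h ⊢ with h1 h2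
  · exact .inl ⟨h1.1, h1.2.1, h1.2.2, rfl⟩
  · exact .inr ⟨h2.1, h2.2.1, h2.2.2, rfl⟩
  · exact absurd rfl h

theorem star_symm (d : Option V → ℕ∞) (u v : Option V) : star c K d u v = star c K d v u := by
  unfold star
  by_cases hu : u = c <;> by_cases hv : v = c <;> simp [hu, hv]

theorem addedIn_ne_top {u v : Option V} (h : H.addedIn K u v ≠ ⊤) :
    u ∈ K ∧ v ∈ K ∧ H.addedIn K u v = H.added u v := by
  unfold addedIn at h ⊢
  split_ifs at h ⊢ with h1
  · exact ⟨h1.1, h1.2, rfl⟩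
  · exact absurd rfl h

/-- A weighted edge of the child is an old one or an edge of the star. -/
theorem child_added {u v : Option V} (h : (H.child K c σ src').added u v ≠ ⊤) :
    (u ∈ K ∧ v ∈ K ∧ (H.child K c σ src').added u v = H.added u v) ∨
    (u = c ∧ v ∈ K ∧ v ≠ c ∧ (H.child K c σ src').added u v = routeDist (H.StepOutside K) σ v) ∨
    (v = c ∧ u ∈ K ∧ u ≠ c ∧ (H.child K c σ src').added u v = routeDist (H.StepOutside K) σ u) := by
  change min _ _ ≠ ⊤ at h
  change (_ ∧ _ ∧ min _ _ = _) ∨ (_ ∧ _ ∧ _ ∧ min _ _ = _) ∨ (_ ∧ _ ∧ _ ∧ min _ _ = _)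
  rcases min_choice (H.addedIn K u v) (star c K (fun x => routeDist (H.StepOutside K) σ x) u v) with e | e
  · rw [e] at h ⊢
    obtain ⟨h1, h2, h3⟩ := addedIn_ne_top h
    exact .inl ⟨h1, h2, h3⟩
  · rw [e] at h ⊢
    rcases star_ne_top h with ⟨h1, h2, h3, h4⟩ | ⟨h1, h2, h3, h4⟩
    · exact .inr (.inl ⟨h1, h2, h3, h4⟩)
    · exact .inr (.inr ⟨h1, h2, h3, h4⟩)

theorem child_step {u v : Option V} {w : ℕ} (h : (H.child K c σ src').Step u v w) :
    (u ∈ K ∧ v ∈ K ∧ H.Step u v w) ∨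
    (u = c ∧ v ∈ K ∧ v ≠ c ∧ routeDist (H.StepOutside K) σ v = w) ∨
    (v = c ∧ u ∈ K ∧ u ≠ c ∧ routeDist (H.StepOutside K) σ u = w) := by
  rcases step_cases h with h | ⟨h', rfl⟩
  · have := child_added (H := H) (show (H.child K c σ src').added u v ≠ ⊤ by
      rw [h]; exact ENat.natCast_ne_top _)
    rw [h] at this
    rcases this with ⟨h1, h2, h3⟩ | ⟨h1, h2, h3, h4⟩ | ⟨h1, h2, h3, h4⟩
    · exact .inl ⟨h1, h2, step_added h3.symm⟩
    · exact .inr (.inl ⟨h1, h2, h3, h4.symm⟩)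
    · exact .inr (.inr ⟨h1, h2, h3, h4.symm⟩)
  · exact .inl ⟨h'.2.1, h'.2.2, step_plain h'.1⟩

theorem step_child {u v : Option V} {w : ℕ} (hu : u ∈ K) (hv : v ∈ K) (h : H.Step u v w) :
    ∃ w', (H.child K c σ src').Step u v w' := by
  rcases step_cases h with h | ⟨h', rfl⟩
  · have : (H.child K c σ src').added u v ≠ ⊤ := by
      refine ne_top_of_le_ne_top (ENat.natCast_ne_top w) ((min_le_left _ _).trans_eq ?_)
      simp only [addedIn, hu, hv, and_self, if_true, h]
    obtain ⟨w', e⟩ := ENat.ne_top_iff_exists.1 this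
    exact ⟨w', step_added e.symm⟩
  · exact ⟨1, step_plain (H := H.child K c σ src') ⟨h', hu, hv⟩⟩

/-- The two kinds of children. -/
def Kind (H : Node V) (K : Finset (Option V)) (c σ src' : Option V) : Prop :=
  (c = σ ∧ c ∈ K ∧ src' = H.src) ∨ (c = none ∧ none ∉ K ∧ σ ∉ K ∧ σ = H.src ∧ src' = c)

/-- If the child is smaller by the factor `8 / 9`, the center of the star joins the cover and
`Route.nodup_le` bounds the new simple routes. Otherwise the child is the old node up to renaming
`σ` to `c`: no route outside `K` has an inner vertex, so star edges are old edges, and cover and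
bound carry over without change of `e`. -/
theorem Good.child_light (h : H.Good n) (hk : H.Kind K c σ src')
    (hsz : 9 * (H.child K c σ src').verts.card ≤ 8 * H.verts.card ∨
      ((H.child K c σ src').verts.card ≤ H.verts.card ∧ ∀ x ∈ H.verts, x = σ ∨ x ∈ K))
    (hsymm : ∀ u v w, (H.child K c σ src').Step u v w → (H.child K c σ src').Step v u w) :
    (H.child K c σ src').Light n := by
  classical
  obtain ⟨e, C, h1, h2, h3, h4, h5⟩ := h.light
  rcases hsz with hsz | ⟨hsz, hall⟩
  · refine ⟨e + 1, insert c C, ?_, (Finset.card_insert_le _ _).trans (by omega), fun u v hne => ?_, ?_,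
      fun u v l ℓ hr hl => ?_⟩
    · rcases hk with ⟨-, -, e⟩ | ⟨-, -, -, -, e⟩
      · exact Finset.mem_insert_of_mem (e ▸ h1)
      · exact e ▸ Finset.mem_insert_self _ _
    · rcases child_added hne with ⟨-, -, k⟩ | ⟨rfl, -⟩ | ⟨rfl, -⟩
      · exact (h3 u v (k ▸ hne)).imp Finset.mem_insert_of_mem Finset.mem_insert_of_mem
      · exact .inl (Finset.mem_insert_self _ _)
      · exact .inr (Finset.mem_insert_self _ _)
    · calc 9 ^ (e + 1) * (H.child K c σ src').verts.card
          = 9 ^ e * (9 * (H.child K c σ src').verts.card) := by ring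
        _ ≤ 9 ^ e * (8 * H.verts.card) := Nat.mul_le_mul_left _ hsz
        _ = 8 * (9 ^ e * H.verts.card) := by ring
        _ ≤ 8 * (8 ^ e * n) := Nat.mul_le_mul_left _ h4
        _ = 8 ^ (e + 1) * n := by ring
    -- The weight of a star edge is a distance, hence at most the weight of a simple route of the
    -- parent.
    · have hstar : ∀ x (w : ℕ), routeDist (H.StepOutside K) σ x = (w : ℕ∞) → w ≤ n * 4 ^ e := by
        intro x w hd
        obtain ⟨l, hr⟩ := exists_route hd
        obtain ⟨l', ℓ', h6, -, h7⟩ := hr.exists_nodup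
        have h8 := h6.dist_le
        rw [hd] at h8
        have h8 : w ≤ ℓ' := by exact_mod_cast h8
        exact h8.trans (h5 _ _ _ _ (h6.mono fun _ _ _ h => h.1) h7)
      calc ℓ ≤ 4 * (n * 4 ^ e) := Route.nodup_le (c := c) hsymm h5 (fun x y w hs hx hy => ?_)
            (fun y w hs => ?_) hr hl
        _ = n * 4 ^ (e + 1) := by ring
      · rcases child_step hs with k | k | k
        · exact k.2.2
        · exact absurd k.1 hx
        · exact absurd k.1 hy
      · rcases child_step hs with k | k | k
        · exact h5 _ _ _ _ (.cons k.2.2 (.nil _)) (by simpa using h.step_ne k.2.2)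
        · exact hstar _ _ k.2.2.2
        · exact hstar _ _ k.2.2.2
  -- All vertices lie in `K` or equal `σ`. A simple route from `σ` outside `K` reaches `K` with its
  -- first edge; a second edge would return to `σ` or stay inside `K`.
  · have hedge : ∀ x (w : ℕ), x ∈ K → x ≠ c → routeDist (H.StepOutside K) σ x = (w : ℕ∞) →
        σ ∉ K ∧ H.Step σ x w := by
      intro x w hx hxc hd
      have hxσ : x ≠ σ := by
        rcases hk with ⟨rfl, -⟩ | ⟨-, -, k, -⟩
        · exact hxc
        · rintro rfl; exact k hx
      obtain ⟨l, hr⟩ := exists_route hd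
      obtain ⟨l', ℓ', h6, h7, h8⟩ := hr.exists_nodup
      have h9 := h6.dist_le
      rw [hd] at h9
      have h9 : w ≤ ℓ' := by exact_mod_cast h9
      obtain rfl : ℓ' = w := by omega
      cases h6 with
      | nil => exact absurd rfl hxσ
      | @cons _ y _ w₁ ℓ₁ l₁ s1 r1 =>
        have hy : y ∈ K := (hall y (h.step_mem s1.1).2).resolve_left (h.step_ne s1.1).symm
        refine ⟨fun hσ => s1.2 ⟨hσ, hy⟩, ?_⟩
        cases r1 with
        | nil => simpa using s1.1
        | @cons _ z _ w₂ ℓ₂ l₂ s2 r2 =>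
          exfalso
          rcases hall z (h.step_mem s2.1).2 with rfl | hz
          · have := r2.start_mem
            simp [this] at h8
          · exact s2.2 ⟨hy, hz⟩
    have hstep : ∀ x y w, (H.child K c σ src').Step x y w →
        H.Step (if x = c then σ else x) (if y = c then σ else y) w := by
      have hc : ∀ x ∈ K, (if x = c then σ else x) = x := by
        intro x hx
        split
        · next e =>
          rcases hk with ⟨k, -⟩ | ⟨k1, k2, -⟩
          · rw [e, k]
          · rw [e, k1] at hx; exact absurd hx k2
        · rfl
      intro x y w hs
      rcases child_step hs with ⟨k1, k2, k3⟩ | ⟨k1, k2, k3, k4⟩ | ⟨k1, k2, k3, k4⟩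
      · rw [hc x k1, hc y k2]; exact k3
      · rw [if_pos k1, if_neg k3]; exact (hedge y w k2 k3 k4).2
      · rw [if_pos k1, if_neg k3]; exact h.step_symm (hedge x w k2 k3 k4).2
    -- The old center is exchanged for the new one, so the cover does not grow. The case `c = σ`
    -- includes an artificial source that is replaced by one of the same name.
    refine ⟨e, if c = σ then C else insert c (C.erase σ), ?_, ?_, fun u v hne => ?_, ?_,
      fun u v l ℓ hr hl => ?_⟩
    · rcases hk with ⟨k1, -, k3⟩ | ⟨k1, k2, k3, k4, k5⟩
      · rw [if_pos k1]; exact k3 ▸ h1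
      · split
        · next e => rw [show (H.child K c σ src').src = src' from rfl, k5, e, k4]; exact h1
        · exact k5 ▸ Finset.mem_insert_self _ _
    · split
      · exact h2
      · next hne =>
        rcases hk with ⟨k1, -⟩ | ⟨-, -, -, k4, -⟩
        · exact absurd k1 hne
        · have hm : σ ∈ C := k4 ▸ h1
          have := Finset.card_erase_of_mem hm
          have := Finset.card_pos.2 ⟨_, hm⟩
          have := Finset.card_insert_le c (C.erase σ)
          omega
    · have hcov : ∀ x ∈ K, x ≠ c → (∃ w : ℕ, routeDist (H.StepOutside K) σ x = (w : ℕ∞)) →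
          c ∈ if c = σ then C else insert c (C.erase σ) := by
        rintro x hx hxc ⟨w, hw⟩
        have := (hedge x w hx hxc hw).1
        split
        · next e =>
          rcases hk with ⟨-, k2, -⟩ | ⟨-, -, -, k4, -⟩
          · exact absurd (e ▸ k2) this
          · rw [e, k4]; exact h1
        · exact Finset.mem_insert_self _ _
      rcases child_added hne with ⟨k1, k2, k⟩ | ⟨rfl, k2, k3, k4⟩ | ⟨rfl, k2, k3, k4⟩
      · have hin : ∀ x ∈ K, x ∈ C → x ∈ if c = σ then C else insert c (C.erase σ) := by
          intro x hx hxC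
          split
          · exact hxC
          · next hne =>
            refine Finset.mem_insert_of_mem (Finset.mem_erase.2 ⟨?_, hxC⟩)
            rcases hk with ⟨k1, -⟩ | ⟨-, -, k3, -⟩
            · exact absurd k1 hne
            · rintro rfl; exact k3 hx
        exact (h3 u v (k ▸ hne)).imp (hin u k1) (hin v k2)
      · exact .inl (hcov v k2 k3 ((ENat.ne_top_iff_exists.1 (k4 ▸ hne)).imp fun _ e => e.symm))
      · exact .inr (hcov u k2 k3 ((ENat.ne_top_iff_exists.1 (k4 ▸ hne)).imp fun _ e => e.symm))
    · exact (Nat.mul_le_mul_left _ hsz).trans h4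
    -- Renaming `c` to `σ` maps routes of the child to routes of the parent with the same weight. It
    -- is injective on the vertices of the child, so simple routes stay simple.
    · refine h5 _ _ _ _ (hr.map (f := fun x => if x = c then σ else x) hstep) ?_ |>.trans le_rfl
      cases hr with
      | nil => simp
      | @cons _ y _ w ℓ' l' s r =>
        refine hl.map_on ?_
        have hmem : ∀ x y w, (H.child K c σ src').Step x y w →
            x ∈ insert c K ∧ y ∈ insert c K := by
          intro x y w hs
          rcases child_step hs with ⟨k1, k2, -⟩ | ⟨k1, k2, -⟩ | ⟨k1, k2, -⟩ <;> simp [k1, k2]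
        have hall := (Route.cons s r).mem_of_closed (K := fun x => x ∈ insert c K) (hmem _ _ _ s).1
          fun x y w hs => (hmem x y w hs).2
        intro x hx z hz exz
        rcases hk with ⟨k1, -⟩ | ⟨-, -, k3, -⟩
        · subst k1
          split_ifs at exz <;> simp_all
        · have hx := Finset.mem_insert.1 (hall x hx)
          have hz := Finset.mem_insert.1 (hall z hz)
          split_ifs at exz with e1 e2 e3
          · rw [e1, e2]
          · exact absurd (exz ▸ hz.resolve_left e2) k3
          · exact absurd (exz ▸ hx.resolve_left e1) k3
          · exact exz

end child

end Node

/-! ### The invariant passes to both children and holds at the root. -/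

namespace Node

variable {V : Type} {H : Node V} {n : ℕ}

theorem Good.child {K : Finset (Option V)} {c σ src' : Option V} (h : H.Good n) (hK : K ⊆ H.verts)
    (hk : H.Kind K c σ src')
    (hsz : 9 * (H.child K c σ src').verts.card ≤ 8 * H.verts.card ∨
      ((H.child K c σ src').verts.card ≤ H.verts.card ∧ ∀ x ∈ H.verts, x = σ ∨ x ∈ K))
    (hsrc : src' ∈ (H.child K c σ src').verts)
    (hreach : ∀ v ∈ (H.child K c σ src').verts, ∃ l ℓ, Route (H.child K c σ src').Step src' v l ℓ) :
    (H.child K c σ src').Good n := by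
  classical
  have hins : (H.child K c σ src').verts = insert c K := by
    ext x; simp [Node.child]
  have hsymm : ∀ u v, (H.child K c σ src').added u v = (H.child K c σ src').added v u := by
    intro u v
    change min _ _ = min _ _
    rw [star_symm]
    congr 1
    simp only [addedIn, and_comm, h.symm]
  refine ⟨fun {u v} hne => ?_, fun {u v} hp => ?_, hsymm, fun u v h0 => ?_, fun u => ?_, hsrc, fun hn => ?_,
    hreach, h.child_light hk hsz fun u v w hs => ?_⟩
  · rw [hins]
    rcases child_added hne with ⟨k1, k2, -⟩ | ⟨k1, k2, -⟩ | ⟨k1, k2, -⟩ <;> simp [k1, k2]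
  · rw [hins]; exact ⟨Finset.mem_insert_of_mem hp.2.1, Finset.mem_insert_of_mem hp.2.2⟩
  · have hstar : ∀ x ∈ K, x ≠ c → routeDist (H.StepOutside K) σ x ≠ ((0 : ℕ) : ℕ∞) := by
      intro x hx hxc hd
      obtain ⟨l, hr⟩ := exists_route hd
      generalize hz : 0 = z at hr
      cases hr with
      | nil =>
        rcases hk with ⟨rfl, -⟩ | ⟨-, -, k, -⟩
        · exact hxc rfl
        · exact k hx
      | cons s _ => have := h.step_pos s.1; omega
    rcases child_added (H := H) (show (H.child K c σ src').added u v ≠ ⊤ by rw [h0]; simp) with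
      ⟨-, -, k⟩ | ⟨-, k1, k2, k⟩ | ⟨-, k1, k2, k⟩
    · exact h.pos u v (k ▸ h0)
    · exact hstar v k1 k2 (by rw [← k, h0]; rfl)
    · exact hstar u k1 k2 (by rw [← k, h0]; rfl)
  · by_contra hne
    rcases child_added hne with ⟨-, -, k⟩ | ⟨k1, -, k2, -⟩ | ⟨k1, -, k2, -⟩
    · exact hne (k.trans (h.loop u))
    · exact k2 k1
    · exact k2 k1
  · rw [hins] at hn
    change src' = none
    rcases hk with ⟨k1, k2, k3⟩ | ⟨k1, -, -, -, k5⟩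
    · rw [Finset.insert_eq_of_mem k2] at hn
      rw [k3]; exact h.none_mem (hK hn)
    · rw [k5, k1]
  · rcases step_cases hs with hs' | ⟨hs', rfl⟩
    · exact step_added (by rw [hsymm, hs'])
    · exact step_plain hs'.symm

theorem Split.subset (S : H.Split) : S.M ⊆ H.verts ∧ S.N ⊆ H.verts :=
  ⟨fun v hv => (S.mem_union v).2 (.inl hv), fun v hv => (S.mem_union v).2 (.inr hv)⟩

theorem Split.card (S : H.Split) : S.M.card + S.N.card = H.verts.card + 1 := by
  classical
  have h1 : S.M ∪ S.N = H.verts := by ext v; rw [Finset.mem_union, S.mem_union]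
  have h2 : S.M ∩ S.N = {S.r} := by ext v; rw [Finset.mem_inter, S.mem_inter, Finset.mem_singleton]
  rw [← Finset.card_union_add_card_inter, h1, h2, Finset.card_singleton]

/-- Either `M` contains all vertices, or it is smaller by the required factor. Reachability holds
because the part of the tree in `M` survives. -/
theorem Good.left (h : H.Good n) (S : H.Split) : (H.left S).Good n := by
  classical
  rw [left_eq]
  have hv : (H.child S.M S.r S.r H.src).verts = S.M := by
    rw [← left_eq]; rfl
  have hcard := S.card
  have h3 := S.third_le_N
  have hM := S.subset.1
  refine h.child hM (.inl ⟨rfl, S.r_mem.1, rfl⟩) ?_ (by rw [hv]; exact S.src_mem) ?_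
  · rw [hv]
    have := Finset.card_le_card hM
    by_cases he : S.M.card = H.verts.card
    · refine .inr ⟨this, fun x hx => .inr ?_⟩
      rwa [Finset.eq_of_subset_of_card_le hM he.ge]
    -- With `v` vertices in the parent, `M` has at most `2 v / 3 + 1`, which suffices for large `v`;
    -- for small `v` it suffices that at least one vertex is missing.
    · left; omega
  · rw [hv]
    refine h.tree_induction S hM (fun v _ hz => hz) S.par_mem_M ⟨_, _, .nil _⟩ ?_
    rintro v hv - hp w hs ⟨l, ℓ, hr⟩
    obtain ⟨w', hs'⟩ := step_child (c := S.r) (σ := S.r) (src' := H.src) hp hv hs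
    exact ⟨_, _, hr.snoc hs'⟩

/-- If `r` is the old source, this is like the left child. Otherwise the new source reaches `r` by a
star edge and the rest through the tree in `N`; the child may then keep its size, with the new
source in the role of the old one. -/
theorem Good.right (h : H.Good n) (S : H.Split) : (H.right S).Good n := by
  classical
  rw [right_eq]
  have hv : (H.child S.N (H.rightSrc S) H.src (H.rightSrc S)).verts = insert (H.rightSrc S) S.N := by
    ext x; simp [Node.child]
  have hcard := S.card
  have h3 := S.third_le_M
  have hN := S.subset.2
  have hstep : ∀ v ∈ S.N, v ≠ S.r → S.par v ∈ S.N → ∀ w, H.Step (S.par v) v w →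
      (∃ l ℓ, Route (H.child S.N (H.rightSrc S) H.src (H.rightSrc S)).Step (H.rightSrc S) (S.par v) l ℓ) →
      ∃ l ℓ, Route (H.child S.N (H.rightSrc S) H.src (H.rightSrc S)).Step (H.rightSrc S) v l ℓ := by
    rintro v hv - hp w hs ⟨l, ℓ, hr⟩
    obtain ⟨w', hs'⟩ := step_child (c := H.rightSrc S) (σ := H.src) (src' := H.rightSrc S) hp hv hs
    exact ⟨_, _, hr.snoc hs'⟩
  have hsrcN : ∀ v ∈ S.N, v ≠ S.r → v ≠ H.src := by
    rintro v hv hr rfl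
    exact hr ((S.mem_inter _).1 ⟨S.src_mem, hv⟩)
  by_cases hr : S.r = H.src
  · have hsr : H.rightSrc S = H.src := if_pos hr
    rw [hsr] at hv hstep ⊢
    have hmem : H.src ∈ S.N := hr ▸ S.r_mem.2
    rw [Finset.insert_eq_of_mem hmem] at hv
    refine h.child hN (.inl ⟨rfl, hmem, rfl⟩) ?_ (by rw [hv]; exact hmem) ?_
    · rw [hv]
      have := Finset.card_le_card hN
      by_cases he : S.N.card = H.verts.card
      · refine .inr ⟨this, fun x hx => .inr ?_⟩
        rwa [Finset.eq_of_subset_of_card_le hN he.ge]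
      · left; omega
    · rw [hv]
      exact h.tree_induction S (Q := fun v => ∃ l ℓ, Route (H.child S.N H.src H.src H.src).Step H.src v l ℓ)
        hN hsrcN S.par_mem_N (by rw [hr]; exact ⟨_, _, .nil _⟩) hstep
  · have hsr : H.rightSrc S = none := if_neg hr
    rw [hsr] at hv hstep ⊢
    have hsN : H.src ∉ S.N := fun hs => hr ((S.mem_inter _).1 ⟨S.src_mem, hs⟩).symm
    have hnN : none ∉ S.N := fun hn => hsN (h.none_mem (hN hn) ▸ hn)
    have h2 : 2 ≤ S.M.card := by
      rw [← Finset.card_pair hr]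
      exact Finset.card_le_card fun x hx => by
        rcases Finset.mem_insert.1 hx with rfl | hx
        · exact S.r_mem.1
        · rw [Finset.mem_singleton.1 hx]; exact S.src_mem
    -- The tree path to `r` stays in `M`, which shares only `r` with `N`; as there are no loops,
    -- none of its edges lies inside `N`, so the star edge to `r` exists.
    have hrr : ∃ l ℓ, Route (H.child S.N none H.src none).Step none S.r l ℓ := by
      obtain ⟨l, ℓ, hrt⟩ : ∃ l ℓ, Route (H.StepOutside S.N) H.src S.r l ℓ := by
        refine h.tree_induction S (Q := fun v => ∃ l ℓ, Route (H.StepOutside S.N) H.src v l ℓ) S.subset.1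
          (fun v _ hz => hz) S.par_mem_M ⟨_, _, .nil _⟩ ?_ S.r S.r_mem.1
        rintro v hv - hp w hs ⟨l, ℓ, hr⟩
        refine ⟨_, _, hr.snoc ⟨hs, fun hb => h.step_ne hs ?_⟩⟩
        rw [(S.mem_inter _).1 ⟨hp, hb.1⟩, (S.mem_inter _).1 ⟨hv, hb.2⟩]
      have hne : (H.child S.N none H.src none).added none S.r ≠ ⊤ := by
        refine ne_top_of_le_ne_top (ENat.natCast_ne_top ℓ) ((min_le_right _ _).trans ?_)
        rw [star, if_pos ⟨rfl, S.r_mem.2, fun e => hnN (e ▸ S.r_mem.2)⟩]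
        exact hrt.dist_le
      obtain ⟨w, e⟩ := ENat.ne_top_iff_exists.1 hne
      exact ⟨_, _, .cons (step_added e.symm) (.nil _)⟩
    refine h.child hN (.inr ⟨rfl, hnN, hsN, rfl, rfl⟩) ?_ (by rw [hv]; exact Finset.mem_insert_self _ _) ?_
    · rw [hv, Finset.card_insert_of_notMem hnN]
      by_cases he : S.N.card + 1 = H.verts.card
      · refine .inr ⟨he.le, fun x hx => ?_⟩
        have : insert H.src S.N = H.verts := Finset.eq_of_subset_of_card_le
          (Finset.insert_subset h.src_mem hN) (by rw [Finset.card_insert_of_notMem hsN]; omega)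
        rw [← this] at hx
        exact Finset.mem_insert.1 hx
      -- The tight case for the ratio `8 / 9`: at most `2 v / 3 + 2` vertices suffices from `v = 9`
      -- on, and one missing vertex suffices up to `v = 9`.
      · left; omega
    · rw [hv]
      intro v hv
      rcases Finset.mem_insert.1 hv with rfl | hv
      · exact ⟨_, _, .nil _⟩
      · exact h.tree_induction S (Q := fun v => ∃ l ℓ, Route (H.child S.N none H.src none).Step none v l ℓ)
          hN hsrcN S.par_mem_N hrr hstep v hv

/-- No generation has passed, so `e = 0`. The cover consists of the source alone, and a simple route
of unit edges is bounded by the number of vertices. -/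
theorem good_root [Fintype V] {G : SimpleGraph V} (hG : G.Connected) (s : V) :
    (root G s).Good (Fintype.card V) := by
  have hstep : ∀ x y w, (root G s).Step x y w → w = 1 := by
    intro x y w hs
    rcases step_cases hs with hs | hs
    · exact absurd hs.symm (ENat.natCast_ne_top w)
    · exact hs.2
  refine ⟨fun {u v} h => absurd rfl h, fun {u v} h => ?_, fun _ _ => rfl, fun _ _ h => ?_, fun _ => rfl, ?_,
    fun h => ?_, fun v hv => ?_, 0, {some s}, by simp [root], by simp, fun u v h => absurd rfl h, ?_,
    fun u v l ℓ hr hl => ?_⟩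
  · obtain ⟨-, a, b, -, rfl, rfl⟩ := h
    simp [root]
  · exact absurd h (by simp [root])
  · simp [root]
  · simp [root] at h
  · obtain ⟨x, -, rfl⟩ := Finset.mem_map.1 hv
    have := (SimpleGraph.reachable_iff_reflTransGen s x).1 (hG.preconnected s x)
    induction this with
    | refl => exact ⟨_, _, .nil _⟩
    | @tail b c _ hbc ih =>
      obtain ⟨l, ℓ, hr⟩ := ih (by simp [root])
      exact ⟨_, _, hr.snoc (step_plain (H := root G s) ⟨by simpa using hbc.ne, _, _, hbc, rfl, rfl⟩)⟩
  · simp [root]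
  · have hlen : ∀ {u v l ℓ}, Route (root G s).Step u v l ℓ → l.length = ℓ + 1 := by
      intro u v l ℓ hr
      induction hr with
      | nil => rfl
      | cons h _ ih => rw [List.length_cons, ih, hstep _ _ _ h]; ring
    classical
    have h1 := hl.length_le_card
    rw [hlen hr, Fintype.card_option] at h1
    omega

theorem InTree.good [Fintype V] {G : SimpleGraph V} (hG : G.Connected) {s : V} {H : Node V}
    (h : InTree G s H) : H.Good (Fintype.card V) := by
  induction h with
  | root => exact good_root hG s
  | left S _ ih => exact ih.left S
  | right S _ ih => exact ih.right S

/-! ### Sizes -/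

theorem Good.card_pos (h : H.Good n) : 0 < H.verts.card := Finset.card_pos.2 ⟨_, h.src_mem⟩

/-- Few vertices cover the weighted edges, and the weights are polynomial. -/
theorem Good.bounds (h : H.Good n) : ∃ (e : ℕ) (C : Finset (Option V)), C.card ≤ e + 1 ∧ 4 ^ e ≤ n ^ 12 ∧
    H.verts.card ≤ n ∧ (∀ u v w, H.IsEdge u v w true → u ∈ C ∨ v ∈ C) ∧
    ∀ u v w, H.Step u v w → w ≤ n ^ 13 := by
  obtain ⟨e, C, -, h2, h3, h4, h5⟩ := h.light
  have h8 : 0 < 8 ^ e := by positivity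
  have h4' : 4 ^ e ≤ n ^ 12 := by
    have h6 : 9 ^ e ≤ 8 ^ e * n := (Nat.le_mul_of_pos_right _ h.card_pos).trans h4
    -- The exponent `12` comes from `4 * 8 ^ 12 ≤ 9 ^ 12`; together with `(9 / 8) ^ e ≤ n` this
    -- bounds `4 ^ e`.
    have h7 : 4 ^ e * (8 ^ e) ^ 12 ≤ (9 ^ e) ^ 12 := by
      rw [← pow_mul, ← pow_mul, mul_comm e 12, pow_mul, pow_mul, ← mul_pow]
      exact Nat.pow_le_pow_left (by norm_num) e
    have h9 : 4 ^ e * (8 ^ e) ^ 12 ≤ n ^ 12 * (8 ^ e) ^ 12 := by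
      refine h7.trans ((Nat.pow_le_pow_left h6 12).trans_eq ?_)
      rw [mul_pow, mul_comm]
    exact Nat.le_of_mul_le_mul_right h9 (by positivity)
  refine ⟨e, C, h2, h4', ?_, fun u v w hw => h3 u v ?_, fun u v w hs => ?_⟩
  · refine Nat.le_of_mul_le_mul_left ((Nat.mul_le_mul_right _ (Nat.pow_le_pow_left ?_ e)).trans h4) h8
    norm_num
  · rw [show H.added u v = w from hw]; exact ENat.natCast_ne_top _
  · refine (h5 _ _ _ _ (.cons hs (.nil _)) (by simpa using h.step_ne hs)).trans ?_
    calc n * 4 ^ e ≤ n * n ^ 12 := Nat.mul_le_mul_left _ h4'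
      _ = n ^ 13 := by ring

theorem Good.edges_le (h : H.Good n) {E : List (Option V × Option V × ℕ × Bool)} (hE : H.IsEdgeList E) :
    E.length ≤ 2 * H.verts.card ^ 2 := by
  classical
  have h1 : (E.map fun a => (s(a.1, a.2.1), a.2.2.2)).toFinset ⊆
      ((H.verts ×ˢ H.verts).image fun p => s(p.1, p.2)) ×ˢ (Finset.univ : Finset Bool) := by
    intro x hx
    obtain ⟨⟨u, v, w, κ⟩, ha, rfl⟩ := List.mem_map.1 (List.mem_toFinset.1 hx)
    have := h.step_mem ⟨κ, (hE.1 u v w κ).2 (.inl ha)⟩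
    simp only [Finset.mem_product, Finset.mem_image, Finset.mem_univ, and_true]
    exact ⟨(u, v), this, rfl⟩
  have h2 := Finset.card_le_card h1
  rw [List.toFinset_card_of_nodup hE.2, List.length_map, Finset.card_product] at h2
  have h3 : ((H.verts ×ˢ H.verts).image fun p => s(p.1, p.2)).card ≤ H.verts.card ^ 2 := by
    rw [sq, ← Finset.card_product]; exact Finset.card_image_le
  have : (Finset.univ : Finset Bool).card = 2 := rfl
  rw [this] at h2
  omega

/-- Every vertex other than the source ends an edge, because it is reachable. This is what lets the
number of vertices be absorbed by the number of edges in the running time. -/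
theorem Good.card_le (h : H.Good n) {E : List (Option V × Option V × ℕ × Bool)} (hE : H.IsEdgeList E) :
    H.verts.card ≤ 2 * E.length + 1 := by
  classical
  have h1 : H.verts ⊆ insert H.src ((E.map fun a => a.1).toFinset ∪ (E.map fun a => a.2.1).toFinset) := by
    intro v hv
    obtain ⟨l, ℓ, hr⟩ := h.reach v hv
    rw [Finset.mem_insert, Finset.mem_union, List.mem_toFinset, List.mem_toFinset, List.mem_map,
      List.mem_map]
    have hr := Route.reverse (A := H.Step) (fun _ _ _ hs => h.step_symm hs) hr
    generalize l.reverse = l' at hr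
    cases hr with
    | nil => exact .inl rfl
    | @cons _ y _ w _ _ s _ =>
      obtain ⟨κ, s⟩ := s
      rcases (hE.1 _ _ _ _).1 s with s | s
      · exact .inr (.inl ⟨_, s, rfl⟩)
      · exact .inr (.inr ⟨_, s, rfl⟩)
  have h2 := Finset.card_le_card h1
  have h3 := Finset.card_insert_le H.src ((E.map fun a => a.1).toFinset ∪ (E.map fun a => a.2.1).toFinset)
  have h4 := Finset.card_union_le (E.map fun a => a.1).toFinset (E.map fun a => a.2.1).toFinset
  have h5 := List.toFinset_card_le (E.map fun a => a.1)
  have h6 := List.toFinset_card_le (E.map fun a => a.2.1)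
  rw [List.length_map] at h5 h6
  omega

end Node

/-! ## The scene of a node -/

theorem Route.toWk {α β : Type} {A : α → α → ℕ → Prop} {B : β → β → ℕ → Prop} {f : α → β}
    (hA : ∀ x y w, A x y w → B (f x) (f y) w) {c : β} {u v : α} {l : List α} {ℓ : ℕ}
    (h : Route A u v l ℓ) : ∀ {k}, Wk B c (f u) k → Wk B c (f v) (k + ℓ) := by
  induction h with
  | nil => exact fun h => h
  | cons h _ ih =>
    intro k hk
    rw [← add_assoc]
    exact ih (hk.snoc (hA _ _ _ h))

theorem Route.restrict {α : Type} {A : α → α → ℕ → Prop} {q : α → Prop} {u v : α} {l : List α} {ℓ : ℕ}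
    (h : Route A u v l ℓ) (hq : ∀ x ∈ l, q x) : Route (fun x y w => A x y w ∧ q x ∧ q y) u v l ℓ := by
  induction h with
  | nil => exact .nil _
  | cons h h' ih =>
    simp only [List.mem_cons, forall_eq_or_imp] at hq
    exact .cons ⟨h, hq.1, hq.2 _ h'.start_mem⟩ (ih hq.2)

theorem Route.le_mul {α : Type} {A : α → α → ℕ → Prop} {W : ℕ} (hW : ∀ x y w, A x y w → w ≤ W) {u v : α}
    {l : List α} {ℓ : ℕ} (h : Route A u v l ℓ) : ℓ ≤ W * l.length := by
  induction h with
  | nil => simp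
  | cons h _ ih =>
    rw [List.length_cons, Nat.mul_add, mul_one]
    have := hW _ _ _ h; omega

theorem Route.eq_concat {α : Type} {A : α → α → ℕ → Prop} {u v : α} {l : List α} {ℓ : ℕ}
    (h : Route A u v l ℓ) : ∃ l', l = l' ++ [v] := by
  induction h with
  | nil u => exact ⟨[], rfl⟩
  | cons _ _ ih =>
    obtain ⟨l', rfl⟩ := ih
    exact ⟨_ :: l', rfl⟩

theorem List.getD_flatMap_four {α : Type} {f : α → List ℕ} (hf : ∀ a, (f a).length = 4) (E : List α)
    (j r : ℕ) (hj : j < E.length) (hr : r < 4) :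
    (E.flatMap f).getD (4 * j + r) 0 = (f E[j]).getD r 0 := by
  induction E generalizing j with
  | nil => simp at hj
  | cons a E ih =>
    rw [List.flatMap_cons]
    cases j with
    | zero => rw [List.getD_append _ _ _ _ (by rw [hf]; omega)]; simp
    | succ j =>
      rw [List.getD_append_right _ _ _ _ (by rw [hf]; omega), hf,
        show 4 * (j + 1) + r - 4 = 4 * j + r by omega]
      exact ih j (by simpa using hj)

namespace Node

variable {V : Type} {H : Node V} {n : ℕ} {S : H.Split} {P : List (Option V)} {num : Option V → ℕ}

/-- A node with a numbering and a primary path. -/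
structure Setup (H : Node V) (n : ℕ) (S : H.Split) (P : List (Option V)) (num : Option V → ℕ) : Prop where
  good : H.Good n
  prim : S.IsPrimary P
  bij : H.IsNumbering num

namespace Setup

theorem inj (h : Setup H n S P num) {x y : Option V} (hx : x ∈ H.verts) (hy : y ∈ H.verts)
    (e : num x = num y) : x = y := h.bij.injOn hx hy e

theorem ex (h : Setup H n S P num) {v : ℕ} (hv : v < H.verts.card) : ∃ x ∈ H.verts, num x = v :=
  h.bij.surjOn hv

theorem num_lt (h : Setup H n S P num) {x : Option V} (hx : x ∈ H.verts) : num x < H.verts.card :=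
  h.bij.mapsTo hx

theorem mem_verts_of_chain (S : H.Split) : ∀ (P : List (Option V)) {r : Option V},
    P.IsChain (fun u v => v ≠ H.src ∧ S.par v = u) → P.getLast? = some r → r ∈ H.verts →
    ∀ x ∈ P, x ∈ H.verts
  | [], _, _, _, _ => by simp
  | [x], r, _, h, hr => by
    obtain rfl : x = r := by simpa using h
    simpa using hr
  | x :: y :: l, r, h, hl, hr => by
    rw [List.isChain_cons_cons] at h
    have ih := mem_verts_of_chain S (y :: l) h.2 (by simpa using hl) hr
    intro z hz
    rcases List.mem_cons.1 hz with rfl | hz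
    · rw [← h.1.2]; exact S.par_mem y (ih y (by simp)) h.1.1
    · exact ih z hz

theorem mem_verts (h : Setup H n S P num) {x : Option V} (hx : x ∈ P) : x ∈ H.verts :=
  mem_verts_of_chain S P h.prim.2.2 h.prim.2.1 (S.subset.1 S.r_mem.1) x hx

theorem P_zero (h : Setup H n S P num) : P.getD 0 H.src = H.src := by
  have := h.prim.1
  cases P with
  | nil => rfl
  | cons x P => simpa using this

theorem length_pos (h : Setup H n S P num) : 0 < P.length := by
  have := h.prim.1
  cases P with
  | nil => simp at this
  | cons x P => simp

theorem getD_mem (h : Setup H n S P num) (a : ℕ) : P.getD a H.src ∈ H.verts := by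
  by_cases ha : a < P.length
  · rw [List.getD_eq_getElem _ _ ha]; exact h.mem_verts (List.getElem_mem ha)
  · rw [List.getD_eq_default _ _ (not_lt.1 ha)]; exact h.good.src_mem

open Classical in
/-- The distance from the source to the vertex with number `v`. -/
noncomputable def dist (H : Node V) (num : Option V → ℕ) (v : ℕ) : ℕ :=
  if h : ∃ x ∈ H.verts, num x = v then (routeDist H.Step H.src h.choose).toNat else 0

theorem dist_num (h : Setup H n S P num) {x : Option V} (hx : x ∈ H.verts) :
    (dist H num (num x) : ℕ∞) = routeDist H.Step H.src x := by
  have hex : ∃ y ∈ H.verts, num y = num x := ⟨x, hx, rfl⟩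
  have hc : hex.choose = x := h.inj hex.choose_spec.1 hx hex.choose_spec.2
  obtain ⟨k, hk⟩ := h.good.exists_dist hx
  rw [dist, dif_pos hex, hc, hk]
  rfl

theorem routeDist_step {A : Option V → Option V → ℕ → Prop} {u v c : Option V} {w k : ℕ} (hs : A u v w)
    (hk : routeDist A c u = (k : ℕ∞)) : routeDist A c v ≤ ((k + w : ℕ) : ℕ∞) := by
  obtain ⟨l, hr⟩ := exists_route hk
  exact (hr.snoc hs).dist_le

theorem isEdge_symm (h : Setup H n S P num) {u v : Option V} {w : ℕ} {κ : Bool}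
    (hs : H.IsEdge u v w κ) : H.IsEdge v u w κ := by
  cases κ with
  | false => exact ⟨H.plain.symm.symm _ _ hs.1, hs.2⟩
  | true => exact (h.good.symm v u).trans hs

noncomputable def scene (h : Setup H n S P num) : Scene where
  E u v w κ := ∃ x ∈ H.verts, ∃ y ∈ H.verts, num x = u ∧ num y = v ∧ H.IsEdge x y w κ
  N := H.verts.card
  -- The default value is the source, so that `p a` is the number of a vertex for every `a`.
  p a := num (P.getD a H.src)
  L := P.length
  d := dist H num
  lt := by
    rintro _ _ w κ ⟨x, hx, y, hy, rfl, rfl, -⟩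
    exact ⟨h.num_lt hx, h.num_lt hy⟩
  symm := by
    rintro _ _ w κ ⟨x, hx, y, hy, rfl, rfl, hs⟩
    exact ⟨y, hy, x, hx, rfl, rfl, h.isEdge_symm hs⟩
  pos := by
    rintro _ _ w κ ⟨x, hx, y, hy, rfl, rfl, hs⟩
    exact h.good.step_pos ⟨κ, hs⟩
  one := by
    rintro _ _ w ⟨x, hx, y, hy, rfl, rfl, hs⟩
    exact hs.2
  d0 := by
    have e := h.dist_num h.good.src_mem
    have := (Route.nil (A := H.Step) H.src).dist_le
    rw [← e] at this
    rw [h.P_zero]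
    have : dist H num (num H.src) ≤ 0 := by exact_mod_cast this
    omega
  d_le := by
    rintro _ _ w κ ⟨x, hx, y, hy, rfl, rfl, hs⟩
    have := routeDist_step ⟨κ, hs⟩ (h.dist_num hx).symm
    rw [← h.dist_num hy] at this
    exact_mod_cast this
  d_ex := by
    intro v hv
    obtain ⟨x, hx, rfl⟩ := h.ex hv
    obtain ⟨l, hr⟩ := exists_route (h.dist_num hx).symm
    have := hr.toWk (B := fun u v w => ∃ κ, ∃ x ∈ H.verts, ∃ y ∈ H.verts, num x = u ∧ num y = v ∧
      H.IsEdge x y w κ) (f := num) (c := num H.src) (fun x y w hs => by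
        obtain ⟨κ, hs⟩ := hs
        have := h.good.step_mem ⟨κ, hs⟩
        exact ⟨κ, x, this.1, y, this.2, rfl, rfl, hs⟩) .refl
    rw [h.P_zero]
    simpa using this
  path := by
    intro j hj
    have hc := List.isChain_iff_getElem.1 h.prim.2.2 j hj
    have h1 : P[j + 1] ∈ H.verts := h.mem_verts (List.getElem_mem _)
    have h0 : P[j] ∈ H.verts := h.mem_verts (List.getElem_mem _)
    obtain ⟨w, ⟨κ, hs⟩, hd⟩ := S.par_dist _ h1 hc.1
    rw [hc.2] at hs hd
    rw [List.getD_eq_getElem _ _ hj, List.getD_eq_getElem _ _ (show j < P.length by omega)]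
    refine ⟨w, κ, ⟨_, h0, _, h1, rfl, rfl, hs⟩, ?_⟩
    rw [← h.dist_num h0, ← h.dist_num h1] at hd
    exact_mod_cast hd
  L_pos := h.length_pos

theorem E_iff (h : Setup H n S P num) {x y : Option V} (hx : x ∈ H.verts) (hy : y ∈ H.verts) {w : ℕ}
    {κ : Bool} : h.scene.E (num x) (num y) w κ ↔ H.IsEdge x y w κ := by
  constructor
  · rintro ⟨x', hx', y', hy', e1, e2, hs⟩
    rwa [h.inj hx' hx e1, h.inj hy' hy e2] at hs
  · exact fun hs => ⟨x, hx, y, hy, rfl, rfl, hs⟩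

theorem N_eq (h : Setup H n S P num) : h.scene.N = H.verts.card := rfl

theorem L_eq (h : Setup H n S P num) : h.scene.L = P.length := rfl

theorem p_eq (h : Setup H n S P num) (a : ℕ) : h.scene.p a = num (P.getD a H.src) := rfl

theorem p_zero (h : Setup H n S P num) : h.scene.p 0 = num H.src := by rw [h.p_eq, h.P_zero]

theorem p_lt (h : Setup H n S P num) (a : ℕ) : h.scene.p a < h.scene.N := h.num_lt (h.getD_mem a)

theorem L_le (h : Setup H n S P num) : h.scene.L ≤ h.scene.N := by
  have : (Finset.range h.scene.L).card ≤ (Finset.range h.scene.N).card :=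
    Finset.card_le_card_of_injOn h.scene.p (fun a _ => by simpa using h.p_lt a) fun a ha b hb e =>
      Scene.p_inj (by simpa using ha) (by simpa using hb) e
  simpa using this

theorem input (h : Setup H n S P num) {E : List (Option V × Option V × ℕ × Bool)} (hE : H.IsEdgeList E) :
    RAM.Input h.scene E.length fun j => (H.encode num P E).getD j 0 := by
  have e0 : H.encode num P E = [H.verts.card, E.length, num H.src, P.length] ++ (P.map num ++
      E.flatMap fun a => [num a.1, num a.2.1, a.2.2.1, a.2.2.2.toNat]) := by
    rw [encode, List.append_assoc]
  have eP : ∀ a < P.length, (H.encode num P E).getD (4 + a) 0 = num (P.getD a H.src) := by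
    intro a ha
    rw [e0, List.getD_append_right _ _ _ _ (by simp), List.getD_append _ _ _ _ (by simpa using ha)]
    simp [ha]
  have eE : ∀ j (hj : j < E.length) r, r < 4 → (H.encode num P E).getD (4 + P.length + 4 * j + r) 0 =
      [num E[j].1, num E[j].2.1, E[j].2.2.1, E[j].2.2.2.toNat].getD r 0 := by
    intro j hj r hr
    rw [e0, List.getD_append_right _ _ _ _ (by simp; omega), List.getD_append_right _ _ _ _ (by simp; omega)]
    rw [← List.getD_flatMap_four (f := fun a : Option V × Option V × ℕ × Bool =>
      [num a.1, num a.2.1, a.2.2.1, a.2.2.2.toNat]) (fun _ => rfl) E j r hj hr]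
    congr 1
    simp; omega
  have hmem : ∀ j (hj : j < E.length), H.IsEdge E[j].1 E[j].2.1 E[j].2.2.1 E[j].2.2.2 := fun j hj =>
    (hE.1 _ _ _ _).2 (.inl (List.getElem_mem hj))
  refine ⟨by simp [e0, h.N_eq], by simp [e0], by simp [e0, h.p_zero], by simp [e0, h.L_eq],
    fun a ha => eP a ha, fun u v w κ => ?_, fun j hj => ?_, fun j hj => ?_⟩
  · rw [h.L_eq]
    constructor
    · rintro ⟨x, hx, y, hy, rfl, rfl, hs⟩
      rcases (hE.1 _ _ _ _).1 hs with hs | hs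
      all_goals
        obtain ⟨j, hj, e⟩ := List.getElem_of_mem hs
        have k0 := eE j hj 0 (by omega)
        have k1 := eE j hj 1 (by omega)
        have k2 := eE j hj 2 (by omega)
        have k3 := eE j hj 3 (by omega)
        rw [e] at k0 k1 k2 k3
      · exact ⟨j, hj, .inl ⟨k0, k1⟩, k2, k3⟩
      · exact ⟨j, hj, .inr ⟨k0, k1⟩, k2, k3⟩
    · rintro ⟨j, hj, k, k2, k3⟩
      have k2' := eE j hj 2 (by omega)
      have k3' := eE j hj 3 (by omega)
      have k0' := eE j hj 0 (by omega)
      have k1' := eE j hj 1 (by omega)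
      have hs := hmem j hj
      have hm := h.good.step_mem ⟨_, hs⟩
      have hw : E[j].2.2.1 = w := k2'.symm.trans k2
      have hκ : E[j].2.2.2 = κ := by
        have : E[j].2.2.2.toNat = κ.toNat := k3'.symm.trans k3
        generalize E[j].2.2.2 = b at this
        revert this; cases b <;> cases κ <;> simp
      rw [hw, hκ] at hs
      rcases k with ⟨k0, k1⟩ | ⟨k0, k1⟩
      · exact ⟨_, hm.1, _, hm.2, k0'.symm.trans k0, k1'.symm.trans k1, hs⟩
      · exact ⟨_, hm.2, _, hm.1, k1'.symm.trans k1, k0'.symm.trans k0, h.isEdge_symm hs⟩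
  · rw [h.L_eq, eE j hj 3 (by omega)]
    exact Bool.toNat_le _
  · refine List.getD_eq_default _ _ ?_
    rw [h.L_eq] at hj
    have : (E.flatMap fun a => [num a.1, num a.2.1, a.2.2.1, a.2.2.2.toNat]).length = 4 * E.length := by
      simp [List.length_flatMap, mul_comm]
    rw [e0]
    simp only [List.length_append, List.length_map, this, List.length_cons, List.length_nil]
    omega

/-! ### Replacement paths -/

section

variable {before after : List (Option V)} {x y : Option V}

theorem getD_before (hP : P = before ++ x :: y :: after) :
    P.getD before.length H.src = x ∧ P.getD (before.length + 1) H.src = y := by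
  subst hP
  constructor
  · simp
  · rw [List.getD_append_right _ _ _ _ (by omega)]; simp

theorem after_iff (h : Setup H n S P num) (hP : P = before ++ x :: y :: after) {z : Option V}
    (hz : z ∈ H.verts) : h.scene.After before.length (num z) ↔ z ∈ y :: after := by
  have hlen : P.length = before.length + (after.length + 2) := by rw [hP]; simp
  have hget : ∀ j, before.length < j → P.getD j H.src = (y :: after).getD (j - before.length - 1) H.src := by
    intro j hj
    rw [hP, List.getD_append_right _ _ _ _ hj.le]
    obtain ⟨k, rfl⟩ : ∃ k, j = before.length + (k + 1) := ⟨j - before.length - 1, by omega⟩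
    rw [Nat.add_sub_cancel_left]; simp
  constructor
  · rintro ⟨j, h1, h2, h3⟩
    rw [h.L_eq] at h2
    rw [h.p_eq] at h3
    rw [← h.inj (h.getD_mem j) hz h3, hget j h1, List.getD_eq_getElem _ _ (by simp; omega)]
    exact List.getElem_mem _
  · intro hm
    obtain ⟨k, hk, e⟩ := List.getElem_of_mem hm
    refine ⟨before.length + k + 1, by omega, by rw [h.L_eq]; simp at hk; omega, ?_⟩
    rw [h.p_eq, hget _ (by omega), show before.length + k + 1 - before.length - 1 = k by omega,
      List.getD_eq_getElem _ _ hk, e]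

theorem step_of_avoid {e : Sym2 (Option V)} {u v : Option V} {w : ℕ} (hs : H.StepAvoid e u v w) :
    H.Step u v w := by
  rcases hs with hs | hs
  · exact ⟨_, hs⟩
  · exact ⟨_, hs.1⟩

theorem avoid_iff (h : Setup H n S P num) (hP : P = before ++ x :: y :: after) {u v : Option V}
    (hu : u ∈ H.verts) (hv : v ∈ H.verts) {w : ℕ} :
    h.scene.AStep before.length (num u) (num v) w ↔ H.StepAvoid s(x, y) u v w := by
  obtain ⟨e1, e2⟩ := getD_before (H := H) hP
  have hx : x ∈ H.verts := e1 ▸ h.getD_mem _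
  have hy : y ∈ H.verts := e2 ▸ h.getD_mem _
  have : s(num u, num v) = s(num x, num y) ↔ s(u, v) = s(x, y) := by
    simp only [Sym2.eq_iff]
    constructor
    · rintro (⟨k1, k2⟩ | ⟨k1, k2⟩)
      · exact .inl ⟨h.inj hu hx k1, h.inj hv hy k2⟩
      · exact .inr ⟨h.inj hu hy k1, h.inj hv hx k2⟩
    · rintro (⟨rfl, rfl⟩ | ⟨rfl, rfl⟩) <;> simp
  rw [Scene.AStep, h.E_iff hu hv, h.E_iff hu hv, h.p_eq, h.p_eq, e1, e2, StepAvoid, Ne, this]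

theorem route_of_wk (h : Setup H n S P num) (hP : P = before ++ x :: y :: after) {v ℓ : ℕ}
    (hw : Wk (h.scene.AStep before.length) (h.scene.p 0) v ℓ) :
    ∃ t ∈ H.verts, num t = v ∧ ∃ l, Route (H.StepAvoid s(x, y)) H.src t l ℓ := by
  induction hw with
  | refl => exact ⟨_, h.good.src_mem, h.p_zero.symm, _, .nil _⟩
  | snoc _ hs ih =>
    obtain ⟨t, ht, rfl, l, hr⟩ := ih
    have hlt : _ < H.verts.card :=
      (hs.elim (fun h' => (h.scene.lt h').2) fun h' => (h.scene.lt h'.1).2)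
    obtain ⟨z, hz, rfl⟩ := h.ex hlt
    exact ⟨z, hz, rfl, _, hr.snoc ((h.avoid_iff hP ht hz).1 hs)⟩

theorem safe_of_route (h : Setup H n S P num) (hP : P = before ++ x :: y :: after) {t : Option V}
    {l : List (Option V)} {ℓ : ℕ} (hr : Route (H.StepAvoid s(x, y)) H.src t l ℓ)
    (hl : ∀ u ∈ l, u ∉ y :: after) : h.scene.Safe before.length (num t) ℓ := by
  rw [Scene.Safe, h.p_zero]
  simpa using (hr.restrict hl).toWk (f := num) (fun u v w hs => by
    have := h.good.step_mem (step_of_avoid hs.1)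
    exact ⟨(h.avoid_iff hP this.1 this.2).2 hs.1, mt (h.after_iff hP this.1).1 hs.2.1,
      mt (h.after_iff hP this.2).1 hs.2.2⟩) .refl

theorem route_of_safe (h : Setup H n S P num) (hP : P = before ++ x :: y :: after) {v ℓ : ℕ}
    (hw : h.scene.Safe before.length v ℓ) :
    ∃ t ∈ H.verts, num t = v ∧ ∃ l, Route (H.StepAvoid s(x, y)) H.src t l ℓ ∧ ∀ u ∈ l, u ∉ y :: after := by
  induction hw with
  | refl =>
    refine ⟨_, h.good.src_mem, h.p_zero.symm, _, .nil _, fun u hu => ?_⟩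
    rw [List.mem_singleton.1 hu, ← h.after_iff hP h.good.src_mem, ← h.p_zero]
    exact Scene.not_after (Nat.zero_le _) (by rw [h.L_eq, hP]; simp)
  | snoc _ hs ih =>
    obtain ⟨t, ht, rfl, l, hr, hl⟩ := ih
    have hlt : _ < H.verts.card :=
      (hs.1.elim (fun h' => (h.scene.lt h').2) fun h' => (h.scene.lt h'.1).2)
    obtain ⟨z, hz, rfl⟩ := h.ex hlt
    refine ⟨z, hz, rfl, _, hr.snoc ((h.avoid_iff hP ht hz).1 hs.1), fun u hu => ?_⟩
    rcases List.mem_append.1 hu with hu | hu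
    · exact hl u hu
    · rw [List.mem_singleton.1 hu]; exact mt (h.after_iff hP hz).2 hs.2.2

/-- A shortest route is not heavier than the simple route obtained by cutting out its cycles, and
that one visits each vertex at most once. -/
theorem lt_of_shortest (h : Setup H n S P num) {W I : ℕ} (hW : ∀ u v w, H.Step u v w → w ≤ W)
    (hI : H.verts.card * W < I) {e : Sym2 (Option V)} {t : Option V} {l : List (Option V)} {ℓ : ℕ}
    (hr : Route (H.StepAvoid e) H.src t l ℓ) (hd : (ℓ : ℕ∞) = routeDist (H.StepAvoid e) H.src t) : ℓ < I := by
  obtain ⟨l', ℓ', hr', hle, hn⟩ := hr.exists_nodup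
  have hv : ∀ u ∈ l', u ∈ H.verts := hr'.mem_of_closed h.good.src_mem
    fun u v w hs => (h.good.step_mem (step_of_avoid hs)).2
  have h1 : ℓ ≤ ℓ' := by
    have := hr'.dist_le
    rw [← hd] at this
    exact_mod_cast this
  have h2 := hr'.le_mul fun u v w hs => hW u v w (step_of_avoid hs)
  have h3 : l'.length ≤ H.verts.card := by
    classical
    rw [← List.toFinset_card_of_nodup hn]
    exact Finset.card_le_card fun u hu => hv u (List.mem_toFinset.1 hu)
  have := Nat.mul_le_mul_left W h3
  rw [mul_comm H.verts.card] at hI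
  omega

/-- `Scene.Out` only provides a route of weight at most `d`. For a departing replacement path of
weight `ℓ`, the optimality of the search gives `d ≤ ℓ` and minimality of `ℓ` gives `ℓ ≤ d`; hence
the route found has weight exactly `ℓ` and is itself a departing replacement path. -/
theorem answer (h : Setup H n S P num) (hP : P = before ++ x :: y :: after) {W I : ℕ}
    (hW : ∀ u v w, H.Step u v w → w ≤ W) (hI : H.verts.card * W < I) {t : Option V} (ht : t ∈ H.verts)
    {f d u : ℕ} (hs : f ≠ 0 → (num t = h.scene.p 0 ∧ d = 0) ∨
      (num t ≠ h.scene.p 0 ∧ h.scene.Out before.length (num t) d u))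
    (hc : ∀ ℓ, h.scene.Safe before.length (num t) ℓ →
      (∀ k, Wk (h.scene.AStep before.length) (h.scene.p 0) (num t) k → ℓ ≤ k) → ℓ < I → f ≠ 0 ∧ d ≤ ℓ) :
    (f ≠ 0 → routeDist (H.StepAvoid s(x, y)) H.src t ≤ (d : ℕ∞)) ∧
    ((∃ l ℓ, H.IsDepartingReplacement s(x, y) (y :: after) t l ℓ) → f ≠ 0 ∧
      (∃ l, H.IsDepartingReplacement s(x, y) (y :: after) t l d) ∧
      (t ≠ H.src → ∃ l z, H.IsDepartingReplacement s(x, y) (y :: after) t (l ++ [z, t]) d ∧ num z = u)) := by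
  have key : h.scene.Out before.length (num t) d u → ∃ l z k, Route (H.StepAvoid s(x, y)) H.src t (l ++ [z, t]) k ∧
      (∀ v ∈ l ++ [z, t], v ∉ y :: after) ∧ num z = u ∧ k ≤ d := by
    rintro ⟨k, w, h1, h2, h3⟩
    obtain ⟨z, hz, rfl, l, hr, hl⟩ := h.route_of_safe hP h1
    obtain ⟨l', rfl⟩ := hr.eq_concat
    have := hr.snoc ((h.avoid_iff hP hz ht).1 h2.1)
    rw [List.append_assoc] at this
    refine ⟨l', z, _, this, fun v hv => ?_, rfl, h3⟩
    rw [← List.singleton_append, ← List.append_assoc] at hv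
    rcases List.mem_append.1 hv with hv | hv
    · exact hl v hv
    · rw [List.mem_singleton.1 hv]; exact mt (h.after_iff hP ht).2 h2.2.2
  have h0 : num t = h.scene.p 0 ↔ t = H.src := by
    rw [h.p_zero]; exact ⟨h.inj ht h.good.src_mem, fun e => by rw [e]⟩
  have lower : f ≠ 0 → routeDist (H.StepAvoid s(x, y)) H.src t ≤ (d : ℕ∞) := by
    intro hf
    rcases hs hf with ⟨h1, rfl⟩ | ⟨-, h1⟩
    · rw [h0.1 h1]; exact (Route.nil H.src).dist_le
    · obtain ⟨l, z, k, hr, -, -, hk⟩ := key h1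
      exact hr.dist_le.trans (by exact_mod_cast hk)
  refine ⟨lower, ?_⟩
  rintro ⟨l, ℓ, hr, hd, hl⟩
  have hmin : ∀ k, Wk (h.scene.AStep before.length) (h.scene.p 0) (num t) k → ℓ ≤ k := by
    intro k hk
    obtain ⟨t', ht', e, l', hr'⟩ := h.route_of_wk hP hk
    obtain rfl := h.inj ht' ht e
    have := hr'.dist_le
    rw [← hd] at this
    exact_mod_cast this
  obtain ⟨hf, hle⟩ := hc ℓ (h.safe_of_route hP hr hl) hmin (h.lt_of_shortest hW hI hr hd)
  have hge := lower hf
  rw [← hd] at hge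
  obtain rfl : d = ℓ := le_antisymm hle (by exact_mod_cast hge)
  refine ⟨hf, ⟨l, hr, hd, hl⟩, fun hts => ?_⟩
  rcases hs hf with ⟨h1, -⟩ | ⟨-, h1⟩
  · exact absurd (h0.1 h1) hts
  · obtain ⟨l', z, k, hr', hl', hz, hk⟩ := key h1
    have hge := hr'.dist_le
    rw [← hd] at hge
    obtain rfl : k = d := le_antisymm hk (by exact_mod_cast hge)
    exact ⟨l', z, ⟨hr', hd, hl'⟩, hz⟩

end

end Setup

end Node

/-! ## Bounds -/

/-- The largest quantity is the infinity value, of order `n ^ 16`: weights up to `n ^ 13`, at most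
`2 * n ^ 2` edges, and another factor `n`. Powers of `n + 2 ≥ 3` up to the exponent `24` absorb the
constants. -/
theorem Nat.budget {n N m W k : ℕ} (hN : N ≤ n) (hn : 1 ≤ n) (hm : m ≤ 2 * N ^ 2) (hW : W ≤ m * n ^ 13)
    (hk : k ≤ n ^ 12 + 1) :
    1000 ≤ (n + 2) ^ 24 ∧ 20 * (N * (W + 1) + 1) < (n + 2) ^ 24 ∧ 4 + N + 4 * m < (n + 2) ^ 24 ∧
      40 * ((5 * N + 2 * k + 6) * N) < (n + 2) ^ 24 ∧ n ^ 13 < (n + 2) ^ 24 := by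
  obtain ⟨b, hb⟩ : ∃ b, b = n + 2 := ⟨_, rfl⟩
  rw [← hb]
  have h3 : 3 ≤ b := by omega
  have hnb : n ≤ b := by omega
  have hp : ∀ i, 1 ≤ b ^ i := fun i => Nat.one_le_pow _ _ (by omega)
  have up : ∀ i c, c < 3 ^ (24 - i) → i ≤ 24 → c * b ^ i < b ^ 24 := by
    intro i c hc hi
    rw [show b ^ 24 = b ^ (24 - i) * b ^ i by rw [← pow_add]; congr 1; omega]
    exact Nat.mul_lt_mul_of_pos_right (hc.trans_le (Nat.pow_le_pow_left h3 _)) (hp i)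
  have hn12 : n ^ 12 ≤ b ^ 12 := Nat.pow_le_pow_left hnb _
  have hn13 : n ^ 13 ≤ b ^ 13 := Nat.pow_le_pow_left hnb _
  have hN2 : N ^ 2 ≤ b ^ 2 := Nat.pow_le_pow_left (hN.trans hnb) _
  have hWb : W ≤ 2 * b ^ 15 := hW.trans <| by
    rw [show 2 * b ^ 15 = (2 * b ^ 2) * b ^ 13 by ring]
    exact Nat.mul_le_mul (by omega) hn13
  refine ⟨?_, ?_, ?_, ?_, ?_⟩
  · simpa using (up 0 1000 (by norm_num) (by norm_num)).le
  · refine lt_of_le_of_lt ?_ (up 16 80 (by norm_num) (by norm_num))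
    have h1 : N * (W + 1) ≤ b * (3 * b ^ 15) := Nat.mul_le_mul (by omega) (by have := hp 15; omega)
    rw [show b * (3 * b ^ 15) = 3 * b ^ 16 by ring] at h1
    have := hp 16; omega
  · refine lt_of_le_of_lt ?_ (up 2 13 (by norm_num) (by norm_num))
    have : b ≤ b ^ 2 := Nat.le_self_pow (by norm_num) b
    have := hp 2; omega
  · refine lt_of_le_of_lt ?_ (up 13 600 (by norm_num) (by norm_num))
    have : b ≤ b ^ 12 := Nat.le_self_pow (by norm_num) b
    have h1 : (5 * N + 2 * k + 6) * N ≤ (15 * b ^ 12) * b :=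
      Nat.mul_le_mul (by have := hp 12; omega) (by omega)
    rw [show 15 * b ^ 12 * b = 15 * b ^ 13 by ring] at h1
    omega
  · have := up 13 1 (by norm_num) (by norm_num); omega

/-- With `L` the logarithm and `q` the root: `ρ ≤ 2 q`, and `e ≤ 12 L` gives `nc ≤ 26 L`. The
constant is `4 * 28 * 14000` from the three factors of the running time. One logarithm comes from
the number of centers and one from the tournament tree, hence the exponent `2`. -/
theorem Real.budget {n N m e ρ nc : ℕ} (hn : 1 ≤ n) (hN : N ≤ n) (hm : N ≤ 2 * m + 1) (h1 : 1 ≤ ρ)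
    (hρ : (ρ - 1) * (ρ - 1) < N) (he : 4 ^ e ≤ n ^ 12) (hc : nc ≤ 2 * (e + 1)) :
    (((2 * m + N + 1) * (ρ + nc) * ((Nat.log 2 (n + 2) + 3) * 400 + 12000) : ℕ) : ℝ) ≤
        (1568000 : ℕ) * ((m : ℝ) + 1) * √(n : ℝ) * Real.log ((n : ℝ) + 2) ^ 2 ∧
      ((40 * ((5 * ρ + nc + 6) * N) : ℕ) : ℝ) ≤
        (1568000 : ℕ) * (N : ℝ) * √(n : ℝ) * Real.log ((n : ℝ) + 2) ^ 2 ∧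
      (((Nat.log 2 (n + 2) + 3) * 50 + nc * 200 + 600 : ℕ) : ℝ) ≤
        (1568000 : ℕ) * Real.log ((n : ℝ) + 2) ^ 2 := by
  obtain ⟨L, hL⟩ : ∃ L, L = Real.log ((n : ℝ) + 2) := ⟨_, rfl⟩
  obtain ⟨q, hq⟩ : ∃ q, q = √(n : ℝ) := ⟨_, rfl⟩
  obtain ⟨g, hg⟩ : ∃ g, g = Nat.log 2 (n + 2) := ⟨_, rfl⟩
  rw [← hL, ← hq, ← hg]
  have hn' : (1 : ℝ) ≤ n := by exact_mod_cast hn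
  have h2 : 0.69 < Real.log 2 := lt_trans (by norm_num) Real.log_two_gt_d9
  have L1 : 1 ≤ L := by
    rw [hL, Real.le_log_iff_exp_le (by linarith)]
    linarith [Real.exp_one_lt_d9]
  have q1 : 1 ≤ q := by rw [hq]; exact Real.one_le_sqrt.2 hn'
  have gL : (g : ℝ) ≤ 2 * L := by
    have h : (2 : ℝ) ^ g ≤ (n : ℝ) + 2 := by
      rw [hg]; exact_mod_cast Nat.pow_log_le_self 2 (show n + 2 ≠ 0 by omega)
    have h := Real.log_le_log (by positivity) h
    rw [Real.log_pow, ← hL] at h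
    have : (g : ℝ) * 0.5 ≤ g * Real.log 2 := by gcongr; linarith
    linarith
  have eL : (e : ℝ) ≤ 12 * L := by
    have h : (4 : ℝ) ^ e ≤ ((n : ℝ) + 2) ^ 12 := by
      have : (4 : ℝ) ^ e ≤ (n : ℝ) ^ 12 := by exact_mod_cast he
      refine this.trans ?_
      gcongr; linarith
    have h := Real.log_le_log (by positivity) h
    rw [Real.log_pow, Real.log_pow, ← hL, show (4 : ℝ) = 2 ^ 2 by norm_num, Real.log_pow] at h
    push_cast at h
    have : (e : ℝ) * 1 ≤ e * (2 * Real.log 2) := by gcongr; linarith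
    linarith
  have cL : (nc : ℝ) ≤ 26 * L := by
    have : (nc : ℝ) ≤ 2 * (e + 1) := by exact_mod_cast hc
    linarith
  have rq : (ρ : ℝ) ≤ 2 * q := by
    obtain ⟨s, rfl⟩ : ∃ s, ρ = s + 1 := ⟨ρ - 1, by omega⟩
    rw [Nat.add_sub_cancel] at hρ
    have : (s : ℝ) ≤ q := by
      rw [hq]
      refine Real.le_sqrt_of_sq_le ?_
      rw [sq]; exact_mod_cast hρ.le.trans hN
    push_cast; linarith
  have qL : q ≤ q * L := le_mul_of_one_le_right (by linarith) L1
  have Lq : L ≤ q * L := le_mul_of_one_le_left (by linarith) q1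
  refine ⟨?_, ?_, ?_⟩
  · have a1 : ((2 * m + N + 1 : ℕ) : ℝ) ≤ 4 * (m + 1) := by
      have : (N : ℝ) ≤ 2 * m + 1 := by exact_mod_cast hm
      push_cast; linarith [(Nat.cast_nonneg m : (0 : ℝ) ≤ m)]
    have a2 : ((ρ + nc : ℕ) : ℝ) ≤ 28 * (q * L) := by push_cast; linarith
    have a3 : (((g + 3) * 400 + 12000 : ℕ) : ℝ) ≤ 14000 * L := by push_cast; linarith
    rw [Nat.cast_mul, Nat.cast_mul]
    calc _ ≤ (4 * ((m : ℝ) + 1)) * (28 * (q * L)) * (14000 * L) := by gcongr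
      _ = _ := by push_cast; ring
  · have a2 : ((5 * ρ + nc + 6 : ℕ) : ℝ) ≤ 42 * (q * L) := by push_cast; linarith
    have L2 : L ≤ L ^ 2 := le_self_pow₀ L1 (by norm_num)
    rw [Nat.cast_mul, Nat.cast_mul]
    calc _ ≤ ((40 : ℕ) : ℝ) * (42 * (q * L) * N) := by gcongr
      _ = 1680 * (N * q * L) := by push_cast; ring
      _ ≤ 1568000 * (N * q * L ^ 2) := by gcongr; norm_num
      _ = _ := by push_cast; ring
  · have L2 : L ≤ L ^ 2 := le_self_pow₀ L1 (by norm_num)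
    push_cast; linarith

theorem RAM.Input.mem_lt {S : Scene} {m M W : ℕ} {mem : ℕ → ℕ} (h : RAM.Input S m mem)
    (hW : ∀ u v w κ, S.E u v w κ → w ≤ W) (hM : W < M) (hp : ∀ a, S.p a < S.N)
    (hX : 4 + S.N + 4 * m < M) (hL : S.L ≤ S.N) (j : ℕ) : mem j < M := by
  rcases lt_or_ge j 4 with h4 | h4
  · have := hp 0
    interval_cases j
    · rw [h.hN]; omega
    · rw [h.hm]; omega
    · rw [h.hsrc]; omega
    · rw [h.hL]; omega
  obtain ⟨i, rfl⟩ := Nat.exists_eq_add_of_le h4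
  rcases lt_or_ge i S.L with hi | hi
  · rw [h.hP i hi]; have := hp i; omega
  obtain ⟨k, rfl⟩ := Nat.exists_eq_add_of_le hi
  rcases le_or_gt (4 * m) k with hk | hk
  · rw [h.end_ _ (by omega)]; omega
  have hj : k / 4 < m := by omega
  obtain ⟨κ, hs⟩ := h.flag hj
  have h1 := S.lt hs
  have h2 := hW _ _ _ _ hs
  have h3 := h.fl _ hj
  rw [← add_assoc]
  rcases (show k = 4 * (k / 4) ∨ k = 4 * (k / 4) + 1 ∨ k = 4 * (k / 4) + 2 ∨ k = 4 * (k / 4) + 3 by omega) with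
    e | e | e | e <;> rw [e]
  · omega
  · rw [← add_assoc]; omega
  · rw [← add_assoc]; omega
  · rw [← add_assoc]; omega

/-! ### Assembly of the main theorem. -/

theorem mainTheorem3 :
    ∃ (build query : RAM.Prog) (C k c : ℕ),
      ∀ (V : Type) [Fintype V] (G : SimpleGraph V) (s : V), G.Connected →
      ∀ (n : ℕ), n = Fintype.card V →
      ∀ (H : Node V), Node.InTree G s H →
      ∀ (S : H.Split) (P : List (Option V)), S.IsPrimary P →
      ∀ (num : Option V → ℕ), H.IsNumbering num →
      ∀ (E : List (Option V × Option V × ℕ × Bool)), H.IsEdgeList E →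
      ∃ (σ : RAM.State) (time size : ℕ),
        RAM.Exec ((n + 2) ^ c) build (RAM.State.ofLists [] (H.encode num P E)) σ time ∧
        (time : ℝ) ≤ C * ((E.length : ℝ) + 1) * √(n : ℝ) * Real.log ((n : ℝ) + 2) ^ k ∧
        (size : ℝ) ≤ C * (H.verts.card : ℝ) * √(n : ℝ) * Real.log ((n : ℝ) + 2) ^ k ∧
        ∀ (before after : List (Option V)) (x y : Option V),
          P = before ++ x :: y :: after → H.plain.Adj x y →
        ∀ t ∈ H.verts, ∀ a b : Option V, s(a, b) = s(x, y) →
        ∃ (τ : RAM.State) (qtime : ℕ),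
          RAM.Exec ((n + 2) ^ c) query
            (RAM.State.ofLists [num t, num a, num b] (σ.firstCells size)) τ qtime ∧
          (qtime : ℝ) ≤ C * Real.log ((n : ℝ) + 2) ^ k ∧
          (τ.reg 0 ≠ 0 →
            routeDist (H.StepAvoid s(x, y)) H.src t ≤ ((τ.reg 1 : ℕ) : ℕ∞)) ∧
          ((∃ l ℓ, H.IsDepartingReplacement s(x, y) (y :: after) t l ℓ) →
            τ.reg 0 ≠ 0 ∧
            (∃ l, H.IsDepartingReplacement s(x, y) (y :: after) t l (τ.reg 1)) ∧
            (t ≠ H.src → ∃ l u,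
              H.IsDepartingReplacement s(x, y) (y :: after) t (l ++ [u, t]) (τ.reg 1) ∧
              num u = τ.reg 2)) := by
  classical
  -- The exponent `288 = 24 * 12`: stored words are below `(n + 2) ^ 24`, and the compiler needs the
  -- twelfth power of that.
  refine ⟨RAM.buildProg, RAM.queryC.code, 1568000, 2, 288, ?_⟩
  rintro V _ G s hG n rfl H hH S P hP num hnum E hE
  obtain ⟨n, hn⟩ : ∃ n, n = Fintype.card V := ⟨_, rfl⟩
  have good := hH.good hG
  rw [← hn] at good ⊢
  have h : Node.Setup H n S P num := ⟨good, hP, hnum⟩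
  obtain ⟨e, C, hC, he, hNn, hcov, hw⟩ := good.bounds
  have hinp := h.input hE
  obtain ⟨mem, hmem⟩ : ∃ mem, mem = fun j => (H.encode num P E).getD j 0 := ⟨_, rfl⟩
  rw [← hmem] at hinp
  have hN1 : 1 ≤ H.verts.card := good.card_pos
  have hn1 : 1 ≤ n := hN1.trans hNn
  have hwS : ∀ u v w κ, h.scene.E u v w κ → w ≤ n ^ 13 := by
    rintro _ _ w κ ⟨x, -, y, -, rfl, rfl, hs⟩
    exact hw _ _ _ ⟨κ, hs⟩
  have hsum : ∑ j ∈ Finset.range E.length, mem (4 + h.scene.L + 4 * j + 2) ≤ E.length * n ^ 13 := by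
    refine (Finset.sum_le_card_nsmul _ _ (n ^ 13) fun j hj => ?_).trans (by simp)
    obtain ⟨κ, hs⟩ := hinp.flag (Finset.mem_range.1 hj)
    exact hwS _ _ _ _ hs
  have hcard : (C.image num).card ≤ n ^ 12 + 1 := by
    have h1 : (C.image num).card ≤ C.card := Finset.card_image_le
    have h2 : e < 4 ^ e := Nat.lt_pow_self (by norm_num)
    omega
  obtain ⟨M, hM⟩ : ∃ M, M = (n + 2) ^ 24 := ⟨_, rfl⟩
  obtain ⟨b1, b2, b3, b4, b5⟩ := Nat.budget hNn hn1 (good.edges_le hE) hsum hcard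
  rw [← hM] at b1 b2 b3 b4 b5
  have hB : (n + 2) ^ 288 = M ^ 12 := by rw [hM, ← pow_mul]
  have hmM : ∀ j, mem j < M := hinp.mem_lt hwS b5 h.p_lt b3 h.L_le
  -- The summand `3` makes `2 ^ lg` exceed `4 * (n + 2)`, enough both for the height of the
  -- tournament tree and for bisecting over `4 * ρ + 1` values of the excess.
  obtain ⟨lg, hlg⟩ : ∃ lg, lg = Nat.log 2 (n + 2) + 3 := ⟨_, rfl⟩
  have hlg2 : 4 * (n + 2) < 2 ^ lg := by
    have := Nat.lt_pow_succ_log_self (b := 2) (by norm_num) (n + 2)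
    rw [hlg, show Nat.log 2 (n + 2) + 3 = (Nat.log 2 (n + 2) + 1) + 2 by ring, pow_add]
    omega
  have hNS := h.N_eq
  have hLN := h.L_le
  have hcovS : ∀ u v w, h.scene.E u v w true → u ∈ C.image num ∨ v ∈ C.image num := by
    rintro _ _ w ⟨x, -, y, -, rfl, rfl, hs⟩
    exact (hcov _ _ _ hs).imp (Finset.mem_image_of_mem _) (Finset.mem_image_of_mem _)
  obtain ⟨σ, time, ρ, nc, D, I, hex, r1, r2, r3, hnc, hI, htime, hD, hQ, hmemD⟩ :=
    RAM.exec_build (lg := lg) (K := C.image num) b1 hinp (h.p_lt 0) hLN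
      (fun a ha b hb e => Scene.p_inj ha hb e) b2 (by omega) hmM (by omega) b4 hcovS
  have hnc' : nc ≤ 2 * (e + 1) := hnc.trans (Nat.mul_le_mul_left _ (Finset.card_image_le.trans hC))
  obtain ⟨t1, t2, t3⟩ := Real.budget hn1 hNn (good.card_le hE) r1 r3 he hnc'
  rw [← hlg] at t1 t3
  rw [hB]
  have hst : RAM.State.ofLists [] (H.encode num P E) = ⟨fun _ => 0, mem⟩ := by
    simp [RAM.State.ofLists, hmem]
  refine ⟨σ, time, 40 * ((5 * ρ + nc + 6) * h.scene.N), by rw [hst]; exact hex,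
    le_trans (by exact_mod_cast htime) t1, t2, ?_⟩
  intro before after x y hPe _ t ht a b hab
  obtain ⟨cells, hcells⟩ : ∃ f : ℕ → ℕ,
      f = fun l => (σ.firstCells (40 * ((5 * ρ + nc + 6) * h.scene.N))).getD l 0 := ⟨_, rfl⟩
  have hcell : ∀ l, cells l = if l < 40 * ((5 * ρ + nc + 6) * h.scene.N) then σ.mem l else 0 := by
    intro l
    rw [hcells]
    split_ifs with hl <;> simp [RAM.State.firstCells, hl]
  have hcD : ∀ a < 40, ∀ j < (5 * ρ + nc + 6) * h.scene.N, cells (40 * j + a) = D a j := by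
    intro a ha j hj
    rw [hcell, if_pos (by omega), hmemD a ha j hj]
  have hcM : ∀ l, cells l < M := by
    intro l
    by_cases hl : l < 40 * ((5 * ρ + nc + 6) * h.scene.N)
    · have := hcD (l % 40) (Nat.mod_lt _ (by norm_num)) (l / 40) (by omega)
      rw [Nat.div_add_mod] at this
      rw [this]; exact hD _ _
    · rw [hcell, if_neg hl]; omega
  obtain ⟨e1, e2⟩ := Node.Setup.getD_before (H := H) hPe
  have h12 : (num a = h.scene.p before.length ∧ num b = h.scene.p (before.length + 1)) ∨
      (num a = h.scene.p (before.length + 1) ∧ num b = h.scene.p before.length) := by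
    rw [h.p_eq, h.p_eq, e1, e2]
    rcases Sym2.eq_iff.1 hab with ⟨rfl, rfl⟩ | ⟨rfl, rfl⟩ <;> simp
  have hIM : 20 * I < M := by rw [hI]; exact b2
  have hNI : h.scene.N < I := by
    rw [hI]
    exact Nat.lt_succ_of_le (Nat.le_mul_of_pos_right _ (by omega))
  obtain ⟨τ, qtime, hqx, hqt, hs, hc⟩ := RAM.exec_query (t := num t) (a := num a) (b := num b) (lg := lg)
    b1 hQ hD hcD hcM (i := before.length) (by rw [h.L_eq, hPe]; simp) (h.num_lt ht) h12 (by omega) (by omega)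
    (by omega) (by omega) (by omega)
  have hfin := h.answer hPe (W := ∑ j ∈ Finset.range E.length, mem (4 + h.scene.L + 4 * j + 2)) (I := I)
    (fun u v w hs => by
      have hm := good.step_mem hs
      obtain ⟨κ, hs⟩ := hs
      obtain ⟨j, hj, -, e, -⟩ := (hinp.E _ _ _ _).1 ((h.E_iff hm.1 hm.2).2 hs)
      rw [← e]
      exact Finset.single_le_sum (f := fun j => mem (4 + h.scene.L + 4 * j + 2)) (fun _ _ => Nat.zero_le _)
        (Finset.mem_range.2 hj))
    (by rw [hI, hNS]; exact Nat.lt_succ_of_le (Nat.mul_le_mul_left _ (by omega))) ht hs hc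
  have hst' : RAM.State.ofLists [num t, num a, num b] (σ.firstCells (40 * ((5 * ρ + nc + 6) * h.scene.N))) =
      ⟨fun x => [num t, num a, num b].getD x 0, cells⟩ := by rw [hcells]; rfl
  exact ⟨τ, qtime, by rw [hst']; exact hqx, le_trans (by exact_mod_cast hqt) t3, hfin⟩
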